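/- **Setting.** Let $P$ be the law of the full data $(X,Z,C,Y_1,Y_0)$ of a unit: covariates $X$ in a standard Borel space, treatment assignment $Z\in\{0,1\}$, principal stratum $C\in\{0,1\}$, square-integrable real potential outcomes $Y_1,Y_0$. The observed data are $O=(X,Z,S,Y)$ with $S=ZC$ and $Y=ZY_1+(1-Z)Y_0$; let $O_1,O_2,\dots$ be i.i.d. copies of $O$, with law $Q$. Assume $Z\perp (C,Y_1,Y_0)\mid X$, fix $c\in\{0,1\}$ with $P(C=c)>0$, and put $e_1(X)=P(Z=1\mid X)$, $e_0=1-e_1$, $\pi_c(X)=P(C=c\mid X)$, $\mu_{1c}(X)=E[Y_1\mid X,C=c]$, $\mu_0(X)=E[Y\mid X,Z=0]$, $\sigma_0^2(X)=\mathrm{var}(Y\mid X,Z=0)$, $\pi_c=E[\pi_c(X)]$, $\rho_1=\rho$, $\rho_0=1/\rho$, $\eta_1=\eta$, $\eta_0=-\eta$. **Estimands.** $\Delta_c=\{E[\pi_c(X)\mu_{1c}(X)]-\nu_{0c}\}/\pi_c$ with $\nu_{0c}=E[\pi_c(X)\mu_{0c}(X)]$, regarded as a functional of $Q$ through $\pi_c(X)=Q(S=c\mid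 X,Z=1)$ and $\mu_{1c}(X)=E_Q[Y\mid X,Z=1,S=c]$, where $\mu_{0c}$ is one of the following. * GOR (with $\rho>0$, bounds $l<h$; $m=\frac{\mu_0-l}{h-l}$): $\mu_{0c}=\frac{\alpha_c-\beta_c}{2(\rho_c-1)\pi_c}(h-l)+l$, $\alpha_c=(\pi_c+m)(\rho_c-1)+1$, $\beta_c=\sqrt{\alpha_c^2-4\pi_c m\rho_c(\rho_c-1)}$, and $\mu_{0c}=\mu_0$ if $\rho=1$. OR is the case $l=0,h=1$. * MR (with $\rho>0$): $\mu_{0c}=\gamma_c\mu_0$, $\gamma_c=\frac{\rho_c}{(\rho_c-1)\pi_c+1}$. * SMDe (with $\eta\in\mathbb R$): $\mu_{0c}=\mu_0+\eta_c\frac{\pi_{1-c}\sigma_0}{\sqrt{1+\eta^2\pi_1\pi_0}}$. (Arguments $X$ are omitted.) **Estimators.** Let $\phi_{\pi_c}=\frac{Z}{e_1}[I(C=c)-\pi_c]+\pi_c$, $\phi_{\nu_{1c}}=\frac{Z}{e_1}I(C=c)[Y-\mu_{1c}]+\frac{Z}{e_1}\mu_{1c}[I(C=c)-\pi_c]+\pi_c\mu_{1c}$,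 $\phi_{\nu_{0c}}=\frac{1-Z}{e_0}\epsilon_\mu[Y-\mu_0]+\frac{Z}{e_1}\epsilon_\pi[I(C=c)-\pi_c]+\pi_c\mu_{0c}$ with, for GOR, $\epsilon_\mu=\frac12-\frac{\alpha_c}{2\beta_c}+\frac{\rho_c\pi_c}{\beta_c}$, $\epsilon_\pi=[\frac12-\frac{\alpha_c}{2\beta_c}+\frac{\rho_c m}{\beta_c}](h-l)+l$ (and $\epsilon_\mu=\pi_c,\epsilon_\pi=\mu_0$ if $\rho=1$); for MR, $\epsilon_\mu=\gamma_c\pi_c$, $\epsilon_\pi=\gamma_1\gamma_0\mu_0$. For SMDe, $\phi_{\nu_{0c}}=\phi^{\rm PI}+\eta_c\phi_\vartheta$, where $\phi^{\rm PI}$ has $\epsilon_\mu=\pi_c$, $\epsilon_\pi=\mu_0$, $\mu_{0c}=\mu_0$, and $\phi_\vartheta=\frac{1-Z}{e_0}\frac{\pi_1\pi_0}{2\sigma_0\sqrt{1+\eta^2\pi_1\pi_0}}\{[Y-\mu_0]^2-\sigma_0^2\}+\frac{Z}{e_1}\frac{(\pi_0-\pi_1)(2+\eta^2\pi_1\pi_0)\sigma_0}{2(1+\eta^2\pi_1\pi_0)^{3/2}}[C-\pi_1]+\frac{\pi_1\pi_0\sigma_0}{\sqrt{1+\eta^2\pi_1\pi_0}}$.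 Let $\tilde e_1,\tilde\pi_1,\tilde\mu_{1c},\tilde\mu_0,\tilde\sigma_0^2$ be estimators obtained by cross-fitting with a fixed number of folds or by sample splitting: the functions evaluated at a unit of fold $k$ are measurable functions of data outside fold $k$; $\tilde e_0=1-\tilde e_1$, $\tilde\pi_0=1-\tilde\pi_1$. With $\mathrm P_n$ the average over the $n$ units and $\tilde\phi$ denoting $\phi$ at the estimated nuisance functions, $\hat\Delta_{c,\rm IF}=(\mathrm P_n\tilde\phi_{\nu_{1c}}-\mathrm P_n\tilde\phi_{\nu_{0c}})/\mathrm P_n\tilde\phi_{\pi_c}$. Norms $\|\cdot\|_2,\|\cdot\|_\infty$ are those of $L^2,L^\infty$ of the law of $X$, with the estimated functions held fixed; conditions on estimators are required for every fold. **Assume** (i) positivity: $\epsilon\le e_1(X)<1-\epsilon$ a.s. for some $\epsilon>0$; (ii) consistency: $\|\tilde f-f\|_2=o_p(1)$ for $f=e_1,\pi_c,\mu_{1c},\mu_0$, and for SMDe also $f=\sigma_0^2$; (iii) bounded inverse propensity estimates: $\|1/\tilde e_1\|_\infty=O_p(1)$, $\|1/\tilde e_0\|_\infty=O_p(1)$ (in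 particular $\tilde e_1,\tilde e_0>0$); (iv) regularity: $\mu_{1c}(X)$ is essentially bounded and $\tilde\pi_1\in[0,1]$; for GOR/OR, $Y_0\in[l,h]$ a.s. and $\tilde\mu_0\in[l,h]$; for MR and SMDe, $\mu_0(X)$ is essentially bounded; for SMDe, $E Y_0^4<\infty$, $\sigma_0^2(X)$ is essentially bounded and bounded away from zero, and $\|1/\tilde\sigma_0^2\|_\infty=O_p(1)$ (with $\tilde\sigma^2_0>0$). **Conclusion.** Suppose $\|\tilde e_1-e_1\|_2\|\tilde\pi_c-\pi_c\|_2$, $\|\tilde e_1-e_1\|_2\|\tilde\mu_{1c}-\mu_{1c}\|_2$, $\|\tilde e_1-e_1\|_2\|\tilde\mu_0-\mu_0\|_2$ are $o_p(n^{-1/2})$ and $\|\tilde\pi_c-\pi_c\|_2=o_p(n^{-1/4})$. Suppose in addition: * for $\hat\Delta^{\rm OR}_{c,\rm IF}$ and $\hat\Delta^{\rm GOR}_{c,\rm IF}$: $\|\tilde\mu_0-\mu_0\|_2=o_p(n^{-1/4})$; * for $\hat\Delta^{\rm MR}_{c,\rm IF}$: $\|\tilde\pi_c-\pi_c\|_2\|\tilde\mu_0-\mu_0\|_2=o_p(n^{-1/2})$;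 * for $\hat\Delta^{\rm SMDe}_{c,\rm IF}$: $\|\tilde e_1-e_1\|_2\|\tilde\sigma_0^2-\sigma_0^2\|_2=o_p(n^{-1/2})$, $\|\tilde\mu_0-\mu_0\|_2=o_p(n^{-1/4})$ and $\|\tilde\sigma_0^2-\sigma_0^2\|_2=o_p(n^{-1/4})$. Then the respective estimator is $\sqrt n$-consistent and asymptotically normal: $\sqrt n(\hat\Delta_{c,\rm IF}-\Delta_c)=O_p(1)$ and $\sqrt n(\hat\Delta_{c,\rm IF}-\Delta_c)\Rightarrow N(0,\mathrm{var}\,\varphi_{\Delta_c}(O))$, where $\varphi_{\Delta_c}=\pi_c^{-1}[\phi_{\nu_{1c}}-\phi_{\nu_{0c}}-\Delta_c\phi_{\pi_c}]$ (at the true nuisance functions) is the nonparametric influence function of the functional $\Delta_c$ at $Q$: it is centered, square integrable, and $\frac{d}{dt}\Delta_c(Q_t)|_{t=0}=E[\varphi_{\Delta_c}g]$ along $dQ_t=(1+tg)\,dQ$ for every bounded measurable $g$ with $E[g(O)]=0$. -/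

import Mathlib

open MeasureTheory ProbabilityTheory Filter Topology
open scoped ENNReal NNReal

noncomputable section

namespace PISens

/-! ### Data -/

/-- Full data of one unit: covariates `X`, assigned treatment `Z`, principal stratum `C`
(`true` for compliers), and the potential outcomes `Y₁`, `Y₀`, in this order. -/
abbrev FullData (𝒳 : Type*) := 𝒳 × Bool × Bool × ℝ × ℝ

/-- Observed data of one unit: `(X, Z, S, Y)`. -/
abbrev Obs (𝒳 : Type*) := 𝒳 × Bool × Bool × ℝ

namespace FullData
variable {𝒳 : Type*}

def X (d : FullData 𝒳) : 𝒳 := d.1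
def Z (d : FullData 𝒳) : Bool := d.2.1
def C (d : FullData 𝒳) : Bool := d.2.2.1
def Y1 (d : FullData 𝒳) : ℝ := d.2.2.2.1
def Y0 (d : FullData 𝒳) : ℝ := d.2.2.2.2

/-- The observed outcome `Y = Z Y₁ + (1 - Z) Y₀`. -/
def Y (d : FullData 𝒳) : ℝ := if d.Z then d.Y1 else d.Y0

/-- Consistency: the observed data are `(X, Z, S, Y)` with `S = Z C`, `Y = Z Y₁ + (1 - Z) Y₀`. -/
def observe (d : FullData 𝒳) : Obs 𝒳 := (d.X, d.Z, d.Z && d.C, d.Y)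

theorem measurable_X [MeasurableSpace 𝒳] : Measurable (X : FullData 𝒳 → 𝒳) := measurable_fst

end FullData

namespace Obs
variable {𝒳 : Type*}

def X (o : Obs 𝒳) : 𝒳 := o.1
def Z (o : Obs 𝒳) : Bool := o.2.1
def S (o : Obs 𝒳) : Bool := o.2.2.1
def Y (o : Obs 𝒳) : ℝ := o.2.2.2

/-- `Z` as a number. -/
def zz (o : Obs 𝒳) : ℝ := if o.Z then 1 else 0

/-- `I(S = c)` as a number. It is only used multiplied by `Z`, where `S = C`. -/
def ind (c : Bool) (o : Obs 𝒳) : ℝ := if o.S = c then 1 else 0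

/-- The σ-algebra generated by the covariates. -/
abbrev sigmaX [MeasurableSpace 𝒳] : MeasurableSpace (Obs 𝒳) :=
  MeasurableSpace.comap (X : Obs 𝒳 → 𝒳) inferInstance

end Obs

/-- The σ-algebra generated by the covariates on the full data space. -/
abbrev FullData.sigmaX {𝒳 : Type*} [MeasurableSpace 𝒳] : MeasurableSpace (FullData 𝒳) :=
  MeasurableSpace.comap (FullData.X : FullData 𝒳 → 𝒳) inferInstance

/-- Treatment assignment ignorability: `Z` is independent of `(C, Y₁, Y₀)` given `X`. -/
def Ignorability {𝒳 : Type*} [MeasurableSpace 𝒳] [StandardBorelSpace 𝒳]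
    (P : Measure (FullData 𝒳)) [IsFiniteMeasure P] : Prop :=
  CondIndepFun FullData.sigmaX (Measurable.comap_le FullData.measurable_X)
    (FullData.Z : FullData 𝒳 → Bool)
    (fun d : FullData 𝒳 => (d.C, d.Y1, d.Y0)) P

/-! ### Nuisance functions -/

/-- A value of the nuisance functions: `e1` for the propensity score `e₁(x)`, `pi1` for the
principal score `π₁(x)`, `mu1` for `μ_{1c}(x)` (with `c` the stratum under study), `mu0` for
`μ₀(x)`, `sigma2` for `σ₀²(x)`. -/
structure Nuisance (𝒳 : Type*) where
  e1 : 𝒳 → ℝ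
  pi1 : 𝒳 → ℝ
  mu1 : 𝒳 → ℝ
  mu0 : 𝒳 → ℝ
  sigma2 : 𝒳 → ℝ

/-- `e₀ = 1 - e₁`. -/
def Nuisance.e0 {𝒳 : Type*} (η : Nuisance 𝒳) (x : 𝒳) : ℝ := 1 - η.e1 x

/-- The principal score `π_c`, with `π₀ = 1 - π₁`. -/
def Nuisance.pi {𝒳 : Type*} (η : Nuisance 𝒳) (c : Bool) (x : 𝒳) : ℝ :=
  if c then η.pi1 x else 1 - η.pi1 x

/-- `η` consists of (measurable versions of) the true nuisance functions of the law `P`: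
`e₁(X) = P(Z = 1 | X)`, `π₁(X) = P(C = 1 | X)`, `μ_{1c}(X) = E[Y₁ | X, C = c]`,
`μ₀(X) = E[Y | X, Z = 0]`, `σ₀²(X) = var(Y | X, Z = 0)`. Conditioning on `X` and on an event `A`
is conditioning on `X` under `P(· | A)`. -/
structure IsTrueNuisance {𝒳 : Type*} [MeasurableSpace 𝒳] (P : Measure (FullData 𝒳)) (c : Bool)
    (η : Nuisance 𝒳) : Prop where
  measurable_e1 : Measurable η.e1
  measurable_pi1 : Measurable η.pi1
  measurable_mu1 : Measurable η.mu1
  measurable_mu0 : Measurable η.mu0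
  measurable_sigma2 : Measurable η.sigma2
  e1_eq : (fun d : FullData 𝒳 => η.e1 d.X) =ᵐ[P]
    P[Set.indicator {d : FullData 𝒳 | d.Z = true} (fun _ => (1 : ℝ)) | FullData.sigmaX]
  pi1_eq : (fun d : FullData 𝒳 => η.pi1 d.X) =ᵐ[P]
    P[Set.indicator {d : FullData 𝒳 | d.C = true} (fun _ => (1 : ℝ)) | FullData.sigmaX]
  mu1_eq : (fun d : FullData 𝒳 => η.mu1 d.X) =ᵐ[ProbabilityTheory.cond P {d | d.C = c}]
    (ProbabilityTheory.cond P {d | d.C = c})[FullData.Y1 | FullData.sigmaX]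
  mu0_eq : (fun d : FullData 𝒳 => η.mu0 d.X) =ᵐ[ProbabilityTheory.cond P {d | d.Z = false}]
    (ProbabilityTheory.cond P {d | d.Z = false})[FullData.Y | FullData.sigmaX]
  sigma2_eq : (fun d : FullData 𝒳 => η.sigma2 d.X) =ᵐ[ProbabilityTheory.cond P {d | d.Z = false}]
    condVar FullData.sigmaX FullData.Y (ProbabilityTheory.cond P {d | d.Z = false})

/-! ### The formulas of the sensitivity analyses

Throughout, `p` stands for `π_c(x)`, `m` for `μ₀(x)`, `s` for `σ₀²(x)` and `r` for `ρ_c`. -/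

/-- `ρ₁ = ρ`, `ρ₀ = 1/ρ`. -/
def rhoC (c : Bool) (ρ : ℝ) : ℝ := if c then ρ else 1 / ρ

/-- `η₁ = η`, `η₀ = -η`. -/
def etaC (c : Bool) (η : ℝ) : ℝ := if c then η else -η

def gorAlpha (r l h p m : ℝ) : ℝ := (p + (m - l) / (h - l)) * (r - 1) + 1

def gorBeta (r l h p m : ℝ) : ℝ :=
  √(gorAlpha r l h p m ^ 2 - 4 * p * ((m - l) / (h - l)) * r * (r - 1))

/-- `μ_{0c}^GOR`. -/
def gorMean (r l h p m : ℝ) : ℝ :=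
  if r = 1 then m
  else (gorAlpha r l h p m - gorBeta r l h p m) / (2 * (r - 1) * p) * (h - l) + l

/-- `ε_{μ,c}^GOR`. -/
def gorEpsMu (r l h p m : ℝ) : ℝ :=
  if r = 1 then p
  else 1 / 2 - gorAlpha r l h p m / (2 * gorBeta r l h p m) + r * p / gorBeta r l h p m

/-- `ε_{π,c}^GOR`. -/
def gorEpsPi (r l h p m : ℝ) : ℝ :=
  if r = 1 then m
  else (1 / 2 - gorAlpha r l h p m / (2 * gorBeta r l h p m)
    + r * ((m - l) / (h - l)) / gorBeta r l h p m) * (h - l) + l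

/-- `γ_c = ρ_c / ((ρ_c - 1) π_c + 1)`. -/
def mrGamma (r p : ℝ) : ℝ := r / ((r - 1) * p + 1)

/-- `μ_{0c}^MR = γ_c μ₀`. -/
def mrMean (r p m : ℝ) : ℝ := mrGamma r p * m

/-- `ε_{μ,c}^MR = γ_c π_c`. -/
def mrEpsMu (r p : ℝ) : ℝ := mrGamma r p * p

/-- `ε_{π,c}^MR = γ₁ γ₀ μ₀`. -/
def mrEpsPi (r p m : ℝ) : ℝ := mrGamma r p * mrGamma (1 / r) (1 - p) * m

/-- `μ_{0c}^SMDe = μ₀ + η_c π_{1-c} σ₀ / √(1 + η² π₁ π₀)`. -/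
def smdeMean (c : Bool) (η p m s : ℝ) : ℝ :=
  m + etaC c η * ((1 - p) * √s / √(1 + η ^ 2 * (p * (1 - p))))

/-- `ϑ(x)`; here and in the next two formulas `q` stands for `π₁(x)`. -/
def theta (η q s : ℝ) : ℝ := q * (1 - q) * √s / √(1 + η ^ 2 * (q * (1 - q)))

/-- The derivative of `ϑ(x)` in `σ₀²(x)`. -/
def thetaDotSigma (η q s : ℝ) : ℝ := q * (1 - q) / (2 * √s * √(1 + η ^ 2 * (q * (1 - q))))

/-- The derivative of `ϑ(x)` in `π₁(x)`. -/
def thetaDotPi (η q s : ℝ) : ℝ :=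
  (1 - 2 * q) * (2 + η ^ 2 * (q * (1 - q))) * √s
    / (2 * (1 + η ^ 2 * (q * (1 - q))) ^ (3 / 2 : ℝ))

/-! ### Estimands, as functionals of the law `Q` of the observed data -/

section Functionals
variable {𝒳 : Type*} [MeasurableSpace 𝒳]

/-- `π_c(X) = Q(S = c | X, Z = 1)`. -/
def obsPi (Q : Measure (Obs 𝒳)) (c : Bool) : Obs 𝒳 → ℝ :=
  (ProbabilityTheory.cond Q {o | o.Z = true})[Obs.ind c | Obs.sigmaX]

/-- `μ_{1c}(X) = E[Y | X, Z = 1, S = c]`. -/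
def obsMu1 (Q : Measure (Obs 𝒳)) (c : Bool) : Obs 𝒳 → ℝ :=
  (ProbabilityTheory.cond Q {o | o.Z = true ∧ o.S = c})[Obs.Y | Obs.sigmaX]

/-- `μ₀(X) = E[Y | X, Z = 0]`. -/
def obsMu0 (Q : Measure (Obs 𝒳)) : Obs 𝒳 → ℝ :=
  (ProbabilityTheory.cond Q {o | o.Z = false})[Obs.Y | Obs.sigmaX]

/-- `σ₀²(X) = var(Y | X, Z = 0)`. -/
def obsSigma2 (Q : Measure (Obs 𝒳)) : Obs 𝒳 → ℝ :=
  condVar Obs.sigmaX Obs.Y (ProbabilityTheory.cond Q {o | o.Z = false})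

/-- The marginal `π_c = E[π_c(X)]`. -/
def margPi (c : Bool) (Q : Measure (Obs 𝒳)) : ℝ := ∫ o, obsPi Q c o ∂Q

/-- `ν_{1c} = E[π_c(X) μ_{1c}(X)]`. -/
def nu1 (c : Bool) (Q : Measure (Obs 𝒳)) : ℝ := ∫ o, obsPi Q c o * obsMu1 Q c o ∂Q

/-- `ν_{0c}^GOR = E[π_c(X) μ_{0c}^GOR(X)]`. -/
def nu0GOR (c : Bool) (ρ l h : ℝ) (Q : Measure (Obs 𝒳)) : ℝ :=
  ∫ o, obsPi Q c o * gorMean (rhoC c ρ) l h (obsPi Q c o) (obsMu0 Q o) ∂Q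

/-- `ν_{0c}^MR = E[π_c(X) μ_{0c}^MR(X)]`. -/
def nu0MR (c : Bool) (ρ : ℝ) (Q : Measure (Obs 𝒳)) : ℝ :=
  ∫ o, obsPi Q c o * mrMean (rhoC c ρ) (obsPi Q c o) (obsMu0 Q o) ∂Q

/-- `ν_{0c}^SMDe = E[π_c(X) μ_{0c}^SMDe(X)]`. -/
def nu0SMDe (c : Bool) (η : ℝ) (Q : Measure (Obs 𝒳)) : ℝ :=
  ∫ o, obsPi Q c o * smdeMean c η (obsPi Q c o) (obsMu0 Q o) (obsSigma2 Q o) ∂Q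

/-- `Δ_c = (ν_{1c} - ν_{0c}) / π_c`, for the version `nu0` of `ν_{0c}` that the sensitivity
assumption identifies. -/
def delta (c : Bool) (nu0 : Measure (Obs 𝒳) → ℝ) (Q : Measure (Obs 𝒳)) : ℝ :=
  (nu1 c Q - nu0 Q) / margPi c Q

end Functionals

/-! ### Influence functions -/

/-- The path `dQ_t = (1 + t g) dQ` through `Q`. -/
def path {𝒪 : Type*} [MeasurableSpace 𝒪] (Q : Measure 𝒪) (g : 𝒪 → ℝ) (t : ℝ) : Measure 𝒪 :=
  Q.withDensity fun o => ENNReal.ofReal (1 + t * g o)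

/-- `φ` is the nonparametric influence function of `Ψ` at `Q`: it is centered and square
integrable, and represents the derivative of `Ψ` along every path `dQ_t = (1 + t g) dQ` with a
bounded score `g` of mean zero. (These scores are dense, so `φ` is unique `Q`-a.e.) -/
def IsInfluenceFunction {𝒪 : Type*} [MeasurableSpace 𝒪] (Ψ : Measure 𝒪 → ℝ) (Q : Measure 𝒪)
    (φ : 𝒪 → ℝ) : Prop :=
  MemLp φ 2 Q ∧ ∫ o, φ o ∂Q = 0 ∧
    ∀ g : 𝒪 → ℝ, Measurable g → (∃ M, ∀ o, |g o| ≤ M) → ∫ o, g o ∂Q = 0 →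
      HasDerivAt (fun t => Ψ (path Q g t)) (∫ o, φ o * g o ∂Q) 0

section Uncentered
variable {𝒳 : Type*}

/-! Uncentered influence functions of the components, at arbitrary nuisance values. -/

/-- `φ_{π_c}`. -/
def phiPi (c : Bool) (η : Nuisance 𝒳) (o : Obs 𝒳) : ℝ :=
  o.zz / η.e1 o.X * (o.ind c - η.pi c o.X) + η.pi c o.X

/-- `φ_{ν_{1c}}`. -/
def phiNu1 (c : Bool) (η : Nuisance 𝒳) (o : Obs 𝒳) : ℝ :=
  o.zz / η.e1 o.X * o.ind c * (o.Y - η.mu1 o.X)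
    + o.zz / η.e1 o.X * η.mu1 o.X * (o.ind c - η.pi c o.X)
    + η.pi c o.X * η.mu1 o.X

/-- `φ_{ν_{0c}}` under principal ignorability. -/
def phiNu0PI (c : Bool) (η : Nuisance 𝒳) (o : Obs 𝒳) : ℝ :=
  (1 - o.zz) / η.e0 o.X * η.pi c o.X * (o.Y - η.mu0 o.X)
    + o.zz / η.e1 o.X * η.mu0 o.X * (o.ind c - η.pi c o.X)
    + η.pi c o.X * η.mu0 o.X

/-- `φ_{ν_{0c}}` under the generalized odds ratio assumption. -/
def phiNu0GOR (c : Bool) (ρ l h : ℝ) (η : Nuisance 𝒳) (o : Obs 𝒳) : ℝ :=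
  (1 - o.zz) / η.e0 o.X * gorEpsMu (rhoC c ρ) l h (η.pi c o.X) (η.mu0 o.X) * (o.Y - η.mu0 o.X)
    + o.zz / η.e1 o.X * gorEpsPi (rhoC c ρ) l h (η.pi c o.X) (η.mu0 o.X)
      * (o.ind c - η.pi c o.X)
    + η.pi c o.X * gorMean (rhoC c ρ) l h (η.pi c o.X) (η.mu0 o.X)

/-- `φ_{ν_{0c}}` under the mean ratio assumption. -/
def phiNu0MR (c : Bool) (ρ : ℝ) (η : Nuisance 𝒳) (o : Obs 𝒳) : ℝ :=
  (1 - o.zz) / η.e0 o.X * mrEpsMu (rhoC c ρ) (η.pi c o.X) * (o.Y - η.mu0 o.X)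
    + o.zz / η.e1 o.X * mrEpsPi (rhoC c ρ) (η.pi c o.X) (η.mu0 o.X) * (o.ind c - η.pi c o.X)
    + η.pi c o.X * mrMean (rhoC c ρ) (η.pi c o.X) (η.mu0 o.X)

/-- `φ_ϑ`; the sensitivity parameter is `κ`. -/
def phiTheta (κ : ℝ) (η : Nuisance 𝒳) (o : Obs 𝒳) : ℝ :=
  (1 - o.zz) / η.e0 o.X * thetaDotSigma κ (η.pi1 o.X) (η.sigma2 o.X)
      * ((o.Y - η.mu0 o.X) ^ 2 - η.sigma2 o.X)
    + o.zz / η.e1 o.X * thetaDotPi κ (η.pi1 o.X) (η.sigma2 o.X) * (o.ind true - η.pi1 o.X)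
    + theta κ (η.pi1 o.X) (η.sigma2 o.X)

/-- `φ_{ν_{0c}}` under the standardized mean difference (equal variances) assumption, where
`ν_{0c}^SMDe = ν_{0c}^PI + η_c ϑ`. -/
def phiNu0SMDe (c : Bool) (κ : ℝ) (η : Nuisance 𝒳) (o : Obs 𝒳) : ℝ :=
  phiNu0PI c η o + etaC c κ * phiTheta κ η o

/-- The influence function of `Δ_c` at true nuisance functions `η`:
`π_c⁻¹ (φ_{ν_{1c}} - φ_{ν_{0c}} - Δ_c φ_{π_c})`. -/
def ifDelta [MeasurableSpace 𝒳] (c : Bool) (nu0 : Measure (Obs 𝒳) → ℝ)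
    (phi0 : Nuisance 𝒳 → Obs 𝒳 → ℝ) (Q : Measure (Obs 𝒳)) (η : Nuisance 𝒳) (o : Obs 𝒳) : ℝ :=
  1 / margPi c Q * (phiNu1 c η o - phi0 η o - delta c nu0 Q * phiPi c η o)

end Uncentered

/-! ### Cross-fitting -/

/-- A sample splitting scheme with `K` folds. At stage `n` the units `0, …, n - 1` on which averages
are taken are partitioned into folds, and the nuisance functions used on fold `k` are estimated
from the units `train n k`, none of which lies in fold `k`. With `train n k` the complement of
fold `k` in `{0, …, n - 1}` this is `K`-fold cross-fitting; with `K = 1` and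
`train n 0 = {n, …, N - 1}` it is sample splitting. -/
structure CrossFitting (K : ℕ) where
  fold : ∀ n : ℕ, Fin n → Fin K
  train : ℕ → Fin K → Finset ℕ
  disjoint : ∀ (n : ℕ) (i : Fin n), (i : ℕ) ∉ train n (fold n i)

/-- Nuisance estimators: for each stage and fold, a map from training data to nuisance values. -/
abbrev NuisanceEstimator (𝒳 : Type*) {K : ℕ} (F : CrossFitting K) :=
  ∀ (n : ℕ) (k : Fin K), (F.train n k → Obs 𝒳) → Nuisance 𝒳

section CrossFit
variable {𝒳 Ω : Type*} {K : ℕ} {F : CrossFitting K}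

/-- Joint measurability of the estimated functions in the training data and the covariates. -/
def NuisanceEstimator.IsMeasurable [MeasurableSpace 𝒳] (N : NuisanceEstimator 𝒳 F) : Prop :=
  ∀ n k,
    Measurable (fun q : (F.train n k → Obs 𝒳) × 𝒳 => (N n k q.1).e1 q.2) ∧
    Measurable (fun q : (F.train n k → Obs 𝒳) × 𝒳 => (N n k q.1).pi1 q.2) ∧
    Measurable (fun q : (F.train n k → Obs 𝒳) × 𝒳 => (N n k q.1).mu1 q.2) ∧
    Measurable (fun q : (F.train n k → Obs 𝒳) × 𝒳 => (N n k q.1).mu0 q.2) ∧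
    Measurable (fun q : (F.train n k → Obs 𝒳) × 𝒳 => (N n k q.1).sigma2 q.2)

/-- The nuisance functions estimated for fold `k` from the sample `O`. -/
def fit (N : NuisanceEstimator 𝒳 F) (O : ℕ → Ω → Obs 𝒳) (n : ℕ) (k : Fin K) (ω : Ω) :
    Nuisance 𝒳 :=
  N n k fun j => O j ω

/-- The cross-fitted sample average `P_n[φ̃(O)]`. -/
def crossAvg (N : NuisanceEstimator 𝒳 F) (O : ℕ → Ω → Obs 𝒳)
    (phi : Nuisance 𝒳 → Obs 𝒳 → ℝ) (n : ℕ) (ω : Ω) : ℝ :=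
  (∑ i : Fin n, phi (fit N O n (F.fold n i) ω) (O i ω)) / n

/-- The influence-function-based estimator `(ν̂_{1c} - ν̂_{0c}) / π̂_c`, where `phi0` is the
uncentered influence function of the relevant version of `ν_{0c}`. -/
def deltaHat (N : NuisanceEstimator 𝒳 F) (O : ℕ → Ω → Obs 𝒳) (c : Bool)
    (phi0 : Nuisance 𝒳 → Obs 𝒳 → ℝ) (n : ℕ) (ω : Ω) : ℝ :=
  (crossAvg N O (phiNu1 c) n ω - crossAvg N O phi0 n ω) / crossAvg N O (phiPi c) n ω

/-- The error `‖f̃(X) - f(X)‖₂` of the component `f` of the nuisance functions on fold `k`; the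
norm is over a fresh `X`, with the estimated function held fixed. -/
def err [MeasurableSpace 𝒳] (PX : Measure 𝒳) (N : NuisanceEstimator 𝒳 F) (O : ℕ → Ω → Obs 𝒳)
    (η : Nuisance 𝒳) (f : Nuisance 𝒳 → 𝒳 → ℝ) (k : Fin K) (n : ℕ) (ω : Ω) : ℝ≥0∞ :=
  eLpNorm (fun x => f (fit N O n k ω) x - f η x) 2 PX

/-- `‖1 / f̃(X)‖_∞` for the component `f`; it is infinite unless `f̃(X)` is positive a.s. -/
def invSup [MeasurableSpace 𝒳] (PX : Measure 𝒳) (N : NuisanceEstimator 𝒳 F)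
    (O : ℕ → Ω → Obs 𝒳) (f : Nuisance 𝒳 → 𝒳 → ℝ) (k : Fin K) (n : ℕ) (ω : Ω) : ℝ≥0∞ :=
  essSup (fun x => (ENNReal.ofReal (f (fit N O n k ω) x))⁻¹) PX

end CrossFit

/-! ### Stochastic orders and the asymptotic statement -/

section Asymptotics
variable {Ω : Type*} [MeasurableSpace Ω]

/-- `A_n = o_p(r_n)`, for nonnegative `A_n` and a deterministic rate `r_n`. -/
def IsLittleOp (μ : Measure Ω) (A : ℕ → Ω → ℝ≥0∞) (r : ℕ → ℝ) : Prop :=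
  ∀ δ : ℝ, 0 < δ → Tendsto (fun n => μ {ω | ENNReal.ofReal (δ * r n) < A n ω}) atTop (𝓝 0)

/-- `A_n = O_p(1)`, for nonnegative `A_n`. -/
def IsBoundedOp (μ : Measure Ω) (A : ℕ → Ω → ℝ≥0∞) : Prop :=
  ∀ δ : ℝ≥0∞, 0 < δ → ∃ M : ℝ, ∀ᶠ n in atTop, μ {ω | ENNReal.ofReal M < A n ω} ≤ δ

/-- `T n` is a `√n`-consistent and asymptotically normal estimator of `Ψ Q`, and its asymptotic
variance is that of the influence function `φ` of `Ψ` at `Q`. -/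
def IsRootNNormal {𝒪 : Type*} [MeasurableSpace 𝒪] (μ : Measure Ω) [IsProbabilityMeasure μ]
    (T : ℕ → Ω → ℝ) (Ψ : Measure 𝒪 → ℝ) (Q : Measure 𝒪) (φ : 𝒪 → ℝ) : Prop :=
  IsInfluenceFunction Ψ Q φ ∧
  IsBoundedOp μ (fun (n : ℕ) ω => ENNReal.ofReal |√(n : ℝ) * (T n ω - Ψ Q)|) ∧
  TendstoInDistribution (fun (n : ℕ) ω => √(n : ℝ) * (T n ω - Ψ Q)) atTop (id : ℝ → ℝ)
    (fun _ => μ) (gaussianReal 0 (variance φ Q).toNNReal)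

end Asymptotics

end PISens

end

open PISens

/-! Each of the three components `π_c`, `ν_{1c}`, `ν_{0c}` has the form `E[G(X)]`, where `G = f(u₁,
u₀)` is a function of a regression `u₁` in the treated arm and a regression `u₀` in the control arm.
Its uncentered influence function is the doubly robust score `drScore`: inverse-propensity-weighted
residuals of the two regressions, multiplied by the partial derivatives `a₁`, `a₀` of `f`, plus the
plug-in term `G`. The part `ϑ` of the standardized mean difference fits this form once its control
outcome is taken to be `(Y - μ₀)²`.

Everything rests on one algebraic identity, `drScore_sub_eq`. For arbitrary functions `v₁`, `v₀`,
`G'`, the score minus `G'` is a sum of (i) weighted residuals of the outcomes from `v₁`, `v₀`, (ii)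
`Z - e` times the errors `v - u` of the regressions, and (iii) minus the Taylor remainder of `f`. It
is applied twice.

Path derivative: the score is taken at the true nuisance functions, and `v₁`, `v₀`, `G'` belong to
the tilted law `Q_t`. Term (i) integrates to zero under `Q_t`. In (ii), `v - u` is of order `t` by
`abs_tilted_sub_le`, and `Z - e` has conditional mean zero under `Q`, so the tilted integral is of
order `t²`, and so is (iii). This yields a quadratic error bound (`IsScore.abs_path_expansion_le`),
hence the derivative (`IsScore.isGradient`). The influence function of `Δ_c` then follows from the
quotient rule.

Estimation: the score is taken at estimated nuisance functions, and `v₁`, `v₀`, `G'` are the true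
ones. Now (i) has mean zero under `Q`, (ii) has mean bounded by (propensity error) × (regression
error), and (iii) is bounded by products of errors (`IsScore.estimate_bounds`). By Cauchy–Schwarz
the bias is bounded by products of `L²` errors, which are `o_p(n^{-1/2})`. For the centered part,
sample splitting makes the units of a fold independent of the functions used on it, so Chebyshev's
inequality given the training data reduces matters to the `L²` distance between estimated and true
score. That distance tends to zero by consistency alone, even for unbounded outcomes, through the
truncation in `MemLp.exists_eLpNorm_mul_min_le`.

The sensitivity models differ only in the remainder (iii). Under the mean ratio, `π_c μ_{0c}` is
linear in `μ₀`, so no squared error of `μ₀` appears. Under the generalized odds ratio, the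
discriminant under the square root is at least `min(1, ρ_c)²` on the relevant rectangle
(`gor_disc_ge`), so `π_c μ_{0c}` is smooth there, up to the boundary. For the standardized mean
difference, the functional is the principal ignorability one (the mean ratio at `ρ = 1`) plus `η_c
ϑ`; estimating `μ₀` inside `(Y - μ₀)²` adds a cross term with conditional mean zero and a squared
error.

Thus each cross-fitted average equals the average of the true score up to `o_p(n^{-1/2})`. The law
of large numbers for the denominator, the central limit theorem and Slutsky's theorem conclude in
`isRootNNormal_deltaHat`. Ignorability enters only through `IsTrueNuisance.isObsNuisance`, which
turns the full-data nuisance functions of the treated arm into regressions of observed data. -/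

noncomputable section

namespace PISens

/-! ### Calculus of stochastic orders -/

section StochasticOrders
variable {Ω : Type*} [MeasurableSpace Ω] {μ : Measure Ω}

theorem ofReal_add_self (x : ℝ) : ENNReal.ofReal x + ENNReal.ofReal x = ENNReal.ofReal (2 * x) := by
  rcases le_total 0 x with h | h
  · rw [← ENNReal.ofReal_add h h]; congr 1; ring
  · rw [ENNReal.ofReal_of_nonpos h, ENNReal.ofReal_of_nonpos (by linarith)]; simp

theorem IsLittleOp.add {A B : ℕ → Ω → ℝ≥0∞} {r : ℕ → ℝ} (hA : IsLittleOp μ A r)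
    (hB : IsLittleOp μ B r) : IsLittleOp μ (fun n ω => A n ω + B n ω) r := by
  intro δ hδ
  have h := (hA (δ / 2) (by positivity)).add (hB (δ / 2) (by positivity))
  rw [add_zero] at h
  refine tendsto_of_tendsto_of_tendsto_of_le_of_le tendsto_const_nhds h (fun _ => zero_le)
    fun n => le_trans (measure_mono ?_) (measure_union_le _ _)
  intro ω hω
  by_contra hcon
  simp only [Set.mem_union, Set.mem_ofPred_eq, not_or, not_lt] at hcon hω
  have := add_le_add hcon.1 hcon.2
  rw [ofReal_add_self] at this
  exact absurd hω (not_lt.2 (this.trans_eq (by congr 1; ring)))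

theorem IsLittleOp.zero {r : ℕ → ℝ} : IsLittleOp μ (fun _ _ => 0) r := by
  intro δ _
  simp

theorem IsLittleOp.sum {ι : Type*} (s : Finset ι) {A : ι → ℕ → Ω → ℝ≥0∞} {r : ℕ → ℝ}
    (hA : ∀ i ∈ s, IsLittleOp μ (A i) r) : IsLittleOp μ (fun n ω => ∑ i ∈ s, A i n ω) r := by
  classical
  induction s using Finset.induction_on with
  | empty => simpa using IsLittleOp.zero
  | insert a s ha ih =>
    simp only [Finset.sum_insert ha]
    exact (hA a (Finset.mem_insert_self _ _)).add
      (ih fun i hi => hA i (Finset.mem_insert_of_mem hi))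

theorem IsLittleOp.mono {A B : ℕ → Ω → ℝ≥0∞} {r : ℕ → ℝ} (hB : IsLittleOp μ B r)
    (h : ∀ n ω, A n ω ≤ B n ω) : IsLittleOp μ A r := by
  intro δ hδ
  exact tendsto_of_tendsto_of_tendsto_of_le_of_le tendsto_const_nhds (hB δ hδ) (fun _ => zero_le)
    fun n => measure_mono fun ω hω => lt_of_lt_of_le hω (h n ω)

/-- `A` is dominated by an `o_p(r)` sequence on events whose probabilities can be made as close to
one as desired. -/
theorem IsLittleOp.of_good {A : ℕ → Ω → ℝ≥0∞} {B : ℝ → ℕ → Ω → ℝ≥0∞} {r : ℕ → ℝ}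
    (G : ℝ → ℕ → Ω → Prop)
    (hG : ∀ δ : ℝ≥0∞, 0 < δ → ∃ M, ∀ᶠ n in atTop, μ {ω | ¬ G M n ω} ≤ δ)
    (hB : ∀ M, IsLittleOp μ (B M) r)
    (h : ∀ M, ∃ C : ℝ, 0 < C ∧ ∀ n ω, G M n ω → A n ω ≤ ENNReal.ofReal C * B M n ω) :
    IsLittleOp μ A r := by
  intro δ hδ
  rw [ENNReal.tendsto_nhds_zero]
  intro ε hε
  -- The threshold `M` is fixed from `ε` alone; after that `C` is a deterministic constant and `B M`
  -- a single `o_p` sequence.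
  obtain ⟨M, hM⟩ := hG (ε / 2) (ENNReal.half_pos hε.ne')
  obtain ⟨C, hC, hCM⟩ := h M
  have h1 := ENNReal.tendsto_nhds_zero.1 (hB M (δ / C) (by positivity)) (ε / 2)
    (ENNReal.half_pos hε.ne')
  filter_upwards [hM, h1] with n hn1 hn2
  have hsub : {ω | ENNReal.ofReal (δ * r n) < A n ω} ⊆
      {ω | ¬ G M n ω} ∪ {ω | ENNReal.ofReal (δ / C * r n) < B M n ω} := by
    intro ω hω
    by_contra hcon
    simp only [Set.mem_union, Set.mem_ofPred_eq, not_or, not_lt, not_not] at hcon hω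
    have h2 := (hCM n ω hcon.1).trans (mul_le_mul_right hcon.2 _)
    rw [← ENNReal.ofReal_mul hC.le] at h2
    refine absurd hω (not_lt.2 (h2.trans_eq ?_))
    congr 1; field_simp
  calc _ ≤ _ := measure_mono hsub
    _ ≤ _ := measure_union_le _ _
    _ ≤ ε / 2 + ε / 2 := add_le_add hn1 hn2
    _ = ε := ENNReal.add_halves ε

theorem IsLittleOp.const_mul {A : ℕ → Ω → ℝ≥0∞} {r : ℕ → ℝ} (hA : IsLittleOp μ A r) {C : ℝ} :
    IsLittleOp μ (fun n ω => ENNReal.ofReal C * A n ω) r := by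
  -- `C` may be nonpositive, whereas `of_good` asks for a positive constant; hence `|C| + 1`.
  refine IsLittleOp.of_good (B := fun _ => A) (fun _ _ _ => True)
    (fun δ hδ => ⟨0, by simp⟩) (fun _ => hA) fun _ => ⟨|C| + 1, by positivity, fun n ω _ => ?_⟩
  gcongr
  linarith [le_abs_self C]

theorem IsLittleOp.mul {A B : ℕ → Ω → ℝ≥0∞} {r s : ℕ → ℝ} (hr : ∀ n, 0 ≤ r n)
    (hA : IsLittleOp μ A r) (hB : IsLittleOp μ B s) :
    IsLittleOp μ (fun n ω => A n ω * B n ω) (fun n => r n * s n) := by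
  intro δ hδ
  have h := (hA (√δ) (by positivity)).add (hB (√δ) (by positivity))
  rw [add_zero] at h
  refine tendsto_of_tendsto_of_tendsto_of_le_of_le tendsto_const_nhds h (fun _ => zero_le)
    fun n => le_trans (measure_mono ?_) (measure_union_le _ _)
  intro ω hω
  by_contra hcon
  simp only [Set.mem_union, Set.mem_ofPred_eq, not_or, not_lt] at hcon hω
  have h2 := mul_le_mul' hcon.1 hcon.2
  rw [← ENNReal.ofReal_mul (mul_nonneg (Real.sqrt_nonneg _) (hr n))] at h2
  refine absurd hω (not_lt.2 (h2.trans_eq ?_))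
  congr 1
  calc √δ * r n * (√δ * s n) = (√δ * √δ) * (r n * s n) := by ring
    _ = _ := by rw [Real.mul_self_sqrt hδ.le]

theorem IsLittleOp.mul_quarter {A B : ℕ → Ω → ℝ≥0∞}
    (hA : IsLittleOp μ A fun n => (n : ℝ) ^ (-(1 / 4) : ℝ))
    (hB : IsLittleOp μ B fun n => (n : ℝ) ^ (-(1 / 4) : ℝ)) :
    IsLittleOp μ (fun n ω => A n ω * B n ω) fun n => (n : ℝ) ^ (-(1 / 2) : ℝ) := by
  have h := IsLittleOp.mul (fun n => by positivity) hA hB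
  convert! h using 2 with n
  -- At `n = 0` both sides are `0`, because a real power of `0` with nonzero exponent is `0`.
  rcases Nat.eq_zero_or_pos n with rfl | hn
  · norm_num
  · rw [← Real.rpow_add (by exact_mod_cast hn)]; norm_num

theorem IsLittleOp.one_of_half {A : ℕ → Ω → ℝ≥0∞}
    (hA : IsLittleOp μ A fun n => (n : ℝ) ^ (-(1 / 2) : ℝ)) : IsLittleOp μ A fun _ => 1 := by
  intro δ hδ
  refine tendsto_of_tendsto_of_tendsto_of_le_of_le' tendsto_const_nhds (hA δ hδ)
    (Eventually.of_forall fun _ => zero_le) ?_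
  filter_upwards [eventually_ge_atTop 1] with n hn
  refine measure_mono fun ω hω => lt_of_le_of_lt (ENNReal.ofReal_le_ofReal ?_) hω
  gcongr
  exact Real.rpow_le_one_of_one_le_of_nonpos (by exact_mod_cast hn) (by norm_num)

theorem IsLittleOp.mul_one {A B : ℕ → Ω → ℝ≥0∞}
    (hA : IsLittleOp μ A fun _ => 1) (hB : IsLittleOp μ B fun _ => 1) :
    IsLittleOp μ (fun n ω => A n ω * B n ω) fun _ => 1 := by
  simpa using IsLittleOp.mul (fun _ => zero_le_one) hA hB

theorem IsLittleOp.tendstoInMeasure {X : ℕ → Ω → ℝ}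
    (h : IsLittleOp μ (fun n ω => ‖X n ω‖ₑ) fun _ => 1) :
    TendstoInMeasure μ X atTop 0 := by
  rw [tendstoInMeasure_iff_norm]
  intro ε hε
  refine tendsto_of_tendsto_of_tendsto_of_le_of_le tendsto_const_nhds (h (ε / 2) (by positivity))
    (fun _ => zero_le) fun n => measure_mono fun ω hω => ?_
  simp only [Set.mem_ofPred_eq, Pi.zero_apply, sub_zero] at hω ⊢
  rw [← ofReal_norm]
  exact (ENNReal.ofReal_lt_ofReal_iff (by linarith)).2 (by linarith)

theorem isLittleOp_of_tendstoInMeasure {X : ℕ → Ω → ℝ} (h : TendstoInMeasure μ X atTop 0) :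
    IsLittleOp μ (fun n ω => ‖X n ω‖ₑ) fun _ => 1 := by
  rw [tendstoInMeasure_iff_norm] at h
  intro δ hδ
  refine tendsto_of_tendsto_of_tendsto_of_le_of_le tendsto_const_nhds (h δ hδ)
    (fun _ => zero_le) fun n => measure_mono fun ω hω => ?_
  simp only [Set.mem_ofPred_eq, Pi.zero_apply, sub_zero, mul_one] at hω ⊢
  rw [← ofReal_norm] at hω
  exact ((ENNReal.ofReal_lt_ofReal_iff_of_nonneg hδ.le).1 hω).le

end StochasticOrders

/-! ### Averages over independent units, given training data -/

section Empirical
variable {Ω 𝒪 : Type*} [MeasurableSpace Ω] [MeasurableSpace 𝒪] {μ : Measure Ω}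
  [IsProbabilityMeasure μ] {Q : Measure 𝒪} {O : ℕ → Ω → 𝒪}

/-- This replaces conditioning on the training data. Disjoint index sets give independent
subsamples, so the joint law is a product and Tonelli's theorem applies: sections over `G`
contribute at most `κ`, and the rest at most the probability that the training data fall outside
`G`. -/
theorem measure_le_of_section_le (hO : ∀ i, Measurable (O i)) (hindep : iIndepFun O μ)
    {T S : Finset ℕ} (hTS : Disjoint T S) {B : Set ((T → 𝒪) × (S → 𝒪))} (hB : MeasurableSet B)
    {G : Set (T → 𝒪)} (hG : MeasurableSet G) {κ : ℝ≥0∞}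
    (h : ∀ d ∈ G, μ {ω | (d, fun i : S => O i ω) ∈ B} ≤ κ) :
    μ {ω | ((fun i : T => O i ω), fun i : S => O i ω) ∈ B}
      ≤ μ {ω | (fun i : T => O i ω) ∉ G} + κ := by
  have mT : Measurable fun ω => fun i : T => O i ω := measurable_pi_lambda _ fun i => hO i
  have mS : Measurable fun ω => fun i : S => O i ω := measurable_pi_lambda _ fun i => hO i
  have hind := hindep.indepFun_finset T S hTS hO
  rw [indepFun_iff_map_prod_eq_prod_map_map mT.aemeasurable mS.aemeasurable] at hind
  have e1 : μ {ω | ((fun i : T => O i ω), fun i : S => O i ω) ∈ B}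
      = ((μ.map fun ω => fun i : T => O i ω).prod (μ.map fun ω => fun i : S => O i ω)) B := by
    rw [← hind, Measure.map_apply (mT.prodMk mS) hB]; rfl
  have : IsProbabilityMeasure (μ.map fun ω => fun i : T => O i ω) :=
    Measure.isProbabilityMeasure_map mT.aemeasurable
  have : IsProbabilityMeasure (μ.map fun ω => fun i : S => O i ω) :=
    Measure.isProbabilityMeasure_map mS.aemeasurable
  rw [e1, Measure.prod_apply hB]
  have e2 : μ {ω | (fun i : T => O i ω) ∉ G} = (μ.map fun ω => fun i : T => O i ω) Gᶜ := by
    rw [Measure.map_apply mT hG.compl]; rfl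
  calc ∫⁻ d, (μ.map fun ω => fun i : S => O i ω) (Prod.mk d ⁻¹' B)
        ∂(μ.map fun ω => fun i : T => O i ω)
      ≤ ∫⁻ d, (Gᶜ.indicator 1 d + κ) ∂(μ.map fun ω => fun i : T => O i ω) := by
        refine lintegral_mono fun d => ?_
        by_cases hd : d ∈ G
        · rw [Measure.map_apply mS (measurable_prodMk_left hB)]
          rw [Set.indicator_of_notMem (by simpa using hd), zero_add]
          exact h d hd
        · simp only [Set.mem_compl_iff, hd, not_false_eq_true, Set.indicator_of_mem, Pi.one_apply]
          exact prob_le_one.trans le_self_add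
    _ = _ := by
        rw [lintegral_add_right _ measurable_const, lintegral_indicator_one hG.compl, e2]
        simp

/-- Chebyshev's inequality: by independence the variance of the sum is the number of terms times the
variance of one term, which the second moment bounds. -/
theorem measure_sum_sub_gt_le (hO : ∀ i, Measurable (O i)) (hindep : iIndepFun O μ)
    (hlaw : ∀ i, μ.map (O i) = Q) {S : Finset ℕ} {f : 𝒪 → ℝ} (hf : Measurable f)
    {τ : ℝ} (hτ : 0 ≤ τ) (hfτ : ∫⁻ o, ‖f o‖ₑ ^ 2 ∂Q ≤ ENNReal.ofReal τ) {c : ℝ} (hc : 0 < c) :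
    μ {ω | c < |∑ i ∈ S, (f (O i ω) - ∫ o, f o ∂Q)|} ≤ ENNReal.ofReal (S.card * τ / c ^ 2) := by
  have : IsProbabilityMeasure Q := hlaw 0 ▸ Measure.isProbabilityMeasure_map (hO 0).aemeasurable
  have hL2 : MemLp f 2 Q := by
    refine ⟨hf.aestronglyMeasurable, ?_⟩
    rw [eLpNorm_lt_top_iff_lintegral_rpow_enorm_lt_top (by norm_num) (by norm_num)]
    simp only [ENNReal.toReal_ofNat, ENNReal.rpow_ofNat]
    exact hfτ.trans_lt ENNReal.ofReal_lt_top
  have hvar : variance f Q ≤ τ := by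
    rw [variance_eq_sub hL2]
    have h1 : ∫ o, (f ^ 2) o ∂Q ≤ τ := by
      simp only [Pi.pow_apply]
      rw [integral_eq_lintegral_of_nonneg_ae (ae_of_all _ fun o => sq_nonneg (f o))
        (hf.pow_const 2).aestronglyMeasurable]
      refine ENNReal.toReal_le_of_le_ofReal hτ ((lintegral_mono fun o => ?_).trans hfτ)
      rw [← ofReal_norm, ← ENNReal.ofReal_pow (norm_nonneg _),
        Real.norm_eq_abs, sq_abs]
    linarith [sq_nonneg (∫ o, f o ∂Q)]
  have hmp (i : ℕ) : MeasurePreserving (O i) μ Q := ⟨hO i, hlaw i⟩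
  have hX (i : ℕ) : MemLp (fun ω => f (O i ω)) 2 μ := hL2.comp_measurePreserving (hmp i)
  have hsum : MemLp (∑ i ∈ S, fun ω => f (O i ω)) 2 μ := memLp_finsetSum' _ fun i _ => hX i
  have hE : μ[∑ i ∈ S, fun ω => f (O i ω)] = ∑ i ∈ S, ∫ o, f o ∂Q := by
    simp only [Finset.sum_apply]
    rw [integral_finsetSum _ fun i _ => (hX i).integrable (by norm_num)]
    refine Finset.sum_congr rfl fun i _ => ?_
    rw [← hlaw i, integral_map (hO i).aemeasurable hf.aestronglyMeasurable]
  have hV : variance (∑ i ∈ S, fun ω => f (O i ω)) μ ≤ S.card * τ := by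
    rw [IndepFun.variance_sum (fun i _ => hX i)
      (fun i _ j _ hij => (hindep.indepFun hij).comp hf hf)]
    calc _ ≤ ∑ i ∈ S, τ := Finset.sum_le_sum fun i _ => by
          have := (hmp i).variance_fun_comp (f := f) hf.aemeasurable
          rw [this]; exact hvar
      _ = _ := by simp
  have := meas_ge_le_variance_div_sq hsum hc
  rw [hE] at this
  refine (measure_mono fun ω hω => ?_).trans (this.trans (ENNReal.ofReal_le_ofReal ?_))
  · simp only [Set.mem_ofPred_eq, Finset.sum_apply] at hω ⊢
    rw [Finset.sum_sub_distrib] at hω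
    exact hω.le
  · gcongr

omit [IsProbabilityMeasure μ] in
-- Markov's inequality. It needs neither centering nor independence, and serves for terms that are
-- already small in `L¹`.
theorem measure_sum_gt_le (hO : ∀ i, Measurable (O i))
    (hlaw : ∀ i, μ.map (O i) = Q) {S : Finset ℕ} {f : 𝒪 → ℝ} (hf : Measurable f)
    {τ : ℝ} (hfτ : ∫⁻ o, ‖f o‖ₑ ∂Q ≤ ENNReal.ofReal τ) {c : ℝ} (hc : 0 < c) :
    μ {ω | c < |∑ i ∈ S, f (O i ω)|} ≤ ENNReal.ofReal (S.card * τ / c) := by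
  have hmeas : Measurable fun ω => ∑ i ∈ S, ‖f (O i ω)‖ₑ :=
    Finset.measurable_sum _ fun i _ => (hf.comp (hO i)).enorm
  have h1 := meas_ge_le_lintegral_div (μ := μ) hmeas.aemeasurable
    (ε := ENNReal.ofReal c) (by simpa using hc) ENNReal.ofReal_ne_top
  refine (measure_mono fun ω hω => ?_).trans (h1.trans ?_)
  · simp only [Set.mem_ofPred_eq] at hω ⊢
    calc ENNReal.ofReal c ≤ ENNReal.ofReal |∑ i ∈ S, f (O i ω)| := ENNReal.ofReal_le_ofReal hω.le
      _ = ‖∑ i ∈ S, f (O i ω)‖ₑ := by rw [← ofReal_norm, Real.norm_eq_abs]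
      _ ≤ _ := enorm_sum_le _ _
  · have hm (i : ℕ) : Measurable fun ω => ‖f (O i ω)‖ₑ := (hf.comp (hO i)).enorm
    rw [lintegral_finsetSum _ fun i _ => hm i]
    have : ∀ i ∈ S, ∫⁻ ω, ‖f (O i ω)‖ₑ ∂μ ≤ ENNReal.ofReal τ := fun i _ => by
      rw [← lintegral_map (f := fun o => ‖f o‖ₑ) hf.enorm (hO i), hlaw i]; exact hfτ
    rw [ENNReal.ofReal_div_of_pos hc]
    gcongr
    calc _ ≤ ∑ i ∈ S, ENNReal.ofReal τ := Finset.sum_le_sum this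
      _ = _ := by
        rw [Finset.sum_const, nsmul_eq_mul, ENNReal.ofReal_mul (by positivity),
          ENNReal.ofReal_natCast]

/-- Chebyshev's inequality for a fixed value `d` of the training data, combined over `d` by
`measure_le_of_section_le`. The set `G` collects the training data for which the second moment of `ψ
d` is at most `τ`. -/
theorem measure_trained_sum_sub_gt_le (hO : ∀ i, Measurable (O i)) (hindep : iIndepFun O μ)
    (hlaw : ∀ i, μ.map (O i) = Q) {T S : Finset ℕ} (hTS : Disjoint T S)
    {ψ : (T → 𝒪) → 𝒪 → ℝ} (hψ : Measurable fun q : (T → 𝒪) × 𝒪 => ψ q.1 q.2)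
    {τ : ℝ} (hτ : 0 ≤ τ) {c : ℝ} (hc : 0 < c) :
    μ {ω | c < |∑ i ∈ S, (ψ (fun j => O j ω) (O i ω) - ∫ o, ψ (fun j => O j ω) o ∂Q)|}
      ≤ μ {ω | ENNReal.ofReal τ < ∫⁻ o, ‖ψ (fun j => O j ω) o‖ₑ ^ 2 ∂Q}
        + ENNReal.ofReal (S.card * τ / c ^ 2) := by
  have : IsProbabilityMeasure Q := hlaw 0 ▸ Measure.isProbabilityMeasure_map (hO 0).aemeasurable
  have mv : Measurable fun d : T → 𝒪 => ∫⁻ o, ‖ψ d o‖ₑ ^ 2 ∂Q :=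
    Measurable.lintegral_prod_right' (f := fun q : (T → 𝒪) × 𝒪 => ‖ψ q.1 q.2‖ₑ ^ 2)
      (hψ.enorm.pow_const 2)
  have mb : Measurable fun d : T → 𝒪 => ∫ o, ψ d o ∂Q :=
    (StronglyMeasurable.integral_prod_right' (f := fun q : (T → 𝒪) × 𝒪 => ψ q.1 q.2)
      hψ.stronglyMeasurable).measurable
  have hB : MeasurableSet {q : (T → 𝒪) × (S → 𝒪) |
      c < |∑ i : S, (ψ q.1 (q.2 i) - ∫ o, ψ q.1 o ∂Q)|} := by
    refine measurableSet_lt measurable_const (Measurable.abs ?_)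
    refine Finset.measurable_fun_sum _ fun i _ => Measurable.sub ?_ (mb.comp measurable_fst)
    exact hψ.comp (measurable_fst.prodMk ((measurable_pi_apply i).comp measurable_snd))
  have hG : MeasurableSet {d : T → 𝒪 | ∫⁻ o, ‖ψ d o‖ₑ ^ 2 ∂Q ≤ ENNReal.ofReal τ} :=
    measurableSet_le mv measurable_const
  have key := measure_le_of_section_le hO hindep hTS hB hG
    (κ := ENNReal.ofReal (S.card * τ / c ^ 2)) ?_
  · refine le_trans (measure_mono fun ω hω => ?_) (key.trans ?_)
    · simp only [Set.mem_ofPred_eq] at hω ⊢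
      rwa [Finset.sum_coe_sort S (fun i => ψ (fun j : T => O j ω) (O i ω)
        - ∫ o, ψ (fun j : T => O j ω) o ∂Q)]
    · simp only [Set.mem_ofPred_eq, not_le]; exact le_rfl
  · intro d hd
    have md : Measurable (ψ d) := hψ.comp measurable_prodMk_left
    refine (measure_mono fun ω hω => ?_).trans
      (measure_sum_sub_gt_le hO hindep hlaw (S := S) md hτ hd hc)
    simp only [Set.mem_ofPred_eq] at hω ⊢
    rwa [Finset.sum_coe_sort S (fun i => ψ d (O i ω) - ∫ o, ψ d o ∂Q)] at hω

theorem measure_trained_sum_gt_le (hO : ∀ i, Measurable (O i)) (hindep : iIndepFun O μ)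
    (hlaw : ∀ i, μ.map (O i) = Q) {T S : Finset ℕ} (hTS : Disjoint T S)
    {ψ : (T → 𝒪) → 𝒪 → ℝ} (hψ : Measurable fun q : (T → 𝒪) × 𝒪 => ψ q.1 q.2)
    {τ : ℝ} {c : ℝ} (hc : 0 < c) :
    μ {ω | c < |∑ i ∈ S, ψ (fun j => O j ω) (O i ω)|}
      ≤ μ {ω | ENNReal.ofReal τ < ∫⁻ o, ‖ψ (fun j => O j ω) o‖ₑ ∂Q}
        + ENNReal.ofReal (S.card * τ / c) := by
  have : IsProbabilityMeasure Q := hlaw 0 ▸ Measure.isProbabilityMeasure_map (hO 0).aemeasurable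
  have mv : Measurable fun d : T → 𝒪 => ∫⁻ o, ‖ψ d o‖ₑ ∂Q :=
    Measurable.lintegral_prod_right' (f := fun q : (T → 𝒪) × 𝒪 => ‖ψ q.1 q.2‖ₑ) hψ.enorm
  have hB : MeasurableSet {q : (T → 𝒪) × (S → 𝒪) | c < |∑ i : S, ψ q.1 (q.2 i)|} := by
    refine measurableSet_lt measurable_const (Measurable.abs ?_)
    refine Finset.measurable_fun_sum _ fun i _ => ?_
    exact hψ.comp (measurable_fst.prodMk ((measurable_pi_apply i).comp measurable_snd))
  have hG : MeasurableSet {d : T → 𝒪 | ∫⁻ o, ‖ψ d o‖ₑ ∂Q ≤ ENNReal.ofReal τ} :=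
    measurableSet_le mv measurable_const
  have key := measure_le_of_section_le hO hindep hTS hB hG
    (κ := ENNReal.ofReal (S.card * τ / c)) ?_
  · refine le_trans (measure_mono fun ω hω => ?_) (key.trans ?_)
    · simp only [Set.mem_ofPred_eq] at hω ⊢
      rwa [Finset.sum_coe_sort S (fun i => ψ (fun j : T => O j ω) (O i ω))]
    · simp only [Set.mem_ofPred_eq, not_le]; exact le_rfl
  · intro d hd
    have md : Measurable (ψ d) := hψ.comp measurable_prodMk_left
    refine (measure_mono fun ω hω => ?_).trans
      (measure_sum_gt_le hO hlaw (S := S) md hd hc)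
    simp only [Set.mem_ofPred_eq] at hω ⊢
    rwa [Finset.sum_coe_sort S (fun i => ψ d (O i ω))] at hω

end Empirical

/-! ### Cross-fitted averages -/

section CrossFitAverages
variable {𝒳 Ω : Type*} {O : ℕ → Ω → Obs 𝒳} {K : ℕ} {F : CrossFitting K}
  {N : NuisanceEstimator 𝒳 F}

/-- Joint measurability of `ψ` at the estimated nuisance functions. -/
def FitMeasurable [MeasurableSpace 𝒳] (N : NuisanceEstimator 𝒳 F) (ψ : Nuisance 𝒳 → Obs 𝒳 → ℝ) : Prop :=
  ∀ n k, Measurable fun q : (F.train n k → Obs 𝒳) × Obs 𝒳 => ψ (N n k q.1) q.2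

/-- The units of fold `k` at stage `n`. -/
def CrossFitting.units (F : CrossFitting K) (n : ℕ) (k : Fin K) : Finset ℕ :=
  (Finset.univ.filter fun i : Fin n => F.fold n i = k).map Fin.valEmbedding

theorem CrossFitting.card_units_le (F : CrossFitting K) (n : ℕ) (k : Fin K) :
    (F.units n k).card ≤ n := by
  unfold units
  rw [Finset.card_map]
  exact (Finset.card_filter_le _ _).trans (by simp)

theorem CrossFitting.disjoint_units (F : CrossFitting K) (n : ℕ) (k : Fin K) :
    Disjoint (F.train n k) (F.units n k) := by
  rw [Finset.disjoint_left]
  intro a ha hau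
  simp only [units, Finset.mem_map, Finset.mem_filter, Finset.mem_univ, true_and,
    Fin.valEmbedding_apply] at hau
  obtain ⟨i, hi, rfl⟩ := hau
  exact F.disjoint n i (hi ▸ ha)

theorem sum_eq_sum_units (N : NuisanceEstimator 𝒳 F) (ψ : Nuisance 𝒳 → Obs 𝒳 → ℝ) (n : ℕ)
    (ω : Ω) : ∑ i : Fin n, ψ (fit N O n (F.fold n i) ω) (O i ω)
      = ∑ k, ∑ i ∈ F.units n k, ψ (fit N O n k ω) (O i ω) := by
  rw [← Finset.sum_fiberwise_of_maps_to (s := Finset.univ) (t := Finset.univ)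
    (g := fun i : Fin n => F.fold n i) (fun _ _ => Finset.mem_univ _)]
  refine Finset.sum_congr rfl fun k _ => ?_
  unfold CrossFitting.units
  rw [Finset.sum_map]
  refine Finset.sum_congr rfl fun i hi => ?_
  rw [(Finset.mem_filter.1 hi).2]
  rfl

theorem sqrt_mul_crossAvg (N : NuisanceEstimator 𝒳 F) (ψ : Nuisance 𝒳 → Obs 𝒳 → ℝ) (n : ℕ)
    (ω : Ω) : √(n : ℝ) * crossAvg N O ψ n ω
      = ∑ k, (∑ i ∈ F.units n k, ψ (fit N O n k ω) (O i ω)) / √(n : ℝ) := by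
  rw [crossAvg, sum_eq_sum_units, ← Finset.sum_div]
  rcases Nat.eq_zero_or_pos n with rfl | hn
  · simp
  · have h : (0 : ℝ) < n := by exact_mod_cast hn
    have h2 := Real.mul_self_sqrt h.le
    have h3 := Real.sqrt_pos.2 h
    field_simp
    rw [Real.sq_sqrt h.le, mul_comm]

variable [MeasurableSpace 𝒳] [MeasurableSpace Ω] {μ : Measure Ω} [IsProbabilityMeasure μ]
  {Q : Measure (Obs 𝒳)}

/-- A fold has at most `n` units, so Markov's inequality with an `L¹` norm below `τ n^{-1/2}` bounds
the exceedance probability of level `δ √n` by `τ / δ`. -/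
theorem isLittleOp_crossAvg_of_L1 (hO : ∀ i, Measurable (O i)) (hindep : iIndepFun O μ)
    (hlaw : ∀ i, μ.map (O i) = Q) {ψ : Nuisance 𝒳 → Obs 𝒳 → ℝ} (hψ : FitMeasurable N ψ)
    (h1 : ∀ k, IsLittleOp μ (fun n ω => ∫⁻ o, ‖ψ (fit N O n k ω) o‖ₑ ∂Q)
      fun n => (n : ℝ) ^ (-(1 / 2) : ℝ)) :
    IsLittleOp μ (fun n ω => ‖√(n : ℝ) * crossAvg N O ψ n ω‖ₑ) fun _ => 1 := by
  suffices h : ∀ k, IsLittleOp μ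
      (fun n ω => ‖(∑ i ∈ F.units n k, ψ (fit N O n k ω) (O i ω)) / √(n : ℝ)‖ₑ) fun _ => 1 by
    refine (IsLittleOp.sum Finset.univ fun k _ => h k).mono fun n ω => ?_
    rw [sqrt_mul_crossAvg]
    exact enorm_sum_le _ _
  intro k δ hδ
  rw [ENNReal.tendsto_nhds_zero]
  intro ε hε
  -- `τ` makes the Markov bound `τ / δ` at most `ε / 2`; the value `ε = ∞` has no real counterpart
  -- and is treated apart.
  obtain ⟨τ, hτ, hτε⟩ : ∃ τ : ℝ, 0 < τ ∧ ENNReal.ofReal (τ / δ) ≤ ε / 2 := by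
    rcases eq_or_ne ε ∞ with rfl | hεt
    · exact ⟨1, one_pos, by simp [ENNReal.top_div]⟩
    · refine ⟨δ * (ε / 2).toReal, mul_pos hδ (ENNReal.toReal_pos (ENNReal.half_pos hε.ne').ne'
        (ENNReal.div_lt_top hεt (by simp)).ne), ?_⟩
      rw [mul_div_cancel_left₀ _ hδ.ne', ENNReal.ofReal_toReal (ENNReal.div_lt_top hεt (by simp)).ne]
  filter_upwards [ENNReal.tendsto_nhds_zero.1 (h1 k τ hτ) (ε / 2) (ENNReal.half_pos hε.ne'),
    eventually_ge_atTop 1] with n hn hn1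
  have hn0 : (0 : ℝ) < n := by exact_mod_cast hn1
  have hs := Real.sqrt_pos.2 hn0
  have key := measure_trained_sum_gt_le hO hindep hlaw (F.disjoint_units n k)
      (ψ := fun d => ψ (N n k d)) (hψ n k)
    (τ := τ * (n : ℝ) ^ (-(1 / 2) : ℝ)) (c := δ * √(n : ℝ)) (by positivity)
  calc _ ≤ _ := measure_mono fun ω hω => ?_
    _ ≤ _ := key
    _ ≤ ε / 2 + ε / 2 := add_le_add hn ((ENNReal.ofReal_le_ofReal ?_).trans hτε)
    _ = ε := ENNReal.add_halves ε
  · simp only [Set.mem_ofPred_eq, mul_one] at hω ⊢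
    rw [← ofReal_norm, ENNReal.ofReal_lt_ofReal_iff_of_nonneg hδ.le, norm_div,
      Real.norm_eq_abs, Real.norm_eq_abs, abs_of_pos hs, lt_div_iff₀ hs] at hω
    exact hω
  · have hc : ((F.units n k).card : ℝ) ≤ n := by exact_mod_cast F.card_units_le n k
    rw [Real.rpow_neg hn0.le, ← Real.sqrt_eq_rpow]
    rw [div_le_div_iff₀ (by positivity) hδ]
    have : (n : ℝ) * (√(n : ℝ))⁻¹ = √(n : ℝ) := by
      field_simp; exact (Real.sq_sqrt hn0.le).symm
    calc _ = ((F.units n k).card : ℝ) * (√(n : ℝ))⁻¹ * (τ * δ) := by ring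
      _ ≤ n * (√(n : ℝ))⁻¹ * (τ * δ) := by gcongr
      _ = _ := by rw [this]; ring

/-- On each fold the sum splits into a centered part, controlled by Chebyshev's inequality and a
vanishing second moment, and the number of units times the conditional mean, for which the rate
`n^{-1/2}` is needed. -/
theorem isLittleOp_crossAvg_of_L2 (hO : ∀ i, Measurable (O i)) (hindep : iIndepFun O μ)
    (hlaw : ∀ i, μ.map (O i) = Q) {ψ : Nuisance 𝒳 → Obs 𝒳 → ℝ} (hψ : FitMeasurable N ψ)
    (h2 : ∀ k, IsLittleOp μ (fun n ω => ∫⁻ o, ‖ψ (fit N O n k ω) o‖ₑ ^ 2 ∂Q) fun _ => 1)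
    (hb : ∀ k, IsLittleOp μ (fun n ω => ‖∫ o, ψ (fit N O n k ω) o ∂Q‖ₑ)
      fun n => (n : ℝ) ^ (-(1 / 2) : ℝ)) :
    IsLittleOp μ (fun n ω => ‖√(n : ℝ) * crossAvg N O ψ n ω‖ₑ) fun _ => 1 := by
  suffices h : ∀ k, IsLittleOp μ
      (fun n ω => ‖(∑ i ∈ F.units n k, ψ (fit N O n k ω) (O i ω)) / √(n : ℝ)‖ₑ) fun _ => 1 by
    refine (IsLittleOp.sum Finset.univ fun k _ => h k).mono fun n ω => ?_
    rw [sqrt_mul_crossAvg]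
    exact enorm_sum_le _ _
  intro k
  have hA : IsLittleOp μ (fun n ω => ‖(∑ i ∈ F.units n k, (ψ (fit N O n k ω) (O i ω)
      - ∫ o, ψ (fit N O n k ω) o ∂Q)) / √(n : ℝ)‖ₑ) fun _ => 1 := by
    intro δ hδ
    rw [ENNReal.tendsto_nhds_zero]
    intro ε hε
    obtain ⟨τ, hτ, hτε⟩ : ∃ τ : ℝ, 0 < τ ∧ ENNReal.ofReal (τ / δ ^ 2) ≤ ε / 2 := by
      rcases eq_or_ne ε ∞ with rfl | hεt
      · exact ⟨1, one_pos, by simp [ENNReal.top_div]⟩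
      · refine ⟨δ ^ 2 * (ε / 2).toReal, mul_pos (by positivity)
          (ENNReal.toReal_pos (ENNReal.half_pos hε.ne').ne'
          (ENNReal.div_lt_top hεt (by simp)).ne), ?_⟩
        rw [mul_div_cancel_left₀ _ (by positivity),
          ENNReal.ofReal_toReal (ENNReal.div_lt_top hεt (by simp)).ne]
    filter_upwards [ENNReal.tendsto_nhds_zero.1 (h2 k τ hτ) (ε / 2) (ENNReal.half_pos hε.ne'),
      eventually_ge_atTop 1] with n hn hn1
    have hn0 : (0 : ℝ) < n := by exact_mod_cast hn1
    have hs := Real.sqrt_pos.2 hn0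
    have key := measure_trained_sum_sub_gt_le hO hindep hlaw (F.disjoint_units n k)
      (ψ := fun d => ψ (N n k d)) (hψ n k)
      (τ := τ * 1) (by positivity) (c := δ * √(n : ℝ)) (by positivity)
    calc _ ≤ _ := measure_mono fun ω hω => ?_
      _ ≤ _ := key
      _ ≤ ε / 2 + ε / 2 := add_le_add hn ((ENNReal.ofReal_le_ofReal ?_).trans hτε)
      _ = ε := ENNReal.add_halves ε
    · simp only [Set.mem_ofPred_eq, mul_one] at hω ⊢
      rw [← ofReal_norm, ENNReal.ofReal_lt_ofReal_iff_of_nonneg hδ.le, norm_div,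
        Real.norm_eq_abs, Real.norm_eq_abs, abs_of_pos hs, lt_div_iff₀ hs] at hω
      exact hω
    · have hc : ((F.units n k).card : ℝ) ≤ n := by exact_mod_cast F.card_units_le n k
      rw [mul_pow, Real.sq_sqrt hn0.le, div_le_div_iff₀ (by positivity) (by positivity)]
      calc _ = ((F.units n k).card : ℝ) * (τ * δ ^ 2) := by ring
        _ ≤ n * (τ * δ ^ 2) := by gcongr
        _ = _ := by ring
  have hB : IsLittleOp μ (fun n ω => ENNReal.ofReal √(n : ℝ) * ‖∫ o, ψ (fit N O n k ω) o ∂Q‖ₑ)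
      fun _ => 1 := by
    intro δ hδ
    refine tendsto_of_tendsto_of_tendsto_of_le_of_le' tendsto_const_nhds (hb k δ hδ)
      (Eventually.of_forall fun _ => zero_le) ?_
    filter_upwards [eventually_ge_atTop 1] with n hn1
    have hn0 : (0 : ℝ) < n := by exact_mod_cast hn1
    have hs := Real.sqrt_pos.2 hn0
    refine measure_mono fun ω hω => ?_
    simp only [Set.mem_ofPred_eq, mul_one] at hω ⊢
    rw [← ofReal_norm, ← ENNReal.ofReal_mul hs.le,
      ENNReal.ofReal_lt_ofReal_iff_of_nonneg hδ.le] at hω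
    rw [← ofReal_norm, ENNReal.ofReal_lt_ofReal_iff_of_nonneg (by positivity),
      Real.rpow_neg hn0.le, ← Real.sqrt_eq_rpow, ← div_eq_mul_inv, div_lt_iff₀ hs]
    linarith
  refine (hA.add hB).mono fun n ω => ?_
  rcases Nat.eq_zero_or_pos n with rfl | hn1
  · simp
  have hn0 : (0 : ℝ) < n := by exact_mod_cast hn1
  have hs := Real.sqrt_pos.2 hn0
  have hc : ((F.units n k).card : ℝ) ≤ n := by exact_mod_cast F.card_units_le n k
  rw [Finset.sum_sub_distrib, Finset.sum_const, nsmul_eq_mul]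
  set s := ∑ i ∈ F.units n k, ψ (fit N O n k ω) (O i ω)
  set b := ∫ o, ψ (fit N O n k ω) o ∂Q
  -- The bias of the fold enters with factor `card / √n`, which is at most `√n` because `card ≤ n`.
  calc ‖s / √(n : ℝ)‖ₑ
      = ‖(s - (F.units n k).card * b) / √(n : ℝ) + (F.units n k).card / √(n : ℝ) * b‖ₑ := by
        congr 1; field_simp; ring
    _ ≤ _ := enorm_add_le _ _
    _ ≤ _ := by
      gcongr
      rw [enorm_mul]
      gcongr
      rw [← ofReal_norm, Real.norm_eq_abs, abs_of_nonneg (by positivity)]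
      refine ENNReal.ofReal_le_ofReal ?_
      rw [div_le_iff₀ hs, Real.mul_self_sqrt hn0.le]
      exact hc

end CrossFitAverages

/-! ### Residuals with conditional mean zero -/

section MeanZero

/-- `r` is integrable and has conditional mean zero given the covariates. -/
structure MeanZero {Ω : Type*} (m : MeasurableSpace Ω) {mΩ : MeasurableSpace Ω}
    (μ : Measure Ω) (r : Ω → ℝ) : Prop where
  integrable : Integrable r μ
  condExp_eq : μ[r | m] =ᵐ[μ] 0

variable {Ω : Type*} {m mΩ : MeasurableSpace Ω} {μ : Measure Ω} {r s : Ω → ℝ}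

theorem MeanZero.mul_left (h : MeanZero m μ r) {f : Ω → ℝ} (hf : Measurable[m] f)
    (hfr : Integrable (fun o => f o * r o) μ) : MeanZero m μ fun o => f o * r o := by
  refine ⟨hfr, ?_⟩
  filter_upwards [condExp_mul_of_stronglyMeasurable_left hf.stronglyMeasurable hfr h.integrable,
    h.condExp_eq] with o h1 h2
  have : μ[fun o => f o * r o | m] o = μ[f * r | m] o := rfl
  rw [this, h1]
  simp [h2]

theorem MeanZero.add (h : MeanZero m μ r) (h' : MeanZero m μ s) : MeanZero m μ fun o => r o + s o := by
  refine ⟨h.integrable.add h'.integrable, ?_⟩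
  filter_upwards [condExp_add h.integrable h'.integrable m, h.condExp_eq,
    h'.condExp_eq] with o h1 h2 h3
  have : μ[fun o => r o + s o | m] o = μ[r + s | m] o := rfl
  rw [this, h1]
  simp [h2, h3]

theorem MeanZero.congr (h : MeanZero m μ r) (hrs : r =ᵐ[μ] s) : MeanZero m μ s :=
  ⟨h.integrable.congr hrs, (condExp_congr_ae hrs).symm.trans h.condExp_eq⟩

theorem MeanZero.neg (h : MeanZero m μ r) : MeanZero m μ fun o => - r o := by
  refine ⟨h.integrable.neg, ?_⟩
  filter_upwards [condExp_neg (μ := μ) r m, h.condExp_eq] with o h1 h2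
  have : μ[fun o => - r o | m] o = μ[-r | m] o := rfl
  rw [this, h1]
  simp [h2]

variable {w V v : Ω → ℝ}

/-- This exhibits `v` as a ratio of conditional expectations, a weighted regression of `V` with
weight `w`. Together with positivity of `μ[w | m]` it identifies `v`, and it transfers bounds on `V`
to `v`. -/
theorem MeanZero.condExp_mul_eq (h : MeanZero m μ fun o => w o * (V o - v o))
    (hv : Measurable[m] v) (hw : Integrable w μ)
    (hwV : Integrable (fun o => w o * V o) μ) :
    μ[fun o => w o * V o | m] =ᵐ[μ] fun o => v o * μ[w | m] o := by
  have h1 : Integrable (v * w) μ := by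
    refine (hwV.sub h.integrable).congr (ae_of_all _ fun o => ?_)
    simp only [Pi.sub_apply, Pi.mul_apply]; ring
  have h2 : (fun o => w o * V o) = (fun o => w o * (V o - v o)) + v * w := by
    ext o; simp only [Pi.add_apply, Pi.mul_apply]; ring
  rw [h2]
  filter_upwards [condExp_add h.integrable h1 m, h.condExp_eq,
    condExp_mul_of_stronglyMeasurable_left hv.stronglyMeasurable h1 hw] with o e1 e2 e3
  rw [e1, Pi.add_apply, e2, e3]
  simp

theorem MeanZero.ae_le_of_le (h : MeanZero m μ fun o => w o * (V o - v o)) (hv : Measurable[m] v)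
    (hw : Integrable w μ) (hwV : Integrable (fun o => w o * V o) μ)
    (hpos : ∀ᵐ o ∂μ, 0 < μ[w | m] o) {a : ℝ} (ha : ∀ᵐ o ∂μ, a * w o ≤ w o * V o) :
    ∀ᵐ o ∂μ, a ≤ v o := by
  have h1 : μ[fun o => a * w o | m] ≤ᵐ[μ] μ[fun o => w o * V o | m] :=
    condExp_mono (hw.const_mul a) hwV ha
  have h2 : μ[fun o => a * w o | m] =ᵐ[μ] fun o => a * μ[w | m] o :=
    condExp_smul (μ := μ) a w m
  filter_upwards [h1, h2, h.condExp_mul_eq hv hw hwV, hpos] with o e1 e2 e3 e4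
  rw [e2, e3] at e1
  exact le_of_mul_le_mul_right e1 e4

theorem MeanZero.ae_ge_of_ge (h : MeanZero m μ fun o => w o * (V o - v o)) (hv : Measurable[m] v)
    (hw : Integrable w μ) (hwV : Integrable (fun o => w o * V o) μ)
    (hpos : ∀ᵐ o ∂μ, 0 < μ[w | m] o) {a : ℝ} (ha : ∀ᵐ o ∂μ, w o * V o ≤ a * w o) :
    ∀ᵐ o ∂μ, v o ≤ a := by
  have h1 : μ[fun o => w o * V o | m] ≤ᵐ[μ] μ[fun o => a * w o | m] :=
    condExp_mono hwV (hw.const_mul a) ha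
  have h2 : μ[fun o => a * w o | m] =ᵐ[μ] fun o => a * μ[w | m] o :=
    condExp_smul (μ := μ) a w m
  filter_upwards [h1, h2, h.condExp_mul_eq hv hw hwV, hpos] with o e1 e2 e3 e4
  rw [e2, e3] at e1
  exact le_of_mul_le_mul_right e1 e4

variable [IsFiniteMeasure μ]

theorem MeanZero.of_setIntegral (hm : m ≤ mΩ) (hr : Integrable r μ)
    (h : ∀ A, MeasurableSet[m] A → ∫ o in A, r o ∂μ = 0) : MeanZero m μ r := by
  refine ⟨hr, ?_⟩
  symm
  refine ae_eq_condExp_of_forall_setIntegral_eq hm hr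
    (fun _ _ _ => integrableOn_zero) (fun A hA _ => ?_) ?_
  · rw [h A hA]; simp
  · exact (@measurable_zero ℝ Ω _ m _).stronglyMeasurable.aestronglyMeasurable

theorem MeanZero.setIntegral_eq_zero (hm : m ≤ mΩ) (h : MeanZero m μ r) {A : Set Ω}
    (hA : MeasurableSet[m] A) : ∫ o in A, r o ∂μ = 0 := by
  rw [← setIntegral_condExp hm h.integrable hA]
  rw [integral_congr_ae (ae_restrict_of_ae h.condExp_eq)]
  simp

theorem MeanZero.integral_eq_zero (hm : m ≤ mΩ) (h : MeanZero m μ r) : ∫ o, r o ∂μ = 0 := by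
  simpa using h.setIntegral_eq_zero hm MeasurableSet.univ

/-- The residual from conditioning on `m` and an event. -/
theorem MeanZero.of_cond (hm : m ≤ mΩ) {E : Set Ω} (hE : MeasurableSet E)
    (hV : IntegrableOn V E μ) {u : Ω → ℝ}
    (hu : u =ᵐ[ProbabilityTheory.cond μ E] (ProbabilityTheory.cond μ E)[V | m]) :
    MeanZero m μ fun o => E.indicator 1 o * (V o - u o) := by
  have e1 : (fun o => E.indicator (1 : Ω → ℝ) o * (V o - u o)) = E.indicator (V - u) := by
    ext o
    by_cases ho : o ∈ E <;> simp [ho]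
  rw [e1]
  -- If `E` is null, the conditioned measure is zero and says nothing about `u`; but then the
  -- indicator vanishes almost everywhere.
  by_cases hE0 : μ E = 0
  · have h0 : E.indicator (V - u) =ᵐ[μ] 0 := by
      have : ∀ᵐ o ∂μ, o ∉ E := measure_eq_zero_iff_ae_notMem.1 hE0
      filter_upwards [this] with o ho
      simp [ho]
    have hz : MeanZero m μ (fun _ => (0 : ℝ)) :=
      MeanZero.of_setIntegral hm (integrable_zero _ _ _) (by simp)
    exact hz.congr h0.symm
  have hEi : μ E ≠ ∞ := measure_ne_top _ _
  have hVc : Integrable V (ProbabilityTheory.cond μ E) := by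
    unfold ProbabilityTheory.cond
    exact hV.smul_measure (ENNReal.inv_ne_top.2 hE0)
  have hui : Integrable u (ProbabilityTheory.cond μ E) := integrable_condExp.congr hu.symm
  have hVu : Integrable (V - u) (ProbabilityTheory.cond μ E) := hVc.sub hui
  have hVu' : Integrable (V - u) (μ.restrict E) := by
    unfold ProbabilityTheory.cond at hVu
    rwa [integrable_smul_measure (ENNReal.inv_ne_zero.2 hEi) (ENNReal.inv_ne_top.2 hE0)] at hVu
  refine MeanZero.of_setIntegral hm ((integrable_indicator_iff hE).2 hVu') fun A hA => ?_
  have h2 : ∫ o in A, (V - u) o ∂(ProbabilityTheory.cond μ E) = 0 := by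
    simp only [Pi.sub_apply]
    rw [integral_sub hVc.restrict hui.restrict, integral_congr_ae (ae_restrict_of_ae hu),
      setIntegral_condExp hm hVc hA, sub_self]
  unfold ProbabilityTheory.cond at h2
  rw [Measure.restrict_smul, integral_smul_measure, smul_eq_mul] at h2
  have h3 : ((μ E)⁻¹).toReal ≠ 0 :=
    (ENNReal.toReal_pos (ENNReal.inv_ne_zero.2 hEi) (ENNReal.inv_ne_top.2 hE0)).ne'
  have h4 := (mul_eq_zero.1 h2).resolve_left h3
  rw [Measure.restrict_restrict (hm _ hA)] at h4
  rwa [integral_indicator hE, Measure.restrict_restrict hE, Set.inter_comm]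

end MeanZero

/-! ### Residuals orthogonal to functions of the covariates -/

section Orthogonality
variable {𝒳 : Type*}

theorem Obs.zz_eq (o : Obs 𝒳) : o.zz = 0 ∨ o.zz = 1 := by
  unfold Obs.zz; split_ifs <;> simp

theorem Obs.ind_eq (c : Bool) (o : Obs 𝒳) : o.ind c = 0 ∨ o.ind c = 1 := by
  unfold Obs.ind; split_ifs <;> simp

variable [MeasurableSpace 𝒳]

theorem Obs.measurable_X : Measurable (Obs.X : Obs 𝒳 → 𝒳) := measurable_fst
theorem Obs.measurable_Z : Measurable (Obs.Z : Obs 𝒳 → Bool) := measurable_fst.comp measurable_snd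
theorem Obs.measurable_S : Measurable (Obs.S : Obs 𝒳 → Bool) :=
  measurable_fst.comp (measurable_snd.comp measurable_snd)
theorem Obs.measurable_Y : Measurable (Obs.Y : Obs 𝒳 → ℝ) :=
  measurable_snd.comp (measurable_snd.comp measurable_snd)

theorem Obs.sigmaX_le : (Obs.sigmaX : MeasurableSpace (Obs 𝒳)) ≤ (inferInstance : MeasurableSpace (Obs 𝒳)) :=
  Obs.measurable_X.comap_le

theorem Obs.measurable_zz : Measurable (Obs.zz : Obs 𝒳 → ℝ) :=
  Measurable.ite (Obs.measurable_Z (measurableSet_singleton true)) measurable_const measurable_const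

theorem Obs.measurable_ind (c : Bool) : Measurable (Obs.ind c : Obs 𝒳 → ℝ) :=
  Measurable.ite (Obs.measurable_S (measurableSet_singleton c)) measurable_const measurable_const

theorem measurable_comp_X {f : 𝒳 → ℝ} (hf : Measurable f) :
    Measurable[Obs.sigmaX] fun o : Obs 𝒳 => f o.X :=
  hf.comp (comap_measurable Obs.X)

/-- `r` is integrable and has conditional mean zero given the covariates. -/
abbrev Orth (Q : Measure (Obs 𝒳)) (r : Obs 𝒳 → ℝ) : Prop := MeanZero Obs.sigmaX Q r

variable {Q : Measure (Obs 𝒳)} {w V v r : Obs 𝒳 → ℝ}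

theorem Integrable.zz_mul (h : Integrable V Q) : Integrable (fun o => o.zz * V o) Q :=
  h.bdd_mul Obs.measurable_zz.aestronglyMeasurable (c := 1)
    (ae_of_all _ fun o => by rcases o.zz_eq with h | h <;> simp [h])

theorem Integrable.one_sub_zz_mul (h : Integrable V Q) :
    Integrable (fun o => (1 - o.zz) * V o) Q :=
  h.bdd_mul (measurable_const.sub Obs.measurable_zz).aestronglyMeasurable (c := 1)
    (ae_of_all _ fun o => by rcases o.zz_eq with h | h <;> simp [h])

theorem Integrable.ind_mul (c : Bool) (h : Integrable V Q) :
    Integrable (fun o => o.ind c * V o) Q :=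
  h.bdd_mul (Obs.measurable_ind c).aestronglyMeasurable (c := 1)
    (ae_of_all _ fun o => by rcases o.ind_eq c with h | h <;> simp [h])

variable [IsFiniteMeasure Q]

theorem Orth.of_setIntegral (hr : Integrable r Q)
    (h : ∀ A, MeasurableSet[Obs.sigmaX] A → ∫ o in A, r o ∂Q = 0) : Orth Q r :=
  MeanZero.of_setIntegral Obs.sigmaX_le hr h

theorem orth_cond {E : Set (Obs 𝒳)} (hE : MeasurableSet E) (hV : IntegrableOn V E Q) :
    Orth Q fun o => E.indicator 1 o *
      (V o - ((ProbabilityTheory.cond Q E)[V | Obs.sigmaX]) o) :=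
  MeanZero.of_cond Obs.sigmaX_le hE hV ae_eq_rfl

/-! Residuals of the observed-data nuisance functions -/

theorem measurableSet_Z (b : Bool) : MeasurableSet {o : Obs 𝒳 | o.Z = b} :=
  Obs.measurable_Z (measurableSet_singleton b)

theorem integrable_zz : Integrable (Obs.zz : Obs 𝒳 → ℝ) Q :=
  Integrable.of_bound Obs.measurable_zz.aestronglyMeasurable 1
    (ae_of_all _ fun o => by rcases o.zz_eq with h | h <;> simp [h])

theorem integrable_one_sub_zz : Integrable (fun o : Obs 𝒳 => 1 - o.zz) Q :=
  (integrable_const 1).sub integrable_zz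

theorem integrable_ind (c : Bool) : Integrable (Obs.ind c : Obs 𝒳 → ℝ) Q :=
  Integrable.of_bound (Obs.measurable_ind c).aestronglyMeasurable 1
    (ae_of_all _ fun o => by rcases o.ind_eq c with h | h <;> simp [h])

theorem orth_cond_treated (hV : IntegrableOn V {o | o.Z = true} Q) :
    Orth Q fun o => o.zz *
      (V o - ((ProbabilityTheory.cond Q {o | o.Z = true})[V | Obs.sigmaX]) o) := by
  refine (orth_cond (measurableSet_Z true) hV).congr (ae_of_all _ fun o => ?_)
  by_cases h : o.Z = true <;> simp [Obs.zz, h]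

theorem orth_cond_control (hV : IntegrableOn V {o | o.Z = false} Q) :
    Orth Q fun o => (1 - o.zz) *
      (V o - ((ProbabilityTheory.cond Q {o | o.Z = false})[V | Obs.sigmaX]) o) := by
  refine (orth_cond (measurableSet_Z false) hV).congr (ae_of_all _ fun o => ?_)
  by_cases h : o.Z = true <;> simp [Obs.zz, h]

theorem measurable_condExp_X (ν : Measure (Obs 𝒳)) (V : Obs 𝒳 → ℝ) :
    Measurable[Obs.sigmaX] (ν[V | Obs.sigmaX]) := stronglyMeasurable_condExp.measurable

theorem orth_obsPi (c : Bool) : Orth Q fun o => o.zz * (o.ind c - obsPi Q c o) :=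
  orth_cond_treated (integrable_ind c).integrableOn

theorem orth_obsMu0 (hY : Integrable Obs.Y Q) :
    Orth Q fun o => (1 - o.zz) * (o.Y - obsMu0 Q o) := orth_cond_control hY.integrableOn

theorem obsPi_mem_Icc (c : Bool) (hpos : ∀ᵐ o ∂Q, 0 < Q[Obs.zz | Obs.sigmaX] o) :
    ∀ᵐ o ∂Q, obsPi Q c o ∈ Set.Icc (0 : ℝ) 1 := by
  have hm : Measurable[Obs.sigmaX] (obsPi Q c) := measurable_condExp_X _ _
  have hi := Integrable.zz_mul (Q := Q) (integrable_ind c)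
  filter_upwards [(orth_obsPi (Q := Q) c).ae_le_of_le hm integrable_zz hi hpos (a := 0)
      (ae_of_all _ fun o => by
        rcases o.zz_eq with h | h <;> rcases o.ind_eq c with h' | h' <;> simp [h, h']),
    (orth_obsPi (Q := Q) c).ae_ge_of_ge hm integrable_zz hi hpos (a := 1)
      (ae_of_all _ fun o => by
        rcases o.zz_eq with h | h <;> rcases o.ind_eq c with h' | h' <;> simp [h, h'])]
    with o h1 h2 using ⟨h1, h2⟩

/-- The regression of `I(S = c) Y` among the treated is `π_c μ_{1c}`. Indeed `E[Z I(S = c) Y | X]`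
can be computed by conditioning on `Z = 1`, or by conditioning on `Z = 1, S = c` and then on `Z =
1`; positivity of `E[Z | X]` allows cancellation. -/
theorem orth_obsPi_mul_obsMu1 (c : Bool) (hY : Integrable Obs.Y Q)
    (hpos : ∀ᵐ o ∂Q, 0 < Q[Obs.zz | Obs.sigmaX] o) :
    Orth Q fun o => o.zz * (o.ind c * o.Y - obsPi Q c o * obsMu1 Q c o) := by
  have hY' : Integrable (fun o : Obs 𝒳 => o.ind c * o.Y) Q := Integrable.ind_mul c hY
  have h1 := orth_cond_treated (Q := Q) hY'.integrableOn
  set q := (ProbabilityTheory.cond Q {o | o.Z = true})[fun o => o.ind c * o.Y | Obs.sigmaX]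
  have hE : MeasurableSet {o : Obs 𝒳 | o.Z = true ∧ o.S = c} :=
    (measurableSet_Z true).inter (Obs.measurable_S (measurableSet_singleton c))
  have h2 : Orth Q fun o => (o.zz * o.ind c) * (o.Y - obsMu1 Q c o) := by
    refine (orth_cond hE hY.integrableOn).congr (ae_of_all _ fun o => ?_)
    change _ * (o.Y - obsMu1 Q c o) = _
    congr 1
    by_cases h : o.Z = true <;> by_cases h' : o.S = c <;> simp [Obs.zz, Obs.ind, h, h']
  have e1 := h1.condExp_mul_eq (measurable_condExp_X _ _) integrable_zz (Integrable.zz_mul hY')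
  have hzi := Integrable.zz_mul (Q := Q) (integrable_ind c)
  have e2 := h2.condExp_mul_eq (measurable_condExp_X _ _) hzi (by
    refine (Integrable.zz_mul hY').congr (ae_of_all _ fun o => ?_); simp only; ring)
  have e3 := (orth_obsPi (Q := Q) c).condExp_mul_eq (measurable_condExp_X _ _) integrable_zz hzi
  refine h1.congr ?_
  have e4 : (fun o : Obs 𝒳 => o.zz * o.ind c * o.Y) = fun o => o.zz * (o.ind c * o.Y) := by
    ext o; ring
  rw [e4] at e2
  filter_upwards [e1, e2, e3, hpos] with o a1 a2 a3 a4
  rw [a1, a3] at a2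
  change q o * _ = obsMu1 Q c o * _ at a2
  have : q o = obsMu1 Q c o * obsPi Q c o := by
    refine mul_right_cancel₀ a4.ne' (a2.trans ?_); ring
  rw [this]; ring

theorem orth_obsSigma2 (hY : MemLp Obs.Y 2 Q) :
    Orth Q fun o => (1 - o.zz) * ((o.Y - obsMu0 Q o) ^ 2 - obsSigma2 Q o) := by
  by_cases hE0 : Q {o | o.Z = false} = 0
  · have h0 : (fun o => (1 - o.zz) * ((o.Y - obsMu0 Q o) ^ 2 - obsSigma2 Q o)) =ᵐ[Q] 0 := by
      have : ∀ᵐ o ∂Q, o ∉ {o : Obs 𝒳 | o.Z = false} := measure_eq_zero_iff_ae_notMem.1 hE0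
      filter_upwards [this] with o ho
      have : o.Z = true := by simpa using ho
      simp [Obs.zz, this]
    have hz : Orth Q (fun _ => (0 : ℝ)) := Orth.of_setIntegral (integrable_zero _ _ _) (by simp)
    exact hz.congr h0.symm
  set E := {o : Obs 𝒳 | o.Z = false} with hEdef
  have hE : MeasurableSet E := measurableSet_Z false
  have hEi : Q E ≠ ∞ := measure_ne_top _ _
  have hYc : MemLp Obs.Y 2 (ProbabilityTheory.cond Q E) := by
    unfold ProbabilityTheory.cond
    exact hY.restrict E |>.smul_measure (ENNReal.inv_ne_top.2 hE0)
  -- The conditional variance is by definition the conditional expectation of this squared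
  -- deviation, so only its integrability on the control arm remains to be supplied.
  have hD : Integrable (fun o => (o.Y - obsMu0 Q o) ^ 2) (ProbabilityTheory.cond Q E) :=
    (hYc.sub (hYc.condExp one_le_two)).integrable_sq
  unfold ProbabilityTheory.cond at hD
  rw [integrable_smul_measure (ENNReal.inv_ne_zero.2 hEi) (ENNReal.inv_ne_top.2 hE0)] at hD
  exact orth_cond_control hD

end Orthogonality

/-! ### Tilted laws -/

section Tilting
variable {𝒳 : Type*} {g : Obs 𝒳 → ℝ} {M t : ℝ}

/-- All statements along the path are made for `|t| M ≤ 1/2`, where the density lies between `1/2`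
and `3/2`: the laws `Q` and `Q_t` then have the same null sets and comparable moments. -/
theorem tilt_bounds (hM : ∀ o, |g o| ≤ M) (ht : |t| * M ≤ 1 / 2) (o : Obs 𝒳) :
    1 / 2 ≤ 1 + t * g o ∧ 1 + t * g o ≤ 3 / 2 := by
  have h : |t * g o| ≤ 1 / 2 := by
    rw [abs_mul]; exact (mul_le_mul_of_nonneg_left (hM o) (abs_nonneg t)).trans ht
  constructor <;> linarith [abs_le.1 h]

variable [MeasurableSpace 𝒳] {Q : Measure (Obs 𝒳)}

theorem path_absolutelyContinuous : path Q g t ≪ Q := withDensity_absolutelyContinuous _ _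

theorem absolutelyContinuous_path (hg : Measurable g) (hM : ∀ o, |g o| ≤ M)
    (ht : |t| * M ≤ 1 / 2) : Q ≪ path Q g t := by
  refine withDensity_absolutelyContinuous' (by fun_prop) (ae_of_all _ fun o => ?_)
  have := (tilt_bounds hM ht o).1
  simp only [ne_eq, ENNReal.ofReal_eq_zero, not_le]
  linarith

theorem integrable_path_iff (hg : Measurable g) (hM : ∀ o, |g o| ≤ M)
    (ht : |t| * M ≤ 1 / 2) {f : Obs 𝒳 → ℝ} :
    Integrable f (path Q g t) ↔ Integrable (fun o => (1 + t * g o) * f o) Q := by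
  unfold path
  rw [integrable_withDensity_iff_integrable_smul' (by fun_prop)
    (ae_of_all _ fun _ => ENNReal.ofReal_lt_top)]
  refine integrable_congr (ae_of_all _ fun o => ?_)
  simp only [smul_eq_mul]
  rw [ENNReal.toReal_ofReal (by linarith [(tilt_bounds hM ht o).1])]

theorem integrable_tilt_mul (hg : Measurable g) (hM : ∀ o, |g o| ≤ M)
    (ht : |t| * M ≤ 1 / 2) {f : Obs 𝒳 → ℝ} (hf : Integrable f Q) :
    Integrable (fun o => (1 + t * g o) * f o) Q :=
  hf.bdd_mul (c := 3 / 2) (by fun_prop) (ae_of_all _ fun o => by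
    have := tilt_bounds hM ht o
    rw [Real.norm_eq_abs, abs_of_nonneg (by linarith)]; exact this.2)

theorem Integrable.path (hg : Measurable g) (hM : ∀ o, |g o| ≤ M)
    (ht : |t| * M ≤ 1 / 2) {f : Obs 𝒳 → ℝ} (hf : Integrable f Q) : Integrable f (path Q g t) :=
  (integrable_path_iff hg hM ht).2 (integrable_tilt_mul hg hM ht hf)

theorem MemLp.path (hM : ∀ o, |g o| ≤ M)
    (ht : |t| * M ≤ 1 / 2) {f : Obs 𝒳 → ℝ} {p : ℝ≥0∞} (hf : MemLp f p Q) :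
    MemLp f p (path Q g t) := by
  refine hf.of_measure_le_smul (c := ENNReal.ofReal (3 / 2)) ENNReal.ofReal_ne_top ?_
  unfold PISens.path
  rw [← withDensity_const]
  exact withDensity_mono (ae_of_all _ fun o => ENNReal.ofReal_le_ofReal (tilt_bounds hM ht o).2)

theorem setIntegral_path (hg : Measurable g) (hM : ∀ o, |g o| ≤ M)
    (ht : |t| * M ≤ 1 / 2) {f : Obs 𝒳 → ℝ} {A : Set (Obs 𝒳)} (hA : MeasurableSet A) :
    ∫ o in A, f o ∂(path Q g t) = ∫ o in A, (1 + t * g o) * f o ∂Q := by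
  unfold path
  rw [restrict_withDensity hA, integral_withDensity_eq_integral_toReal_smul (by fun_prop)
    (ae_of_all _ fun _ => ENNReal.ofReal_lt_top)]
  refine integral_congr_ae (ae_of_all _ fun o => ?_)
  simp only [smul_eq_mul]
  rw [ENNReal.toReal_ofReal (by linarith [(tilt_bounds hM ht o).1])]

theorem integral_path (hg : Measurable g) (hM : ∀ o, |g o| ≤ M)
    (ht : |t| * M ≤ 1 / 2) {f : Obs 𝒳 → ℝ} :
    ∫ o, f o ∂(path Q g t) = ∫ o, (1 + t * g o) * f o ∂Q := by
  simpa using setIntegral_path (Q := Q) hg hM ht (f := f) MeasurableSet.univ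

theorem path_zero : path Q g 0 = Q := by
  unfold path
  simp

variable [IsFiniteMeasure Q]

theorem isFiniteMeasure_path (hM : ∀ o, |g o| ≤ M) (ht : |t| * M ≤ 1 / 2) :
    IsFiniteMeasure (path Q g t) := by
  have : path Q g t ≤ ENNReal.ofReal (3 / 2) • Q := by
    unfold path
    rw [← withDensity_const]
    exact withDensity_mono (ae_of_all _ fun o => ENNReal.ofReal_le_ofReal (tilt_bounds hM ht o).2)
  exact ⟨(this Set.univ).trans_lt (by
    simp [ENNReal.mul_lt_top])⟩

/-- The density is not a function of the covariates, so it cannot be dropped: a residual of the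
tilted law is orthogonal under `Q` only after multiplication by `1 + t g`. -/
theorem Orth.of_path (hg : Measurable g) (hM : ∀ o, |g o| ≤ M) (ht : |t| * M ≤ 1 / 2)
    {r : Obs 𝒳 → ℝ} (h : Orth (path Q g t) r) : Orth Q fun o => (1 + t * g o) * r o := by
  have := isFiniteMeasure_path (Q := Q) hM ht
  refine Orth.of_setIntegral ((integrable_path_iff hg hM ht).1 h.integrable) fun A hA => ?_
  rw [← setIntegral_path hg hM ht (Obs.sigmaX_le _ hA)]
  exact h.setIntegral_eq_zero Obs.sigmaX_le hA

/-- A conditional mean changes by a multiple of `t` along the path `(1 + t g) dQ`. -/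
theorem abs_tilted_sub_le (hg : Measurable g) (hM : ∀ o, |g o| ≤ M) (ht : |t| * M ≤ 1 / 2)
    {w V v v' e : Obs 𝒳 → ℝ} {ε : ℝ} (hε : 0 < ε) (he : ∀ᵐ o ∂Q, ε ≤ e o)
    (hem : Measurable[Obs.sigmaX] e) (hv : Measurable[Obs.sigmaX] v)
    (hv' : Measurable[Obs.sigmaX] v') (hw0 : ∀ o, 0 ≤ w o) (hw : Integrable w Q)
    (hwe : Orth Q fun o => w o - e o) (hV : Orth Q fun o => w o * (V o - v o))
    (hV' : Orth (path Q g t) fun o => w o * (V o - v' o)) :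
    ∀ᵐ o ∂Q, |v' o - v o| ≤
      |t| * (2 * M / ε * Q[fun o => |w o * (V o - v o)| | Obs.sigmaX] o) := by
  set r := fun o => w o * (V o - v o) with hr
  have h' := hV'.of_path hg hM ht
  have hri := hV.integrable
  have hgr : Integrable (fun o => g o * r o) Q :=
    hri.bdd_mul (c := M) hg.aestronglyMeasurable (ae_of_all _ hM)
  have hwt := integrable_tilt_mul hg hM ht hw
  have hd : Integrable ((fun o => v' o - v o) * fun o => (1 + t * g o) * w o) Q := by
    refine ((integrable_tilt_mul hg hM ht hri).sub h'.integrable).congr (ae_of_all _ fun o => ?_)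
    simp only [Pi.sub_apply, Pi.mul_apply, hr]; ring
  have e1 := condExp_mul_of_stronglyMeasurable_left (m := Obs.sigmaX)
    ((hv'.sub hv).stronglyMeasurable) hd hwt
  -- Given the covariates, `r` and the tilted residual both have mean zero, so this identity yields
  -- `(v' - v) E[(1 + t g) w | X] = t E[g r | X]`.
  have e2 : ((fun o => v' o - v o) * fun o => (1 + t * g o) * w o)
      = (r + t • fun o => g o * r o) - fun o => (1 + t * g o) * (w o * (V o - v' o)) := by
    ext o; simp only [Pi.sub_apply, Pi.mul_apply, Pi.add_apply, Pi.smul_apply, smul_eq_mul, hr]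
    ring
  change Q[(fun o => v' o - v o) * fun o => (1 + t * g o) * w o | Obs.sigmaX] =ᵐ[Q] _ at e1
  rw [e2] at e1
  have e3 := condExp_sub (hri.add (hgr.smul t)) h'.integrable Obs.sigmaX
  have e4 := condExp_add hri (hgr.smul t) Obs.sigmaX
  have e5 := condExp_smul (μ := Q) t (fun o => g o * r o) Obs.sigmaX
  have habs : Integrable (fun o => |r o|) Q := hri.abs
  have e6 : ∀ᵐ o ∂Q, Q[fun o => g o * r o | Obs.sigmaX] o ≤ M * Q[fun o => |r o| | Obs.sigmaX] o := by
    filter_upwards [condExp_mono (m := Obs.sigmaX) hgr (habs.const_mul M) (ae_of_all _ fun o => by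
        calc g o * r o ≤ |g o * r o| := le_abs_self _
          _ = |g o| * |r o| := abs_mul _ _
          _ ≤ M * |r o| := mul_le_mul_of_nonneg_right (hM o) (abs_nonneg _)),
      condExp_smul (μ := Q) M (fun o => |r o|) Obs.sigmaX] with o a1 a2
    exact a1.trans_eq a2
  have e7 : ∀ᵐ o ∂Q, -(M * Q[fun o => |r o| | Obs.sigmaX] o) ≤ Q[fun o => g o * r o | Obs.sigmaX] o := by
    filter_upwards [condExp_mono (m := Obs.sigmaX) (habs.const_mul (-M)) hgr (ae_of_all _ fun o => by
        have : |g o * r o| ≤ M * |r o| := by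
          rw [abs_mul]; exact mul_le_mul_of_nonneg_right (hM o) (abs_nonneg _)
        change -M * |r o| ≤ _
        linarith [neg_abs_le (g o * r o)]),
      condExp_smul (μ := Q) (-M) (fun o => |r o|) Obs.sigmaX] with o a1 a2
    have := a2.symm.trans_le a1
    simp only [Pi.smul_apply, smul_eq_mul] at this
    linarith
  have hei : Integrable e Q := (hw.sub hwe.integrable).congr (ae_of_all _ fun o => by simp)
  -- The divisor: since the density is at least `1/2`, it is at least `e / 2 ≥ ε / 2`, whence the
  -- factor `2 M / ε`.
  have e8 : ∀ᵐ o ∂Q, e o / 2 ≤ Q[fun o => (1 + t * g o) * w o | Obs.sigmaX] o := by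
    have a0 : Q[w | Obs.sigmaX] =ᵐ[Q] e := by
      have : w = (fun o => w o - e o) + e := by ext o; simp
      have b0 := condExp_of_stronglyMeasurable (μ := Q) Obs.sigmaX_le hem.stronglyMeasurable hei
      filter_upwards [condExp_add hwe.integrable hei Obs.sigmaX, hwe.condExp_eq] with o b1 b2
      rw [this, b1, Pi.add_apply, b2, b0]; simp
    filter_upwards [condExp_mono (m := Obs.sigmaX) (hw.const_mul (1 / 2)) hwt (ae_of_all _ fun o =>
        mul_le_mul_of_nonneg_right (tilt_bounds hM ht o).1 (hw0 o)),
      condExp_smul (μ := Q) (1 / 2 : ℝ) w Obs.sigmaX, a0] with o a1 a2 a3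
    have := a2.symm.trans_le a1
    simp only [Pi.smul_apply, smul_eq_mul, a3] at this
    linarith
  filter_upwards [e1, e3, e4, e5, e6, e7, e8, hV.condExp_eq, h'.condExp_eq, he]
    with o a1 a3 a4 a5 a6 a7 a8 b1 b2 b3
  rw [a3, Pi.sub_apply, a4, Pi.add_apply, a5, b2] at a1
  have b1' : Q[r | Obs.sigmaX] o = 0 := b1
  simp only [b1', Pi.smul_apply, smul_eq_mul, Pi.mul_apply, Pi.zero_apply, zero_add, sub_zero] at a1
  set H := Q[fun o => |r o| | Obs.sigmaX] o
  set D := Q[fun o => (1 + t * g o) * w o | Obs.sigmaX] o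
  have hD : ε / 2 ≤ D := by linarith
  have h1 : |v' o - v o| * D ≤ |t| * (M * H) := by
    have : |v' o - v o| * D = |(v' o - v o) * D| := by
      rw [abs_mul, abs_of_nonneg (by linarith : 0 ≤ D)]
    have a1' : t * Q[fun o => g o * r o | Obs.sigmaX] o = (v' o - v o) * D := a1
    rw [this, ← a1', abs_mul]
    exact mul_le_mul_of_nonneg_left (abs_le.2 ⟨a7, a6⟩) (abs_nonneg t)
  have h2 : |v' o - v o| * (ε / 2) ≤ |t| * (M * H) :=
    (mul_le_mul_of_nonneg_left hD (abs_nonneg _)).trans h1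
  calc |v' o - v o| = |v' o - v o| * (ε / 2) * (2 / ε) := by field_simp
    _ ≤ |t| * (M * H) * (2 / ε) := by gcongr
    _ = _ := by ring

/-- On the set `A` of covariates where the tilted conditional mean of `w` is nonpositive, the tilted
integral of `w` is nonpositive; yet it is at least half the `Q`-integral, which is at least `ε
Q(A)`. So `A` is null. -/
theorem condExp_path_pos (hg : Measurable g) (hM : ∀ o, |g o| ≤ M) (ht : |t| * M ≤ 1 / 2)
    {w e : Obs 𝒳 → ℝ} {ε : ℝ} (hε : 0 < ε) (he : ∀ᵐ o ∂Q, ε ≤ e o)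
    (hw0 : ∀ o, 0 ≤ w o) (hw : Integrable w Q) (hwe : Orth Q fun o => w o - e o) :
    ∀ᵐ o ∂(path Q g t), 0 < (path Q g t)[w | Obs.sigmaX] o := by
  have := isFiniteMeasure_path (Q := Q) hM ht
  set A := {o | (path Q g t)[w | Obs.sigmaX] o ≤ 0} with hAdef
  have hA : MeasurableSet[Obs.sigmaX] A :=
    measurable_condExp_X (path Q g t) w measurableSet_Iic
  have hA' := Obs.sigmaX_le _ hA
  have hei : Integrable e Q := (hw.sub hwe.integrable).congr (ae_of_all _ fun o => by simp)
  have h1 : ∫ o in A, w o ∂(path Q g t) ≤ 0 := by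
    rw [← setIntegral_condExp Obs.sigmaX_le (Integrable.path hg hM ht hw) hA]
    exact setIntegral_nonpos hA' fun o ho => ho
  rw [setIntegral_path hg hM ht hA'] at h1
  have h2 : 1 / 2 * ∫ o in A, w o ∂Q ≤ ∫ o in A, (1 + t * g o) * w o ∂Q := by
    rw [← integral_const_mul]
    exact integral_mono (hw.const_mul _).integrableOn (integrable_tilt_mul hg hM ht hw).integrableOn
      fun o => mul_le_mul_of_nonneg_right (tilt_bounds hM ht o).1 (hw0 o)
  have h3 : ∫ o in A, w o ∂Q = ∫ o in A, e o ∂Q := by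
    have := hwe.setIntegral_eq_zero Obs.sigmaX_le hA
    rw [integral_sub hw.integrableOn hei.integrableOn] at this
    linarith
  have h4 : ε * Q.real A ≤ ∫ o in A, e o ∂Q := by
    calc ε * Q.real A = ∫ o in A, ε ∂Q := by simp [mul_comm]
      _ ≤ _ := integral_mono_ae (integrable_const _) hei.integrableOn (ae_restrict_of_ae he)
  have h5 : Q.real A = 0 := by
    refine le_antisymm ?_ measureReal_nonneg
    by_contra hcon
    have := mul_pos hε (not_le.1 hcon)
    linarith
  have h6 : Q A = 0 := by rwa [measureReal_eq_zero_iff] at h5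
  have h7 := path_absolutelyContinuous (g := g) (t := t) h6
  filter_upwards [measure_eq_zero_iff_ae_notMem.1 h7] with o ho
  simpa [hAdef] using ho

end Tilting

/-! ### Doubly robust scores -/

section Scores
variable {𝒳 : Type*}

/-- The doubly robust score with propensity `e`, outcomes `V₁`, `V₀` in the two arms, outcome means
`u₁`, `u₀`, weights `a₁`, `a₀`, and plug-in term `G`. -/
def drScore (V1 V0 e a1 u1 a0 u0 G : Obs 𝒳 → ℝ) (o : Obs 𝒳) : ℝ :=
  o.zz / e o * a1 o * (V1 o - u1 o) + (1 - o.zz) / (1 - e o) * a0 o * (V0 o - u0 o) + G o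

/-- The algebra behind double robustness. The functions `v1`, `v0`, `G'` are arbitrary: when they
are the regressions of some law, the first two terms have mean zero under that law, and what is left
is `Z - e` times regression errors, minus a Taylor remainder. The score may be evaluated at the
truth or at estimates. -/
theorem drScore_sub_eq {V1 V0 e a1 u1 a0 u0 G v1 v0 G' : Obs 𝒳 → ℝ} {o : Obs 𝒳}
    (h1 : e o ≠ 0) (h0 : 1 - e o ≠ 0) :
    drScore V1 V0 e a1 u1 a0 u0 G o - G' o
      = a1 o / e o * (o.zz * (V1 o - v1 o)) + a0 o / (1 - e o) * ((1 - o.zz) * (V0 o - v0 o))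
        + ((o.zz - e o) * ((a1 o * (v1 o - u1 o)) / e o - (a0 o * (v0 o - u0 o)) / (1 - e o))
          - (G' o - G o - a1 o * (v1 o - u1 o) - a0 o * (v0 o - u0 o))) := by
  unfold drScore
  field_simp
  ring

variable [MeasurableSpace 𝒳]

/-- The score built from functions of the covariates that are the conditional means of the
treatment and of the outcomes in the two arms under `Q`. -/
structure IsScore (Q : Measure (Obs 𝒳)) (ε : ℝ) (V1 V0 e a1 u1 a0 u0 G : Obs 𝒳 → ℝ) : Prop where
  measurable_e : Measurable[Obs.sigmaX] e
  measurable_a1 : Measurable[Obs.sigmaX] a1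
  measurable_u1 : Measurable[Obs.sigmaX] u1
  measurable_a0 : Measurable[Obs.sigmaX] a0
  measurable_u0 : Measurable[Obs.sigmaX] u0
  measurable_G : Measurable[Obs.sigmaX] G
  eps_pos : 0 < ε
  e_mem : ∀ᵐ o ∂Q, ε ≤ e o ∧ e o ≤ 1 - ε
  orth_e : Orth Q fun o => o.zz - e o
  orth1 : Orth Q fun o => o.zz * (V1 o - u1 o)
  orth0 : Orth Q fun o => (1 - o.zz) * (V0 o - u0 o)
  integrable1 : Integrable (fun o => a1 o * (o.zz * (V1 o - u1 o))) Q
  integrable0 : Integrable (fun o => a0 o * ((1 - o.zz) * (V0 o - u0 o))) Q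
  integrable_G : Integrable G Q

variable {Q : Measure (Obs 𝒳)} {ε : ℝ} {V1 V0 e a1 u1 a0 u0 G : Obs 𝒳 → ℝ}

theorem Measurable.of_sigmaX {f : Obs 𝒳 → ℝ} (hf : Measurable[Obs.sigmaX] f) : Measurable f :=
  hf.mono Obs.sigmaX_le le_rfl

theorem integrable_div_of_le {f h : Obs 𝒳 → ℝ} (hf : Integrable f Q) (hh : Measurable h)
    {δ : ℝ} (hδ : 0 < δ) (hle : ∀ᵐ o ∂Q, δ ≤ h o) : Integrable (fun o => f o / h o) Q := by
  have : Integrable (fun o => (h o)⁻¹ * f o) Q :=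
    hf.bdd_mul (c := δ⁻¹) hh.inv.aestronglyMeasurable (by
      filter_upwards [hle] with o ho
      rw [Real.norm_eq_abs, abs_of_nonneg (inv_nonneg.2 (hδ.le.trans ho))]
      exact inv_anti₀ hδ ho)
  exact this.congr (ae_of_all _ fun o => by simp only; rw [div_eq_inv_mul])

namespace IsScore

theorem e_ne (S : IsScore Q ε V1 V0 e a1 u1 a0 u0 G) : ∀ᵐ o ∂Q, e o ≠ 0 ∧ 1 - e o ≠ 0 := by
  filter_upwards [S.e_mem] with o ho
  have := S.eps_pos
  exact ⟨by linarith [ho.1], by linarith [ho.2]⟩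

theorem integrable_div1 (S : IsScore Q ε V1 V0 e a1 u1 a0 u0 G) {f : Obs 𝒳 → ℝ}
    (hf : Integrable f Q) : Integrable (fun o => f o / e o) Q :=
  integrable_div_of_le hf (Measurable.of_sigmaX S.measurable_e) S.eps_pos
    (S.e_mem.mono fun _ h => h.1)

theorem integrable_div0 (S : IsScore Q ε V1 V0 e a1 u1 a0 u0 G) {f : Obs 𝒳 → ℝ}
    (hf : Integrable f Q) : Integrable (fun o => f o / (1 - e o)) Q :=
  integrable_div_of_le hf (measurable_const.sub (Measurable.of_sigmaX S.measurable_e)) S.eps_pos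
    (S.e_mem.mono fun _ h => by linarith [h.2])

theorem orth1' (S : IsScore Q ε V1 V0 e a1 u1 a0 u0 G) :
    Orth Q fun o => a1 o / e o * (o.zz * (V1 o - u1 o)) :=
  S.orth1.mul_left (S.measurable_a1.div S.measurable_e) ((S.integrable_div1 S.integrable1).congr
    (ae_of_all _ fun o => by simp only; ring))

theorem orth0' (S : IsScore Q ε V1 V0 e a1 u1 a0 u0 G) :
    Orth Q fun o => a0 o / (1 - e o) * ((1 - o.zz) * (V0 o - u0 o)) :=
  S.orth0.mul_left (S.measurable_a0.div (measurable_const.sub S.measurable_e))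
    ((S.integrable_div0 S.integrable0).congr (ae_of_all _ fun o => by simp only; ring))

theorem sub_eq (S : IsScore Q ε V1 V0 e a1 u1 a0 u0 G) :
    (fun o => a1 o / e o * (o.zz * (V1 o - u1 o)) +
      a0 o / (1 - e o) * ((1 - o.zz) * (V0 o - u0 o)) + G o)
      =ᵐ[Q] drScore V1 V0 e a1 u1 a0 u0 G := by
  filter_upwards [S.e_ne] with o ho
  have := drScore_sub_eq (V1 := V1) (V0 := V0) (a1 := a1) (u1 := u1) (a0 := a0) (u0 := u0) (G := G)
    (v1 := u1) (v0 := u0) (G' := G) ho.1 ho.2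
  simp only [sub_self, mul_zero, zero_div, add_zero] at this
  linarith

theorem integrable (S : IsScore Q ε V1 V0 e a1 u1 a0 u0 G) :
    Integrable (drScore V1 V0 e a1 u1 a0 u0 G) Q :=
  ((S.orth1'.integrable.add S.orth0'.integrable).add S.integrable_G).congr S.sub_eq

variable [IsFiniteMeasure Q]

theorem integral_eq (S : IsScore Q ε V1 V0 e a1 u1 a0 u0 G) :
    ∫ o, drScore V1 V0 e a1 u1 a0 u0 G o ∂Q = ∫ o, G o ∂Q := by
  rw [← integral_congr_ae S.sub_eq]
  refine (integral_add (S.orth1'.integrable.add S.orth0'.integrable) S.integrable_G).trans ?_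
  rw [integral_add' S.orth1'.integrable S.orth0'.integrable, S.orth1'.integral_eq_zero Obs.sigmaX_le,
    S.orth0'.integral_eq_zero Obs.sigmaX_le]
  simp

variable {g : Obs 𝒳 → ℝ} {M t : ℝ}

/-- Second-order expansion of a functional along the path `(1 + t g) dQ`. -/
theorem abs_path_expansion_le (S : IsScore Q ε V1 V0 e a1 u1 a0 u0 G)
    (hg : Measurable g) (hM : ∀ o, |g o| ≤ M) (ht : |t| * M ≤ 1 / 2)
    {v1 v0 G' B : Obs 𝒳 → ℝ} (hv1 : Measurable[Obs.sigmaX] v1) (hv0 : Measurable[Obs.sigmaX] v0)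
    (hG' : Measurable[Obs.sigmaX] G')
    (h1 : Orth (path Q g t) fun o => o.zz * (V1 o - v1 o))
    (h0 : Orth (path Q g t) fun o => (1 - o.zz) * (V0 o - v0 o))
    (hB : Integrable B Q)
    (b1 : ∀ᵐ o ∂Q, |a1 o * (v1 o - u1 o)| ≤ |t| * B o)
    (b0 : ∀ᵐ o ∂Q, |a0 o * (v0 o - u0 o)| ≤ |t| * B o)
    (bG : ∀ᵐ o ∂Q, |G' o - G o - a1 o * (v1 o - u1 o) - a0 o * (v0 o - u0 o)| ≤ t ^ 2 * B o) :
    Integrable G' (path Q g t) ∧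
    |∫ o, G' o ∂(path Q g t) - ∫ o, G o ∂Q
      - t * ∫ o, drScore V1 V0 e a1 u1 a0 u0 G o * g o ∂Q|
      ≤ (2 * M / ε + 3 / 2) * (∫ o, B o ∂Q) * t ^ 2 := by
  have hfin := isFiniteMeasure_path (Q := Q) hM ht
  set Φ := drScore V1 V0 e a1 u1 a0 u0 G with hΦ
  have hε := S.eps_pos
  have me := Measurable.of_sigmaX S.measurable_e
  have m1 : Measurable[Obs.sigmaX] fun o => a1 o * (v1 o - u1 o) :=
    S.measurable_a1.mul (hv1.sub S.measurable_u1)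
  have m0 : Measurable[Obs.sigmaX] fun o => a0 o * (v0 o - u0 o) :=
    S.measurable_a0.mul (hv0.sub S.measurable_u0)
  have i1 : Integrable (fun o => a1 o * (v1 o - u1 o)) Q :=
    (hB.const_mul |t|).mono' (Measurable.of_sigmaX m1).aestronglyMeasurable b1
  have i0 : Integrable (fun o => a0 o * (v0 o - u0 o)) Q :=
    (hB.const_mul |t|).mono' (Measurable.of_sigmaX m0).aestronglyMeasurable b0
  set R : Obs 𝒳 → ℝ := fun o => G' o - G o - a1 o * (v1 o - u1 o) - a0 o * (v0 o - u0 o) with hR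
  have iR : Integrable R Q := (hB.const_mul (t ^ 2)).mono'
    (Measurable.of_sigmaX (((hG'.sub S.measurable_G).sub m1).sub m0)).aestronglyMeasurable bG
  have iG' : Integrable G' Q := (((iR.add S.integrable_G).add i1).add i0).congr
    (ae_of_all _ fun o => by simp only [Pi.add_apply, hR]; ring)
  set k : Obs 𝒳 → ℝ := fun o =>
    (a1 o * (v1 o - u1 o)) / e o - (a0 o * (v0 o - u0 o)) / (1 - e o) with hk
  have mk : Measurable[Obs.sigmaX] k :=
    (m1.div S.measurable_e).sub (m0.div (measurable_const.sub S.measurable_e))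
  have ik : Integrable k Q := (S.integrable_div1 i1).sub (S.integrable_div0 i0)
  have bze : ∀ᵐ o ∂Q, |o.zz - e o| ≤ 1 := by
    filter_upwards [S.e_mem] with o ho
    rw [abs_le]
    rcases o.zz_eq with h | h <;> rw [h] <;> constructor <;> linarith [ho.1, ho.2]
  have izk : Integrable (fun o => k o * (o.zz - e o)) Q :=
    ik.mul_bdd (c := 1) (Obs.measurable_zz.sub me).aestronglyMeasurable bze
  have igzk : Integrable (fun o => g o * (k o * (o.zz - e o))) Q :=
    izk.bdd_mul (c := M) hg.aestronglyMeasurable (ae_of_all _ hM)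
  -- `k` depends on the covariates only, and `e` is the propensity score of the untilted law.
  have ozk : ∫ o, k o * (o.zz - e o) ∂Q = 0 := (S.orth_e.mul_left mk izk).integral_eq_zero Obs.sigmaX_le
  -- the residuals under the tilted law
  have j1 : Integrable (fun o => a1 o / e o * (o.zz * (V1 o - v1 o))) (path Q g t) := by
    refine Integrable.path hg hM ht ((S.orth1'.integrable.sub
      (Integrable.zz_mul (S.integrable_div1 i1))).congr (ae_of_all _ fun o => ?_))
    simp only [Pi.sub_apply]; ring
  have j0 : Integrable (fun o => a0 o / (1 - e o) * ((1 - o.zz) * (V0 o - v0 o))) (path Q g t) := by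
    refine Integrable.path hg hM ht ((S.orth0'.integrable.sub
      (Integrable.one_sub_zz_mul (S.integrable_div0 i0))).congr (ae_of_all _ fun o => ?_))
    simp only [Pi.sub_apply]; ring
  have z1 : ∫ o, a1 o / e o * (o.zz * (V1 o - v1 o)) ∂(path Q g t) = 0 := (h1.mul_left (S.measurable_a1.div S.measurable_e) j1).integral_eq_zero Obs.sigmaX_le
  have z0 : ∫ o, a0 o / (1 - e o) * ((1 - o.zz) * (V0 o - v0 o)) ∂(path Q g t) = 0 := (h0.mul_left (S.measurable_a0.div (measurable_const.sub S.measurable_e)) j0).integral_eq_zero Obs.sigmaX_le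
  have pG' := Integrable.path hg hM ht iG'
  have pΦ := Integrable.path hg hM ht S.integrable
  have pzk := Integrable.path hg hM ht izk
  have pR := Integrable.path hg hM ht iR
  -- The identity `drScore_sub_eq` with the regressions of the tilted law, integrated under that
  -- law: both weighted residuals disappear.
  have key : ∫ o, Φ o ∂(path Q g t) - ∫ o, G' o ∂(path Q g t)
      = ∫ o, k o * (o.zz - e o) ∂(path Q g t) - ∫ o, R o ∂(path Q g t) := by
    rw [← integral_sub pΦ pG']
    have : (fun o => Φ o - G' o) =ᵐ[path Q g t] fun o =>
        (a1 o / e o * (o.zz * (V1 o - v1 o)) + a0 o / (1 - e o) * ((1 - o.zz) * (V0 o - v0 o)))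
          + (k o * (o.zz - e o) - R o) := by
      filter_upwards [path_absolutelyContinuous.ae_le S.e_ne] with o ho
      rw [hΦ, drScore_sub_eq (v1 := v1) (v0 := v0) (G' := G') ho.1 ho.2]
      simp only [hk, hR]; ring
    rw [integral_congr_ae this]
    refine (integral_add (j1.add j0) (pzk.sub pR)).trans ?_
    rw [integral_add' j1 j0, integral_sub' pzk pR, z1, z0]; ring
  -- The zeroth-order term vanishes, leaving an explicit factor `t`; as `k` is itself of order `t`,
  -- the product is of order `t²`.
  have e1 : ∫ o, k o * (o.zz - e o) ∂(path Q g t) = t * ∫ o, g o * (k o * (o.zz - e o)) ∂Q := by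
    rw [integral_path hg hM ht, ← integral_const_mul]
    have : (fun o => (1 + t * g o) * (k o * (o.zz - e o)))
        = fun o => k o * (o.zz - e o) + t * (g o * (k o * (o.zz - e o))) := by ext o; ring
    rw [this, integral_add izk (igzk.const_mul t), ozk, zero_add]
  have igΦ : Integrable (fun o => Φ o * g o) Q :=
    S.integrable.mul_bdd (c := M) hg.aestronglyMeasurable (ae_of_all _ hM)
  have e2 : ∫ o, Φ o ∂(path Q g t) = ∫ o, G o ∂Q + t * ∫ o, Φ o * g o ∂Q := by
    rw [integral_path hg hM ht, ← integral_const_mul, ← S.integral_eq,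
      ← integral_add S.integrable (igΦ.const_mul t)]
    refine integral_congr_ae (ae_of_all _ fun o => ?_)
    simp only [hΦ]; ring
  have e3 : |∫ o, R o ∂(path Q g t)| ≤ 3 / 2 * (∫ o, B o ∂Q) * t ^ 2 := by
    rw [integral_path hg hM ht]
    have : 3 / 2 * (∫ o, B o ∂Q) * t ^ 2 = ∫ o, 3 / 2 * (t ^ 2 * B o) ∂Q := by
      rw [integral_const_mul, integral_const_mul]; ring
    rw [this, ← Real.norm_eq_abs]
    refine norm_integral_le_of_norm_le ((hB.const_mul _).const_mul _) ?_
    filter_upwards [bG] with o ho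
    have hb := tilt_bounds hM ht o
    rw [Real.norm_eq_abs, abs_mul, abs_of_nonneg (by linarith : 0 ≤ 1 + t * g o)]
    exact mul_le_mul hb.2 ho (abs_nonneg _) (by norm_num)
  -- The factor `2 / ε` comes from the two arms, each divided by a propensity of at least `ε`, and
  -- `M` from the bound on `g`.
  have e4 : |∫ o, g o * (k o * (o.zz - e o)) ∂Q| ≤ 2 * M / ε * (∫ o, B o ∂Q) * |t| := by
    have : 2 * M / ε * (∫ o, B o ∂Q) * |t| = ∫ o, 2 * M / ε * (|t| * B o) ∂Q := by
      rw [integral_const_mul, integral_const_mul]; ring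
    rw [this, ← Real.norm_eq_abs]
    refine norm_integral_le_of_norm_le ((hB.const_mul _).const_mul _) ?_
    filter_upwards [b1, b0, bze, S.e_mem] with o c1 c0 c2 c3
    have d1 : |a1 o * (v1 o - u1 o) / e o| ≤ |t| * B o / ε := by
      rw [abs_div, abs_of_pos (hε.trans_le c3.1)]
      exact div_le_div₀ ((abs_nonneg _).trans c1) c1 hε c3.1
    have d0 : |a0 o * (v0 o - u0 o) / (1 - e o)| ≤ |t| * B o / ε := by
      rw [abs_div, abs_of_pos (by linarith [c3.2] : 0 < 1 - e o)]
      exact div_le_div₀ ((abs_nonneg _).trans c0) c0 hε (by linarith [c3.2])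
    have d2 : |k o| ≤ 2 * (|t| * B o / ε) := by
      calc |k o| ≤ _ := abs_sub _ _
        _ ≤ _ := by linarith
    rw [Real.norm_eq_abs, abs_mul, abs_mul]
    have hM0 : 0 ≤ M := (abs_nonneg _).trans (hM o)
    calc |g o| * (|k o| * |o.zz - e o|) ≤ M * (2 * (|t| * B o / ε) * 1) := by
          gcongr
          · exact hM o
          · exact (abs_nonneg _).trans d2
      _ = _ := by ring
  refine ⟨pG', ?_⟩
  have e5 : ∫ o, G' o ∂(path Q g t) - ∫ o, G o ∂Q - t * ∫ o, Φ o * g o ∂Q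
      = ∫ o, R o ∂(path Q g t) - t * ∫ o, g o * (k o * (o.zz - e o)) ∂Q := by
    rw [e1, e2] at key; linarith
  rw [e5]
  calc _ ≤ |∫ o, R o ∂(path Q g t)| + |t * ∫ o, g o * (k o * (o.zz - e o)) ∂Q| := abs_sub _ _
    _ ≤ 3 / 2 * (∫ o, B o ∂Q) * t ^ 2 + |t| * (2 * M / ε * (∫ o, B o ∂Q) * |t|) := by
      rw [abs_mul]; gcongr
    _ = _ := by rw [← sq_abs t]; ring

end IsScore

theorem hasDerivAt_of_sq_bound {f : ℝ → ℝ} {L C δ : ℝ} (hδ : 0 < δ)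
    (h : ∀ t, |t| ≤ δ → |f t - f 0 - t * L| ≤ C * t ^ 2) : HasDerivAt f L 0 := by
  rw [hasDerivAt_iff_isLittleO_nhds_zero]
  have h1 : (fun t : ℝ => f (0 + t) - f 0 - t • L) =O[𝓝 0] fun t => t ^ 2 := by
    refine Asymptotics.IsBigO.of_bound C ?_
    filter_upwards [Metric.ball_mem_nhds (0 : ℝ) hδ] with t ht
    rw [Metric.mem_ball, dist_zero_right, Real.norm_eq_abs] at ht
    simpa using h t ht.le
  refine h1.trans_isLittleO ?_
  simpa using Asymptotics.isLittleO_pow_id (𝕜 := ℝ) one_lt_two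

end Scores

/-! ### Observed-data characterization of the true nuisance functions -/

section Truth
variable {𝒳 : Type*} [MeasurableSpace 𝒳]

namespace FullData

theorem measurable_Z : Measurable (Z : FullData 𝒳 → Bool) := measurable_fst.comp measurable_snd
theorem measurable_C : Measurable (C : FullData 𝒳 → Bool) :=
  measurable_fst.comp (measurable_snd.comp measurable_snd)
theorem measurable_Y1 : Measurable (Y1 : FullData 𝒳 → ℝ) :=
  measurable_fst.comp (measurable_snd.comp (measurable_snd.comp measurable_snd))
theorem measurable_Y0 : Measurable (Y0 : FullData 𝒳 → ℝ) :=
  measurable_snd.comp (measurable_snd.comp (measurable_snd.comp measurable_snd))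
theorem measurable_Y : Measurable (Y : FullData 𝒳 → ℝ) :=
  Measurable.ite (measurable_Z (measurableSet_singleton true)) measurable_Y1 measurable_Y0

theorem measurable_observe : Measurable (observe : FullData 𝒳 → Obs 𝒳) := by
  refine measurable_X.prodMk (measurable_Z.prodMk (Measurable.prodMk ?_ measurable_Y))
  exact (measurable_of_finite fun q : Bool × Bool => q.1 && q.2).comp
    (measurable_Z.prodMk measurable_C)

theorem sigmaX_le : (sigmaX : MeasurableSpace (FullData 𝒳)) ≤ (inferInstance : MeasurableSpace (FullData 𝒳)) :=
  measurable_X.comap_le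

end FullData

/-- Sets generated by the covariates pull back to sets generated by the covariates, so mean-zero
residuals can be checked on the full data. -/
theorem MeanZero.observe {P : Measure (FullData 𝒳)} [IsFiniteMeasure P] {r : Obs 𝒳 → ℝ}
    (hr : Measurable r) (h : MeanZero FullData.sigmaX P fun d => r d.observe) :
    Orth (P.map FullData.observe) r := by
  have hi : Integrable r (P.map FullData.observe) :=
    (integrable_map_measure hr.aestronglyMeasurable FullData.measurable_observe.aemeasurable).2
      h.integrable
  refine Orth.of_setIntegral hi ?_
  rintro A ⟨A', hA', rfl⟩
  rw [setIntegral_map (Obs.measurable_X hA') hr.aestronglyMeasurable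
    FullData.measurable_observe.aemeasurable]
  exact h.setIntegral_eq_zero FullData.sigmaX_le ⟨A', hA', rfl⟩

theorem MeanZero.of_condExp {Ω : Type*} {m mΩ : MeasurableSpace Ω} {μ : Measure Ω}
    [IsFiniteMeasure μ] (hm : m ≤ mΩ) {V v : Ω → ℝ} (hV : Integrable V μ)
    (hv : v =ᵐ[μ] μ[V | m]) : MeanZero m μ fun o => V o - v o := by
  have hvi : Integrable v μ := integrable_condExp.congr hv.symm
  refine MeanZero.of_setIntegral hm (hV.sub hvi) fun A hA => ?_
  rw [integral_sub hV.integrableOn hvi.integrableOn, integral_congr_ae (ae_restrict_of_ae hv),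
    setIntegral_condExp hm hV hA, sub_self]

theorem MemLp.exists_ae_abs_le {Ω : Type*} {mΩ : MeasurableSpace Ω} {μ : Measure Ω} {f : Ω → ℝ}
    (hf : MemLp f ∞ μ) : ∃ B : ℝ, ∀ᵐ x ∂μ, |f x| ≤ B := by
  refine ⟨(eLpNormEssSup f μ).toReal, ?_⟩
  have h := hf.2
  rw [eLpNorm_exponent_top] at h
  filter_upwards [ae_le_eLpNormEssSup (f := f) (μ := μ)] with x hx
  rw [← Real.norm_eq_abs, ← toReal_enorm]
  exact ENNReal.toReal_mono h.ne hx

theorem integrable_indicator_one {Ω : Type*} {mΩ : MeasurableSpace Ω} {μ : Measure Ω}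
    [IsFiniteMeasure μ] {E : Set Ω} (hE : MeasurableSet E) :
    Integrable (E.indicator fun _ => (1 : ℝ)) μ := (integrable_const 1).indicator hE

variable {P : Measure (FullData 𝒳)} [IsProbabilityMeasure P] {c : Bool} {η : Nuisance 𝒳} {ε : ℝ}

theorem measurable_comp_fullX {f : 𝒳 → ℝ} (hf : Measurable f) :
    Measurable[FullData.sigmaX] fun d : FullData 𝒳 => f d.X :=
  hf.comp (comap_measurable FullData.X)

omit [IsProbabilityMeasure P] in
theorem IsTrueNuisance.measurable_pi (hη : IsTrueNuisance P c η) (b : Bool) :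
    Measurable (η.pi b) := by
  cases b
  · exact measurable_const.sub hη.measurable_pi1
  · exact hη.measurable_pi1

/-- Ignorability in integrated form. -/
theorem Ignorability.integral_treated [StandardBorelSpace 𝒳] (hA1 : Ignorability P)
    (hη : IsTrueNuisance P c η) (he : ∀ᵐ d ∂P, 0 ≤ η.e1 d.X ∧ η.e1 d.X ≤ 1)
    {h : 𝒳 × Bool × ℝ × ℝ → ℝ} (hh : Measurable h) :
    ∫ d in {d | d.Z = true}, h (d.X, d.C, d.Y1, d.Y0) ∂P
      = ∫ d, η.e1 d.X * h (d.X, d.C, d.Y1, d.Y0) ∂P := by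
  have mZ : MeasurableSet {d : FullData 𝒳 | d.Z = true} :=
    FullData.measurable_Z (measurableSet_singleton true)
  have mD : Measurable fun d : FullData 𝒳 => (d.C, d.Y1, d.Y0) :=
    FullData.measurable_C.prodMk (FullData.measurable_Y1.prodMk FullData.measurable_Y0)
  have mXD : Measurable fun d : FullData 𝒳 => (d.X, d.C, d.Y1, d.Y0) :=
    FullData.measurable_X.prodMk mD
  have me : Measurable fun d : FullData 𝒳 => η.e1 d.X := hη.measurable_e1.comp FullData.measurable_X
  have ie : Integrable (fun d : FullData 𝒳 => η.e1 d.X) P :=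
    Integrable.of_bound me.aestronglyMeasurable 1 (by
      filter_upwards [he] with d hd
      rw [Real.norm_eq_abs, abs_of_nonneg hd.1]; exact hd.2)
  -- Ignorability as an equality of measures: the law of `(X, C, Y₁, Y₀)` on the treated is the
  -- `e₁`-weighted law. It suffices to test on rectangles, where conditional independence gives a
  -- product of conditional probabilities.
  have key : (P.restrict {d | d.Z = true}).map (fun d => (d.X, d.C, d.Y1, d.Y0))
      = (P.withDensity fun d => ENNReal.ofReal (η.e1 d.X)).map
        (fun d => (d.X, d.C, d.Y1, d.Y0)) := by
    refine Measure.ext_prod fun {A T} hA hT => ?_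
    have hAT := hA.prod hT
    have hA' := FullData.measurable_X hA
    have hT' := mD hT
    rw [Measure.map_apply mXD hAT, Measure.map_apply mXD hAT, Measure.restrict_apply (mXD hAT),
      withDensity_apply _ (mXD hAT)]
    have hci := (condIndepFun_iff_condExp_inter_preimage_eq_mul FullData.measurable_Z mD).1 hA1
      {true} T (measurableSet_singleton _) hT
    set EZ := (FullData.Z : FullData 𝒳 → Bool) ⁻¹' {true} with hEZ
    set ET := (fun d : FullData 𝒳 => (d.C, d.Y1, d.Y0)) ⁻¹' T with hET
    have hset : (fun d : FullData 𝒳 => (d.X, d.C, d.Y1, d.Y0)) ⁻¹' A ×ˢ T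
        = FullData.X ⁻¹' A ∩ ET := by ext d; simp [hET]
    have mEZ : MeasurableSet EZ := mZ
    have r1 : P.real (FullData.X ⁻¹' A ∩ (EZ ∩ ET))
        = ∫ d in FullData.X ⁻¹' A, η.e1 d.X * P[ET.indicator fun _ => (1 : ℝ) | FullData.sigmaX] d ∂P := by
      rw [show P.real (FullData.X ⁻¹' A ∩ (EZ ∩ ET))
        = ∫ d in FullData.X ⁻¹' A, (EZ ∩ ET).indicator (fun _ => (1 : ℝ)) d ∂P by
          rw [integral_indicator (mEZ.inter hT')]
          simp [Measure.restrict_restrict (mEZ.inter hT'), Measure.real, Set.inter_comm,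
            Measure.restrict_apply],
        ← setIntegral_condExp FullData.sigmaX_le (integrable_indicator_one (mEZ.inter hT'))
          ⟨A, hA, rfl⟩]
      refine integral_congr_ae (ae_restrict_of_ae ?_)
      filter_upwards [hci, hη.e1_eq] with d h1 h2
      rw [h1, h2]; rfl
    have i3 : Integrable ((fun d : FullData 𝒳 => η.e1 d.X) * ET.indicator fun _ => (1 : ℝ)) P :=
      ie.mul_bdd (c := 1) ((measurable_const.indicator hT').aestronglyMeasurable)
        (ae_of_all _ fun d => by
          by_cases hd : d ∈ ET <;> simp [hd])
    have r2 : ∫ d in FullData.X ⁻¹' A, η.e1 d.X * P[ET.indicator fun _ => (1 : ℝ) | FullData.sigmaX] d ∂P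
        = ∫ d in FullData.X ⁻¹' A ∩ ET, η.e1 d.X ∂P := by
      have h1 := condExp_mul_of_stronglyMeasurable_left (m := FullData.sigmaX) (μ := P)
        (measurable_comp_fullX hη.measurable_e1).stronglyMeasurable i3
        (integrable_indicator_one hT')
      refine (integral_congr_ae (ae_restrict_of_ae h1.symm)).trans ?_
      rw [setIntegral_condExp FullData.sigmaX_le i3 ⟨A, hA, rfl⟩,
        show (fun d : FullData 𝒳 => η.e1 d.X) * ET.indicator (fun _ => (1 : ℝ))
          = ET.indicator fun d => η.e1 d.X by
            ext d; by_cases hd : d ∈ ET <;> simp [hd],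
        integral_indicator hT', Measure.restrict_restrict hT', Set.inter_comm]
    have r3 : ∫⁻ d in FullData.X ⁻¹' A ∩ ET, ENNReal.ofReal (η.e1 d.X) ∂P
        = ENNReal.ofReal (∫ d in FullData.X ⁻¹' A ∩ ET, η.e1 d.X ∂P) :=
      (ofReal_integral_eq_lintegral_ofReal ie.integrableOn
        (ae_restrict_of_ae (he.mono fun d hd => hd.1))).symm
    rw [hset, r3, ← r2, ← r1, Measure.real, ENNReal.ofReal_toReal (measure_ne_top _ _)]
    congr 1
    ext d; simp only [Set.mem_inter_iff, hEZ, Set.mem_preimage, Set.mem_singleton_iff]; tauto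
  calc _ = ∫ q, h q ∂((P.restrict {d | d.Z = true}).map fun d => (d.X, d.C, d.Y1, d.Y0)) :=
        (integral_map mXD.aemeasurable hh.aestronglyMeasurable).symm
    _ = ∫ d, h (d.X, d.C, d.Y1, d.Y0) ∂(P.withDensity fun d => ENNReal.ofReal (η.e1 d.X)) := by
        rw [key, integral_map mXD.aemeasurable hh.aestronglyMeasurable]
    _ = _ := by
        rw [integral_withDensity_eq_integral_toReal_smul me.ennreal_ofReal
          (ae_of_all _ fun _ => ENNReal.ofReal_lt_top)]
        refine integral_congr_ae ?_
        filter_upwards [he] with d hd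
        rw [ENNReal.toReal_ofReal hd.1, smul_eq_mul]

/-- What the proofs use about the true nuisance functions `η` of the law `Q` of the observed data,
for the stratum `c`. -/
structure IsObsNuisance (Q : Measure (Obs 𝒳)) (c : Bool) (ε : ℝ) (η : Nuisance 𝒳) : Prop where
  measurable_e1 : Measurable η.e1
  measurable_pi1 : Measurable η.pi1
  measurable_mu1 : Measurable η.mu1
  measurable_mu0 : Measurable η.mu0
  measurable_sigma2 : Measurable η.sigma2
  eps_pos : 0 < ε
  e_mem : ∀ᵐ o ∂Q, ε ≤ η.e1 o.X ∧ η.e1 o.X ≤ 1 - ε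
  memLp_Y : MemLp Obs.Y 2 Q
  memLp_mu1 : MemLp (fun o : Obs 𝒳 => η.mu1 o.X) ∞ Q
  orth_e : Orth Q fun o => o.zz - η.e1 o.X
  orth_pi : Orth Q fun o => o.zz * (o.ind c - η.pi c o.X)
  orth_mu1 : Orth Q fun o => o.zz * (o.ind c * o.Y - η.pi c o.X * η.mu1 o.X)
  orth_mu0 : Orth Q fun o => (1 - o.zz) * (o.Y - η.mu0 o.X)
  orth_sigma2 : Orth Q fun o => (1 - o.zz) * ((o.Y - η.mu0 o.X) ^ 2 - η.sigma2 o.X)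

omit [MeasurableSpace 𝒳] in
theorem observe_zz (d : FullData 𝒳) :
    d.observe.zz = Set.indicator {d : FullData 𝒳 | d.Z = true} (fun _ => (1 : ℝ)) d := by
  by_cases h : d.Z = true <;> simp [Obs.zz, FullData.observe, Obs.Z, h]

theorem meanZero_stratum (hη : IsTrueNuisance P c η) (b : Bool) :
    MeanZero FullData.sigmaX P fun d : FullData 𝒳 => (if d.C = b then 1 else 0) - η.pi b d.X := by
  have mC : MeasurableSet {d : FullData 𝒳 | d.C = true} :=
    FullData.measurable_C (measurableSet_singleton true)
  have h1 := MeanZero.of_condExp FullData.sigmaX_le (integrable_indicator_one mC) hη.pi1_eq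
  cases b
  · refine h1.neg.congr (ae_of_all _ fun d => ?_)
    by_cases h : d.C = true <;> simp [Nuisance.pi, h]
  · refine h1.congr (ae_of_all _ fun d => ?_)
    by_cases h : d.C = true <;> simp [Nuisance.pi, h]

/-- Identification. A full-data residual `h(X, C, Y₁, Y₀)` with conditional mean zero, restricted to
treated units, integrates over `{X ∈ A}` to the integral of `e₁ h`, by ignorability, and this is
zero because `e₁` depends on `X` only. Among the treated, `C` and `Y₁` are observed as `S` and `Y`,
so the residual is one of observed data. -/
theorem IsTrueNuisance.isObsNuisance [StandardBorelSpace 𝒳] (hA1 : Ignorability P)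
    (hη : IsTrueNuisance P c η)
    (hε : 0 < ε) (hpos : ∀ᵐ x ∂(P.map FullData.X), ε ≤ η.e1 x ∧ η.e1 x < 1 - ε)
    (hY1 : MemLp FullData.Y1 2 P) (hY0 : MemLp FullData.Y0 2 P)
    (hmu1 : MemLp η.mu1 ∞ (P.map FullData.X)) :
    IsObsNuisance (P.map FullData.observe) c ε η := by
  have mX := FullData.measurable_X (𝒳 := 𝒳)
  have mo := FullData.measurable_observe (𝒳 := 𝒳)
  have hpos' : ∀ᵐ d ∂P, ε ≤ η.e1 d.X ∧ η.e1 d.X < 1 - ε := ae_of_ae_map mX.aemeasurable hpos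
  have he : ∀ᵐ d ∂P, 0 ≤ η.e1 d.X ∧ η.e1 d.X ≤ 1 := by
    filter_upwards [hpos'] with d hd
    constructor <;> linarith [hd.1, hd.2]
  have mZ : MeasurableSet {d : FullData 𝒳 | d.Z = true} :=
    FullData.measurable_Z (measurableSet_singleton true)
  have mZ0 : MeasurableSet {d : FullData 𝒳 | d.Z = false} :=
    FullData.measurable_Z (measurableSet_singleton false)
  have mC : MeasurableSet {d : FullData 𝒳 | d.C = c} :=
    FullData.measurable_C (measurableSet_singleton c)
  have hY : MemLp FullData.Y 2 P := by
    have h1 := hY1.indicator mZ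
    have h2 := hY0.indicator mZ.compl
    refine (h1.add h2).congr_norm FullData.measurable_Y.aestronglyMeasurable
      (ae_of_all _ fun d => ?_)
    by_cases h : d.Z = true <;> simp [FullData.Y, h]
  have hmu1' : MemLp (fun d : FullData 𝒳 => η.mu1 d.X) ∞ P := hmu1.comp_of_map mX.aemeasurable
  have hpi := meanZero_stratum hη c
  have ipi : Integrable (fun d : FullData 𝒳 => η.pi c d.X) P := by
    have h1 : Integrable (fun d : FullData 𝒳 => if d.C = c then (1 : ℝ) else 0) P :=
      (integrable_indicator_one mC).congr (ae_of_all _ fun d => by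
        by_cases h : d.C = c <;> simp [h])
    refine (h1.sub hpi.integrable).congr (ae_of_all _ fun d => ?_)
    simp only [Pi.sub_apply]; ring
  -- transfer of a full-data residual that does not involve treatment
  have treat : ∀ {s : Obs 𝒳 → ℝ} {h : 𝒳 × Bool × ℝ × ℝ → ℝ}, Measurable s → Measurable h →
      (∀ d : FullData 𝒳, d.Z = true → s d.observe = h (d.X, d.C, d.Y1, d.Y0)) →
      MeanZero FullData.sigmaX P (fun d => h (d.X, d.C, d.Y1, d.Y0)) →
      Orth (P.map FullData.observe) fun o => o.zz * s o := by
    intro s h ms mh hs hM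
    refine MeanZero.observe (Obs.measurable_zz.mul ms) ?_
    have e1 : (fun d : FullData 𝒳 => d.observe.zz * s d.observe)
        = Set.indicator {d : FullData 𝒳 | d.Z = true} fun d => h (d.X, d.C, d.Y1, d.Y0) := by
      ext d
      rw [observe_zz]
      by_cases hd : d.Z = true <;> simp [hd, hs]
    rw [e1]
    refine MeanZero.of_setIntegral FullData.sigmaX_le (hM.integrable.indicator mZ) ?_
    rintro A ⟨A', hA', rfl⟩
    have mA := mX hA'
    have hig := hA1.integral_treated hη he (h := fun q => (Prod.fst ⁻¹' A').indicator h q)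
      (mh.indicator (measurable_fst hA'))
    have e2 : (fun d : FullData 𝒳 => (Prod.fst ⁻¹' A').indicator h (d.X, d.C, d.Y1, d.Y0))
        = (FullData.X ⁻¹' A').indicator fun d => h (d.X, d.C, d.Y1, d.Y0) := by
      ext d
      by_cases hd : d.X ∈ A' <;> simp [Set.indicator, hd]
    have e3 : (fun d : FullData 𝒳 => η.e1 d.X * (Prod.fst ⁻¹' A').indicator h (d.X, d.C, d.Y1, d.Y0))
        = (FullData.X ⁻¹' A').indicator fun d => η.e1 d.X * h (d.X, d.C, d.Y1, d.Y0) := by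
      ext d
      by_cases hd : d.X ∈ A' <;> simp [Set.indicator, hd]
    rw [e3, integral_indicator mA] at hig
    rw [integral_indicator mZ, Measure.restrict_restrict mZ, Set.inter_comm,
      ← Measure.restrict_restrict mA, ← integral_indicator mA, ← e2, hig]
    have hM' := hM.mul_left (measurable_comp_fullX hη.measurable_e1)
      (hM.integrable.bdd_mul (c := 1) (hη.measurable_e1.comp mX).aestronglyMeasurable (by
        filter_upwards [he] with d hd
        rw [Real.norm_eq_abs, abs_of_nonneg hd.1]; exact hd.2))
    exact hM'.setIntegral_eq_zero FullData.sigmaX_le ⟨A', hA', rfl⟩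
  -- No ignorability is needed in the control arm: `μ₀` and `σ₀²` are defined by conditioning on `Z
  -- = 0`.
  have control : ∀ {s : Obs 𝒳 → ℝ}, Measurable s →
      (MeanZero FullData.sigmaX P fun d => Set.indicator {d : FullData 𝒳 | d.Z = false} 1 d
        * s d.observe) → Orth (P.map FullData.observe) fun o => (1 - o.zz) * s o := by
    intro s ms hM
    refine MeanZero.observe ((measurable_const.sub Obs.measurable_zz).mul ms)
      (hM.congr (ae_of_all _ fun d => ?_))
    simp only
    rw [observe_zz]
    by_cases hd : d.Z = true <;> simp [hd]
  have mind : Measurable fun q : 𝒳 × Bool × ℝ × ℝ => if q.2.1 = c then (1 : ℝ) else 0 :=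
    Measurable.ite ((measurable_fst.comp measurable_snd) (measurableSet_singleton c))
      measurable_const measurable_const
  have hobs : ∀ d : FullData 𝒳, d.Z = true → d.observe.ind c = if d.C = c then 1 else 0 := by
    intro d hd
    simp [Obs.ind, Obs.S, FullData.observe, hd]
  have mfX {f : 𝒳 → ℝ} (hf : Measurable f) : Measurable fun o : Obs 𝒳 => f o.X :=
    hf.comp Obs.measurable_X
  refine
    { measurable_e1 := hη.measurable_e1
      measurable_pi1 := hη.measurable_pi1
      measurable_mu1 := hη.measurable_mu1
      measurable_mu0 := hη.measurable_mu0
      measurable_sigma2 := hη.measurable_sigma2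
      eps_pos := hε
      e_mem := ?_
      memLp_Y := ?_
      memLp_mu1 := ?_
      orth_e := ?_
      orth_pi := ?_
      orth_mu1 := ?_
      orth_mu0 := ?_
      orth_sigma2 := ?_ }
  · rw [ae_map_iff mo.aemeasurable]
    · filter_upwards [hpos'] with d hd using ⟨hd.1, hd.2.le⟩
    · exact (measurableSet_le measurable_const (mfX hη.measurable_e1)).inter
        (measurableSet_le (mfX hη.measurable_e1) measurable_const)
  · rw [memLp_map_measure_iff Obs.measurable_Y.aestronglyMeasurable mo.aemeasurable]
    exact hY
  · rw [memLp_map_measure_iff (mfX hη.measurable_mu1).aestronglyMeasurable mo.aemeasurable]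
    exact hmu1'
  · refine MeanZero.observe (Obs.measurable_zz.sub (mfX hη.measurable_e1)) ?_
    refine (MeanZero.of_condExp FullData.sigmaX_le (integrable_indicator_one mZ) hη.e1_eq).congr
      (ae_of_all _ fun d => ?_)
    simp only
    rw [observe_zz]; rfl
  · refine treat (h := fun q => (if q.2.1 = c then 1 else 0) - η.pi c q.1)
      ((Obs.measurable_ind c).sub (mfX (hη.measurable_pi c)))
      (mind.sub ((hη.measurable_pi c).comp measurable_fst)) (fun d hd => ?_) hpi
    rw [hobs d hd]; rfl
  · refine treat (h := fun q => (if q.2.1 = c then 1 else 0) * q.2.2.1 - η.pi c q.1 * η.mu1 q.1)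
      (((Obs.measurable_ind c).mul Obs.measurable_Y).sub
        ((mfX (hη.measurable_pi c)).mul (mfX hη.measurable_mu1)))
      ((mind.mul (by fun_prop)).sub
        (((hη.measurable_pi c).comp measurable_fst).mul (hη.measurable_mu1.comp measurable_fst)))
      (fun d hd => ?_) ?_
    · rw [hobs d hd]
      simp [FullData.observe, Obs.Y, FullData.Y, hd, Obs.X]
    -- The residual splits as `I(C = c)(Y₁ - μ_{1c}) + μ_{1c}(I(C = c) - π_c)`; essential
    -- boundedness of `μ_{1c}` makes the second product integrable.
    · have h1 : MeanZero FullData.sigmaX P fun d => Set.indicator {d : FullData 𝒳 | d.C = c} 1 d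
          * (d.Y1 - η.mu1 d.X) :=
        MeanZero.of_cond FullData.sigmaX_le mC (hY1.integrable one_le_two).integrableOn hη.mu1_eq
      have h2 := hpi.mul_left (measurable_comp_fullX hη.measurable_mu1) (by
        obtain ⟨B, hB⟩ := MemLp.exists_ae_abs_le hmu1'
        exact hpi.integrable.bdd_mul hmu1'.1 hB)
      refine (h1.add h2).congr (ae_of_all _ fun d => ?_)
      by_cases hd : d.C = c <;> simp [hd] <;> ring
  · refine control (Obs.measurable_Y.sub (mfX hη.measurable_mu0)) ?_
    exact MeanZero.of_cond FullData.sigmaX_le mZ0 (hY.integrable one_le_two).integrableOn hη.mu0_eq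
  · refine control (((Obs.measurable_Y.sub (mfX hη.measurable_mu0)).pow_const 2).sub
      (mfX hη.measurable_sigma2)) ?_
    -- Without controls `Z = 1` almost surely, and `Z - e₁ ≥ ε` could not have mean zero.
    have hE0 : P {d : FullData 𝒳 | d.Z = false} ≠ 0 := by
      intro h0
      have h1 := (MeanZero.of_condExp FullData.sigmaX_le (integrable_indicator_one mZ)
        hη.e1_eq).integral_eq_zero FullData.sigmaX_le
      have h2 : ∀ᵐ d ∂P, {d : FullData 𝒳 | d.Z = true}.indicator (fun _ => (1 : ℝ)) d = 1 := by
        filter_upwards [measure_eq_zero_iff_ae_notMem.1 h0] with d hd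
        have : d.Z = true := by simpa using hd
        simp [this]
      have h3 : ε ≤ ∫ d, ({d : FullData 𝒳 | d.Z = true}.indicator (fun _ => (1 : ℝ)) d - η.e1 d.X) ∂P := by
        calc ε = ∫ _ : FullData 𝒳, ε ∂P := by simp
          _ ≤ _ := integral_mono_ae (integrable_const _)
            (MeanZero.of_condExp FullData.sigmaX_le (integrable_indicator_one mZ)
              hη.e1_eq).integrable (by
                filter_upwards [h2, hpos'] with d a b
                rw [a]; linarith [b.2])
      linarith
    set ν := ProbabilityTheory.cond P {d : FullData 𝒳 | d.Z = false} with hν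
    have hYc : MemLp FullData.Y 2 ν := by
      rw [hν]; unfold ProbabilityTheory.cond
      exact (hY.restrict _).smul_measure (ENNReal.inv_ne_top.2 hE0)
    have hD : Integrable (fun d => (d.Y - (ν[FullData.Y | FullData.sigmaX]) d) ^ 2) ν :=
      (hYc.sub (hYc.condExp one_le_two)).integrable_sq
    have hD' : Integrable (fun d : FullData 𝒳 => (d.Y - η.mu0 d.X) ^ 2) ν :=
      hD.congr (by filter_upwards [hη.mu0_eq] with d hd; rw [← hd])
    have hD2 : IntegrableOn (fun d : FullData 𝒳 => (d.Y - η.mu0 d.X) ^ 2)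
        {d : FullData 𝒳 | d.Z = false} P := by
      rw [hν] at hD'; unfold ProbabilityTheory.cond at hD'
      rwa [integrable_smul_measure (ENNReal.inv_ne_zero.2 (measure_ne_top _ _))
        (ENNReal.inv_ne_top.2 hE0)] at hD'
    refine MeanZero.of_cond FullData.sigmaX_le mZ0 hD2 (hη.sigma2_eq.trans ?_)
    refine condExp_congr_ae ?_
    filter_upwards [hη.mu0_eq] with d hd
    simp only [Pi.pow_apply, Pi.sub_apply, ← hd]

end Truth

/-! ### Reduction of cross-fitted averages to deterministic bounds -/

section Reduction
variable {𝒳 : Type*} [MeasurableSpace 𝒳]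

/-- All components of `θ` are measurable. -/
structure Nuisance.IsMeasurable (θ : Nuisance 𝒳) : Prop where
  e1 : Measurable θ.e1
  pi1 : Measurable θ.pi1
  mu1 : Measurable θ.mu1
  mu0 : Measurable θ.mu0
  sigma2 : Measurable θ.sigma2

theorem Nuisance.IsMeasurable.pi {θ : Nuisance 𝒳} (h : θ.IsMeasurable) (c : Bool) :
    Measurable (θ.pi c) := by
  cases c
  · exact measurable_const.sub h.pi1
  · exact h.pi1

/-- The error of the component `f` of `θ`, as a function of the observation. -/
def gap (f : Nuisance 𝒳 → 𝒳 → ℝ) (η θ : Nuisance 𝒳) (o : Obs 𝒳) : ℝ := f θ o.X - f η o.X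

/-- Truncation of the weight `W`: where `|W| ≥ T` the minimum is bounded by `1` and the tail of `W`
is small in `L²`; elsewhere the minimum is bounded by `|D|` and `W` by `T`. Thus an error `D` small
in `L²` stays small after multiplication by an unbounded residual, provided it is cut off at `1`. -/
theorem MemLp.exists_eLpNorm_mul_min_le {Q : Measure (Obs 𝒳)} {W : Obs 𝒳 → ℝ} (hW : MemLp W 2 Q)
    (mW : Measurable W) {τ : ℝ} (hτ : 0 < τ) : ∃ T : ℝ, ∀ D : Obs 𝒳 → ℝ, Measurable D →
      eLpNorm (fun o => |W o| * min 1 |D o|) 2 Q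
        ≤ ENNReal.ofReal τ + ENNReal.ofReal T * eLpNorm D 2 Q := by
  obtain ⟨T, hT⟩ := hW.eLpNorm_indicator_norm_ge_le mW.stronglyMeasurable hτ
  refine ⟨max T 0, fun D hD => ?_⟩
  set S := {x | T ≤ ↑‖W x‖₊} with hS
  have mS : MeasurableSet S := measurableSet_le measurable_const mW.norm
  have h1 : (fun o => |W o| * min 1 |D o|)
      = S.indicator (fun o => |W o| * min 1 |D o|) + Sᶜ.indicator fun o => |W o| * min 1 |D o| := by
    rw [Set.indicator_self_add_compl]
  have mf : Measurable fun o => |W o| * min 1 |D o| :=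
    mW.abs.mul (measurable_const.min hD.abs)
  rw [h1]
  refine (eLpNorm_add_le (mf.indicator mS).aestronglyMeasurable
    (mf.indicator mS.compl).aestronglyMeasurable one_le_two).trans (add_le_add ?_ ?_)
  · refine le_trans (eLpNorm_mono fun o => ?_) hT
    by_cases ho : o ∈ S
    · simp only [ho, Set.indicator_of_mem, norm_mul, Real.norm_eq_abs, abs_abs]
      rw [abs_of_nonneg (le_min zero_le_one (abs_nonneg (D o)))]
      exact mul_le_of_le_one_right (abs_nonneg _) (min_le_left _ _)
    · simp [ho]
  · refine eLpNorm_le_mul_eLpNorm_of_ae_le_mul (ae_of_all _ fun o => ?_) 2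
    by_cases ho : o ∈ S
    · simp [ho, mul_nonneg (le_max_right T 0) (abs_nonneg _)]
    · simp only [Set.mem_compl_iff, ho, not_false_eq_true, Set.indicator_of_mem, norm_mul,
        Real.norm_eq_abs, abs_abs]
      rw [abs_of_nonneg (le_min zero_le_one (abs_nonneg (D o)))]
      have hlt : |W o| ≤ max T 0 :=
        le_max_of_le_left (by simpa using (not_le.1 (show ¬ T ≤ ↑‖W o‖₊ from ho)).le)
      exact mul_le_mul hlt (min_le_right _ _) (le_min zero_le_one (abs_nonneg _))
        ((abs_nonneg _).trans hlt)

theorem lintegral_mul_le_eLpNorm {Ω : Type*} {mΩ : MeasurableSpace Ω} {μ : Measure Ω}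
    {f g : Ω → ℝ} (hf : Measurable f) (hg : Measurable g) :
    ∫⁻ o, ‖f o‖ₑ * ‖g o‖ₑ ∂μ ≤ eLpNorm f 2 μ * eLpNorm g 2 μ := by
  have h := ENNReal.lintegral_mul_le_Lp_mul_Lq μ Real.HolderConjugate.two_two
    hf.enorm.aemeasurable hg.enorm.aemeasurable
  rw [eLpNorm_eq_lintegral_rpow_enorm_toReal (by norm_num) (by norm_num),
    eLpNorm_eq_lintegral_rpow_enorm_toReal (by norm_num) (by norm_num)]
  simpa using h

theorem enorm_integral_le_sum {Ω ι : Type*} {mΩ : MeasurableSpace Ω} {μ : Measure Ω}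
    {D : ι → Ω → ℝ} (hD : ∀ i, Measurable (D i)) (s : Finset (ι × ι)) :
    ENNReal.ofReal (∫ o, ∑ p ∈ s, |D p.1 o| * |D p.2 o| ∂μ)
      ≤ ∑ p ∈ s, eLpNorm (D p.1) 2 μ * eLpNorm (D p.2) 2 μ := by
  have h0 : ∀ o, 0 ≤ ∑ p ∈ s, |D p.1 o| * |D p.2 o| := fun o =>
    Finset.sum_nonneg fun p _ => mul_nonneg (abs_nonneg _) (abs_nonneg _)
  calc _ ≤ ∫⁻ o, ENNReal.ofReal (∑ p ∈ s, |D p.1 o| * |D p.2 o|) ∂μ := by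
        rw [integral_eq_lintegral_of_nonneg_ae (ae_of_all _ h0)
          (Measurable.aestronglyMeasurable (Finset.measurable_sum _ fun p _ =>
            (hD p.1).abs.mul (hD p.2).abs))]
        exact ENNReal.ofReal_toReal_le
    _ = ∑ p ∈ s, ∫⁻ o, ‖D p.1 o‖ₑ * ‖D p.2 o‖ₑ ∂μ := by
        rw [← lintegral_finsetSum _ fun p _ => (hD p.1).enorm.mul (hD p.2).enorm]
        refine lintegral_congr fun o => ?_
        rw [ENNReal.ofReal_sum_of_nonneg fun p _ => mul_nonneg (abs_nonneg _) (abs_nonneg _)]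
        refine Finset.sum_congr rfl fun p _ => ?_
        rw [ENNReal.ofReal_mul (abs_nonneg _), ← Real.norm_eq_abs, ← Real.norm_eq_abs,
          ofReal_norm, ofReal_norm]
    _ ≤ _ := Finset.sum_le_sum fun p _ => lintegral_mul_le_eLpNorm (hD p.1) (hD p.2)

variable {Ω : Type*} [MeasurableSpace Ω] {μ : Measure Ω} [IsProbabilityMeasure μ]
  {K : ℕ} {F : CrossFitting K} {N : NuisanceEstimator 𝒳 F} {O : ℕ → Ω → Obs 𝒳}
  {Q : Measure (Obs 𝒳)} {PX : Measure 𝒳} {η : Nuisance 𝒳}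

omit [MeasurableSpace Ω] in
theorem NuisanceEstimator.IsMeasurable.fit (hN : N.IsMeasurable) (n : ℕ) (k : Fin K) (ω : Ω) :
    (PISens.fit N O n k ω).IsMeasurable where
  e1 := (hN n k).1.comp measurable_prodMk_left
  pi1 := (hN n k).2.1.comp measurable_prodMk_left
  mu1 := (hN n k).2.2.1.comp measurable_prodMk_left
  mu0 := (hN n k).2.2.2.1.comp measurable_prodMk_left
  sigma2 := (hN n k).2.2.2.2.comp measurable_prodMk_left

omit [MeasurableSpace Ω] in
theorem eLpNorm_gap_fit (hN : N.IsMeasurable) (hQX : Q.map Obs.X = PX) (hη : η.IsMeasurable)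
    {f : Nuisance 𝒳 → 𝒳 → ℝ} (hf : ∀ θ : Nuisance 𝒳, θ.IsMeasurable → Measurable (f θ))
    (k : Fin K) (n : ℕ) (ω : Ω) :
    eLpNorm (gap f η (fit N O n k ω)) 2 Q = err PX N O η f k n ω := by
  unfold err gap
  rw [← hQX]
  exact (eLpNorm_map_measure (f := Obs.X) (μ := Q) (p := 2)
    (((hf _ (hN.fit n k ω)).sub (hf _ hη)).aestronglyMeasurable)
    Obs.measurable_X.aemeasurable).symm

omit [IsProbabilityMeasure μ] in
-- The companion of the truncation bound: the additive term `τ` is arbitrarily small, while `T` may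
-- blow up as `τ` decreases, since `T` is deterministic.
theorem isLittleOp_of_le_add_mul {A B : ℕ → Ω → ℝ≥0∞} (hB : IsLittleOp μ B fun _ => 1)
    (h : ∀ τ : ℝ, 0 < τ → ∃ T : ℝ, ∀ n ω, A n ω ≤ ENNReal.ofReal τ + ENNReal.ofReal T * B n ω) :
    IsLittleOp μ A fun _ => 1 := by
  intro δ hδ
  obtain ⟨T, hT⟩ := h (δ / 2) (by positivity)
  refine tendsto_of_tendsto_of_tendsto_of_le_of_le tendsto_const_nhds
    ((hB.const_mul (C := T)) (δ / 2) (by positivity)) (fun _ => zero_le) fun n =>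
      measure_mono fun ω hω => ?_
  simp only [Set.mem_ofPred_eq, mul_one] at hω ⊢
  by_contra hcon
  have := (hT n ω).trans (add_le_add le_rfl (not_lt.1 hcon))
  rw [ofReal_add_self, show 2 * (δ / 2) = δ by ring] at this
  exact absurd hω (not_lt.2 this)

/-- A cross-fitted average of `ψ` is `o_p(n^{-1/2})` when, on events of probability close to one,
`ψ` is dominated by the errors of the nuisance components and its mean by products of errors. -/
theorem isLittleOp_crossAvg_of_bounds (hO : ∀ i, Measurable (O i)) (hindep : iIndepFun O μ)
    (hlaw : ∀ i, μ.map (O i) = Q) (hN : N.IsMeasurable) (hQX : Q.map Obs.X = PX)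
    (hη : η.IsMeasurable) {ι : Type*} [Fintype ι] {f : ι → Nuisance 𝒳 → 𝒳 → ℝ}
    (hf : ∀ i (θ : Nuisance 𝒳), θ.IsMeasurable → Measurable (f i θ))
    (hcons : ∀ i k, IsLittleOp μ (err PX N O η (f i) k) fun _ => 1)
    {pairs : Finset (ι × ι)}
    (hpairs : ∀ p ∈ pairs, ∀ k, IsLittleOp μ
      (fun n ω => err PX N O η (f p.1) k n ω * err PX N O η (f p.2) k n ω)
      fun n => (n : ℝ) ^ (-(1 / 2) : ℝ))
    {W : Obs 𝒳 → ℝ} (hW : MemLp W 2 Q) (mW : Measurable W)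
    {Good : ℝ → Nuisance 𝒳 → Prop}
    (hGood : ∀ k, ∀ δ : ℝ≥0∞, 0 < δ →
      ∃ M, ∀ᶠ n in atTop, μ {ω | ¬ Good M (fit N O n k ω)} ≤ δ)
    {ψ : Nuisance 𝒳 → Obs 𝒳 → ℝ} (hψ : FitMeasurable N ψ)
    (hbound : ∀ M, ∃ C : ℝ, ∀ θ : Nuisance 𝒳, θ.IsMeasurable → Good M θ →
      (∀ i, MemLp (gap (f i) η θ) 2 Q) →
      (∀ᵐ o ∂Q, |ψ θ o| ≤ C * ∑ i, (|W o| * min 1 |gap (f i) η θ o| + |gap (f i) η θ o|)) ∧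
      |∫ o, ψ θ o ∂Q| ≤ C * ∫ o, ∑ p ∈ pairs, |gap (f p.1) η θ o| * |gap (f p.2) η θ o| ∂Q) :
    IsLittleOp μ (fun n ω => ‖√(n : ℝ) * crossAvg N O ψ n ω‖ₑ) fun _ => 1 := by
  choose C hC using hbound
  -- the good events
  set G : Fin K → ℝ → ℕ → Ω → Prop := fun k M n ω =>
    Good M (fit N O n k ω) ∧ ∀ i, err PX N O η (f i) k n ω ≤ ENNReal.ofReal 1 with hGdef
  have hG : ∀ k, ∀ δ : ℝ≥0∞, 0 < δ → ∃ M, ∀ᶠ n in atTop, μ {ω | ¬ G k M n ω} ≤ δ := by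
    intro k δ hδ
    obtain ⟨M, hM⟩ := hGood k (δ / 2) (ENNReal.half_pos hδ.ne')
    refine ⟨M, ?_⟩
    -- By consistency all errors are at most `1` with probability tending to one; this makes the
    -- error functions elements of `L²(Q)`, as `hbound` requires.
    have hs := (ENNReal.tendsto_nhds_zero.1
      ((IsLittleOp.sum Finset.univ fun i _ => hcons i k) 1 one_pos)) (δ / 2)
      (ENNReal.half_pos hδ.ne')
    filter_upwards [hM, hs] with n h1 h2
    refine (measure_mono ?_).trans ((measure_union_le _ _).trans
      ((add_le_add h1 h2).trans_eq (ENNReal.add_halves δ)))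
    intro ω hω
    by_contra hcon
    simp only [Set.mem_union, Set.mem_ofPred_eq, not_or, not_not, not_lt, mul_one] at hcon
    exact hω ⟨hcon.1, fun i => (Finset.single_le_sum (f := fun i => err PX N O η (f i) k n ω)
      (fun _ _ => zero_le) (Finset.mem_univ i)).trans hcon.2⟩
  have mgap : ∀ i n k ω, Measurable (gap (f i) η (fit N O n k ω)) := fun i n k ω =>
    ((hf i _ (hN.fit n k ω)).comp Obs.measurable_X).sub ((hf i _ hη).comp Obs.measurable_X)
  have hmem : ∀ k M n ω, G k M n ω → ∀ i, MemLp (gap (f i) η (fit N O n k ω)) 2 Q := by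
    intro k M n ω hω i
    refine ⟨(mgap i n k ω).aestronglyMeasurable, ?_⟩
    rw [eLpNorm_gap_fit hN hQX hη (hf i)]
    exact (hω.2 i).trans_lt ENNReal.ofReal_lt_top
  refine isLittleOp_crossAvg_of_L2 hO hindep hlaw hψ (fun k => ?_) (fun k => ?_)
  -- The triangle inequality is available for the `L²` norm, so the norm is shown to vanish first
  -- and is squared afterwards.
  · have h2 : IsLittleOp μ (fun n ω => eLpNorm (ψ (fit N O n k ω)) 2 Q) fun _ => 1 := by
      refine IsLittleOp.of_good (G k) (hG k)
        (B := fun _ n ω => ∑ i, (eLpNorm (fun o => |W o| * min 1 |gap (f i) η (fit N O n k ω) o|) 2 Q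
          + err PX N O η (f i) k n ω))
        (fun M => IsLittleOp.sum _ fun i _ => IsLittleOp.add ?_ (hcons i k))
        fun M => ⟨|C M| + 1, by positivity, fun n ω hω => ?_⟩
      · refine isLittleOp_of_le_add_mul (hcons i k) fun τ hτ => ?_
        obtain ⟨T, hT⟩ := MemLp.exists_eLpNorm_mul_min_le hW mW hτ
        refine ⟨T, fun n ω => ?_⟩
        rw [← eLpNorm_gap_fit hN hQX hη (hf i)]
        exact hT _ (mgap i n k ω)
      · have h := (hC M _ (hN.fit n k ω) hω.1 (hmem k M n ω hω)).1
        have hs : ∀ i, Measurable fun o => |W o| * min 1 |gap (f i) η (fit N O n k ω) o| :=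
          fun i => mW.abs.mul (measurable_const.min (mgap i n k ω).abs)
        have hn : ∀ o, 0 ≤ ∑ i, (|W o| * min 1 |gap (f i) η (fit N O n k ω) o|
            + |gap (f i) η (fit N O n k ω) o|) := fun o => Finset.sum_nonneg fun i _ => by positivity
        refine (eLpNorm_le_mul_eLpNorm_of_ae_le_mul (c := |C M| + 1) (g := ∑ i,
          ((fun o => |W o| * min 1 |gap (f i) η (fit N O n k ω) o|)
            + fun o => |gap (f i) η (fit N O n k ω) o|)) (h.mono fun o ho => ?_) 2).trans ?_
        · rw [Real.norm_eq_abs, Real.norm_eq_abs, Finset.sum_apply]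
          simp only [Pi.add_apply]
          rw [abs_of_nonneg (hn o)]
          refine ho.trans (mul_le_mul_of_nonneg_right ?_ (hn o))
          linarith [le_abs_self (C M)]
        · gcongr
          refine (eLpNorm_sum_le (fun i _ => ((hs i).add (mgap i n k ω).abs).aestronglyMeasurable)
            one_le_two).trans (Finset.sum_le_sum fun i _ => ?_)
          refine (eLpNorm_add_le (hs i).aestronglyMeasurable
            (mgap i n k ω).abs.aestronglyMeasurable one_le_two).trans (add_le_add le_rfl ?_)
          rw [← eLpNorm_gap_fit hN hQX hη (hf i)]
          exact (eLpNorm_norm (gap (f i) η (fit N O n k ω))).le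
    have h3 := h2.mul_one h2
    refine h3.mono fun n ω => ?_
    have := eLpNorm_nnreal_pow_eq_lintegral (μ := Q) (f := ψ (fit N O n k ω)) (p := 2) (by norm_num)
    simp only [NNReal.coe_ofNat, ENNReal.coe_ofNat, ENNReal.rpow_ofNat] at this
    rw [← this, sq]
  · refine IsLittleOp.of_good (G k) (hG k)
      (B := fun _ n ω => ∑ p ∈ pairs, err PX N O η (f p.1) k n ω * err PX N O η (f p.2) k n ω)
      (fun M => IsLittleOp.sum _ fun p hp => hpairs p hp k)
      fun M => ⟨|C M| + 1, by positivity, fun n ω hω => ?_⟩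
    have h := (hC M _ (hN.fit n k ω) hω.1 (hmem k M n ω hω)).2
    have h0 : 0 ≤ ∫ o, ∑ p ∈ pairs, |gap (f p.1) η (fit N O n k ω) o|
        * |gap (f p.2) η (fit N O n k ω) o| ∂Q :=
      integral_nonneg fun o => Finset.sum_nonneg fun p _ => by positivity
    rw [← ofReal_norm, Real.norm_eq_abs]
    refine (ENNReal.ofReal_le_ofReal (h.trans (mul_le_mul_of_nonneg_right
      ((le_abs_self _).trans (by linarith : |C M| ≤ |C M| + 1)) h0))).trans ?_
    rw [ENNReal.ofReal_mul (by positivity)]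
    gcongr
    refine (enorm_integral_le_sum (fun i => mgap i n k ω) pairs).trans
      (Finset.sum_le_sum fun p _ => ?_)
    rw [eLpNorm_gap_fit hN hQX hη (hf _), eLpNorm_gap_fit hN hQX hη (hf _)]

/-- The propensity values of `θ` and their complements are at least `1 / M`. -/
def BoundedPropensity (Q : Measure (Obs 𝒳)) (M : ℝ) (θ : Nuisance 𝒳) : Prop :=
  ∀ᵐ o ∂Q, 0 < θ.e1 o.X ∧ θ.e1 o.X < 1 ∧ 1 ≤ M * θ.e1 o.X ∧ 1 ≤ M * (1 - θ.e1 o.X)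

omit [MeasurableSpace Ω] in
-- At a nonpositive value of `f` the inverse taken in `ℝ≥0∞` is `∞`, so a finite essential supremum
-- also forces positivity.
theorem one_le_mul_of_invSup_le (hQX : Q.map Obs.X = PX) {f : Nuisance 𝒳 → 𝒳 → ℝ} {k : Fin K}
    {n : ℕ} {ω : Ω} {M : ℝ} (h : invSup PX N O f k n ω ≤ ENNReal.ofReal M) :
    ∀ᵐ o ∂Q, 0 < f (fit N O n k ω) o.X ∧ 1 ≤ M * f (fit N O n k ω) o.X := by
  have h1 : ∀ᵐ x ∂PX, (ENNReal.ofReal (f (fit N O n k ω) x))⁻¹ ≤ ENNReal.ofReal M := by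
    filter_upwards [ae_le_essSup (μ := PX)
      (f := fun x => (ENNReal.ofReal (f (fit N O n k ω) x))⁻¹)] with x hx using hx.trans h
  rw [← hQX] at h1
  filter_upwards [ae_of_ae_map Obs.measurable_X.aemeasurable h1] with o ho
  have hp : 0 < f (fit N O n k ω) o.X := by
    by_contra hcon
    rw [ENNReal.ofReal_of_nonpos (not_lt.1 hcon)] at ho
    simp at ho
  refine ⟨hp, ?_⟩
  rw [← ENNReal.ofReal_inv_of_pos hp] at ho
  have hM := (ENNReal.ofReal_le_ofReal_iff' .. |>.1 ho)
  rcases hM with hM | hM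
  · rwa [inv_le_iff_one_le_mul₀ hp] at hM
  · exact absurd (inv_pos.2 hp) (not_lt.2 hM)

omit [IsProbabilityMeasure μ] in
-- The conclusion holds for every `M` above a threshold, rather than for one `M`, so that several
-- such events can share the same `M`.
theorem IsBoundedOp.good {A : ℕ → Ω → ℝ≥0∞} (hA : IsBoundedOp μ A) {G : ℝ → ℕ → Ω → Prop}
    (h : ∀ M n ω, A n ω ≤ ENNReal.ofReal M → G M n ω) (δ : ℝ≥0∞) (hδ : 0 < δ) :
    ∃ M₀, ∀ M, M₀ ≤ M → ∀ᶠ n in atTop, μ {ω | ¬ G M n ω} ≤ δ := by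
  obtain ⟨M₀, hM⟩ := hA δ hδ
  refine ⟨M₀, fun M hMM => hM.mono fun n hn => (measure_mono fun ω hω => ?_).trans hn⟩
  by_contra hcon
  exact hω (h M n ω ((not_lt.1 hcon).trans (ENNReal.ofReal_le_ofReal hMM)))

omit [IsProbabilityMeasure μ] in
theorem exists_good_and {G G' : ℝ → ℕ → Ω → Prop}
    (h : ∀ δ : ℝ≥0∞, 0 < δ → ∃ M₀, ∀ M, M₀ ≤ M → ∀ᶠ n in atTop, μ {ω | ¬ G M n ω} ≤ δ)
    (h' : ∀ δ : ℝ≥0∞, 0 < δ → ∃ M₀, ∀ M, M₀ ≤ M → ∀ᶠ n in atTop, μ {ω | ¬ G' M n ω} ≤ δ) :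
    ∀ δ : ℝ≥0∞, 0 < δ → ∃ M₀, ∀ M, M₀ ≤ M →
      ∀ᶠ n in atTop, μ {ω | ¬ (G M n ω ∧ G' M n ω)} ≤ δ := by
  intro δ hδ
  obtain ⟨M₁, h1⟩ := h (δ / 2) (ENNReal.half_pos hδ.ne')
  obtain ⟨M₂, h2⟩ := h' (δ / 2) (ENNReal.half_pos hδ.ne')
  refine ⟨max M₁ M₂, fun M hM => ?_⟩
  filter_upwards [h1 M (le_of_max_le_left hM), h2 M (le_of_max_le_right hM)] with n a1 a2
  refine (measure_mono ?_).trans ((measure_union_le _ _).trans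
      ((add_le_add a1 a2).trans_eq (ENNReal.add_halves δ)))
  intro ω hω
  by_contra hcon
  simp only [Set.mem_union, Set.mem_ofPred_eq, not_or, not_not] at hcon
  exact hω hcon

omit [IsProbabilityMeasure μ] in
theorem boundedPropensity_fit (hQX : Q.map Obs.X = PX)
    {k : Fin K} (he1 : IsBoundedOp μ (invSup PX N O Nuisance.e1 k))
    (he0 : IsBoundedOp μ (invSup PX N O Nuisance.e0 k)) :
    ∀ δ : ℝ≥0∞, 0 < δ → ∃ M₀, ∀ M, M₀ ≤ M →
      ∀ᶠ n in atTop, μ {ω | ¬ BoundedPropensity Q M (fit N O n k ω)} ≤ δ := by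
  have h := exists_good_and (μ := μ)
    (G := fun M n ω => invSup PX N O Nuisance.e1 k n ω ≤ ENNReal.ofReal M)
    (G' := fun M n ω => invSup PX N O Nuisance.e0 k n ω ≤ ENNReal.ofReal M)
    (he1.good fun _ _ _ h => h) (he0.good fun _ _ _ h => h)
  intro δ hδ
  obtain ⟨M₀, hM⟩ := h δ hδ
  refine ⟨M₀, fun M hMM => (hM M hMM).mono fun n hn => (measure_mono fun ω hω => ?_).trans hn⟩
  intro hcon
  refine hω ?_
  filter_upwards [one_le_mul_of_invSup_le hQX hcon.1, one_le_mul_of_invSup_le hQX hcon.2]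
    with o h1 h2
  simp only [Nuisance.e0] at h2
  exact ⟨h1.1, by linarith [h2.1], h1.2, h2.2⟩

end Reduction

/-! ### Estimated doubly robust scores -/

section EstimatedScores

/-- Telescoping through a change of weight, then of propensity, then of residual. The first two
differences carry the true residual `z v`; the last carries the estimated weight and the error of
the regression. -/
theorem abs_weighted_sub_le {z v v' e e' a a' M ε : ℝ} (hz : |z| ≤ 1) (he : ε ≤ e) (hε : 0 < ε)
    (he' : 0 < e') (hM : 1 ≤ M * e') :
    |z / e' * a' * v' - z / e * a * v| ≤
      M * (1 + 1 / ε) * (|z * v| * (|a' - a| + |a| * |e' - e|)) + M * |a' * (v' - v)| := by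
  have he0 : 0 < e := hε.trans_le he
  have hMp : 0 < M := by
    by_contra h
    nlinarith [mul_nonneg (by linarith [not_lt.1 h] : 0 ≤ -M) he'.le]
  have hi : 1 / e' ≤ M := by rwa [div_le_iff₀ he']
  have hie : 1 / e ≤ 1 / ε := one_div_le_one_div_of_le hε he
  have e1 : z / e' * a' * v' - z / e * a * v
      = z * v * (1 / e') * (a' - a) - z * v * (1 / e') * a * (1 / e) * (e' - e)
        + z * (1 / e') * (a' * (v' - v)) := by
    field_simp; ring
  have b1 : |z * v * (1 / e') * (a' - a)| ≤ M * (|z * v| * |a' - a|) := by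
    rw [abs_mul, abs_mul, abs_of_pos (by positivity : 0 < 1 / e')]
    calc _ = 1 / e' * (|z * v| * |a' - a|) := by ring
      _ ≤ _ := by gcongr
  have b2 : |z * v * (1 / e') * a * (1 / e) * (e' - e)| ≤ M * (1 / ε) * (|z * v| * (|a| * |e' - e|)) := by
    rw [abs_mul, abs_mul, abs_mul, abs_mul, abs_of_pos (by positivity : 0 < 1 / e'),
      abs_of_pos (by positivity : 0 < 1 / e)]
    calc _ = 1 / e' * (1 / e) * (|z * v| * (|a| * |e' - e|)) := by ring
      _ ≤ _ := by gcongr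
  have b3 : |z * (1 / e') * (a' * (v' - v))| ≤ M * |a' * (v' - v)| := by
    rw [abs_mul, abs_mul, abs_of_pos (by positivity : 0 < 1 / e')]
    have : |z| * (1 / e') ≤ 1 * M := mul_le_mul hz hi (by positivity) (by norm_num)
    exact mul_le_mul_of_nonneg_right (by linarith) (abs_nonneg _)
  have p1 : 0 ≤ M * (1 / ε) * (|z * v| * |a' - a|) := by positivity
  have p2 : 0 ≤ M * (|z * v| * (|a| * |e' - e|)) := by positivity
  rw [e1]
  calc _ ≤ |z * v * (1 / e') * (a' - a)| + |z * v * (1 / e') * a * (1 / e) * (e' - e)|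
      + |z * (1 / e') * (a' * (v' - v))| := by
        refine (abs_add_le _ _).trans (add_le_add (abs_sub _ _) le_rfl)
    _ ≤ _ := by nlinarith

variable {𝒳 : Type*} [MeasurableSpace 𝒳] {Q : Measure (Obs 𝒳)} [IsFiniteMeasure Q] {ε : ℝ}
  {V1 V0 e a1 u1 a0 u0 G : Obs 𝒳 → ℝ}

/-- The pointwise bound is of first order and controls the variance. The bound on the mean is of
second order: in `drScore_sub_eq` at the estimates, with the true regressions in place of `v1`,
`v0`, the residuals integrate to zero, and of `Z - e' = (Z - e) + (e - e')` only the second summand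
survives, multiplied by regression errors. -/
theorem IsScore.estimate_bounds (S : IsScore Q ε V1 V0 e a1 u1 a0 u0 G)
    {e' a1' u1' a0' u0' G' : Obs 𝒳 → ℝ}
    (me : Measurable[Obs.sigmaX] e') (ma1 : Measurable[Obs.sigmaX] a1')
    (mu1 : Measurable[Obs.sigmaX] u1') (ma0 : Measurable[Obs.sigmaX] a0')
    (mu0 : Measurable[Obs.sigmaX] u0') (mG : Measurable[Obs.sigmaX] G')
    {M C : ℝ} (hC : 0 ≤ C)
    (he' : ∀ᵐ o ∂Q, 0 < e' o ∧ e' o < 1 ∧ 1 ≤ M * e' o ∧ 1 ≤ M * (1 - e' o))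
    {B D R : Obs 𝒳 → ℝ} (iB : Integrable B Q) (mD : Measurable D) (iD : Integrable (fun o => |e' o - e o| * D o) Q)
    (iR : Integrable R Q) (hDB : ∀ o, 0 ≤ D o ∧ D o ≤ B o)
    (H1 : ∀ᵐ o ∂Q, |o.zz * (V1 o - u1 o)| * (|a1' o - a1 o| + |a1 o| * |e' o - e o|)
      + |(1 - o.zz) * (V0 o - u0 o)| * (|a0' o - a0 o| + |a0 o| * |e' o - e o|) ≤ C * B o)
    (H2 : ∀ᵐ o ∂Q, |a1' o * (u1' o - u1 o)| + |a0' o * (u0' o - u0 o)| ≤ C * D o)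
    (H3 : ∀ᵐ o ∂Q, |G' o - G o| ≤ C * B o)
    (H4 : ∀ᵐ o ∂Q, |G o - G' o - a1' o * (u1 o - u1' o) - a0' o * (u0 o - u0' o)| ≤ C * R o) :
    (∀ᵐ o ∂Q, |drScore V1 V0 e' a1' u1' a0' u0' G' o - drScore V1 V0 e a1 u1 a0 u0 G o|
      ≤ C * (|M| * (2 + 1 / ε) + 1) * B o) ∧
    |∫ o, (drScore V1 V0 e' a1' u1' a0' u0' G' o - drScore V1 V0 e a1 u1 a0 u0 G o) ∂Q|
      ≤ C * (|M| * (2 + 1 / ε) + 1) * ∫ o, (|e' o - e o| * D o + R o) ∂Q := by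
  have hε := S.eps_pos
  have hzz : ∀ o : Obs 𝒳, |o.zz| ≤ 1 ∧ |1 - o.zz| ≤ 1 := fun o => by
    rcases o.zz_eq with h | h <;> simp [h]
  have L2 : ∀ᵐ o ∂Q, |drScore V1 V0 e' a1' u1' a0' u0' G' o - drScore V1 V0 e a1 u1 a0 u0 G o|
      ≤ C * (|M| * (2 + 1 / ε) + 1) * B o := by
    filter_upwards [he', S.e_mem, H1, H2, H3] with o c1 c2 c3 c4 c5
    have hM : 0 < M := by
      by_contra h
      nlinarith [mul_nonneg (by linarith [not_lt.1 h] : 0 ≤ -M) c1.1.le]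
    rw [abs_of_pos hM]
    have t1 := abs_weighted_sub_le (v := V1 o - u1 o) (v' := V1 o - u1' o) (a := a1 o)
      (a' := a1' o) (hzz o).1 c2.1 hε c1.1 c1.2.2.1
    have t0 := abs_weighted_sub_le (v := V0 o - u0 o) (v' := V0 o - u0' o) (a := a0 o)
      (a' := a0' o) (hzz o).2 (by linarith [c2.2] : ε ≤ 1 - e o) hε (by linarith) c1.2.2.2
    have r1 : |a1' o * (V1 o - u1' o - (V1 o - u1 o))| = |a1' o * (u1' o - u1 o)| := by
      rw [← abs_neg]; congr 1; ring
    have r0 : |a0' o * (V0 o - u0' o - (V0 o - u0 o))| = |a0' o * (u0' o - u0 o)| := by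
      rw [← abs_neg]; congr 1; ring
    have r2 : |1 - e' o - (1 - e o)| = |e' o - e o| := by
      rw [← abs_neg]; congr 1; ring
    rw [r1] at t1; rw [r0, r2] at t0
    have hd : drScore V1 V0 e' a1' u1' a0' u0' G' o - drScore V1 V0 e a1 u1 a0 u0 G o
        = (o.zz / e' o * a1' o * (V1 o - u1' o) - o.zz / e o * a1 o * (V1 o - u1 o))
        + ((1 - o.zz) / (1 - e' o) * a0' o * (V0 o - u0' o)
          - (1 - o.zz) / (1 - e o) * a0 o * (V0 o - u0 o)) + (G' o - G o) := by
      unfold drScore; ring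
    rw [hd]
    have h1 : M * (1 + 1 / ε) * (|o.zz * (V1 o - u1 o)| * (|a1' o - a1 o| + |a1 o| * |e' o - e o|)
        + |(1 - o.zz) * (V0 o - u0 o)| * (|a0' o - a0 o| + |a0 o| * |e' o - e o|))
        ≤ M * (1 + 1 / ε) * (C * B o) := mul_le_mul_of_nonneg_left c3 (by positivity)
    have h2 : M * (|a1' o * (u1' o - u1 o)| + |a0' o * (u0' o - u0 o)|) ≤ M * (C * B o) :=
      mul_le_mul_of_nonneg_left (c4.trans (mul_le_mul_of_nonneg_left (hDB o).2 hC)) hM.le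
    have h3 := abs_add_three (o.zz / e' o * a1' o * (V1 o - u1' o) - o.zz / e o * a1 o * (V1 o - u1 o))
      ((1 - o.zz) / (1 - e' o) * a0' o * (V0 o - u0' o)
          - (1 - o.zz) / (1 - e o) * a0 o * (V0 o - u0 o)) (G' o - G o)
    linarith
  refine ⟨L2, ?_⟩
  set φ' := drScore V1 V0 e' a1' u1' a0' u0' G' with hφ'
  set φ := drScore V1 V0 e a1 u1 a0 u0 G with hφ
  -- integrability
  have mzv1 : AEStronglyMeasurable (fun o => o.zz * (V1 o - u1 o)) Q := S.orth1.integrable.1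
  have mzv0 : AEStronglyMeasurable (fun o => (1 - o.zz) * (V0 o - u0 o)) Q := S.orth0.integrable.1
  have me' := Measurable.of_sigmaX me
  have mG' := Measurable.of_sigmaX mG
  have bdd_div : ∀ {w h : Obs 𝒳 → ℝ}, Integrable w Q → Measurable h →
      (∀ᵐ o ∂Q, 0 < h o ∧ 1 ≤ M * h o) → Integrable (fun o => w o / h o) Q := by
    intro w h hw mh hh
    have : Integrable (fun o => (h o)⁻¹ * w o) Q :=
      hw.bdd_mul (c := |M|) mh.inv.aestronglyMeasurable (by
        filter_upwards [hh] with o ho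
        rw [Real.norm_eq_abs, abs_of_pos (inv_pos.2 ho.1), inv_eq_one_div, div_le_iff₀ ho.1]
        exact ho.2.trans (mul_le_mul_of_nonneg_right (le_abs_self M) ho.1.le))
    exact this.congr (ae_of_all _ fun o => by simp only; rw [div_eq_inv_mul])
  -- The estimated weight need not be bounded; its difference from the true weight, multiplied by
  -- the residual, is dominated through `H1`.
  have ia1 : Integrable (fun o => a1' o * (o.zz * (V1 o - u1 o))) Q := by
    refine ((iB.const_mul C).add S.integrable1.abs).mono'
      ((Measurable.of_sigmaX ma1).aestronglyMeasurable.mul mzv1) ?_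
    filter_upwards [H1] with o c3
    rw [Real.norm_eq_abs, Pi.add_apply]
    have q1 : |a1' o * (o.zz * (V1 o - u1 o))| ≤ |(a1' o - a1 o) * (o.zz * (V1 o - u1 o))|
        + |a1 o * (o.zz * (V1 o - u1 o))| := by
      refine le_trans (le_of_eq ?_) (abs_add_le _ _); congr 1; ring
    have q2 : |(a1' o - a1 o) * (o.zz * (V1 o - u1 o))| ≤ C * B o := by
      refine le_trans ?_ c3
      rw [abs_mul, mul_comm]
      have : 0 ≤ |o.zz * (V1 o - u1 o)| * (|a1 o| * |e' o - e o|) := by positivity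
      have : 0 ≤ |(1 - o.zz) * (V0 o - u0 o)| * (|a0' o - a0 o| + |a0 o| * |e' o - e o|) := by positivity
      linarith
    linarith
  have ia0 : Integrable (fun o => a0' o * ((1 - o.zz) * (V0 o - u0 o))) Q := by
    refine ((iB.const_mul C).add S.integrable0.abs).mono'
      ((Measurable.of_sigmaX ma0).aestronglyMeasurable.mul mzv0) ?_
    filter_upwards [H1] with o c3
    rw [Real.norm_eq_abs, Pi.add_apply]
    have q1 : |a0' o * ((1 - o.zz) * (V0 o - u0 o))| ≤ |(a0' o - a0 o) * ((1 - o.zz) * (V0 o - u0 o))|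
        + |a0 o * ((1 - o.zz) * (V0 o - u0 o))| := by
      refine le_trans (le_of_eq ?_) (abs_add_le _ _); congr 1; ring
    have q2 : |(a0' o - a0 o) * ((1 - o.zz) * (V0 o - u0 o))| ≤ C * B o := by
      refine le_trans ?_ c3
      rw [abs_mul, mul_comm]
      have : 0 ≤ |(1 - o.zz) * (V0 o - u0 o)| * (|a0 o| * |e' o - e o|) := by positivity
      have : 0 ≤ |o.zz * (V1 o - u1 o)| * (|a1' o - a1 o| + |a1 o| * |e' o - e o|) := by positivity
      linarith
    linarith
  have O1 : Orth Q fun o => a1' o / e' o * (o.zz * (V1 o - u1 o)) :=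
    S.orth1.mul_left (ma1.div me) ((bdd_div ia1 me' (he'.mono fun o h => ⟨h.1, h.2.2.1⟩)).congr
      (ae_of_all _ fun o => by simp only; ring))
  have O0 : Orth Q fun o => a0' o / (1 - e' o) * ((1 - o.zz) * (V0 o - u0 o)) :=
    S.orth0.mul_left (ma0.div (measurable_const.sub me))
      ((bdd_div (h := fun o => 1 - e' o) ia0 (measurable_const.sub me')
        (he'.mono fun o h => ⟨by linarith [h.2.1], h.2.2.2⟩)).congr
      (ae_of_all _ fun o => by simp only; ring))
  have m1 : Measurable[Obs.sigmaX] fun o => a1' o * (u1 o - u1' o) := ma1.mul (S.measurable_u1.sub mu1)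
  have m0 : Measurable[Obs.sigmaX] fun o => a0' o * (u0 o - u0' o) := ma0.mul (S.measurable_u0.sub mu0)
  set k : Obs 𝒳 → ℝ := fun o =>
    (a1' o * (u1 o - u1' o)) / e' o - (a0' o * (u0 o - u0' o)) / (1 - e' o) with hk
  have mk : Measurable[Obs.sigmaX] k := (m1.div me).sub (m0.div (measurable_const.sub me))
  have kle : ∀ᵐ o ∂Q, |k o| ≤ |M| * (C * D o) := by
    filter_upwards [he', H2] with o c1 c4
    have i1 : |1 / e' o| ≤ |M| := by
      rw [abs_of_pos (by have := c1.1; positivity), div_le_iff₀ c1.1]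
      exact c1.2.2.1.trans (mul_le_mul_of_nonneg_right (le_abs_self M) c1.1.le)
    have i0 : |1 / (1 - e' o)| ≤ |M| := by
      have hp : 0 < 1 - e' o := by linarith [c1.2.1]
      rw [abs_of_pos (by positivity), div_le_iff₀ hp]
      exact c1.2.2.2.trans (mul_le_mul_of_nonneg_right (le_abs_self M) hp.le)
    calc |k o| = |1 / e' o * (a1' o * (u1 o - u1' o)) - 1 / (1 - e' o) * (a0' o * (u0 o - u0' o))| := by
          simp only [hk]; congr 1; ring
      _ ≤ |1 / e' o| * |a1' o * (u1 o - u1' o)| + |1 / (1 - e' o)| * |a0' o * (u0 o - u0' o)| := by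
          rw [← abs_mul, ← abs_mul]; exact abs_sub _ _
      _ ≤ |M| * |a1' o * (u1 o - u1' o)| + |M| * |a0' o * (u0 o - u0' o)| := by gcongr
      _ = |M| * (|a1' o * (u1' o - u1 o)| + |a0' o * (u0' o - u0 o)|) := by
          rw [← abs_neg (a1' o * (u1' o - u1 o)), ← abs_neg (a0' o * (u0' o - u0 o)), mul_add]
          congr 3 <;> ring
      _ ≤ _ := by gcongr
  have iDD : Integrable D Q := iB.mono' mD.aestronglyMeasurable (ae_of_all _ fun o => by
    rw [Real.norm_eq_abs, abs_of_nonneg (hDB o).1]; exact (hDB o).2)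
  have ik : Integrable k Q := ((iDD.const_mul C).const_mul |M|).mono'
    (Measurable.of_sigmaX mk).aestronglyMeasurable kle
  have bze : ∀ᵐ o ∂Q, |o.zz - e o| ≤ 1 := by
    filter_upwards [S.e_mem] with o ho
    rw [abs_le]
    rcases o.zz_eq with h | h <;> rw [h] <;> constructor <;> linarith [ho.1, ho.2]
  have izk : Integrable (fun o => k o * (o.zz - e o)) Q :=
    ik.mul_bdd (c := 1) (Obs.measurable_zz.sub (Measurable.of_sigmaX S.measurable_e)).aestronglyMeasurable bze
  have ozk := (S.orth_e.mul_left mk izk).integral_eq_zero Obs.sigmaX_le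
  set rem : Obs 𝒳 → ℝ := fun o =>
    G o - G' o - a1' o * (u1 o - u1' o) - a0' o * (u0 o - u0' o) with hrem
  have irem : Integrable rem Q := (iR.const_mul C).mono'
    (Measurable.of_sigmaX (((S.measurable_G.sub mG).sub m1).sub m0)).aestronglyMeasurable H4
  -- The product of propensity error and regression error, the only first-order error that survives
  -- integration.
  set k2 : Obs 𝒳 → ℝ := fun o => k o * (e o - e' o) with hk2
  have k2le : ∀ᵐ o ∂Q, |k2 o| ≤ |M| * C * (|e' o - e o| * D o) := by
    filter_upwards [kle] with o ho
    rw [hk2, abs_mul, abs_sub_comm (e o)]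
    nlinarith [mul_le_mul_of_nonneg_right ho (abs_nonneg (e' o - e o))]
  have ik2 : Integrable k2 Q := (iD.const_mul _).mono'
    (Measurable.of_sigmaX (mk.mul (S.measurable_e.sub me))).aestronglyMeasurable k2le
  have hφi : Integrable φ Q := S.integrable
  -- All terms except `k2 - rem` have mean zero: the weighted residuals, the term in `Z - e`, and `G
  -- - φ`, since the true score integrates to the plug-in functional.
  have key : (fun o => φ' o - φ o) =ᵐ[Q] fun o =>
      (a1' o / e' o * (o.zz * (V1 o - u1 o)) + a0' o / (1 - e' o) * ((1 - o.zz) * (V0 o - u0 o)))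
      + (k o * (o.zz - e o) + (k2 o - rem o)) + (G o - φ o) := by
    filter_upwards [he'] with o ho
    have := drScore_sub_eq (V1 := V1) (V0 := V0) (a1 := a1') (u1 := u1') (a0 := a0') (u0 := u0')
      (G := G') (v1 := u1) (v0 := u0) (G' := G) ho.1.ne' (by linarith [ho.2.1] : 1 - e' o ≠ 0)
    rw [show φ' o - φ o = (φ' o - G o) + (G o - φ o) by ring, hφ', this]
    simp only [hk, hk2, hrem]; ring
  have i01 := O1.integrable.add O0.integrable
  have i23 : Integrable (fun o => k o * (o.zz - e o) + (k2 o - rem o)) Q := izk.add (ik2.sub irem)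
  have iGφ : Integrable (fun o => G o - φ o) Q := S.integrable_G.sub hφi
  have hGφ : ∫ o, (G o - φ o) ∂Q = 0 := by
    rw [integral_sub S.integrable_G hφi, hφ, S.integral_eq, sub_self]
  have e1 : ∫ o, (φ' o - φ o) ∂Q = ∫ o, (k2 o - rem o) ∂Q := by
    rw [integral_congr_ae key]
    refine (integral_add (i01.add i23) iGφ).trans ?_
    rw [hGφ, add_zero]
    refine (integral_add i01 i23).trans ?_
    have h01 := integral_add O1.integrable O0.integrable
    rw [O1.integral_eq_zero Obs.sigmaX_le, O0.integral_eq_zero Obs.sigmaX_le, add_zero] at h01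
    have h23 := integral_add izk (ik2.sub irem)
    rw [ozk, zero_add] at h23
    exact (congrArg₂ (· + ·) h01 h23).trans (zero_add _)
  rw [e1, ← Real.norm_eq_abs, ← integral_const_mul]
  refine norm_integral_le_of_norm_le ((iD.add iR).const_mul _) ?_
  filter_upwards [k2le, H4] with o c1 c2
  rw [Real.norm_eq_abs]
  have hR0 : 0 ≤ C * R o := (abs_nonneg _).trans c2
  have hD0 := mul_nonneg hC (mul_nonneg (abs_nonneg (e' o - e o)) (hDB o).1)
  have hMe : |M| * 1 ≤ |M| * (2 + 1 / ε) :=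
    mul_le_mul_of_nonneg_left (by have : 0 < 1 / ε := by positivity
                                  linarith) (abs_nonneg M)
  calc |k2 o - rem o| ≤ |k2 o| + |rem o| := abs_sub _ _
    _ ≤ |M| * C * (|e' o - e o| * D o) + C * R o := add_le_add c1 c2
    _ ≤ (|M| * (2 + 1 / ε)) * (C * (|e' o - e o| * D o)) + C * R o := by nlinarith
    _ ≤ _ := by
      have : 0 ≤ (|M| * (2 + 1 / ε)) * (C * R o) := by positivity
      linarith

end EstimatedScores

/-! ### Scores as functions of the nuisance value, and their cross-fitted averages. -/

section ScoreFamilies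
variable {𝒳 : Type*} [MeasurableSpace 𝒳]

/-- A doubly robust score as a function of the nuisance value: weights, outcome means and plug-in
term depending on the nuisance value. -/
structure ScoreFamily (𝒳 : Type*) where
  a1 : Nuisance 𝒳 → Obs 𝒳 → ℝ
  u1 : Nuisance 𝒳 → Obs 𝒳 → ℝ
  a0 : Nuisance 𝒳 → Obs 𝒳 → ℝ
  u0 : Nuisance 𝒳 → Obs 𝒳 → ℝ
  G : Nuisance 𝒳 → Obs 𝒳 → ℝ

structure ScoreFamily.IsMeasurable (s : ScoreFamily 𝒳) : Prop where
  a1 : ∀ θ : Nuisance 𝒳, θ.IsMeasurable → Measurable[Obs.sigmaX] (s.a1 θ)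
  u1 : ∀ θ : Nuisance 𝒳, θ.IsMeasurable → Measurable[Obs.sigmaX] (s.u1 θ)
  a0 : ∀ θ : Nuisance 𝒳, θ.IsMeasurable → Measurable[Obs.sigmaX] (s.a0 θ)
  u0 : ∀ θ : Nuisance 𝒳, θ.IsMeasurable → Measurable[Obs.sigmaX] (s.u0 θ)
  G : ∀ θ : Nuisance 𝒳, θ.IsMeasurable → Measurable[Obs.sigmaX] (s.G θ)

/-- The score at the nuisance value `θ`. -/
def ScoreFamily.score (s : ScoreFamily 𝒳) (V1 V0 : Obs 𝒳 → ℝ) (θ : Nuisance 𝒳) : Obs 𝒳 → ℝ :=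
  drScore V1 V0 (fun o => θ.e1 o.X) (s.a1 θ) (s.u1 θ) (s.a0 θ) (s.u0 θ) (s.G θ)

/-- The score family consists of true conditional means at `η`. -/
abbrev ScoreFamily.IsTrue (s : ScoreFamily 𝒳) (Q : Measure (Obs 𝒳)) (ε : ℝ) (V1 V0 : Obs 𝒳 → ℝ)
    (η : Nuisance 𝒳) : Prop :=
  IsScore Q ε V1 V0 (fun o => η.e1 o.X) (s.a1 η) (s.u1 η) (s.a0 η) (s.u0 η) (s.G η)

/-- The pointwise bounds on an estimated score in terms of the errors of the nuisance components:
`B` bounds first-order terms, `D` the errors of outcome means, `R` the second-order remainder. -/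
structure ScoreFamily.Bounds (s : ScoreFamily 𝒳) (V1 V0 : Obs 𝒳 → ℝ) (η θ : Nuisance 𝒳)
    (C B D R : ℝ) (o : Obs 𝒳) : Prop where
  weights : |o.zz * (V1 o - s.u1 η o)| *
        (|s.a1 θ o - s.a1 η o| + |s.a1 η o| * |θ.e1 o.X - η.e1 o.X|)
      + |(1 - o.zz) * (V0 o - s.u0 η o)| *
        (|s.a0 θ o - s.a0 η o| + |s.a0 η o| * |θ.e1 o.X - η.e1 o.X|) ≤ C * B
  means : |s.a1 θ o * (s.u1 θ o - s.u1 η o)| + |s.a0 θ o * (s.u0 θ o - s.u0 η o)| ≤ C * D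
  plugin : |s.G θ o - s.G η o| ≤ C * B
  remainder : |s.G η o - s.G θ o - s.a1 θ o * (s.u1 η o - s.u1 θ o)
      - s.a0 θ o * (s.u0 η o - s.u0 θ o)| ≤ C * R

variable {Ω : Type*} [MeasurableSpace Ω] {μ : Measure Ω} [IsProbabilityMeasure μ]
  {K : ℕ} {F : CrossFitting K} {N : NuisanceEstimator 𝒳 F} {O : ℕ → Ω → Obs 𝒳}
  {Q : Measure (Obs 𝒳)} {PX : Measure 𝒳} {η : Nuisance 𝒳} {ε : ℝ}

/-- The set `J` lists the components whose errors bound those of the regressions, and so meet the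
propensity error; `rem` lists the pairs of errors in the Taylor remainder. These are the only
products that need a rate. -/
theorem ScoreFamily.isLittleOp_crossAvg {s : ScoreFamily 𝒳} {V1 V0 : Obs 𝒳 → ℝ}
    (S : s.IsTrue Q ε V1 V0 η) (hs : s.IsMeasurable)
    (hO : ∀ i, Measurable (O i)) (hindep : iIndepFun O μ)
    (hlaw : ∀ i, μ.map (O i) = Q) (hN : N.IsMeasurable) (hQX : Q.map Obs.X = PX)
    (hη : η.IsMeasurable) {ι : Type*} [Fintype ι] [DecidableEq ι]
    {f : ι → Nuisance 𝒳 → 𝒳 → ℝ} {i₀ : ι} (hi₀ : f i₀ = Nuisance.e1)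
    (hf : ∀ i (θ : Nuisance 𝒳), θ.IsMeasurable → Measurable (f i θ))
    (hcons : ∀ i k, IsLittleOp μ (err PX N O η (f i) k) fun _ => 1)
    {J : Finset ι} {rem : Finset (ι × ι)}
    (hJ : ∀ i ∈ J, ∀ k, IsLittleOp μ
      (fun n ω => err PX N O η Nuisance.e1 k n ω * err PX N O η (f i) k n ω)
      fun n => (n : ℝ) ^ (-(1 / 2) : ℝ))
    (hrem : ∀ p ∈ rem, ∀ k, IsLittleOp μ
      (fun n ω => err PX N O η (f p.1) k n ω * err PX N O η (f p.2) k n ω)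
      fun n => (n : ℝ) ^ (-(1 / 2) : ℝ))
    {W : Obs 𝒳 → ℝ} (hW : MemLp W 2 Q) (mW : Measurable W)
    {Good : ℝ → Nuisance 𝒳 → Prop} (hGe : ∀ M θ, Good M θ → BoundedPropensity Q M θ)
    (hGood : ∀ k, ∀ δ : ℝ≥0∞, 0 < δ →
      ∃ M, ∀ᶠ n in atTop, μ {ω | ¬ Good M (fit N O n k ω)} ≤ δ)
    (hψ : FitMeasurable N fun θ o => s.score V1 V0 θ o - s.score V1 V0 η o)
    (hbound : ∀ M, ∃ C : ℝ, 0 ≤ C ∧ ∀ θ : Nuisance 𝒳, θ.IsMeasurable → Good M θ →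
      ∀ᵐ o ∂Q, s.Bounds V1 V0 η θ C
        (∑ i, (|W o| * min 1 |gap (f i) η θ o| + |gap (f i) η θ o|))
        (∑ i ∈ J, |gap (f i) η θ o|)
        (∑ p ∈ rem, |gap (f p.1) η θ o| * |gap (f p.2) η θ o|) o) :
    IsLittleOp μ (fun n ω => ‖√(n : ℝ) * crossAvg N O
      (fun θ o => s.score V1 V0 θ o - s.score V1 V0 η o) n ω‖ₑ) fun _ => 1 := by
  have : IsProbabilityMeasure Q := hlaw 0 ▸ Measure.isProbabilityMeasure_map (hO 0).aemeasurable
  set pairs : Finset (ι × ι) := J.image (fun i => (i₀, i)) ∪ rem with hpairs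
  refine isLittleOp_crossAvg_of_bounds hO hindep hlaw hN hQX hη hf hcons (pairs := pairs) ?_ hW mW
    hGood hψ fun M => ?_
  · intro p hp k
    rcases Finset.mem_union.1 hp with h | h
    · obtain ⟨i, hi, rfl⟩ := Finset.mem_image.1 h
      simp only [hi₀]
      exact hJ i hi k
    · exact hrem p h k
  · obtain ⟨C, hC, hb⟩ := hbound M
    set C' := C * (|M| * (2 + 1 / ε) + 1) with hC'
    have hε := S.eps_pos
    have hC'0 : 0 ≤ C' := by positivity
    -- The two groups of pairs may overlap in the union, so each is bounded separately by the full
    -- sum; hence the factor `2`.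
    refine ⟨2 * C', fun θ hθ hM hL2 => ?_⟩
    have mg : ∀ i, Measurable (gap (f i) η θ) := fun i =>
      ((hf i _ hθ).comp Obs.measurable_X).sub ((hf i _ hη).comp Obs.measurable_X)
    have ig : ∀ i, Integrable (fun o => |gap (f i) η θ o|) Q := fun i =>
      ((hL2 i).integrable one_le_two).abs
    have igg : ∀ i j, Integrable (fun o => |gap (f i) η θ o| * |gap (f j) η θ o|) Q := fun i j =>
      (hL2 i).abs.integrable_mul (hL2 j).abs
    have iW : ∀ i, Integrable (fun o => |W o| * min 1 |gap (f i) η θ o|) Q := fun i =>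
      (hW.integrable one_le_two).abs.mul_bdd (c := 1)
        (measurable_const.min (mg i).abs).aestronglyMeasurable (ae_of_all _ fun o => by
          rw [Real.norm_eq_abs, abs_of_nonneg (le_min zero_le_one (abs_nonneg _))]
          exact min_le_left _ _)
    have hWn : ∀ i o, 0 ≤ |W o| * min 1 |gap (f i) η θ o| := fun i o =>
      mul_nonneg (abs_nonneg _) (le_min zero_le_one (abs_nonneg _))
    have he : ∀ o, |gap (f i₀) η θ o| = |θ.e1 o.X - η.e1 o.X| := fun o => by
      rw [gap, hi₀]
    have hb' := hb θ hθ hM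
    have iD : Integrable (fun o => ∑ i ∈ J, |gap (f i₀) η θ o| * |gap (f i) η θ o|) Q :=
      integrable_finsetSum _ fun i _ => igg i₀ i
    have iR : Integrable (fun o => ∑ p ∈ rem, |gap (f p.1) η θ o| * |gap (f p.2) η θ o|) Q :=
      integrable_finsetSum _ fun p _ => igg p.1 p.2
    have h := S.estimate_bounds (measurable_comp_X hθ.e1) (hs.a1 θ hθ) (hs.u1 θ hθ) (hs.a0 θ hθ)
      (hs.u0 θ hθ) (hs.G θ hθ) hC (hGe M θ hM)
      (B := fun o => ∑ i, (|W o| * min 1 |gap (f i) η θ o| + |gap (f i) η θ o|))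
      (D := fun o => ∑ i ∈ J, |gap (f i) η θ o|)
      (R := fun o => ∑ p ∈ rem, |gap (f p.1) η θ o| * |gap (f p.2) η θ o|)
      (integrable_finsetSum _ fun i _ => (iW i).add (ig i))
      (Finset.measurable_sum _ fun i _ => (mg i).abs)
      (by simpa only [Finset.mul_sum, he] using iD) iR
      (fun o => ⟨Finset.sum_nonneg fun i _ => abs_nonneg _,
        (Finset.sum_le_univ_sum_of_nonneg fun i => abs_nonneg _).trans
          (Finset.sum_le_sum fun i _ => by linarith [hWn i o])⟩)
      (hb'.mono fun o ho => ho.weights) (hb'.mono fun o ho => ho.means)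
      (hb'.mono fun o ho => ho.plugin) (hb'.mono fun o ho => ho.remainder)
    refine ⟨h.1.mono fun o ho => ho.trans (mul_le_mul_of_nonneg_right (by linarith)
      (Finset.sum_nonneg fun i _ => add_nonneg (hWn i o) (abs_nonneg _))), h.2.trans ?_⟩
    rw [← hC', mul_comm 2, mul_assoc C' 2]
    refine mul_le_mul_of_nonneg_left ?_ hC'0
    rw [← integral_const_mul]
    have iP : Integrable (fun o => ∑ p ∈ pairs, |gap (f p.1) η θ o| * |gap (f p.2) η θ o|) Q :=
      integrable_finsetSum _ fun p _ => igg p.1 p.2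
    refine integral_mono ((by simpa only [Finset.mul_sum, he] using iD : Integrable (fun o =>
      |θ.e1 o.X - η.e1 o.X| * ∑ i ∈ J, |gap (f i) η θ o|) Q).add iR) (iP.const_mul 2) fun o => ?_
    have h1 : |θ.e1 o.X - η.e1 o.X| * ∑ i ∈ J, |gap (f i) η θ o|
        ≤ ∑ p ∈ pairs, |gap (f p.1) η θ o| * |gap (f p.2) η θ o| := by
      rw [← he, Finset.mul_sum]
      refine le_trans (le_of_eq ?_) (Finset.sum_le_sum_of_subset_of_nonneg
        (Finset.subset_union_left (s₁ := J.image fun i => (i₀, i)) (s₂ := rem))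
        fun p _ _ => mul_nonneg (abs_nonneg _) (abs_nonneg _))
      rw [Finset.sum_image fun a _ b _ hab => (Prod.mk.inj hab).2]
    have h2 : ∑ p ∈ rem, |gap (f p.1) η θ o| * |gap (f p.2) η θ o|
        ≤ ∑ p ∈ pairs, |gap (f p.1) η θ o| * |gap (f p.2) η θ o| :=
      Finset.sum_le_sum_of_subset_of_nonneg Finset.subset_union_right
        fun p _ _ => mul_nonneg (abs_nonneg _) (abs_nonneg _)
    linarith

end ScoreFamilies

/-! ### First- and second-order bounds for the formulas -/

section Calculus

/-- First- and second-order bounds, on a compact convex set, for a function of two variables with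
continuously differentiable partial derivatives. -/
theorem exists_bounds_of_contDiffOn {f a b : ℝ → ℝ → ℝ} {s : Set (ℝ × ℝ)} (hs : IsCompact s)
    (hc : Convex ℝ s) (ha : ContDiffOn ℝ 1 (fun x : ℝ × ℝ => a x.1 x.2) s)
    (hb : ContDiffOn ℝ 1 (fun x : ℝ × ℝ => b x.1 x.2) s)
    (hd : ∀ x ∈ s, ∀ y ∈ s, ∀ t ∈ Set.Icc (0 : ℝ) 1,
      HasDerivWithinAt (fun t => f (x.1 + t * (y.1 - x.1)) (x.2 + t * (y.2 - x.2)))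
        (a (x.1 + t * (y.1 - x.1)) (x.2 + t * (y.2 - x.2)) * (y.1 - x.1)
          + b (x.1 + t * (y.1 - x.1)) (x.2 + t * (y.2 - x.2)) * (y.2 - x.2)) (Set.Icc 0 1) t) :
    ∃ C : ℝ, 0 ≤ C ∧ ∀ p m p' m', (p, m) ∈ s → (p', m') ∈ s →
      |a p m| ≤ C ∧ |b p m| ≤ C ∧ |a p' m' - a p m| ≤ C * (|p' - p| + |m' - m|) ∧
      |b p' m' - b p m| ≤ C * (|p' - p| + |m' - m|) ∧
      |f p' m' - f p m| ≤ C * (|p' - p| + |m' - m|) ∧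
      |f p' m' - f p m - a p m * (p' - p) - b p m * (m' - m)|
        ≤ C * ((p' - p) ^ 2 + (m' - m) ^ 2) := by
  obtain ⟨Ka, hKa⟩ := ha.exists_lipschitzOnWith one_ne_zero hc hs
  obtain ⟨Kb, hKb⟩ := hb.exists_lipschitzOnWith one_ne_zero hc hs
  obtain ⟨Ca, hCa⟩ := hs.exists_bound_of_continuousOn ha.continuousOn
  obtain ⟨Cb, hCb⟩ := hs.exists_bound_of_continuousOn hb.continuousOn
  set K : ℝ := Ka + Kb with hK
  have hK0 : 0 ≤ K := by positivity
  set C : ℝ := |Ca| + |Cb| + 2 * K with hC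
  have hd1 : ∀ x y : ℝ × ℝ, dist y x ≤ |y.1 - x.1| + |y.2 - x.2| := fun x y => by
    rw [Prod.dist_eq, Real.dist_eq, Real.dist_eq]
    exact max_le (by linarith [abs_nonneg (y.2 - x.2)]) (by linarith [abs_nonneg (y.1 - x.1)])
  have la : ∀ x ∈ s, ∀ y ∈ s, |a y.1 y.2 - a x.1 x.2| ≤ K * (|y.1 - x.1| + |y.2 - x.2|) := by
    intro x hx y hy
    have := hKa.dist_le_mul y hy x hx
    rw [Real.dist_eq] at this
    refine this.trans (mul_le_mul (by rw [hK]; linarith [Kb.2]) (hd1 x y) dist_nonneg hK0)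
  have lb : ∀ x ∈ s, ∀ y ∈ s, |b y.1 y.2 - b x.1 x.2| ≤ K * (|y.1 - x.1| + |y.2 - x.2|) := by
    intro x hx y hy
    have := hKb.dist_le_mul y hy x hx
    rw [Real.dist_eq] at this
    refine this.trans (mul_le_mul (by rw [hK]; linarith [Ka.2]) (hd1 x y) dist_nonneg hK0)
  have ba : ∀ x ∈ s, |a x.1 x.2| ≤ |Ca| := fun x hx => (hCa x hx).trans (le_abs_self _)
  have bb : ∀ x ∈ s, |b x.1 x.2| ≤ |Cb| := fun x hx => (hCb x hx).trans (le_abs_self _)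
  have hseg : ∀ x ∈ s, ∀ y ∈ s, ∀ t ∈ Set.Icc (0 : ℝ) 1,
      (x.1 + t * (y.1 - x.1), x.2 + t * (y.2 - x.2)) ∈ s := by
    intro x hx y hy t ht
    have := hc hx hy (by linarith [ht.2] : 0 ≤ 1 - t) ht.1 (by ring)
    convert! this using 1
    ext <;> simp <;> ring
  have hCK : K ≤ C := by rw [hC]; linarith [abs_nonneg Ca, abs_nonneg Cb]
  refine ⟨C, by positivity, fun p m p' m' hx hy => ?_⟩
  have hD : 0 ≤ |p' - p| + |m' - m| := by positivity
  refine ⟨(ba _ hx).trans (by rw [hC]; linarith [abs_nonneg Cb]),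
    (bb _ hx).trans (by rw [hC]; linarith [abs_nonneg Ca]),
    (la _ hx _ hy).trans (mul_le_mul_of_nonneg_right hCK hD),
    (lb _ hx _ hy).trans (mul_le_mul_of_nonneg_right hCK hD), ?_, ?_⟩
  · have := (convex_Icc (0 : ℝ) 1).norm_image_sub_le_of_norm_hasDerivWithin_le
      (C := C * (|p' - p| + |m' - m|)) (hd _ hx _ hy) (fun t ht => ?_)
      (Set.left_mem_Icc.2 zero_le_one) (Set.right_mem_Icc.2 zero_le_one)
    · simpa using this
    · have h1 := ba _ (hseg _ hx _ hy t ht)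
      have h2 := bb _ (hseg _ hx _ hy t ht)
      simp only at h1 h2 ⊢
      rw [Real.norm_eq_abs]
      refine (abs_add_le _ _).trans ?_
      rw [abs_mul, abs_mul, mul_add]
      refine add_le_add (mul_le_mul_of_nonneg_right (h1.trans ?_) (abs_nonneg _))
        (mul_le_mul_of_nonneg_right (h2.trans ?_) (abs_nonneg _)) <;> rw [hC] <;>
        linarith [abs_nonneg Ca, abs_nonneg Cb]
  -- Along the segment, `f` minus its linearization at the starting point has derivative at most `K
  -- (|p' - p| + |m' - m|)²`, by the Lipschitz bounds on `a` and `b`; the mean value inequality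
  -- turns this into the second-order bound.
  · have hd' : ∀ t ∈ Set.Icc (0 : ℝ) 1,
        HasDerivWithinAt (fun t => f (p + t * (p' - p)) (m + t * (m' - m))
          - t * (a p m * (p' - p) + b p m * (m' - m)))
        (a (p + t * (p' - p)) (m + t * (m' - m)) * (p' - p)
          + b (p + t * (p' - p)) (m + t * (m' - m)) * (m' - m)
          - 1 * (a p m * (p' - p) + b p m * (m' - m))) (Set.Icc 0 1) t := fun t ht =>
      (hd _ hx _ hy t ht).sub ((hasDerivWithinAt_id t _).mul_const _)
    have := (convex_Icc (0 : ℝ) 1).norm_image_sub_le_of_norm_hasDerivWithin_le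
      (C := K * (|p' - p| + |m' - m|) ^ 2) hd' (fun t ht => ?_)
      (Set.left_mem_Icc.2 zero_le_one) (Set.right_mem_Icc.2 zero_le_one)
    · simp only [one_mul, zero_mul, add_zero, sub_zero, add_sub_cancel, norm_one, mul_one,
        Real.norm_eq_abs] at this
      have h2 : K * (|p' - p| + |m' - m|) ^ 2 ≤ C * ((p' - p) ^ 2 + (m' - m) ^ 2) := by
        have h3 : (|p' - p| + |m' - m|) ^ 2 ≤ 2 * ((p' - p) ^ 2 + (m' - m) ^ 2) := by
          rw [← sq_abs (p' - p), ← sq_abs (m' - m)]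
          nlinarith [sq_nonneg (|p' - p| - |m' - m|)]
        calc _ ≤ K * (2 * ((p' - p) ^ 2 + (m' - m) ^ 2)) := mul_le_mul_of_nonneg_left h3 hK0
          _ = (2 * K) * ((p' - p) ^ 2 + (m' - m) ^ 2) := by ring
          _ ≤ _ := by
            refine mul_le_mul_of_nonneg_right ?_ (by positivity)
            rw [hC]; linarith [abs_nonneg Ca, abs_nonneg Cb]
      refine le_trans (le_of_eq ?_) (this.trans h2)
      congr 1; ring
    · have h1 := la _ hx _ (hseg _ hx _ hy t ht)
      have h2 := lb _ hx _ (hseg _ hx _ hy t ht)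
      simp only [add_sub_cancel_left, abs_mul] at h1 h2 ⊢
      have ht1 : |t| ≤ 1 := abs_le.2 ⟨by linarith [ht.1], ht.2⟩
      have ht2 : |t| * |p' - p| + |t| * |m' - m| ≤ |p' - p| + |m' - m| := by
        rw [← mul_add]; exact mul_le_of_le_one_left hD ht1
      replace h1 := h1.trans (mul_le_mul_of_nonneg_left ht2 hK0)
      replace h2 := h2.trans (mul_le_mul_of_nonneg_left ht2 hK0)
      rw [Real.norm_eq_abs]
      have e1 : a (p + t * (p' - p)) (m + t * (m' - m)) * (p' - p)
          + b (p + t * (p' - p)) (m + t * (m' - m)) * (m' - m)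
          - 1 * (a p m * (p' - p) + b p m * (m' - m))
          = (a (p + t * (p' - p)) (m + t * (m' - m)) - a p m) * (p' - p)
          + (b (p + t * (p' - p)) (m + t * (m' - m)) - b p m) * (m' - m) := by ring
      rw [e1]
      refine (abs_add_le _ _).trans ?_
      rw [abs_mul, abs_mul]
      calc _ ≤ K * (|p' - p| + |m' - m|) * |p' - p| + K * (|p' - p| + |m' - m|) * |m' - m| := by
            gcongr
        _ = _ := by ring

/-- The one-variable case on the unit interval. -/
theorem exists_bounds_of_hasDerivAt {k k' : ℝ → ℝ} (hk' : ContDiffOn ℝ 1 k' (Set.Icc 0 1))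
    (hd : ∀ x ∈ Set.Icc (0 : ℝ) 1, HasDerivAt k (k' x) x) :
    ∃ C : ℝ, 0 ≤ C ∧ ∀ p ∈ Set.Icc (0 : ℝ) 1, ∀ q ∈ Set.Icc (0 : ℝ) 1,
      |k p| ≤ C ∧ |k' p| ≤ C ∧ |k' q - k' p| ≤ C * |q - p| ∧ |k q - k p| ≤ C * |q - p| ∧
      |k q - k p - k' p * (q - p)| ≤ C * (q - p) ^ 2 := by
  -- The second variable is a dummy confined to `{0}`.
  have hd' : ∀ x ∈ Set.Icc (0 : ℝ) 1 ×ˢ ({0} : Set ℝ), ∀ y ∈ Set.Icc (0 : ℝ) 1 ×ˢ ({0} : Set ℝ),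
      ∀ t ∈ Set.Icc (0 : ℝ) 1, HasDerivWithinAt (fun t => k (x.1 + t * (y.1 - x.1)))
        (k' (x.1 + t * (y.1 - x.1)) * (y.1 - x.1) + 0 * (y.2 - x.2)) (Set.Icc 0 1) t := by
    intro x hx y hy t ht
    have hm : x.1 + t * (y.1 - x.1) ∈ Set.Icc (0 : ℝ) 1 := by
      have := (convex_Icc (0 : ℝ) 1) hx.1 hy.1 (by linarith [ht.2] : 0 ≤ 1 - t) ht.1 (by ring)
      convert! this using 1; simp; ring
    have h1 := (hd _ hm).comp t (((hasDerivAt_id t).mul_const (y.1 - x.1)).const_add x.1)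
    refine (h1.congr_deriv ?_).hasDerivWithinAt
    simp
  obtain ⟨C, hC, h⟩ := exists_bounds_of_contDiffOn (f := fun x _ => k x) (a := fun x _ => k' x)
    (b := fun _ _ => 0) (s := Set.Icc (0 : ℝ) 1 ×ˢ {0}) (isCompact_Icc.prod isCompact_singleton)
    ((convex_Icc 0 1).prod (convex_singleton 0))
    (hk'.comp contDiff_fst.contDiffOn fun x hx => hx.1) contDiffOn_const hd'
  -- The two-variable lemma bounds increments of the function but not its size, which is supplied
  -- here by compactness.
  · obtain ⟨C₀, hC₀⟩ := isCompact_Icc.exists_bound_of_continuousOn (f := k)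
      fun x hx => (hd x hx).continuousAt.continuousWithinAt
    refine ⟨C + |C₀|, by positivity, fun p hp q hq => ?_⟩
    obtain ⟨h1, -, h3, -, h5, h6⟩ := h p 0 q 0 ⟨hp, rfl⟩ ⟨hq, rfl⟩
    simp only [sub_self, abs_zero, add_zero, mul_zero, sub_zero, ne_eq, OfNat.ofNat_ne_zero,
      not_false_eq_true, zero_pow] at h3 h5 h6
    have h0 := hC₀ p hp
    rw [Real.norm_eq_abs] at h0
    have hC₀' := abs_nonneg C₀
    refine ⟨by linarith [le_abs_self C₀], by linarith, h3.trans ?_, h5.trans ?_, h6.trans ?_⟩ <;>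
    exact mul_le_mul_of_nonneg_right (by linarith) (by positivity)

end Calculus

/-! ### Derivatives for the mean ratio. -/

section MeanRatio

variable {r p : ℝ}

theorem mr_denom_pos (hr : 0 < r) (hp : p ∈ Set.Icc (0 : ℝ) 1) : 0 < (r - 1) * p + 1 := by
  nlinarith [hp.1, hp.2, mul_nonneg hr.le hp.1]

/-- In this form `mrEpsPi` is visibly the derivative in `p` of `p · γ_c · m`, with `p γ_c = r p /
((r - 1) p + 1)`. -/
theorem mrEpsPi_eq (hr : 0 < r) (hp : p ∈ Set.Icc (0 : ℝ) 1) (m : ℝ) :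
    mrEpsPi r p m = r / ((r - 1) * p + 1) ^ 2 * m := by
  have h := (mr_denom_pos hr hp).ne'
  have h2 : (1 / r - 1) * (1 - p) + 1 = ((r - 1) * p + 1) / r := by field_simp; ring
  unfold mrEpsPi mrGamma
  rw [h2]
  field_simp

theorem exists_mr_bounds (hr : 0 < r) :
    ∃ C : ℝ, 0 ≤ C ∧ ∀ p ∈ Set.Icc (0 : ℝ) 1, ∀ q ∈ Set.Icc (0 : ℝ) 1,
      |mrEpsMu r p| ≤ C ∧ |r / ((r - 1) * p + 1) ^ 2| ≤ C ∧
      |r / ((r - 1) * q + 1) ^ 2 - r / ((r - 1) * p + 1) ^ 2| ≤ C * |q - p| ∧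
      |mrEpsMu r q - mrEpsMu r p| ≤ C * |q - p| ∧
      |mrEpsMu r q - mrEpsMu r p - r / ((r - 1) * p + 1) ^ 2 * (q - p)| ≤ C * (q - p) ^ 2 := by
  refine exists_bounds_of_hasDerivAt (k := mrEpsMu r) (k' := fun p => r / ((r - 1) * p + 1) ^ 2)
    ?_ fun x hx => ?_
  · intro x hx
    have h := (mr_denom_pos hr hx).ne'
    exact ContDiffAt.contDiffWithinAt (ContDiffAt.div (by fun_prop) (by fun_prop) (pow_ne_zero 2 h))
  · have h := (mr_denom_pos hr hx).ne'
    unfold mrEpsMu mrGamma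
    have h1 : HasDerivAt (fun p => (r - 1) * p + 1) ((r - 1) * 1) x :=
      ((hasDerivAt_id x).const_mul (r - 1)).add_const 1
    refine (((hasDerivAt_const x r).div h1 h).mul (hasDerivAt_id x)).congr_deriv ?_
    simp only [id, Pi.div_apply]
    field_simp
    ring

end MeanRatio

/-! ### Derivatives for the standardized mean difference. -/

section Theta

/-- `ϑ = thetaK · σ₀`. -/
def thetaK (κ q : ℝ) : ℝ := q * (1 - q) / √(1 + κ ^ 2 * (q * (1 - q)))

/-- The derivative of `thetaK`. -/
def thetaK' (κ q : ℝ) : ℝ :=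
  (1 - 2 * q) * (2 + κ ^ 2 * (q * (1 - q))) / (2 * (1 + κ ^ 2 * (q * (1 - q))) ^ (3 / 2 : ℝ))

theorem theta_eq (κ q s : ℝ) : theta κ q s = thetaK κ q * √s := by
  unfold theta thetaK; ring

theorem thetaDotSigma_eq (κ q s : ℝ) : thetaDotSigma κ q s = thetaK κ q * (1 / (2 * √s)) := by
  unfold thetaDotSigma thetaK
  rw [div_mul_div_comm, mul_one, mul_comm (√(1 + κ ^ 2 * (q * (1 - q))))]

theorem thetaDotPi_eq (κ q s : ℝ) : thetaDotPi κ q s = thetaK' κ q * √s := by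
  unfold thetaDotPi thetaK'; ring

theorem theta_denom_pos (κ : ℝ) {q : ℝ} (hq : q ∈ Set.Icc (0 : ℝ) 1) :
    0 < 1 + κ ^ 2 * (q * (1 - q)) := by
  have : 0 ≤ κ ^ 2 * (q * (1 - q)) := mul_nonneg (sq_nonneg _) (mul_nonneg hq.1 (by linarith [hq.2]))
  linarith

theorem exists_theta_bounds (κ : ℝ) :
    ∃ C : ℝ, 0 ≤ C ∧ ∀ p ∈ Set.Icc (0 : ℝ) 1, ∀ q ∈ Set.Icc (0 : ℝ) 1,
      |thetaK κ p| ≤ C ∧ |thetaK' κ p| ≤ C ∧ |thetaK' κ q - thetaK' κ p| ≤ C * |q - p| ∧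
      |thetaK κ q - thetaK κ p| ≤ C * |q - p| ∧
      |thetaK κ q - thetaK κ p - thetaK' κ p * (q - p)| ≤ C * (q - p) ^ 2 := by
  refine exists_bounds_of_hasDerivAt (fun x hx => ?_) fun x hx => ?_
  · have h := theta_denom_pos κ hx
    unfold thetaK'
    refine ContDiffAt.contDiffWithinAt (ContDiffAt.div (by fun_prop) ?_ (by positivity))
    exact contDiffAt_const.mul (ContDiffAt.rpow_const_of_ne (by fun_prop) h.ne')
  · have h := theta_denom_pos κ hx
    set D := 1 + κ ^ 2 * (x * (1 - x)) with hD
    have hs : 0 < √D := Real.sqrt_pos.2 h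
    have hss : √D ^ 2 = D := Real.sq_sqrt h.le
    have h1 : HasDerivAt (fun q : ℝ => q * (1 - q)) (1 * (1 - x) + x * (0 - 1)) x :=
      (hasDerivAt_id x).mul ((hasDerivAt_const x 1).sub (hasDerivAt_id x))
    have h2 : HasDerivAt (fun q : ℝ => √(1 + κ ^ 2 * (q * (1 - q)))) _ x :=
      ((h1.const_mul (κ ^ 2)).const_add 1).sqrt h.ne'
    have h3 : D ^ (3 / 2 : ℝ) = D * √D := by
      rw [Real.sqrt_eq_rpow, show (3 / 2 : ℝ) = 1 + 1 / 2 by norm_num, Real.rpow_add h, Real.rpow_one]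
    refine (h1.div h2 hs.ne').congr_deriv ?_
    unfold thetaK'
    rw [← hD, h3]
    field_simp
    rw [hss, hD]
    ring

/-- `ϑ` is symmetric under exchanging the strata, and its derivative in the principal score
antisymmetric. So `φ_ϑ`, defined with `π₁`, can be handled with `π_c` for either stratum. -/
theorem thetaK_symm (κ q : ℝ) : thetaK κ (1 - q) = thetaK κ q := by
  unfold thetaK; ring_nf

theorem thetaK'_symm (κ q : ℝ) : thetaK' κ (1 - q) = - thetaK' κ q := by
  unfold thetaK'
  rw [show (1 - q) * (1 - (1 - q)) = q * (1 - q) by ring]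
  ring

/-- The exact Taylor remainder of the square root, obtained from `s' - s = (√s' - √s)(√s + √s')`. -/
theorem sqrt_sub_eq {s s' : ℝ} (hs : 0 < s) (hs' : 0 ≤ s') :
    √s' - √s - 1 / (2 * √s) * (s' - s) = - (s' - s) ^ 2 / (2 * √s * (√s + √s') ^ 2) := by
  have h1 : 0 < √s := Real.sqrt_pos.2 hs
  have h2 := Real.sqrt_nonneg s'
  have e1 : s = √s ^ 2 := (Real.sq_sqrt hs.le).symm
  have e2 : s' = √s' ^ 2 := (Real.sq_sqrt hs').symm
  have h3 : √s + √s' ≠ 0 := by positivity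
  have e3 : s' - s = (√s' - √s) * (√s + √s') := by
    conv_lhs => rw [e1, e2]
    ring
  rw [e3]
  field_simp
  ring

theorem abs_sqrt_sub_le {s s' c : ℝ} (hc : 0 < c) (hs : c ≤ s) (hs' : 0 ≤ s') :
    |√s' - √s| ≤ 1 / √c * |s' - s| := by
  have h0 : 0 < √c := Real.sqrt_pos.2 hc
  have h1 : √c ≤ √s := Real.sqrt_le_sqrt hs
  have h2 := Real.sqrt_nonneg s'
  have e1 : s = √s ^ 2 := (Real.sq_sqrt (hc.le.trans hs)).symm
  have e2 : s' = √s' ^ 2 := (Real.sq_sqrt hs').symm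
  have e3 : s' - s = (√s' - √s) * (√s + √s') := by
    conv_lhs => rw [e1, e2]
    ring
  rw [e3, abs_mul, abs_of_pos (by linarith : 0 < √s + √s'), one_div, ← div_eq_inv_mul,
    le_div_iff₀ h0]
  exact mul_le_mul_of_nonneg_left (by linarith) (abs_nonneg _)

/-- Only the base point `s` must stay away from zero. This matters along the path, where the tilted
variance is merely known to be nonnegative. -/
theorem abs_sqrt_remainder_le {s s' c : ℝ} (hc : 0 < c) (hs : c ≤ s) (hs' : 0 ≤ s') :
    |√s' - √s - 1 / (2 * √s) * (s' - s)| ≤ 1 / (2 * √c * c) * (s' - s) ^ 2 := by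
  have h0 : 0 < √c := Real.sqrt_pos.2 hc
  have h1 : √c ≤ √s := Real.sqrt_le_sqrt hs
  have h2 := Real.sqrt_nonneg s'
  have h3 : 0 < √s := h0.trans_le h1
  rw [sqrt_sub_eq (hc.trans_le hs) hs', abs_div, abs_neg, abs_of_nonneg (sq_nonneg _),
    abs_of_pos (by positivity : 0 < 2 * √s * (√s + √s') ^ 2), div_eq_mul_one_div, mul_comm]
  refine mul_le_mul_of_nonneg_right (one_div_le_one_div_of_le (by positivity) ?_) (sq_nonneg _)
  refine mul_le_mul (by linarith) ?_ hc.le (by positivity)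
  calc c = √c ^ 2 := (Real.sq_sqrt hc.le).symm
    _ ≤ _ := by gcongr; linarith

/-- The Lipschitz bound and the uniform bound together give a multiple of `min 1 |s' - s|`, the form
needed beside an unbounded residual. -/
theorem abs_inv_sqrt_sub_le {s s' c : ℝ} (hc : 0 < c) (hs : c ≤ s) (hs' : c ≤ s') :
    |1 / (2 * √s') - 1 / (2 * √s)| ≤ 1 / (√c * c) * |s' - s| ∧
      |1 / (2 * √s') - 1 / (2 * √s)| ≤ 1 / √c := by
  have h0 : 0 < √c := Real.sqrt_pos.2 hc
  have h1 : √c ≤ √s := Real.sqrt_le_sqrt hs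
  have h1' : √c ≤ √s' := Real.sqrt_le_sqrt hs'
  have hsc : √c * √c = c := Real.mul_self_sqrt hc.le
  constructor
  · have e1 : 1 / (2 * √s') - 1 / (2 * √s) = - (√s' - √s) / (2 * (√s * √s')) := by
      have : √s ≠ 0 := by linarith
      have : √s' ≠ 0 := by linarith
      field_simp; ring
    have hcc : c ≤ √s * √s' := by rw [← hsc]; exact mul_le_mul h1 h1' h0.le (h0.le.trans h1)
    rw [e1, abs_div, abs_neg, abs_of_pos (by linarith : 0 < 2 * (√s * √s')),
      div_le_iff₀ (by linarith)]
    have := abs_sqrt_sub_le hc hs (hc.le.trans hs')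
    have h4 : 1 / (√c * c) * |s' - s| * (2 * (√s * √s')) ≥ 1 / (√c * c) * |s' - s| * c := by
      gcongr; linarith
    have h5 : 1 / (√c * c) * |s' - s| * c = 1 / √c * |s' - s| := by field_simp
    linarith
  · have b1 : 1 / (2 * √s') ≤ 1 / √c := one_div_le_one_div_of_le h0 (by linarith)
    have b2 : 1 / (2 * √s) ≤ 1 / √c := one_div_le_one_div_of_le h0 (by linarith)
    have b3 : 0 ≤ 1 / (2 * √s') := by positivity
    have b4 : 0 ≤ 1 / (2 * √s) := by positivity
    rw [abs_le]
    constructor <;> linarith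

end Theta

/-! ### Derivatives for the generalized odds ratio. -/

section GeneralizedOddsRatio

/-- For `r ≥ 1` the discriminant equals `1 + 2 (r - 1)(p + w - 2 p w) + (r - 1)² (p - w)²`, a sum of
`1` and nonnegative terms. The bound keeps the square root away from its singularity on the whole
closed unit square, so the smoothness of the mean extends to the boundary. -/
theorem gor_disc_ge {r p w : ℝ} (hr : 0 < r) (hp : p ∈ Set.Icc (0 : ℝ) 1)
    (hw : w ∈ Set.Icc (0 : ℝ) 1) :
    min 1 r ^ 2 ≤ ((p + w) * (r - 1) + 1) ^ 2 - 4 * p * w * r * (r - 1) := by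
  have hs : 0 ≤ p + w - 2 * p * w := by
    nlinarith [mul_nonneg hp.1 (by linarith [hw.2] : 0 ≤ 1 - w),
      mul_nonneg hw.1 (by linarith [hp.2] : 0 ≤ 1 - p)]
  rcases le_total 1 r with h | h
  · rw [min_eq_left h]
    nlinarith [mul_nonneg (by linarith : 0 ≤ r - 1) hs, sq_nonneg ((r - 1) * (p - w))]
  · rw [min_eq_right h]
    have h1 : 0 ≤ 1 - (p - w) ^ 2 := by nlinarith [hp.1, hp.2, hw.1, hw.2]
    -- For `r ≤ 1` the excess over `r²` factors with nonnegative factors, because `|p - w| ≤ 1`.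
    have e : ((p + w) * (r - 1) + 1) ^ 2 - 4 * p * w * r * (r - 1) - r ^ 2
        = (1 - r) * ((1 - p - w) ^ 2 + r * (1 - (p - w) ^ 2)) := by ring
    have : 0 ≤ (1 - r) * ((1 - p - w) ^ 2 + r * (1 - (p - w) ^ 2)) :=
      mul_nonneg (by linarith) (add_nonneg (sq_nonneg _) (mul_nonneg hr.le h1))
    linarith

variable {r l h : ℝ}

theorem gor_scaled_mem (hlh : l < h) {m : ℝ} (hm : m ∈ Set.Icc l h) :
    (m - l) / (h - l) ∈ Set.Icc (0 : ℝ) 1 := by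
  have : 0 < h - l := by linarith
  exact ⟨div_nonneg (by linarith [hm.1]) this.le, (div_le_one this).2 (by linarith [hm.2])⟩

theorem gor_disc_pos (hr : 0 < r) (hlh : l < h) {p m : ℝ} (hp : p ∈ Set.Icc (0 : ℝ) 1)
    (hm : m ∈ Set.Icc l h) :
    0 < gorAlpha r l h p m ^ 2 - 4 * p * ((m - l) / (h - l)) * r * (r - 1) :=
  lt_of_lt_of_le (pow_pos (lt_min one_pos hr) 2) (gor_disc_ge hr hp (gor_scaled_mem hlh hm))

/-- Multiplication by `p` removes the division by `p`. At `p = 0` the left side is `0`, and so is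
the right one, because `α ≥ 0` and `β = √(α²) = α` there. -/
theorem mul_gorMean_eq (hr : 0 < r) (hr1 : r ≠ 1) (hlh : l < h) {p m : ℝ} (hm : m ∈ Set.Icc l h) :
    p * gorMean r l h p m = (gorAlpha r l h p m - gorBeta r l h p m) / (2 * (r - 1)) * (h - l)
      + p * l := by
  rw [gorMean, if_neg hr1]
  have hr1' : r - 1 ≠ 0 := sub_ne_zero.2 hr1
  rcases eq_or_ne p 0 with rfl | hp
  · have hw := gor_scaled_mem hlh hm
    have : 0 ≤ gorAlpha r l h 0 m := by
      unfold gorAlpha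
      nlinarith [hw.1, hw.2, mul_nonneg hw.1 hr.le]
    simp [gorBeta, Real.sqrt_sq this]
  · field_simp

/-- `gorEpsPi` and `gorEpsMu` are the partial derivatives of `p · gorMean`; they are continuously
differentiable on the compact rectangle because the discriminant is bounded below there. The case `r
= 1` is the bilinear function `p m`. -/
theorem exists_gor_bounds (hr : 0 < r) (hlh : l < h) :
    ∃ C : ℝ, 0 ≤ C ∧ ∀ p m p' m', (p, m) ∈ Set.Icc (0 : ℝ) 1 ×ˢ Set.Icc l h →
      (p', m') ∈ Set.Icc (0 : ℝ) 1 ×ˢ Set.Icc l h →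
      |gorEpsPi r l h p m| ≤ C ∧ |gorEpsMu r l h p m| ≤ C ∧
      |gorEpsPi r l h p' m' - gorEpsPi r l h p m| ≤ C * (|p' - p| + |m' - m|) ∧
      |gorEpsMu r l h p' m' - gorEpsMu r l h p m| ≤ C * (|p' - p| + |m' - m|) ∧
      |p' * gorMean r l h p' m' - p * gorMean r l h p m| ≤ C * (|p' - p| + |m' - m|) ∧
      |p' * gorMean r l h p' m' - p * gorMean r l h p m - gorEpsPi r l h p m * (p' - p)
        - gorEpsMu r l h p m * (m' - m)| ≤ C * ((p' - p) ^ 2 + (m' - m) ^ 2) := by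
  have hlh' : h - l ≠ 0 := by linarith
  have hconv : Convex ℝ (Set.Icc (0 : ℝ) 1 ×ˢ Set.Icc l h) := (convex_Icc _ _).prod (convex_Icc _ _)
  refine exists_bounds_of_contDiffOn (f := fun p m => p * gorMean r l h p m)
    (isCompact_Icc.prod isCompact_Icc) hconv ?_ ?_ ?_
  · by_cases hr1 : r = 1
    · simp only [gorEpsPi, if_pos hr1]; fun_prop
    · simp only [gorEpsPi, if_neg hr1]
      intro x hx
      have hB := gor_disc_pos hr hlh hx.1 hx.2
      have hβ : gorBeta r l h x.1 x.2 ≠ 0 := (Real.sqrt_pos.2 hB).ne'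
      have cα : ContDiffAt ℝ 1 (fun x : ℝ × ℝ => gorAlpha r l h x.1 x.2) x := by
        unfold gorAlpha; fun_prop
      have cβ : ContDiffAt ℝ 1 (fun x : ℝ × ℝ => gorBeta r l h x.1 x.2) x := by
        unfold gorBeta
        exact ContDiffAt.sqrt (by fun_prop) hB.ne'
      refine ContDiffAt.contDiffWithinAt ?_
      refine ContDiffAt.add (ContDiffAt.mul (ContDiffAt.add (ContDiffAt.sub contDiffAt_const
        (cα.div (contDiffAt_const.mul cβ) (by positivity))) (ContDiffAt.div (by fun_prop) cβ hβ))
        contDiffAt_const) contDiffAt_const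
  · by_cases hr1 : r = 1
    · simp only [gorEpsMu, if_pos hr1]; fun_prop
    · simp only [gorEpsMu, if_neg hr1]
      intro x hx
      have hB := gor_disc_pos hr hlh hx.1 hx.2
      have hβ : gorBeta r l h x.1 x.2 ≠ 0 := (Real.sqrt_pos.2 hB).ne'
      have cα : ContDiffAt ℝ 1 (fun x : ℝ × ℝ => gorAlpha r l h x.1 x.2) x := by
        unfold gorAlpha; fun_prop
      have cβ : ContDiffAt ℝ 1 (fun x : ℝ × ℝ => gorBeta r l h x.1 x.2) x := by
        unfold gorBeta
        exact ContDiffAt.sqrt (by fun_prop) hB.ne'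
      refine ContDiffAt.contDiffWithinAt ?_
      exact ContDiffAt.add (ContDiffAt.sub contDiffAt_const
        (cα.div (contDiffAt_const.mul cβ) (by positivity))) (ContDiffAt.div (by fun_prop) cβ hβ)
  · intro x hx y hy
    have hseg : ∀ t ∈ Set.Icc (0 : ℝ) 1,
        (x.1 + t * (y.1 - x.1), x.2 + t * (y.2 - x.2)) ∈ Set.Icc (0 : ℝ) 1 ×ˢ Set.Icc l h := by
      intro t ht
      have := hconv hx hy (by linarith [ht.2] : 0 ≤ 1 - t) ht.1 (by ring)
      convert! this using 1
      ext <;> simp <;> ring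
    intro t ht
    have hm := hseg t ht
    have d1 : HasDerivAt (fun t => x.1 + t * (y.1 - x.1)) (y.1 - x.1) t := by
      simpa using ((hasDerivAt_id t).mul_const (y.1 - x.1)).const_add x.1
    have d2 : HasDerivAt (fun t => x.2 + t * (y.2 - x.2)) (y.2 - x.2) t := by
      simpa using ((hasDerivAt_id t).mul_const (y.2 - x.2)).const_add x.2
    by_cases hr1 : r = 1
    · simp only [gorMean, gorEpsPi, gorEpsMu, if_pos hr1]
      refine ((d1.mul d2).congr_deriv ?_).hasDerivWithinAt
      ring
    · have hr1' : r - 1 ≠ 0 := sub_ne_zero.2 hr1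
      set P := x.1 + t * (y.1 - x.1) with hP
      set w := x.2 + t * (y.2 - x.2) with hw
      have hB := gor_disc_pos hr hlh hm.1 hm.2
      have hβ : gorBeta r l h P w ≠ 0 := (Real.sqrt_pos.2 hB).ne'
      have d3 : HasDerivAt (fun t => (x.2 + t * (y.2 - x.2) - l) / (h - l))
          ((y.2 - x.2) / (h - l)) t := (d2.sub_const l).div_const _
      have dα : HasDerivAt (fun t => gorAlpha r l h (x.1 + t * (y.1 - x.1)) (x.2 + t * (y.2 - x.2)))
          ((y.1 - x.1 + (y.2 - x.2) / (h - l)) * (r - 1)) t :=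
        ((d1.add d3).mul_const (r - 1)).add_const 1
      have dβ : HasDerivAt (fun t => gorBeta r l h (x.1 + t * (y.1 - x.1)) (x.2 + t * (y.2 - x.2)))
          _ t :=
        ((dα.pow 2).sub ((((d1.const_mul 4).mul d3).mul_const r).mul_const (r - 1))).sqrt hB.ne'
      have dT := (((dα.sub dβ).div_const (2 * (r - 1))).mul_const (h - l)).add (d1.mul_const l)
      -- The formula free of division by `p` is justified only for points of the rectangle, so the
      -- functions are compared along the segment, and the derivative is taken within `[0, 1]`.
      refine HasDerivWithinAt.congr_of_mem (f := fun t =>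
        (gorAlpha r l h (x.1 + t * (y.1 - x.1)) (x.2 + t * (y.2 - x.2))
          - gorBeta r l h (x.1 + t * (y.1 - x.1)) (x.2 + t * (y.2 - x.2))) / (2 * (r - 1)) * (h - l)
          + (x.1 + t * (y.1 - x.1)) * l) ?_ (fun u hu => ?_) ht
      · refine (dT.congr_deriv ?_).hasDerivWithinAt
        rw [gorEpsPi, gorEpsMu, if_neg hr1, if_neg hr1]
        change (((y.1 - x.1 + (y.2 - x.2) / (h - l)) * (r - 1) - _ / (2 * gorBeta r l h P w))
          / (2 * (r - 1)) * (h - l) + (y.1 - x.1) * l) = _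
        simp only [← hP, ← hw]
        field_simp
        ring
      · exact mul_gorMean_eq hr hr1 hlh (hseg u hu).2

end GeneralizedOddsRatio

/-! ### The scores of the sensitivity analyses -/

section Families
variable {𝒳 : Type*}

/-- The family for a functional `E[f(π_c(X), w(X))]`, with `a` and `b` the partial derivatives of
`f`. -/
def bivFamily (c : Bool) (w : Nuisance 𝒳 → 𝒳 → ℝ) (a b f : ℝ → ℝ → ℝ) : ScoreFamily 𝒳 where
  a1 θ o := a (θ.pi c o.X) (w θ o.X)
  u1 θ o := θ.pi c o.X
  a0 θ o := b (θ.pi c o.X) (w θ o.X)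
  u0 θ o := w θ o.X
  G θ o := f (θ.pi c o.X) (w θ o.X)

/-- The family for `ν_{1c}`. -/
def nu1Family (c : Bool) : ScoreFamily 𝒳 where
  a1 _ _ := 1
  u1 θ o := θ.pi c o.X * θ.mu1 o.X
  a0 _ _ := 0
  u0 _ _ := 0
  G θ o := θ.pi c o.X * θ.mu1 o.X

theorem phiPi_eq (c : Bool) (V0 : Obs 𝒳 → ℝ) (θ : Nuisance 𝒳) (o : Obs 𝒳) :
    phiPi c θ o = (bivFamily c (fun _ _ => 0) (fun _ _ => 1) (fun _ _ => 0) fun p _ => p).score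
      (Obs.ind c) V0 θ o := by
  simp only [phiPi, ScoreFamily.score, drScore, bivFamily]; ring

theorem phiNu1_eq (c : Bool) (V0 : Obs 𝒳 → ℝ) (θ : Nuisance 𝒳) (o : Obs 𝒳) :
    phiNu1 c θ o = (nu1Family c).score (fun o => o.ind c * o.Y) V0 θ o := by
  simp only [phiNu1, ScoreFamily.score, drScore, nu1Family]; ring

theorem phiNu0GOR_eq (c : Bool) (ρ l h : ℝ) (θ : Nuisance 𝒳) (o : Obs 𝒳) :
    phiNu0GOR c ρ l h θ o = (bivFamily c Nuisance.mu0 (gorEpsPi (rhoC c ρ) l h)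
      (gorEpsMu (rhoC c ρ) l h) fun p m => p * gorMean (rhoC c ρ) l h p m).score
      (Obs.ind c) Obs.Y θ o := by
  simp only [phiNu0GOR, ScoreFamily.score, drScore, bivFamily, Nuisance.e0]; ring

theorem phiNu0MR_eq (c : Bool) (ρ : ℝ) (θ : Nuisance 𝒳) (o : Obs 𝒳) :
    phiNu0MR c ρ θ o = (bivFamily c Nuisance.mu0 (mrEpsPi (rhoC c ρ))
      (fun p _ => mrEpsMu (rhoC c ρ) p) fun p m => p * mrMean (rhoC c ρ) p m).score
      (Obs.ind c) Obs.Y θ o := by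
  simp only [phiNu0MR, ScoreFamily.score, drScore, bivFamily, Nuisance.e0]; ring

variable [MeasurableSpace 𝒳]

theorem bivFamily_isMeasurable (c : Bool) {w : Nuisance 𝒳 → 𝒳 → ℝ} {a b f : ℝ → ℝ → ℝ}
    (hw : ∀ θ : Nuisance 𝒳, θ.IsMeasurable → Measurable (w θ))
    (ha : Measurable fun x : ℝ × ℝ => a x.1 x.2) (hb : Measurable fun x : ℝ × ℝ => b x.1 x.2)
    (hf : Measurable fun x : ℝ × ℝ => f x.1 x.2) : (bivFamily c w a b f).IsMeasurable where
  a1 θ hθ := measurable_comp_X (f := fun x => a (θ.pi c x) (w θ x))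
    (ha.comp ((hθ.pi c).prodMk (hw θ hθ)))
  u1 _ hθ := measurable_comp_X (hθ.pi c)
  a0 θ hθ := measurable_comp_X (f := fun x => b (θ.pi c x) (w θ x))
    (hb.comp ((hθ.pi c).prodMk (hw θ hθ)))
  u0 θ hθ := measurable_comp_X (hw θ hθ)
  G θ hθ := measurable_comp_X (f := fun x => f (θ.pi c x) (w θ x))
    (hf.comp ((hθ.pi c).prodMk (hw θ hθ)))

theorem nu1Family_isMeasurable (c : Bool) : (nu1Family (𝒳 := 𝒳) c).IsMeasurable where
  a1 _ _ := measurable_const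
  u1 θ hθ := measurable_comp_X (f := fun x => θ.pi c x * θ.mu1 x) ((hθ.pi c).mul hθ.mu1)
  a0 _ _ := measurable_const
  u0 _ _ := measurable_const
  G θ hθ := measurable_comp_X (f := fun x => θ.pi c x * θ.mu1 x) ((hθ.pi c).mul hθ.mu1)

namespace IsObsNuisance
variable {Q : Measure (Obs 𝒳)} {c : Bool} {ε : ℝ} {η : Nuisance 𝒳}

theorem isMeasurable (H : IsObsNuisance Q c ε η) : η.IsMeasurable :=
  ⟨H.measurable_e1, H.measurable_pi1, H.measurable_mu1, H.measurable_mu0, H.measurable_sigma2⟩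

variable [IsFiniteMeasure Q]

omit [IsFiniteMeasure Q] in
theorem orth_one_sub_e (H : IsObsNuisance Q c ε η) :
    Orth Q fun o => (1 - o.zz) - (1 - η.e1 o.X) :=
  H.orth_e.neg.congr (ae_of_all _ fun o => by simp only; ring)

theorem condExp_zz_pos (H : IsObsNuisance Q c ε η) {g : Obs 𝒳 → ℝ} {M t : ℝ} (hg : Measurable g)
    (hM : ∀ o, |g o| ≤ M) (ht : |t| * M ≤ 1 / 2) :
    ∀ᵐ o ∂(path Q g t), 0 < (path Q g t)[Obs.zz | Obs.sigmaX] o :=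
  condExp_path_pos hg hM ht H.eps_pos (H.e_mem.mono fun _ h => h.1)
    (fun o => by rcases o.zz_eq with h | h <;> simp [h]) integrable_zz H.orth_e

theorem condExp_one_sub_zz_pos (H : IsObsNuisance Q c ε η) {g : Obs 𝒳 → ℝ} {M t : ℝ}
    (hg : Measurable g) (hM : ∀ o, |g o| ≤ M) (ht : |t| * M ≤ 1 / 2) :
    ∀ᵐ o ∂(path Q g t), 0 < (path Q g t)[fun o => 1 - o.zz | Obs.sigmaX] o :=
  condExp_path_pos hg hM ht H.eps_pos
    (e := fun o => 1 - η.e1 o.X) (H.e_mem.mono fun _ h => by linarith [h.2])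
    (fun o => by rcases o.zz_eq with h | h <;> simp [h]) integrable_one_sub_zz H.orth_one_sub_e

theorem condExp_zz_pos' (H : IsObsNuisance Q c ε η) : ∀ᵐ o ∂Q, 0 < Q[Obs.zz | Obs.sigmaX] o := by
  -- The untilted law is the path at `t = 0`.
  have := H.condExp_zz_pos (g := fun _ => 0) (M := 0) (t := 0) measurable_const (by simp) (by simp)
  rwa [path_zero] at this

theorem condExp_one_sub_zz_pos' (H : IsObsNuisance Q c ε η) :
    ∀ᵐ o ∂Q, 0 < Q[fun o => 1 - o.zz | Obs.sigmaX] o := by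
  have := H.condExp_one_sub_zz_pos (g := fun _ => 0) (M := 0) (t := 0) measurable_const (by simp)
    (by simp)
  rwa [path_zero] at this

theorem pi_mem (H : IsObsNuisance Q c ε η) : ∀ᵐ o ∂Q, η.pi c o.X ∈ Set.Icc (0 : ℝ) 1 := by
  have hm : Measurable[Obs.sigmaX] fun o : Obs 𝒳 => η.pi c o.X :=
    measurable_comp_X (H.isMeasurable.pi c)
  have hi := Integrable.zz_mul (Q := Q) (integrable_ind c)
  filter_upwards [H.orth_pi.ae_le_of_le hm integrable_zz hi H.condExp_zz_pos' (a := 0)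
      (ae_of_all _ fun o => by
        rcases o.zz_eq with h | h <;> rcases o.ind_eq c with h' | h' <;> simp [h, h']),
    H.orth_pi.ae_ge_of_ge hm integrable_zz hi H.condExp_zz_pos' (a := 1)
      (ae_of_all _ fun o => by
        rcases o.zz_eq with h | h <;> rcases o.ind_eq c with h' | h' <;> simp [h, h'])]
    with o h1 h2 using ⟨h1, h2⟩

theorem abs_zz_mul_le (H : IsObsNuisance Q c ε η) :
    ∀ᵐ o ∂Q, |o.zz * (o.ind c - η.pi c o.X)| ≤ 1 := by
  filter_upwards [H.pi_mem] with o ho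
  rw [abs_le]
  rcases o.zz_eq with h | h <;> rcases o.ind_eq c with h' | h' <;> rw [h, h'] <;>
    constructor <;> linarith [ho.1, ho.2]

theorem isTrue_bivFamily (H : IsObsNuisance Q c ε η) {w : Nuisance 𝒳 → 𝒳 → ℝ} {a b f : ℝ → ℝ → ℝ}
    (hw : ∀ θ : Nuisance 𝒳, θ.IsMeasurable → Measurable (w θ))
    (ha : Measurable fun x : ℝ × ℝ => a x.1 x.2) (hb : Measurable fun x : ℝ × ℝ => b x.1 x.2)
    (hf : Measurable fun x : ℝ × ℝ => f x.1 x.2) {V0 : Obs 𝒳 → ℝ}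
    (hV0 : Orth Q fun o => (1 - o.zz) * (V0 o - w η o.X)) {C : ℝ}
    (hC : ∀ᵐ o ∂Q, |a (η.pi c o.X) (w η o.X)| ≤ C ∧ |b (η.pi c o.X) (w η o.X)| ≤ C ∧
      |f (η.pi c o.X) (w η o.X)| ≤ C) :
    (bivFamily c w a b f).IsTrue Q ε (Obs.ind c) V0 η where
  measurable_e := measurable_comp_X H.measurable_e1
  measurable_a1 := (bivFamily_isMeasurable c hw ha hb hf).a1 η H.isMeasurable
  measurable_u1 := (bivFamily_isMeasurable c hw ha hb hf).u1 η H.isMeasurable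
  measurable_a0 := (bivFamily_isMeasurable c hw ha hb hf).a0 η H.isMeasurable
  measurable_u0 := (bivFamily_isMeasurable c hw ha hb hf).u0 η H.isMeasurable
  measurable_G := (bivFamily_isMeasurable c hw ha hb hf).G η H.isMeasurable
  eps_pos := H.eps_pos
  e_mem := H.e_mem
  orth_e := H.orth_e
  orth1 := H.orth_pi
  orth0 := hV0
  integrable1 := H.orth_pi.integrable.bdd_mul (c := C)
    (Measurable.of_sigmaX ((bivFamily_isMeasurable c hw ha hb hf).a1 η H.isMeasurable)).aestronglyMeasurable
    (hC.mono fun _ h => h.1)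
  integrable0 := hV0.integrable.bdd_mul (c := C)
    (Measurable.of_sigmaX ((bivFamily_isMeasurable c hw ha hb hf).a0 η H.isMeasurable)).aestronglyMeasurable
    (hC.mono fun _ h => h.2.1)
  integrable_G := Integrable.of_bound
    (Measurable.of_sigmaX ((bivFamily_isMeasurable c hw ha hb hf).G η H.isMeasurable)).aestronglyMeasurable
    C (hC.mono fun _ h => h.2.2)

theorem isTrue_nu1Family (H : IsObsNuisance Q c ε η) :
    (nu1Family c).IsTrue Q ε (fun o => o.ind c * o.Y) (fun _ => 0) η where
  measurable_e := measurable_comp_X H.measurable_e1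
  measurable_a1 := measurable_const
  measurable_u1 := (nu1Family_isMeasurable c).u1 η H.isMeasurable
  measurable_a0 := measurable_const
  measurable_u0 := measurable_const
  measurable_G := (nu1Family_isMeasurable c).G η H.isMeasurable
  eps_pos := H.eps_pos
  e_mem := H.e_mem
  orth_e := H.orth_e
  orth1 := H.orth_mu1
  orth0 := Orth.of_setIntegral (by simp [nu1Family]) (by simp [nu1Family])
  integrable1 := H.orth_mu1.integrable.const_mul 1
  integrable0 := by simp [nu1Family]
  integrable_G := by
    obtain ⟨B, hB⟩ := MemLp.exists_ae_abs_le H.memLp_mu1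
    refine Integrable.of_bound
      (Measurable.of_sigmaX ((nu1Family_isMeasurable c).G η H.isMeasurable)).aestronglyMeasurable B ?_
    filter_upwards [hB, H.pi_mem] with o h1 h2
    simp only [nu1Family]
    rw [Real.norm_eq_abs, abs_mul, abs_of_nonneg h2.1]
    exact (mul_le_of_le_one_left (abs_nonneg _) h2.2).trans h1

end IsObsNuisance

end Families

/-! ### Negligibility of the estimation error for the score families. -/

section CrossFitFamilies
variable {𝒳 : Type*} [MeasurableSpace 𝒳] {Ω : Type*} [MeasurableSpace Ω] {μ : Measure Ω}
  [IsProbabilityMeasure μ]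
  {K : ℕ} {F : CrossFitting K} {N : NuisanceEstimator 𝒳 F} {O : ℕ → Ω → Obs 𝒳}
  {Q : Measure (Obs 𝒳)} {PX : Measure 𝒳} {η : Nuisance 𝒳} {ε : ℝ} {c : Bool}

/-- Joint measurability of the estimated component `f` in the training data and the covariates. -/
def JointMeasurable (N : NuisanceEstimator 𝒳 F) (f : Nuisance 𝒳 → 𝒳 → ℝ) : Prop :=
  ∀ n k, Measurable fun q : (F.train n k → Obs 𝒳) × Obs 𝒳 => f (N n k q.1) q.2.X

theorem NuisanceEstimator.IsMeasurable.joint (hN : N.IsMeasurable) :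
    JointMeasurable N Nuisance.e1 ∧ (∀ c, JointMeasurable N fun θ => θ.pi c) ∧
    JointMeasurable N Nuisance.mu1 ∧ JointMeasurable N Nuisance.mu0 ∧
    JointMeasurable N Nuisance.sigma2 := by
  have h : ∀ n k, Measurable fun q : (F.train n k → Obs 𝒳) × Obs 𝒳 => (q.1, q.2.X) := fun n k =>
    measurable_fst.prodMk (Obs.measurable_X.comp measurable_snd)
  refine ⟨fun n k => (hN n k).1.comp (h n k), fun c n k => ?_, fun n k => (hN n k).2.2.1.comp (h n k),
    fun n k => (hN n k).2.2.2.1.comp (h n k), fun n k => (hN n k).2.2.2.2.comp (h n k)⟩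
  cases c
  · exact measurable_const.sub ((hN n k).2.1.comp (h n k))
  · exact (hN n k).2.1.comp (h n k)

theorem FitMeasurable.sub_const {ψ : Nuisance 𝒳 → Obs 𝒳 → ℝ} (h : FitMeasurable N ψ)
    {φ : Obs 𝒳 → ℝ} (hφ : Measurable φ) : FitMeasurable N fun θ o => ψ θ o - φ o :=
  fun n k => (h n k).sub (hφ.comp measurable_snd)

theorem fitMeasurable_score {s : ScoreFamily 𝒳} {V1 V0 : Obs 𝒳 → ℝ} (hN : N.IsMeasurable)
    (hV1 : Measurable V1) (hV0 : Measurable V0) (h1 : FitMeasurable N s.a1)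
    (h2 : FitMeasurable N s.u1) (h3 : FitMeasurable N s.a0) (h4 : FitMeasurable N s.u0)
    (h5 : FitMeasurable N s.G) : FitMeasurable N (s.score V1 V0) := by
  intro n k
  have he := hN.joint.1 n k
  have hz : Measurable fun q : (F.train n k → Obs 𝒳) × Obs 𝒳 => q.2.zz :=
    Obs.measurable_zz.comp measurable_snd
  exact (((hz.div he).mul (h1 n k)).mul ((hV1.comp measurable_snd).sub (h2 n k))).add
    ((((measurable_const.sub hz).div (measurable_const.sub he)).mul (h3 n k)).mul
      ((hV0.comp measurable_snd).sub (h4 n k))) |>.add (h5 n k)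

theorem fitMeasurable_bivFamily {w : Nuisance 𝒳 → 𝒳 → ℝ} {a b f : ℝ → ℝ → ℝ}
    (hN : N.IsMeasurable) (hw : JointMeasurable N w)
    (ha : Measurable fun x : ℝ × ℝ => a x.1 x.2) (hb : Measurable fun x : ℝ × ℝ => b x.1 x.2)
    (hf : Measurable fun x : ℝ × ℝ => f x.1 x.2) {V0 : Obs 𝒳 → ℝ} (hV0 : Measurable V0) :
    FitMeasurable N ((bivFamily c w a b f).score (Obs.ind c) V0) :=
  fitMeasurable_score hN (Obs.measurable_ind c) hV0
    (fun n k => ha.comp ((hN.joint.2.1 c n k).prodMk (hw n k)))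
    (fun n k => hN.joint.2.1 c n k)
    (fun n k => hb.comp ((hN.joint.2.1 c n k).prodMk (hw n k)))
    hw (fun n k => hf.comp ((hN.joint.2.1 c n k).prodMk (hw n k)))

theorem fitMeasurable_nu1Family (hN : N.IsMeasurable) {V0 : Obs 𝒳 → ℝ} (hV0 : Measurable V0) :
    FitMeasurable N ((nu1Family c).score (fun o => o.ind c * o.Y) V0) :=
  fitMeasurable_score hN ((Obs.measurable_ind c).mul Obs.measurable_Y) hV0
    (fun _ _ => measurable_const)
    (fun n k => (hN.joint.2.1 c n k).mul (hN.joint.2.2.1 n k))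
    (fun _ _ => measurable_const) (fun _ _ => measurable_const)
    (fun n k => (hN.joint.2.1 c n k).mul (hN.joint.2.2.1 n k))

theorem measurable_score {s : ScoreFamily 𝒳} {V1 V0 : Obs 𝒳 → ℝ} (hs : s.IsMeasurable)
    (hV1 : Measurable V1) (hV0 : Measurable V0) (hη : η.IsMeasurable) :
    Measurable (s.score V1 V0 η) := by
  have he : Measurable fun o : Obs 𝒳 => η.e1 o.X := hη.e1.comp Obs.measurable_X
  exact (((Obs.measurable_zz.div he).mul (Measurable.of_sigmaX (hs.a1 η hη))).mul
    (hV1.sub (Measurable.of_sigmaX (hs.u1 η hη)))).add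
    ((((measurable_const.sub Obs.measurable_zz).div (measurable_const.sub he)).mul
      (Measurable.of_sigmaX (hs.a0 η hη))).mul (hV0.sub (Measurable.of_sigmaX (hs.u0 η hη))))
    |>.add (Measurable.of_sigmaX (hs.G η hη))

theorem abs_gap_e1_le {M : ℝ} {θ : Nuisance 𝒳} (hε : 0 < ε)
    (he : ∀ᵐ o ∂Q, ε ≤ η.e1 o.X ∧ η.e1 o.X ≤ 1 - ε) (hθ : BoundedPropensity Q M θ) :
    ∀ᵐ o ∂Q, |gap Nuisance.e1 η θ o| ≤ 1 := by
  filter_upwards [he, hθ] with o h1 h2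
  rw [gap, abs_le]
  constructor <;> linarith [h1.1, h1.2, h2.1, h2.2.1]

/-- The component `v` records which error accompanies that of `w` in the remainder: the error of
`π_c` when `f` is linear in its second argument, and that of `w` itself otherwise. Increments of `b`
are required in truncated form because they multiply the control residual, which is dominated by `W`
but may be unbounded; the treated residual is bounded by `1`, so increments of `a` need no
truncation. -/
theorem isLittleOp_crossAvg_bivFamily (H : IsObsNuisance Q c ε η)
    {w : Nuisance 𝒳 → 𝒳 → ℝ} {a b f : ℝ → ℝ → ℝ}
    (hw : ∀ θ : Nuisance 𝒳, θ.IsMeasurable → Measurable (w θ))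
    (ha : Measurable fun x : ℝ × ℝ => a x.1 x.2) (hb : Measurable fun x : ℝ × ℝ => b x.1 x.2)
    (hf : Measurable fun x : ℝ × ℝ => f x.1 x.2) {V0 : Obs 𝒳 → ℝ} (mV0 : Measurable V0)
    (S : (bivFamily c w a b f).IsTrue Q ε (Obs.ind c) V0 η)
    (hO : ∀ i, Measurable (O i)) (hindep : iIndepFun O μ)
    (hlaw : ∀ i, μ.map (O i) = Q) (hN : N.IsMeasurable) (hwN : JointMeasurable N w)
    (hQX : Q.map Obs.X = PX)
    (he : ∀ k, IsLittleOp μ (err PX N O η Nuisance.e1 k) fun _ => 1)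
    (hp : ∀ k, IsLittleOp μ (err PX N O η (fun θ => θ.pi c) k) fun _ => 1)
    (hwc : ∀ k, IsLittleOp μ (err PX N O η w k) fun _ => 1)
    (hep : ∀ k, IsLittleOp μ (fun n ω => err PX N O η Nuisance.e1 k n ω
        * err PX N O η (fun θ => θ.pi c) k n ω) fun n => (n : ℝ) ^ (-(1 / 2) : ℝ))
    (hew : ∀ k, IsLittleOp μ (fun n ω => err PX N O η Nuisance.e1 k n ω
        * err PX N O η w k n ω) fun n => (n : ℝ) ^ (-(1 / 2) : ℝ))
    (hpp : ∀ k, IsLittleOp μ (fun n ω => err PX N O η (fun θ => θ.pi c) k n ω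
        * err PX N O η (fun θ => θ.pi c) k n ω) fun n => (n : ℝ) ^ (-(1 / 2) : ℝ))
    {v : Nuisance 𝒳 → 𝒳 → ℝ} (hv : v = (fun θ => θ.pi c) ∨ v = w)
    (hvw : ∀ k, IsLittleOp μ (fun n ω => err PX N O η v k n ω
        * err PX N O η w k n ω) fun n => (n : ℝ) ^ (-(1 / 2) : ℝ))
    {W : Obs 𝒳 → ℝ} (hW : MemLp W 2 Q) (mW : Measurable W)
    (hWV : ∀ᵐ o ∂Q, 1 + |(1 - o.zz) * (V0 o - w η o.X)| ≤ W o)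
    {Good : ℝ → Nuisance 𝒳 → Prop} (hGe : ∀ M θ, Good M θ → BoundedPropensity Q M θ)
    (hGood : ∀ k, ∀ δ : ℝ≥0∞, 0 < δ →
      ∃ M, ∀ᶠ n in atTop, μ {ω | ¬ Good M (fit N O n k ω)} ≤ δ)
    (hbound : ∀ M, ∃ C : ℝ, 0 ≤ C ∧ ∀ θ : Nuisance 𝒳, θ.IsMeasurable → Good M θ →
      ∀ᵐ o ∂Q, ∀ p q m m', p = η.pi c o.X → q = θ.pi c o.X → m = w η o.X → m' = w θ o.X →
      q ∈ Set.Icc (0 : ℝ) 1 ∧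
      |a p m| ≤ C ∧ |b p m| ≤ C ∧ |b q m'| ≤ C ∧
      |a q m' - a p m| ≤ C * (|q - p| + |m' - m|) ∧
      |b q m' - b p m| ≤ C * (min 1 |q - p| + min 1 |m' - m|) ∧
      |f q m' - f p m| ≤ C * (|q - p| + |m' - m|) ∧
      |f p m - f q m' - a q m' * (p - q) - b q m' * (m - m')|
        ≤ C * (|q - p| * |q - p| + |gap v η θ o| * |m' - m|)) :
    IsLittleOp μ (fun n ω => ‖√(n : ℝ) * crossAvg N O
      (fun θ o => (bivFamily c w a b f).score (Obs.ind c) V0 θ o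
        - (bivFamily c w a b f).score (Obs.ind c) V0 η o) n ω‖ₑ) fun _ => 1 := by
  have : IsProbabilityMeasure Q := hlaw 0 ▸ Measure.isProbabilityMeasure_map (hO 0).aemeasurable
  have hη := H.isMeasurable
  have hs := bivFamily_isMeasurable c hw ha hb hf
  set comp : Fin 3 → Nuisance 𝒳 → 𝒳 → ℝ := ![Nuisance.e1, fun θ => θ.pi c, w] with hcomp
  obtain ⟨j, hj⟩ : ∃ j : Fin 3, comp j = v := by
    rcases hv with rfl | rfl
    exacts [⟨1, rfl⟩, ⟨2, rfl⟩]
  refine ScoreFamily.isLittleOp_crossAvg S hs hO hindep hlaw hN hQX hη (f := comp) (i₀ := 0) rfl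
    ?_ ?_ (J := {1, 2}) (rem := {(1, 1), (j, 2)}) ?_ ?_ hW mW hGe hGood
    ((fitMeasurable_bivFamily hN hwN ha hb hf mV0).sub_const
      (measurable_score hs (Obs.measurable_ind c) mV0 hη)) fun M => ?_
  · intro i θ hθ
    fin_cases i
    exacts [hθ.e1, hθ.pi c, hw θ hθ]
  · intro i k
    fin_cases i
    exacts [he k, hp k, hwc k]
  · intro i hi k
    simp only [Finset.mem_insert, Finset.mem_singleton] at hi
    rcases hi with rfl | rfl
    exacts [hep k, hew k]
  · intro i hi k
    simp only [Finset.mem_insert, Finset.mem_singleton] at hi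
    rcases hi with rfl | rfl
    · exact hpp k
    · simp only [hj]; exact hvw k
  · obtain ⟨C, hC, hb'⟩ := hbound M
    refine ⟨2 * C, by positivity, fun θ hθ hM => ?_⟩
    filter_upwards [hb' θ hθ hM, H.abs_zz_mul_le, H.pi_mem, hWV,
      abs_gap_e1_le H.eps_pos H.e_mem (hGe M θ hM)] with o h1 h2 h3 h4 h5
    obtain ⟨hq, b1, b2, b3, b4, b5, b6, b7⟩ := h1 _ _ _ _ rfl rfl rfl rfl
    have hR : |gap (comp 1) η θ o| * |gap (comp 1) η θ o| + |gap (comp j) η θ o| * |gap (comp 2) η θ o|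
        ≤ ∑ p ∈ ({(1, 1), (j, 2)} : Finset (Fin 3 × Fin 3)),
        |gap (comp p.1) η θ o| * |gap (comp p.2) η θ o| := by
      rw [Finset.sum_insert (by simp), Finset.sum_singleton]
    rw [hj] at hR
    have hBeq : ∑ i, (|W o| * min 1 |gap (comp i) η θ o| + |gap (comp i) η θ o|)
        = W o * (min 1 |gap Nuisance.e1 η θ o| + min 1 |gap (fun θ => θ.pi c) η θ o|
          + min 1 |gap w η θ o|) + (|gap Nuisance.e1 η θ o| + |gap (fun θ => θ.pi c) η θ o|
          + |gap w η θ o|) := by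
      rw [Fin.sum_univ_three, abs_of_nonneg (by linarith [abs_nonneg ((1 - o.zz) * (V0 o - w η o.X))] : 0 ≤ W o)]
      simp only [hcomp, Matrix.cons_val_zero, Matrix.cons_val_one, Matrix.cons_val]
      ring
    have hDeq : ∑ i ∈ ({1, 2} : Finset (Fin 3)), |gap (comp i) η θ o|
        = |gap (fun θ => θ.pi c) η θ o| + |gap w η θ o| := by
      rw [Finset.sum_insert (by simp), Finset.sum_singleton]
      simp only [hcomp, Matrix.cons_val_one, Matrix.cons_val]
    rw [hBeq, hDeq]
    rw [min_eq_right h5]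
    set E := |gap Nuisance.e1 η θ o| with hE
    set x := |gap (fun θ => θ.pi c) η θ o| with hx
    set y := |gap w η θ o| with hy
    have hx0 : 0 ≤ x := abs_nonneg _
    have hy0 : 0 ≤ y := abs_nonneg _
    have hE0 : 0 ≤ E := abs_nonneg _
    have hx1 : x ≤ 1 := by
      rw [hx, gap, abs_le]
      constructor <;> linarith [hq.1, hq.2, h3.1, h3.2]
    have hmx : 0 ≤ min 1 x := le_min zero_le_one hx0
    have hmy : 0 ≤ min 1 y := le_min zero_le_one hy0
    change |_| ≤ C * (x + y) at b4
    change |_| ≤ C * (min 1 x + min 1 y) at b5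
    change |_| ≤ C * (x + y) at b6
    set v0 := |(1 - o.zz) * (V0 o - w η o.X)| with hv0
    have hv0' : 0 ≤ v0 := abs_nonneg _
    have hWs : (1 + v0) * (E + min 1 x + min 1 y) ≤ W o * (E + min 1 x + min 1 y) :=
      mul_le_mul_of_nonneg_right h4 (by positivity)
    have hWC := mul_le_mul_of_nonneg_left hWs hC
    refine ⟨?_, ?_, ?_, ?_⟩
    · change |o.zz * (o.ind c - η.pi c o.X)| * (|a _ _ - a _ _| + |a _ _| * E)
        + v0 * (|b _ _ - b _ _| + |b _ _| * E) ≤ _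
      have t1 : |o.zz * (o.ind c - η.pi c o.X)| * (|a (θ.pi c o.X) (w θ o.X) - a (η.pi c o.X) (w η o.X)|
          + |a (η.pi c o.X) (w η o.X)| * E) ≤ 1 * (C * (x + y) + C * E) := by
        gcongr
      have t2 : v0 * (|b (θ.pi c o.X) (w θ o.X) - b (η.pi c o.X) (w η o.X)|
          + |b (η.pi c o.X) (w η o.X)| * E) ≤ v0 * (C * (min 1 x + min 1 y) + C * E) := by
        gcongr
      refine (add_le_add t1 t2).trans ?_
      have : 0 ≤ C * (W o * (E + min 1 x + min 1 y)) := by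
        refine mul_nonneg hC (mul_nonneg (by linarith) (by positivity))
      have h7 : 0 ≤ C * (E + x + y) := by positivity
      have h8 : 0 ≤ C * (E + min 1 x + min 1 y) := by positivity
      nlinarith
    · change |a _ _ * _| + |b _ _ * _| ≤ _
      rw [abs_mul, abs_mul]
      -- The weight `a` is not assumed bounded at the estimate (under the mean ratio it contains the
      -- estimated `μ₀`). It is bounded through its value at the truth; the resulting quadratic
      -- terms become linear since `x ≤ 1`.
      have t1 : |a (θ.pi c o.X) (w θ o.X)| ≤ C + C * (x + y) := by
        have := abs_sub_abs_le_abs_sub (a (θ.pi c o.X) (w θ o.X)) (a (η.pi c o.X) (w η o.X))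
        linarith
      calc _ ≤ (C + C * (x + y)) * x + C * y := by
            refine add_le_add (mul_le_mul_of_nonneg_right t1 hx0) (mul_le_mul_of_nonneg_right b3 hy0)
        _ ≤ _ := by
            have h7 : C * (x + y) * x ≤ C * (x + y) * 1 :=
              mul_le_mul_of_nonneg_left hx1 (by positivity)
            linarith
    · refine b6.trans ?_
      have : 0 ≤ C * (W o * (E + min 1 x + min 1 y)) := by
        refine mul_nonneg hC (mul_nonneg (by linarith) (by positivity))
      have h7 : 0 ≤ C * (x + y) := by positivity
      have h8 : 0 ≤ C * E := by positivity
      nlinarith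
    · refine b7.trans ?_
      refine le_trans (mul_le_mul_of_nonneg_left hR hC) (mul_le_mul_of_nonneg_right (by linarith) ?_)
      exact Finset.sum_nonneg fun p _ => mul_nonneg (abs_nonneg _) (abs_nonneg _)

/-- Here the regression is the product `π_c μ_{1c}` itself, with weight `1`, and the plug-in term
equals the regression: the functional is linear, the Taylor remainder is zero, and no product of the
errors of `π_c` and `μ_{1c}` appears. -/
theorem isLittleOp_crossAvg_nu1Family (H : IsObsNuisance Q c ε η)
    (hO : ∀ i, Measurable (O i)) (hindep : iIndepFun O μ)
    (hlaw : ∀ i, μ.map (O i) = Q) (hN : N.IsMeasurable) (hQX : Q.map Obs.X = PX)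
    (hpi : ∀ n k data x, (N n k data).pi1 x ∈ Set.Icc (0 : ℝ) 1)
    (he : ∀ k, IsLittleOp μ (err PX N O η Nuisance.e1 k) fun _ => 1)
    (hp : ∀ k, IsLittleOp μ (err PX N O η (fun θ => θ.pi c) k) fun _ => 1)
    (hmc : ∀ k, IsLittleOp μ (err PX N O η Nuisance.mu1 k) fun _ => 1)
    (hep : ∀ k, IsLittleOp μ (fun n ω => err PX N O η Nuisance.e1 k n ω
        * err PX N O η (fun θ => θ.pi c) k n ω) fun n => (n : ℝ) ^ (-(1 / 2) : ℝ))
    (hem : ∀ k, IsLittleOp μ (fun n ω => err PX N O η Nuisance.e1 k n ω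
        * err PX N O η Nuisance.mu1 k n ω) fun n => (n : ℝ) ^ (-(1 / 2) : ℝ))
    (hGood : ∀ k, ∀ δ : ℝ≥0∞, 0 < δ →
      ∃ M, ∀ᶠ n in atTop, μ {ω | ¬ BoundedPropensity Q M (fit N O n k ω)} ≤ δ) :
    IsLittleOp μ (fun n ω => ‖√(n : ℝ) * crossAvg N O
      (fun θ o => phiNu1 c θ o - phiNu1 c η o) n ω‖ₑ) fun _ => 1 := by
  have : IsProbabilityMeasure Q := hlaw 0 ▸ Measure.isProbabilityMeasure_map (hO 0).aemeasurable
  have hη := H.isMeasurable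
  have hs := nu1Family_isMeasurable (𝒳 := 𝒳) c
  simp only [phiNu1_eq c (fun _ => 0)]
  set comp : Fin 3 → Nuisance 𝒳 → 𝒳 → ℝ := ![Nuisance.e1, fun θ => θ.pi c, Nuisance.mu1] with hcomp
  obtain ⟨B, hB⟩ := MemLp.exists_ae_abs_le H.memLp_mu1
  refine ScoreFamily.isLittleOp_crossAvg (H.isTrue_nu1Family) hs hO hindep hlaw hN hQX hη (f := comp)
    (i₀ := 0) rfl ?_ ?_ (J := {1, 2}) (rem := ∅) ?_ (by simp)
    (W := fun o => |o.Y| + |B|) (H.memLp_Y.abs.add (memLp_const _)) (Obs.measurable_Y.abs.add_const _)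
    (Good := fun M θ => BoundedPropensity Q M θ ∧ ∀ x, θ.pi1 x ∈ Set.Icc (0 : ℝ) 1)
    (fun M θ h => h.1) (fun k δ hδ => ?_)
    ((fitMeasurable_nu1Family hN measurable_const).sub_const
      (measurable_score hs ((Obs.measurable_ind c).mul Obs.measurable_Y) measurable_const hη))
    fun M => ?_
  · intro i θ hθ
    fin_cases i
    exacts [hθ.e1, hθ.pi c, hθ.mu1]
  · intro i k
    fin_cases i
    exacts [he k, hp k, hmc k]
  · intro i hi k
    simp only [Finset.mem_insert, Finset.mem_singleton] at hi
    rcases hi with rfl | rfl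
    exacts [hep k, hem k]
  · obtain ⟨M, hM⟩ := hGood k δ hδ
    refine ⟨M, hM.mono fun n hn => (measure_mono ?_).trans hn⟩
    exact fun ω hω hcon => hω ⟨hcon, fun x => hpi n k _ x⟩
  · refine ⟨1 + |B|, by positivity, fun θ hθ hM => ?_⟩
    filter_upwards [H.pi_mem, hB, abs_gap_e1_le H.eps_pos H.e_mem hM.1] with o h3 hBo h5
    have hq : θ.pi c o.X ∈ Set.Icc (0 : ℝ) 1 := by
      have := hM.2 o.X
      cases c
      · exact ⟨by simp [Nuisance.pi, this.2], by simp [Nuisance.pi, this.1]⟩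
      · exact this
    have hBeq : ∑ i, (|(fun o : Obs 𝒳 => |o.Y| + |B|) o| * min 1 |gap (comp i) η θ o| + |gap (comp i) η θ o|)
        = (|o.Y| + |B|) * (min 1 |gap Nuisance.e1 η θ o| + min 1 |gap (fun θ => θ.pi c) η θ o|
          + min 1 |gap Nuisance.mu1 η θ o|) + (|gap Nuisance.e1 η θ o| + |gap (fun θ => θ.pi c) η θ o|
          + |gap Nuisance.mu1 η θ o|) := by
      rw [Fin.sum_univ_three, abs_of_nonneg (by positivity)]
      simp only [hcomp, Matrix.cons_val_zero, Matrix.cons_val_one, Matrix.cons_val]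
      ring
    have hDeq : ∑ i ∈ ({1, 2} : Finset (Fin 3)), |gap (comp i) η θ o|
        = |gap (fun θ => θ.pi c) η θ o| + |gap Nuisance.mu1 η θ o| := by
      rw [Finset.sum_insert (by simp), Finset.sum_singleton]
      simp only [hcomp, Matrix.cons_val_one, Matrix.cons_val]
    rw [hBeq, hDeq, min_eq_right h5]
    set E := |gap Nuisance.e1 η θ o| with hE
    set x := |gap (fun θ => θ.pi c) η θ o| with hx
    set y := |gap Nuisance.mu1 η θ o| with hy
    have hx0 : 0 ≤ x := abs_nonneg _
    have hy0 : 0 ≤ y := abs_nonneg _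
    have hE0 : 0 ≤ E := abs_nonneg _
    have hmx : 0 ≤ min 1 x := le_min zero_le_one hx0
    have hmy : 0 ≤ min 1 y := le_min zero_le_one hy0
    have hB0 := abs_nonneg B
    have hY0 := abs_nonneg o.Y
    -- The product is telescoped so that the estimate of `π_c`, lying in `[0, 1]`, multiplies the
    -- error of `μ_{1c}`, and the bounded true `μ_{1c}` multiplies the error of `π_c`; the estimate
    -- of `μ_{1c}` may be unbounded.
    have hmu : |θ.pi c o.X * θ.mu1 o.X - η.pi c o.X * η.mu1 o.X| ≤ (1 + |B|) * (x + y) := by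
      have e : θ.pi c o.X * θ.mu1 o.X - η.pi c o.X * η.mu1 o.X
          = θ.pi c o.X * (θ.mu1 o.X - η.mu1 o.X) + (θ.pi c o.X - η.pi c o.X) * η.mu1 o.X := by ring
      rw [e]
      refine (abs_add_le _ _).trans ?_
      rw [abs_mul, abs_mul, abs_of_nonneg hq.1]
      have t1 : θ.pi c o.X * |θ.mu1 o.X - η.mu1 o.X| ≤ 1 * y :=
        mul_le_mul_of_nonneg_right hq.2 hy0
      have t2 : |θ.pi c o.X - η.pi c o.X| * |η.mu1 o.X| ≤ x * |B| :=
        mul_le_mul_of_nonneg_left (hBo.trans (le_abs_self _)) hx0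
      nlinarith [mul_nonneg hB0 hy0]
    have hpl : (1 + |B|) * (x + y) ≤ (1 + |B|) * ((|o.Y| + |B|) * (E + min 1 x + min 1 y) + (E + x + y)) := by
      refine mul_le_mul_of_nonneg_left ?_ (by positivity)
      have : 0 ≤ (|o.Y| + |B|) * (E + min 1 x + min 1 y) := by positivity
      linarith
    refine ⟨?_, ?_, ?_, ?_⟩
    · simp only [nu1Family, sub_self, abs_zero, abs_one, one_mul, zero_add, zero_mul, mul_zero,
        add_zero]
      change |o.zz * (o.ind c * o.Y - η.pi c o.X * η.mu1 o.X)| * E ≤ _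
      have t1 : |o.zz * (o.ind c * o.Y - η.pi c o.X * η.mu1 o.X)| ≤ |o.Y| + |B| := by
        have a1 : |η.pi c o.X * η.mu1 o.X| ≤ |B| := by
          rw [abs_mul, abs_of_nonneg h3.1]
          exact (mul_le_of_le_one_left (abs_nonneg _) h3.2).trans (hBo.trans (le_abs_self _))
        have a2 : |o.ind c * o.Y| ≤ |o.Y| := by
          rcases o.ind_eq c with h | h <;> simp [h]
        rcases o.zz_eq with h | h
        · rw [h]; simp; positivity
        · rw [h, one_mul]
          exact (abs_sub _ _).trans (add_le_add a2 a1)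
      have t2 := mul_le_mul_of_nonneg_right t1 hE0
      have t3 : (|o.Y| + |B|) * E ≤ (|o.Y| + |B|) * (E + min 1 x + min 1 y) + (E + x + y) := by
        have : 0 ≤ (|o.Y| + |B|) * (min 1 x + min 1 y) := by positivity
        nlinarith
      refine t2.trans (t3.trans ?_)
      exact le_mul_of_one_le_left (by positivity) (by linarith)
    · simp only [nu1Family, one_mul, zero_mul, abs_zero, add_zero]
      exact hmu
    · exact hmu.trans hpl
    · simp [nu1Family]

end CrossFitFamilies

/-! ### Estimation error of the individual components. -/

section Instances
variable {𝒳 : Type*} [MeasurableSpace 𝒳] {Ω : Type*} [MeasurableSpace Ω]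

/-- The assumptions on the sample and on the estimators that are common to all estimands. -/
structure SampleSetup (μ : Measure Ω) [IsProbabilityMeasure μ] {K : ℕ} {F : CrossFitting K}
    (N : NuisanceEstimator 𝒳 F) (O : ℕ → Ω → Obs 𝒳) (Q : Measure (Obs 𝒳)) (PX : Measure 𝒳)
    (η : Nuisance 𝒳) (ε : ℝ) (c : Bool) : Prop where
  nuisance : IsObsNuisance Q c ε η
  measurable_sample : ∀ i, Measurable (O i)
  indep : iIndepFun O μ
  law : ∀ i, μ.map (O i) = Q
  measurable_fit : N.IsMeasurable
  law_X : Q.map Obs.X = PX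
  pi_mem : ∀ n k data x, (N n k data).pi1 x ∈ Set.Icc (0 : ℝ) 1
  e_cons : ∀ k, IsLittleOp μ (err PX N O η Nuisance.e1 k) fun _ => 1
  pi_cons : ∀ k, IsLittleOp μ (err PX N O η (fun θ => θ.pi c) k) fun _ => 1
  propensity : ∀ k, ∀ δ : ℝ≥0∞, 0 < δ → ∃ M₀, ∀ M, M₀ ≤ M →
    ∀ᶠ n in atTop, μ {ω | ¬ BoundedPropensity Q M (fit N O n k ω)} ≤ δ
  e_pi : ∀ k, IsLittleOp μ (fun n ω => err PX N O η Nuisance.e1 k n ω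
      * err PX N O η (fun θ => θ.pi c) k n ω) fun n => (n : ℝ) ^ (-(1 / 2) : ℝ)
  pi_pi : ∀ k, IsLittleOp μ (fun n ω => err PX N O η (fun θ => θ.pi c) k n ω
      * err PX N O η (fun θ => θ.pi c) k n ω) fun n => (n : ℝ) ^ (-(1 / 2) : ℝ)

omit [MeasurableSpace 𝒳] in
theorem Nuisance.pi_mem_Icc {θ : Nuisance 𝒳} {x : 𝒳} (h : θ.pi1 x ∈ Set.Icc (0 : ℝ) 1) (c : Bool) :
    θ.pi c x ∈ Set.Icc (0 : ℝ) 1 := by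
  cases c
  · exact ⟨by simp [Nuisance.pi, h.2], by simp [Nuisance.pi, h.1]⟩
  · exact h

theorem abs_sub_le_one_of_mem {p q : ℝ} (hp : p ∈ Set.Icc (0 : ℝ) 1) (hq : q ∈ Set.Icc (0 : ℝ) 1) :
    |q - p| ≤ 1 := abs_le.2 ⟨by linarith [hp.2, hq.1], by linarith [hp.1, hq.2]⟩

variable {μ : Measure Ω} [IsProbabilityMeasure μ]
  {K : ℕ} {F : CrossFitting K} {N : NuisanceEstimator 𝒳 F} {O : ℕ → Ω → Obs 𝒳}
  {Q : Measure (Obs 𝒳)} {PX : Measure 𝒳} {η : Nuisance 𝒳} {ε : ℝ} {c : Bool}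

namespace SampleSetup

theorem isProbabilityMeasure (D : SampleSetup μ N O Q PX η ε c) : IsProbabilityMeasure Q :=
  D.law 0 ▸ Measure.isProbabilityMeasure_map (D.measurable_sample 0).aemeasurable

/-- The good events, with a property that every estimate has. -/
theorem exists_good (D : SampleSetup μ N O Q PX η ε c) {p : Nuisance 𝒳 → Prop}
    (hp : ∀ n k data, p (N n k data)) (k : Fin K) (δ : ℝ≥0∞) (hδ : 0 < δ) :
    ∃ M, ∀ᶠ n in atTop, μ {ω | ¬ (BoundedPropensity Q M (fit N O n k ω) ∧
      (∀ x, (fit N O n k ω).pi1 x ∈ Set.Icc (0 : ℝ) 1) ∧ p (fit N O n k ω))} ≤ δ := by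
  obtain ⟨M, hM⟩ := D.propensity k δ hδ
  refine ⟨M, (hM M le_rfl).mono fun n hn => (measure_mono ?_).trans hn⟩
  exact fun ω hω hcon => hω ⟨hcon, fun x => D.pi_mem n k _ x, hp n k _⟩

theorem crossAvg_phiPi (D : SampleSetup μ N O Q PX η ε c) :
    IsLittleOp μ (fun n ω => ‖√(n : ℝ) * crossAvg N O
      (fun θ o => phiPi c θ o - phiPi c η o) n ω‖ₑ) fun _ => 1 := by
  have := D.isProbabilityMeasure
  have H := D.nuisance
  have h0 : ∀ k n ω, err PX N O η (fun _ _ => 0) k n ω = 0 := by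
    intro k n ω
    simp [err]
  simp only [phiPi_eq c (fun _ => 0)]
  refine isLittleOp_crossAvg_bivFamily H (w := fun _ _ => 0) (fun _ _ => measurable_const)
    measurable_const measurable_const measurable_fst measurable_const
    (H.isTrue_bivFamily (fun _ _ => measurable_const) measurable_const measurable_const
      measurable_fst (V0 := fun _ => 0) ?_ (C := 1) ?_) D.measurable_sample D.indep D.law
    D.measurable_fit (fun _ _ => measurable_const) D.law_X D.e_cons D.pi_cons
    (fun k => ?_) D.e_pi (fun k => ?_) D.pi_pi (v := fun _ _ => 0) (Or.inr rfl) (fun k => ?_)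
    (W := fun _ => 1) (memLp_const _) measurable_const (by simp)
    (Good := fun M θ => BoundedPropensity Q M θ ∧
      (∀ x, θ.pi1 x ∈ Set.Icc (0 : ℝ) 1) ∧ True) (fun _ _ h => h.1)
    (D.exists_good (p := fun _ => True) fun _ _ _ => trivial) fun M => ⟨1, zero_le_one, fun θ hθ hM => ?_⟩
  · exact Orth.of_setIntegral (by simp) (by simp)
  · filter_upwards [H.pi_mem] with o ho
    simp [abs_of_nonneg ho.1, ho.2]
  · exact IsLittleOp.zero.mono fun n ω => (h0 k n ω).le
  · simp only [h0, mul_zero]; exact IsLittleOp.zero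
  · simp only [h0, mul_zero]; exact IsLittleOp.zero
  · refine ae_of_all _ fun o p q m m' _ hq hm hm' => ⟨hq ▸ Nuisance.pi_mem_Icc (hM.2.1 o.X) c, ?_⟩
    subst hm hm'
    simp only [sub_self, abs_zero, abs_one, add_zero, one_mul, zero_le_one, le_refl, true_and,
      mul_zero]
    exact ⟨abs_nonneg _, add_nonneg (le_min zero_le_one (abs_nonneg _)) (by norm_num),
      mul_nonneg (abs_nonneg _) (abs_nonneg _)⟩

theorem crossAvg_phiNu1 (D : SampleSetup μ N O Q PX η ε c)
    (hmc : ∀ k, IsLittleOp μ (err PX N O η Nuisance.mu1 k) fun _ => 1)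
    (hem : ∀ k, IsLittleOp μ (fun n ω => err PX N O η Nuisance.e1 k n ω
        * err PX N O η Nuisance.mu1 k n ω) fun n => (n : ℝ) ^ (-(1 / 2) : ℝ)) :
    IsLittleOp μ (fun n ω => ‖√(n : ℝ) * crossAvg N O
      (fun θ o => phiNu1 c θ o - phiNu1 c η o) n ω‖ₑ) fun _ => 1 :=
  isLittleOp_crossAvg_nu1Family D.nuisance D.measurable_sample D.indep D.law D.measurable_fit
    D.law_X D.pi_mem D.e_cons D.pi_cons hmc D.e_pi hem fun k δ hδ => by
      obtain ⟨M, hM⟩ := D.propensity k δ hδ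
      exact ⟨M, hM M le_rfl⟩

end SampleSetup

/-! Mean ratio -/

theorem measurable_mr (r : ℝ) : (Measurable fun x : ℝ × ℝ => mrEpsPi r x.1 x.2) ∧
    (Measurable fun x : ℝ × ℝ => mrEpsMu r x.1) ∧
    Measurable fun x : ℝ × ℝ => x.1 * mrMean r x.1 x.2 := by
  unfold mrEpsPi mrEpsMu mrMean mrGamma
  exact ⟨by fun_prop, by fun_prop, by fun_prop⟩

theorem rhoC_pos {ρ : ℝ} (hρ : 0 < ρ) (c : Bool) : 0 < rhoC c ρ := by
  cases c <;> simp [rhoC, hρ]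

theorem IsObsNuisance.isTrue_mr [IsFiniteMeasure Q] (H : IsObsNuisance Q c ε η) {r : ℝ} (hr : 0 < r)
    {B : ℝ} (hB : ∀ᵐ o ∂Q, |η.mu0 o.X| ≤ B) :
    (bivFamily c Nuisance.mu0 (mrEpsPi r) (fun p _ => mrEpsMu r p)
      fun p m => p * mrMean r p m).IsTrue Q ε (Obs.ind c) Obs.Y η := by
  obtain ⟨C, hC, h⟩ := exists_mr_bounds hr
  refine H.isTrue_bivFamily (fun θ hθ => hθ.mu0) (measurable_mr r).1 (measurable_mr r).2.1
    (measurable_mr r).2.2 H.orth_mu0 (C := C * (1 + |B|)) ?_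
  filter_upwards [hB, H.pi_mem] with o h1 hp
  obtain ⟨b1, b2, -⟩ := h _ hp _ hp
  have hB' : |η.mu0 o.X| ≤ 1 + |B| := by linarith [le_abs_self B]
  refine ⟨?_, ?_, ?_⟩
  · rw [mrEpsPi_eq hr hp, abs_mul]; gcongr
  · exact b1.trans (le_mul_of_one_le_right hC (by linarith [abs_nonneg B]))
  · rw [show η.pi c o.X * mrMean r (η.pi c o.X) (η.mu0 o.X) = mrEpsMu r (η.pi c o.X) * η.mu0 o.X by
      unfold mrMean mrEpsMu; ring, abs_mul]
    gcongr

/-- `π_c μ_{0c}` equals `mrEpsMu(π_c) · μ₀`, which is linear in `μ₀`. The remainder therefore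
consists of a squared error of `π_c` and a product of the errors of `π_c` and `μ₀`, and no separate
rate for `μ₀` is needed. -/
theorem SampleSetup.crossAvg_phiNu0MR (D : SampleSetup μ N O Q PX η ε c) {ρ : ℝ} (hρ : 0 < ρ)
    {B : ℝ} (hB : ∀ᵐ o ∂Q, |η.mu0 o.X| ≤ B)
    (hmc : ∀ k, IsLittleOp μ (err PX N O η Nuisance.mu0 k) fun _ => 1)
    (hem : ∀ k, IsLittleOp μ (fun n ω => err PX N O η Nuisance.e1 k n ω
        * err PX N O η Nuisance.mu0 k n ω) fun n => (n : ℝ) ^ (-(1 / 2) : ℝ))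
    (hpm : ∀ k, IsLittleOp μ (fun n ω => err PX N O η (fun θ => θ.pi c) k n ω
        * err PX N O η Nuisance.mu0 k n ω) fun n => (n : ℝ) ^ (-(1 / 2) : ℝ)) :
    IsLittleOp μ (fun n ω => ‖√(n : ℝ) * crossAvg N O
      (fun θ o => phiNu0MR c ρ θ o - phiNu0MR c ρ η o) n ω‖ₑ) fun _ => 1 := by
  have := D.isProbabilityMeasure
  have H := D.nuisance
  have hr := rhoC_pos hρ c
  set r := rhoC c ρ with hr_def
  simp only [phiNu0MR_eq, ← hr_def]
  obtain ⟨C, hC, h⟩ := exists_mr_bounds hr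
  have hB0 := abs_nonneg B
  refine isLittleOp_crossAvg_bivFamily H (fun θ hθ => hθ.mu0) (measurable_mr r).1
    (measurable_mr r).2.1 (measurable_mr r).2.2 Obs.measurable_Y (H.isTrue_mr hr hB)
    D.measurable_sample D.indep D.law
    D.measurable_fit D.measurable_fit.joint.2.2.2.1 D.law_X D.e_cons D.pi_cons
    hmc D.e_pi hem D.pi_pi (v := fun θ => θ.pi c) (Or.inl rfl) hpm
    (W := fun o => 1 + |B| + |o.Y|) ((memLp_const (1 + |B|)).add H.memLp_Y.abs)
    (measurable_const.add Obs.measurable_Y.abs) ?_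
    (Good := fun M θ => BoundedPropensity Q M θ ∧
      (∀ x, θ.pi1 x ∈ Set.Icc (0 : ℝ) 1) ∧ True) (fun _ _ h => h.1)
    (D.exists_good (p := fun _ => True) fun _ _ _ => trivial)
    fun M => ⟨2 * (C * (1 + |B|)), by positivity, fun θ hθ hM => ?_⟩
  · filter_upwards [hB] with o ho
    have := abs_sub o.Y (η.mu0 o.X)
    have h2 := le_abs_self B
    rcases o.zz_eq with h | h
    · rw [h]
      simp only [sub_zero, one_mul]
      linarith [abs_nonneg o.Y]
    · rw [h]
      simp only [sub_self, zero_mul, abs_zero]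
      linarith [abs_nonneg o.Y]
  · filter_upwards [hB, H.pi_mem] with o ho hp' p q m m' hp hq hm hm'
    rw [← hm] at ho
    rw [← hp] at hp'
    have hq' : q ∈ Set.Icc (0 : ℝ) 1 := hq ▸ Nuisance.pi_mem_Icc (hM.2.1 o.X) c
    have hg : gap (fun θ => θ.pi c) η θ o = q - p := by rw [gap, hq, hp]
    have hx1 := abs_sub_le_one_of_mem hp' hq'
    rw [hg]
    obtain ⟨b1, b2, b3, b4, -⟩ := h p hp' q hq'
    obtain ⟨b1', b2', -, -, b5'⟩ := h q hq' p hp'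
    have hm0 : |m| ≤ |B| := ho.trans (le_abs_self B)
    rw [mrEpsPi_eq hr hp', mrEpsPi_eq hr hq']
    have ef : ∀ p m, p * mrMean r p m = mrEpsMu r p * m := fun p m => by
      unfold mrMean mrEpsMu; ring
    rw [ef, ef]
    set kp := r / ((r - 1) * p + 1) ^ 2
    set kq := r / ((r - 1) * q + 1) ^ 2
    set x := |q - p| with hx
    set y := |m' - m| with hy
    have hx0 : 0 ≤ x := abs_nonneg _
    have hy0 : 0 ≤ y := abs_nonneg _
    have hCB : 0 ≤ C * |B| := by positivity
    have prod : ∀ {u v : ℝ}, |v| ≤ C → |v - u| ≤ C * x → |v * m' - u * m| ≤ 2 * (C * (1 + |B|)) * (x + y) := by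
      intro u v h1 h2
      have e : v * m' - u * m = v * (m' - m) + (v - u) * m := by ring
      rw [e]
      refine (abs_add_le _ _).trans ?_
      rw [abs_mul, abs_mul]
      have t1 : |v| * |m' - m| ≤ C * y := mul_le_mul_of_nonneg_right h1 hy0
      have t2 : |v - u| * |m| ≤ C * x * |B| := mul_le_mul h2 hm0 (abs_nonneg _) (by positivity)
      nlinarith [mul_nonneg hC hx0, mul_nonneg hC hy0, mul_nonneg hCB hx0, mul_nonneg hCB hy0]
    refine ⟨hq', ?_, by linarith, by linarith, prod b2' b3, ?_, prod b1' b4, ?_⟩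
    · rw [abs_mul]
      have : |kp| * |m| ≤ C * |B| := mul_le_mul b2 hm0 (abs_nonneg _) hC
      linarith
    · rw [min_eq_right hx1]
      have : 0 ≤ min 1 y := le_min zero_le_one hy0
      have h3 : C * x ≤ 2 * (C * (1 + |B|)) * x := mul_le_mul_of_nonneg_right (by linarith) hx0
      have h4 : 0 ≤ 2 * (C * (1 + |B|)) * min 1 y := by positivity
      linarith
    -- Expansion around the estimate `(q, m')`: a second-order term in `π_c` times `m'`, plus a
    -- cross term.
    · have e : mrEpsMu r p * m - mrEpsMu r q * m' - kq * m' * (p - q) - mrEpsMu r q * (m - m')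
          = (mrEpsMu r p - mrEpsMu r q - kq * (p - q)) * m'
            + (mrEpsMu r p - mrEpsMu r q) * (m - m') := by ring
      rw [e]
      refine (abs_add_le _ _).trans ?_
      rw [abs_mul, abs_mul]
      -- The estimate of `μ₀` is not bounded; the excess `y` over the bound for the truth gives `x²
      -- y ≤ x y`, which the cross term absorbs.
      have hm'' : |m'| ≤ |B| + y := by
        have := abs_sub_abs_le_abs_sub m' m
        linarith
      have hxx : (p - q) ^ 2 = x * x := by rw [hx, ← sq, sq_abs]; ring
      rw [hxx] at b5'
      have t1 : |mrEpsMu r p - mrEpsMu r q - kq * (p - q)| * |m'| ≤ C * (x * x) * (|B| + y) :=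
        mul_le_mul b5' hm'' (abs_nonneg _) (by positivity)
      have t2 : |mrEpsMu r p - mrEpsMu r q| * |m - m'| ≤ C * x * y := by
        rw [abs_sub_comm _ (mrEpsMu r q), abs_sub_comm m m']
        exact mul_le_mul_of_nonneg_right b4 hy0
      have t3 : C * (x * x) * y ≤ C * (x * y) := by
        have : x * x * y ≤ x * y := by
          have := mul_le_mul_of_nonneg_right hx1 (mul_nonneg hx0 hy0); linarith
        nlinarith
      have p1 : 0 ≤ C * (x * x) := by positivity
      have p2 : 0 ≤ C * |B| * (x * y) := by positivity
      have p3 : 0 ≤ C * |B| * (x * x) := by positivity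
      linarith

/-! Generalized odds ratio -/

theorem measurable_gor (r l h : ℝ) : (Measurable fun x : ℝ × ℝ => gorEpsPi r l h x.1 x.2) ∧
    (Measurable fun x : ℝ × ℝ => gorEpsMu r l h x.1 x.2) ∧
    Measurable fun x : ℝ × ℝ => x.1 * gorMean r l h x.1 x.2 := by
  have hα : Measurable fun x : ℝ × ℝ => gorAlpha r l h x.1 x.2 := by unfold gorAlpha; fun_prop
  have hβ : Measurable fun x : ℝ × ℝ => gorBeta r l h x.1 x.2 := by
    unfold gorBeta; exact Measurable.sqrt (by fun_prop)
  unfold gorEpsPi gorEpsMu gorMean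
  by_cases hr : r = 1
  · simp only [if_pos hr]
    exact ⟨by fun_prop, by fun_prop, by fun_prop⟩
  · simp only [if_neg hr]
    exact ⟨by fun_prop, by fun_prop, by fun_prop⟩

/-- Stated for a general law, so that it applies both to `Q` and to the tilted laws. -/
theorem mem_Icc_of_orth_control {ν : Measure (Obs 𝒳)} [IsFiniteMeasure ν] {m : Obs 𝒳 → ℝ}
    (hm : Measurable[Obs.sigmaX] m) (hYi : Integrable Obs.Y ν)
    (ho : Orth ν fun o => (1 - o.zz) * (o.Y - m o))
    (hpos : ∀ᵐ o ∂ν, 0 < ν[fun o => 1 - o.zz | Obs.sigmaX] o) {l h : ℝ}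
    (hY : ∀ᵐ o ∂ν, o.Z = false → o.Y ∈ Set.Icc l h) : ∀ᵐ o ∂ν, m o ∈ Set.Icc l h := by
  have hi := Integrable.one_sub_zz_mul hYi
  have hz : ∀ᵐ o ∂ν, o.zz = 1 ∨ o.zz = 0 ∧ o.Y ∈ Set.Icc l h := by
    filter_upwards [hY] with o ho
    by_cases hZ : o.Z = true
    · left; simp [Obs.zz, hZ]
    · right; exact ⟨by simp [Obs.zz, hZ], ho (by simpa using hZ)⟩
  filter_upwards [ho.ae_le_of_le hm integrable_one_sub_zz hi hpos (a := l)
      (hz.mono fun o ho => by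
        rcases ho with h | ⟨h, h'⟩ <;> rw [h] <;> simp; exact h'.1),
    ho.ae_ge_of_ge hm integrable_one_sub_zz hi hpos (a := h)
      (hz.mono fun o ho => by
        rcases ho with h | ⟨h, h'⟩ <;> rw [h] <;> simp; exact h'.2)]
    with o h1 h2 using ⟨h1, h2⟩

theorem IsObsNuisance.mu0_mem [IsFiniteMeasure Q] (H : IsObsNuisance Q c ε η) {l h : ℝ}
    (hY : ∀ᵐ o ∂Q, o.Z = false → o.Y ∈ Set.Icc l h) : ∀ᵐ o ∂Q, η.mu0 o.X ∈ Set.Icc l h :=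
  mem_Icc_of_orth_control (measurable_comp_X H.measurable_mu0) (H.memLp_Y.integrable one_le_two)
    H.orth_mu0 H.condExp_one_sub_zz_pos' hY

theorem IsObsNuisance.isTrue_gor [IsFiniteMeasure Q] (H : IsObsNuisance Q c ε η) {r l h : ℝ}
    (hr : 0 < r) (hlh : l < h) (hY : ∀ᵐ o ∂Q, o.Z = false → o.Y ∈ Set.Icc l h) :
    (bivFamily c Nuisance.mu0 (gorEpsPi r l h) (gorEpsMu r l h)
      fun p m => p * gorMean r l h p m).IsTrue Q ε (Obs.ind c) Obs.Y η := by
  obtain ⟨C, hC, hb⟩ := exists_gor_bounds hr hlh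
  -- At this corner `p · gorMean` vanishes, so a bound on increments bounds the function itself.
  have h0 : ((0 : ℝ), l) ∈ Set.Icc (0 : ℝ) 1 ×ˢ Set.Icc l h :=
    ⟨⟨le_rfl, zero_le_one⟩, ⟨le_rfl, hlh.le⟩⟩
  refine H.isTrue_bivFamily (fun θ hθ => hθ.mu0) (measurable_gor r l h).1 (measurable_gor r l h).2.1
    (measurable_gor r l h).2.2 H.orth_mu0 (C := C * (1 + (1 + (h - l)))) ?_
  filter_upwards [H.mu0_mem hY, H.pi_mem] with o hm hp
  obtain ⟨b1, b2, -, -, b5, -⟩ := hb 0 l _ _ h0 ⟨hp, hm⟩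
  obtain ⟨b1, b2, -⟩ := hb _ _ 0 l ⟨hp, hm⟩ h0
  have hC' : C ≤ C * (1 + (1 + (h - l))) := le_mul_of_one_le_right hC (by linarith)
  refine ⟨b1.trans hC', b2.trans hC', ?_⟩
  simp only [zero_mul, sub_zero] at b5
  refine b5.trans (mul_le_mul_of_nonneg_left ?_ hC)
  have t1 : |η.pi c o.X| ≤ 1 := abs_le.2 ⟨by linarith [hp.1], hp.2⟩
  have t2 : |η.mu0 o.X - l| ≤ h - l := abs_le.2 ⟨by linarith [hm.1], by linarith [hm.2]⟩
  exact (add_le_add t1 t2).trans (by linarith)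

theorem le_mul_min_one {y H : ℝ} (hy : 0 ≤ y) (hH : 0 ≤ H) (h : y ≤ H) : y ≤ (1 + H) * min 1 y := by
  rcases le_total 1 y with h1 | h1
  · rw [min_eq_left h1]; linarith
  · rw [min_eq_right h1]; nlinarith

/-- Outcomes, regression and estimates all lie in `[l, h]`, so the dominating weight `W` can be
constant. Curvature in both variables brings in the squared errors of `π_c` and `μ₀`, whence the two
quarter rates. -/
theorem SampleSetup.crossAvg_phiNu0GOR (D : SampleSetup μ N O Q PX η ε c) {ρ l h : ℝ} (hρ : 0 < ρ)
    (hlh : l < h) (hY : ∀ᵐ o ∂Q, o.Z = false → o.Y ∈ Set.Icc l h)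
    (hm0 : ∀ n k data x, (N n k data).mu0 x ∈ Set.Icc l h)
    (hmc : ∀ k, IsLittleOp μ (err PX N O η Nuisance.mu0 k) fun _ => 1)
    (hem : ∀ k, IsLittleOp μ (fun n ω => err PX N O η Nuisance.e1 k n ω
        * err PX N O η Nuisance.mu0 k n ω) fun n => (n : ℝ) ^ (-(1 / 2) : ℝ))
    (hmm : ∀ k, IsLittleOp μ (fun n ω => err PX N O η Nuisance.mu0 k n ω
        * err PX N O η Nuisance.mu0 k n ω) fun n => (n : ℝ) ^ (-(1 / 2) : ℝ)) :
    IsLittleOp μ (fun n ω => ‖√(n : ℝ) * crossAvg N O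
      (fun θ o => phiNu0GOR c ρ l h θ o - phiNu0GOR c ρ l h η o) n ω‖ₑ) fun _ => 1 := by
  have := D.isProbabilityMeasure
  have H := D.nuisance
  have hr := rhoC_pos hρ c
  set r := rhoC c ρ with hr_def
  simp only [phiNu0GOR_eq, ← hr_def]
  obtain ⟨C, hC, hb⟩ := exists_gor_bounds hr hlh
  set T := |l| + |h| with hT
  refine isLittleOp_crossAvg_bivFamily H (fun θ hθ => hθ.mu0) (measurable_gor r l h).1
    (measurable_gor r l h).2.1 (measurable_gor r l h).2.2 Obs.measurable_Y (H.isTrue_gor hr hlh hY)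
    D.measurable_sample D.indep D.law
    D.measurable_fit D.measurable_fit.joint.2.2.2.1 D.law_X D.e_cons D.pi_cons
    hmc D.e_pi hem D.pi_pi (v := Nuisance.mu0) (Or.inr rfl) hmm
    (W := fun o => 1 + (h - l)) (memLp_const _) measurable_const ?_
    (Good := fun M θ => BoundedPropensity Q M θ ∧
      (∀ x, θ.pi1 x ∈ Set.Icc (0 : ℝ) 1) ∧ ∀ x, θ.mu0 x ∈ Set.Icc l h) (fun _ _ h => h.1)
    (D.exists_good (p := fun θ => ∀ x, θ.mu0 x ∈ Set.Icc l h) hm0)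
    fun M => ⟨C * (1 + (h - l)), mul_nonneg hC (by linarith), fun θ hθ hM => ?_⟩
  · filter_upwards [hY, H.mu0_mem hY] with o h1 h2
    by_cases hZ : o.Z = true
    · simp only [Obs.zz, hZ, if_true, sub_self, zero_mul, abs_zero]; linarith
    · have h3 := h1 (by simpa using hZ)
      have : |o.Y - η.mu0 o.X| ≤ h - l :=
        abs_le.2 ⟨by linarith [h3.1, h2.2], by linarith [h3.2, h2.1]⟩
      simpa [Obs.zz, hZ] using this
  · filter_upwards [H.mu0_mem hY, H.pi_mem] with o hmm' hp' p q m m' hp hq hm hm'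
    rw [← hm] at hmm'
    rw [← hp] at hp'
    have hq' : q ∈ Set.Icc (0 : ℝ) 1 := hq ▸ Nuisance.pi_mem_Icc (hM.2.1 o.X) c
    have hmm'' : m' ∈ Set.Icc l h := hm' ▸ hM.2.2 o.X
    have hg : gap Nuisance.mu0 η θ o = m' - m := by rw [gap, hm, hm']
    have hx1 := abs_sub_le_one_of_mem hp' hq'
    have hy1 : |m' - m| ≤ h - l :=
      abs_le.2 ⟨by linarith [hmm'.2, hmm''.1], by linarith [hmm'.1, hmm''.2]⟩
    rw [hg]
    obtain ⟨b1, b2, b3, b4, b5, -⟩ := hb p m q m' ⟨hp', hmm'⟩ ⟨hq', hmm''⟩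
    -- The roles are exchanged: the remainder in `estimate_bounds` is expanded around the estimate,
    -- because the score carries the estimated weights.
    obtain ⟨-, b2', -, -, -, b6⟩ := hb q m' p m ⟨hq', hmm''⟩ ⟨hp', hmm'⟩
    have hC' : C ≤ C * (1 + (h - l)) := le_mul_of_one_le_right hC (by linarith)
    have hC'' : 0 ≤ C * (h - l) := mul_nonneg hC (by linarith)
    refine ⟨hq', b1.trans hC', b2.trans hC', b2'.trans hC',
      b3.trans (mul_le_mul_of_nonneg_right hC' (by positivity)), b4.trans ?_,
      b5.trans (mul_le_mul_of_nonneg_right hC' (by positivity)), b6.trans ?_⟩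
    · rw [min_eq_right hx1, mul_assoc]
      refine mul_le_mul_of_nonneg_left ?_ hC
      have := le_mul_min_one (abs_nonneg (m' - m)) (by linarith) hy1
      have h2 : 0 ≤ (h - l) * |q - p| := mul_nonneg (by linarith) (abs_nonneg _)
      nlinarith
    · refine (mul_le_mul_of_nonneg_right hC' (by positivity)).trans (le_of_eq ?_)
      rw [abs_mul_abs_self, abs_mul_abs_self]; ring

end Instances

/-! ### Standardized mean difference -/

section SMD
variable {𝒳 : Type*}

/-- The family for `ϑ`. -/
abbrev thetaFamily (c : Bool) (κ : ℝ) : ScoreFamily 𝒳 :=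
  bivFamily c Nuisance.sigma2 (fun q s => thetaK' κ q * √s) (fun q s => thetaK κ q * (1 / (2 * √s)))
    fun q s => thetaK κ q * √s

/-- The control outcome is the squared deviation from the regression `θ.mu0` at which the score is
evaluated, so it depends on the nuisance value. For the stratum `c = false`, the residual of `C` and
the derivative of `thetaK` both change sign. -/
theorem phiTheta_eq (c : Bool) (κ : ℝ) (θ : Nuisance 𝒳) (o : Obs 𝒳) :
    phiTheta κ θ o = (thetaFamily c κ).score (Obs.ind c) (fun o => (o.Y - θ.mu0 o.X) ^ 2) θ o := by
  simp only [phiTheta, ScoreFamily.score, drScore, bivFamily, Nuisance.e0, theta_eq,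
    thetaDotSigma_eq, thetaDotPi_eq]
  cases c
  · have h1 : Nuisance.pi θ false o.X = 1 - θ.pi1 o.X := by simp [Nuisance.pi]
    have h2 : Obs.ind false o = 1 - Obs.ind true o := by
      unfold Obs.ind; cases o.S <;> simp
    rw [h1, h2, thetaK'_symm, thetaK_symm]
    ring
  · have h1 : Nuisance.pi θ true o.X = θ.pi1 o.X := by simp [Nuisance.pi]
    rw [h1]; ring

/-- Principal ignorability is the mean ratio model with ratio one, so its estimation error and
gradient need no separate treatment. -/
theorem phiNu0PI_eq (c : Bool) (θ : Nuisance 𝒳) (o : Obs 𝒳) :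
    phiNu0PI c θ o = phiNu0MR c 1 θ o := by
  have h : rhoC c 1 = 1 := by cases c <;> simp [rhoC]
  simp [phiNu0PI, phiNu0MR, h, mrEpsMu, mrEpsPi, mrMean, mrGamma]

variable [MeasurableSpace 𝒳]

theorem measurable_theta (κ : ℝ) : (Measurable fun x : ℝ × ℝ => thetaK' κ x.1 * √x.2) ∧
    (Measurable fun x : ℝ × ℝ => thetaK κ x.1 * (1 / (2 * √x.2))) ∧
    Measurable fun x : ℝ × ℝ => thetaK κ x.1 * √x.2 := by
  have h1 : Measurable fun x : ℝ × ℝ => √x.2 := measurable_snd.sqrt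
  have h2 : Measurable fun x : ℝ × ℝ => thetaK κ x.1 := by
    unfold thetaK
    exact Measurable.div (by fun_prop) (Measurable.sqrt (by fun_prop))
  have h3 : Measurable fun x : ℝ × ℝ => thetaK' κ x.1 := by
    unfold thetaK'
    exact Measurable.div (by fun_prop) (measurable_const.mul (Measurable.pow_const (by fun_prop) _))
  exact ⟨h3.mul h1, h2.mul (measurable_const.div (measurable_const.mul h1)), h2.mul h1⟩

variable {Ω : Type*} [MeasurableSpace Ω] {μ : Measure Ω} [IsProbabilityMeasure μ]
  {K : ℕ} {F : CrossFitting K} {N : NuisanceEstimator 𝒳 F} {O : ℕ → Ω → Obs 𝒳}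
  {Q : Measure (Obs 𝒳)} {PX : Measure 𝒳} {η : Nuisance 𝒳} {ε : ℝ} {c : Bool}

theorem IsObsNuisance.isTrue_theta [IsFiniteMeasure Q] (H : IsObsNuisance Q c ε η) (κ : ℝ)
    {s B : ℝ} (hs : 0 < s) (hsB : ∀ᵐ o ∂Q, s ≤ η.sigma2 o.X ∧ η.sigma2 o.X ≤ B) :
    (thetaFamily c κ).IsTrue Q ε (Obs.ind c) (fun o => (o.Y - η.mu0 o.X) ^ 2) η := by
  obtain ⟨C, hC, hb⟩ := exists_theta_bounds κ
  refine H.isTrue_bivFamily (fun θ hθ => hθ.sigma2) (measurable_theta κ).1 (measurable_theta κ).2.1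
    (measurable_theta κ).2.2 H.orth_sigma2 (C := C * (√B + 1 / √s)) ?_
  filter_upwards [hsB, H.pi_mem] with o h hp
  obtain ⟨b1, b2, -⟩ := hb _ hp _ hp
  have h0 : 0 < √s := Real.sqrt_pos.2 hs
  have h1 : √s ≤ √(η.sigma2 o.X) := Real.sqrt_le_sqrt h.1
  have h2 : √(η.sigma2 o.X) ≤ √B := Real.sqrt_le_sqrt h.2
  have h3 : 1 / (2 * √(η.sigma2 o.X)) ≤ 1 / √s := one_div_le_one_div_of_le h0 (by linarith)
  have h4 : 0 < 1 / √s := by positivity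
  have h5 := Real.sqrt_nonneg B
  refine ⟨?_, ?_, ?_⟩
  · rw [abs_mul, abs_of_nonneg (Real.sqrt_nonneg _)]
    exact mul_le_mul b2 (by linarith) (Real.sqrt_nonneg _) hC
  · rw [abs_mul, abs_of_nonneg (by positivity : 0 ≤ 1 / (2 * √(η.sigma2 o.X)))]
    exact mul_le_mul b1 (by linarith) (by positivity) hC
  · rw [abs_mul, abs_of_nonneg (Real.sqrt_nonneg _)]
    exact mul_le_mul b1 (by linarith) (Real.sqrt_nonneg _) hC

/-- The variance values of `θ` are at least `1 / M`. -/
def BoundedVariance (Q : Measure (Obs 𝒳)) (M : ℝ) (θ : Nuisance 𝒳) : Prop :=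
  ∀ᵐ o ∂Q, 0 < θ.sigma2 o.X ∧ 1 ≤ M * θ.sigma2 o.X

theorem SampleSetup.exists_good_variance (D : SampleSetup μ N O Q PX η ε c)
    (hinv : ∀ k, IsBoundedOp μ (invSup PX N O Nuisance.sigma2 k)) (k : Fin K) (δ : ℝ≥0∞)
    (hδ : 0 < δ) : ∃ M, ∀ᶠ n in atTop, μ {ω | ¬ (BoundedPropensity Q M (fit N O n k ω) ∧
      (∀ x, (fit N O n k ω).pi1 x ∈ Set.Icc (0 : ℝ) 1) ∧ BoundedVariance Q M (fit N O n k ω))} ≤ δ := by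
  have h := exists_good_and (D.propensity k) ((hinv k).good
    (G := fun M n ω => BoundedVariance Q M (fit N O n k ω))
    fun M n ω h => one_le_mul_of_invSup_le D.law_X h)
  obtain ⟨M, hM⟩ := h δ hδ
  refine ⟨M, (hM M le_rfl).mono fun n hn => (measure_mono ?_).trans hn⟩
  exact fun ω hω hcon => hω ⟨hcon.1, fun x => D.pi_mem n k _ x, hcon.2⟩

theorem min_le_mul_min_one {A B y z : ℝ} (hA : 0 ≤ A) (hB : 0 ≤ B) (hy : 0 ≤ y) (h1 : z ≤ A * y) (h2 : z ≤ B) :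
    z ≤ (A + B) * min 1 y := by
  rcases le_total 1 y with h | h
  · rw [min_eq_left h]; linarith
  · rw [min_eq_right h]; nlinarith

/-- Both variances are at least `d`, but only the true one, `m`, is bounded above; the remainder is
expanded around the estimate `(q, m')`. -/
theorem exists_theta_family_bounds (κ : ℝ) {d B : ℝ} (hd0 : 0 < d) : ∃ C : ℝ, 0 ≤ C ∧
    ∀ p ∈ Set.Icc (0 : ℝ) 1, ∀ q ∈ Set.Icc (0 : ℝ) 1, ∀ m m' : ℝ, d ≤ m → m ≤ B → d ≤ m' →
      |thetaK' κ p * √m| ≤ C ∧ |thetaK κ p * (1 / (2 * √m))| ≤ C ∧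
      |thetaK κ q * (1 / (2 * √m'))| ≤ C ∧
      |thetaK' κ q * √m' - thetaK' κ p * √m| ≤ C * (|q - p| + |m' - m|) ∧
      |thetaK κ q * (1 / (2 * √m')) - thetaK κ p * (1 / (2 * √m))|
        ≤ C * (min 1 |q - p| + min 1 |m' - m|) ∧
      |thetaK κ q * √m' - thetaK κ p * √m| ≤ C * (|q - p| + |m' - m|) ∧
      |thetaK κ p * √m - thetaK κ q * √m' - thetaK' κ q * √m' * (p - q)
          - thetaK κ q * (1 / (2 * √m')) * (m - m')|
        ≤ C * (|q - p| * |q - p| + |m' - m| * |m' - m|) := by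
  obtain ⟨C, hC, hb⟩ := exists_theta_bounds κ
  have hsd : 0 < √d := Real.sqrt_pos.2 hd0
  obtain ⟨A, hA⟩ : ∃ A, A = √B + 1 / √d + 1 / (√d * d) + 1 / (2 * √d * d) := ⟨_, rfl⟩
  have hB0 := Real.sqrt_nonneg B
  have q1 : 0 < 1 / √d := by positivity
  have q2 : 0 < 1 / (√d * d) := by positivity
  have q3 : 0 < 1 / (2 * √d * d) := by positivity
  have hA0 : 0 < A := by rw [hA]; positivity
  refine ⟨C * (2 * A), by positivity, fun p hp' q hq' m m' hdm hmB hdm' => ?_⟩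
  have hx1 := abs_sub_le_one_of_mem hp' hq'
  obtain ⟨b1, b2, b3, b4, -⟩ := hb p hp' q hq'
  obtain ⟨b1', b2', -, -, b5'⟩ := hb q hq' p hp'
  have hsm : √m ≤ √B := Real.sqrt_le_sqrt hmB
  have hsm0 := Real.sqrt_nonneg m
  have half : ∀ {u : ℝ}, d ≤ u → 0 ≤ 1 / (2 * √u) ∧ 1 / (2 * √u) ≤ 1 / √d := fun {u} hu =>
    ⟨by positivity, one_div_le_one_div_of_le hsd (by linarith [Real.sqrt_le_sqrt hu])⟩
  have l1 := abs_sqrt_sub_le hd0 hdm (hd0.le.trans hdm')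
  have l2 := abs_sqrt_remainder_le hd0 hdm' (hd0.le.trans hdm)
  have l3 := abs_inv_sqrt_sub_le hd0 hdm hdm'
  have hx0 : 0 ≤ |q - p| := abs_nonneg _
  have hy0 : 0 ≤ |m' - m| := abs_nonneg _
  have hxx : (p - q) ^ 2 = |q - p| * |q - p| := by rw [← sq, sq_abs]; ring
  have hyy : (m - m') ^ 2 = |m' - m| * |m' - m| := by rw [← sq, sq_abs]; ring
  have es : |m - m'| = |m' - m| := abs_sub_comm _ _
  have ep : |p - q| = |q - p| := abs_sub_comm _ _
  rw [hxx] at b5'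
  rw [hyy] at l2
  generalize |q - p| = x at *
  generalize |m' - m| = y at *
  have bound : ∀ {u v : ℝ}, |u| ≤ C → 0 ≤ v → v ≤ A → |u * v| ≤ C * (2 * A) := by
    intro u v hu hv hvA
    rw [abs_mul, abs_of_nonneg hv]
    exact mul_le_mul hu (by linarith) hv hC
  have prod : ∀ {u v : ℝ}, |v| ≤ C → |v - u| ≤ C * x → |v * √m' - u * √m| ≤ C * (2 * A) * (x + y) := by
    intro u v h1 h2
    have e : v * √m' - u * √m = v * (√m' - √m) + (v - u) * √m := by ring
    rw [e]
    refine (abs_add_le _ _).trans ?_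
    rw [abs_mul, abs_mul, abs_of_nonneg hsm0]
    have t1 : |v| * |√m' - √m| ≤ C * (1 / √d * y) := mul_le_mul h1 l1 (abs_nonneg _) hC
    have t2 : |v - u| * √m ≤ C * x * √B := mul_le_mul h2 hsm hsm0 (by positivity)
    have t3 : 1 / √d * y ≤ A * y := mul_le_mul_of_nonneg_right (by linarith) hy0
    have t4 : x * √B ≤ x * A := mul_le_mul_of_nonneg_left (by linarith) hx0
    have t5 : 1 / √d * y + x * √B ≤ 2 * A * (x + y) := by
      have : 0 ≤ A * (x + y) := by positivity
      linarith
    have := mul_le_mul_of_nonneg_left t5 hC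
    linarith
  refine ⟨bound b2 hsm0 (by linarith), bound b1 (half hdm).1 (by linarith [(half hdm).2]),
    bound b1' (half hdm').1 (by linarith [(half hdm').2]), prod b2' b3, ?_, prod b1' b4, ?_⟩
  · have e : thetaK κ q * (1 / (2 * √m')) - thetaK κ p * (1 / (2 * √m))
        = thetaK κ q * (1 / (2 * √m') - 1 / (2 * √m)) + (thetaK κ q - thetaK κ p) * (1 / (2 * √m)) := by
      ring
    rw [e, min_eq_right hx1]
    refine (abs_add_le _ _).trans ?_
    rw [abs_mul, abs_mul, abs_of_nonneg (half hdm).1]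
    have t0 := min_le_mul_min_one q2.le q1.le hy0 l3.1 l3.2
    have t1 : |thetaK κ q| * |1 / (2 * √m') - 1 / (2 * √m)|
        ≤ C * ((1 / (√d * d) + 1 / √d) * min 1 y) := mul_le_mul b1' t0 (abs_nonneg _) hC
    have t2 : |thetaK κ q - thetaK κ p| * (1 / (2 * √m)) ≤ C * x * (1 / √d) :=
      mul_le_mul b4 (half hdm).2 (half hdm).1 (by positivity)
    have hmy : 0 ≤ min 1 y := le_min zero_le_one hy0
    have t3 : (1 / (√d * d) + 1 / √d) * min 1 y ≤ 2 * A * min 1 y :=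
      mul_le_mul_of_nonneg_right (by linarith) hmy
    have t4 : x * (1 / √d) ≤ x * (2 * A) := mul_le_mul_of_nonneg_left (by linarith) hx0
    have := mul_le_mul_of_nonneg_left (add_le_add t3 t4) hC
    linarith
  -- The remainder of a product: the remainder of each factor times the other factor, and the
  -- product of the two increments, which is split into squares by `2 x y ≤ x² + y²`.
  · have e : thetaK κ p * √m - thetaK κ q * √m' - thetaK' κ q * √m' * (p - q)
        - thetaK κ q * (1 / (2 * √m')) * (m - m')
        = (thetaK κ p - thetaK κ q - thetaK' κ q * (p - q)) * √m
          + thetaK κ q * (√m - √m' - 1 / (2 * √m') * (m - m'))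
          + -(thetaK' κ q * (p - q) * (√m' - √m)) := by ring
    rw [e]
    refine (abs_add_three _ _ _).trans ?_
    rw [abs_neg, abs_mul, abs_mul, abs_mul, abs_mul, abs_of_nonneg hsm0, ep]
    have t1 := mul_le_mul b5' hsm hsm0 (by positivity : 0 ≤ C * (x * x))
    have t2 := mul_le_mul b1' l2 (abs_nonneg _) hC
    have t3 : |thetaK' κ q| * x * |√m' - √m| ≤ C * x * (1 / √d * y) :=
      mul_le_mul (mul_le_mul_of_nonneg_right b2' hx0) l1 (abs_nonneg _) (by positivity)
    have t4 : x * y ≤ (x * x + y * y) / 2 := by nlinarith [sq_nonneg (x - y)]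
    have t5 : x * x * √B + 1 / (2 * √d * d) * (y * y) + 1 / √d * (x * y)
        ≤ 2 * A * (x * x + y * y) := by
      have u1 : x * x * √B ≤ x * x * A := mul_le_mul_of_nonneg_left (by linarith) (by positivity)
      have u2 : 1 / (2 * √d * d) * (y * y) ≤ A * (y * y) :=
        mul_le_mul_of_nonneg_right (by linarith) (by positivity)
      have u3 : 1 / √d * (x * y) ≤ A * ((x * x + y * y) / 2) :=
        mul_le_mul (by linarith) t4 (by positivity) (by positivity)
      have : 0 ≤ A * (x * x + y * y) := by positivity
      linarith
    have := mul_le_mul_of_nonneg_left t5 hC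
    linarith

/-- The outcome `(Y - μ₀)²` is kept at the true `μ₀`, so that it does not vary with the estimates
and the general theory applies. The effect of estimating `μ₀` is added in `crossAvg_phiTheta`. -/
theorem SampleSetup.crossAvg_thetaFamily (D : SampleSetup μ N O Q PX η ε c) (κ : ℝ)
    {s B : ℝ} (hs : 0 < s) (hsB : ∀ᵐ o ∂Q, s ≤ η.sigma2 o.X ∧ η.sigma2 o.X ≤ B)
    (hL4 : MemLp (fun o => (1 - o.zz) * ((o.Y - η.mu0 o.X) ^ 2 - η.sigma2 o.X)) 2 Q)
    (hinv : ∀ k, IsBoundedOp μ (invSup PX N O Nuisance.sigma2 k))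
    (hsc : ∀ k, IsLittleOp μ (err PX N O η Nuisance.sigma2 k) fun _ => 1)
    (hes : ∀ k, IsLittleOp μ (fun n ω => err PX N O η Nuisance.e1 k n ω
        * err PX N O η Nuisance.sigma2 k n ω) fun n => (n : ℝ) ^ (-(1 / 2) : ℝ))
    (hss : ∀ k, IsLittleOp μ (fun n ω => err PX N O η Nuisance.sigma2 k n ω
        * err PX N O η Nuisance.sigma2 k n ω) fun n => (n : ℝ) ^ (-(1 / 2) : ℝ)) :
    IsLittleOp μ (fun n ω => ‖√(n : ℝ) * crossAvg N O
      (fun θ o => (thetaFamily c κ).score (Obs.ind c) (fun o => (o.Y - η.mu0 o.X) ^ 2) θ o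
        - (thetaFamily c κ).score (Obs.ind c) (fun o => (o.Y - η.mu0 o.X) ^ 2) η o) n ω‖ₑ)
      fun _ => 1 := by
  have := D.isProbabilityMeasure
  have H := D.nuisance
  have mV0 : Measurable fun o : Obs 𝒳 => (o.Y - η.mu0 o.X) ^ 2 :=
    (Obs.measurable_Y.sub (H.measurable_mu0.comp Obs.measurable_X)).pow_const 2
  have mW : Measurable fun o : Obs 𝒳 =>
      1 + |(1 - o.zz) * ((o.Y - η.mu0 o.X) ^ 2 - η.sigma2 o.X)| :=
    measurable_const.add (((measurable_const.sub Obs.measurable_zz).mul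
      (mV0.sub (H.measurable_sigma2.comp Obs.measurable_X))).abs)
  have hW : MemLp (fun o : Obs 𝒳 =>
      1 + |(1 - o.zz) * ((o.Y - η.mu0 o.X) ^ 2 - η.sigma2 o.X)|) 2 Q :=
    (memLp_const (1 : ℝ)).add hL4.abs
  refine isLittleOp_crossAvg_bivFamily (w := Nuisance.sigma2) (a := fun q s => thetaK' κ q * √s)
    (b := fun q s => thetaK κ q * (1 / (2 * √s))) (f := fun q s => thetaK κ q * √s)
    (V0 := fun o => (o.Y - η.mu0 o.X) ^ 2) H (fun θ hθ => hθ.sigma2) (measurable_theta κ).1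
    (measurable_theta κ).2.1 (measurable_theta κ).2.2 mV0 (H.isTrue_theta κ hs hsB)
    D.measurable_sample D.indep D.law
    D.measurable_fit D.measurable_fit.joint.2.2.2.2 D.law_X D.e_cons D.pi_cons
    hsc D.e_pi hes D.pi_pi (v := Nuisance.sigma2) (Or.inr rfl) hss
    (W := fun o => 1 + |(1 - o.zz) * ((o.Y - η.mu0 o.X) ^ 2 - η.sigma2 o.X)|)
    hW mW (ae_of_all _ fun o => le_rfl)
    (Good := fun M θ => BoundedPropensity Q M θ ∧
      (∀ x, θ.pi1 x ∈ Set.Icc (0 : ℝ) 1) ∧ BoundedVariance Q M θ) (fun _ _ h => h.1)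
    (D.exists_good_variance hinv) fun M => ?_
  have hM0 := abs_nonneg M
  -- A common lower bound for the true variance and, on the good event, for the estimated one: `1 ≤
  -- M σ̃²` implies `σ̃² ≥ 1 / (|M| + 1)`.
  obtain ⟨C, hC, hb⟩ := exists_theta_family_bounds κ (B := B)
    (lt_min hs (by positivity : 0 < 1 / (|M| + 1)))
  refine ⟨C, hC, fun θ hθ hM => ?_⟩
  filter_upwards [hsB, H.pi_mem, hM.2.2] with o hso hp' hvo p q m m' hp hq hm hm'
  rw [← hm] at hso
  rw [← hp] at hp'
  rw [← hm'] at hvo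
  have hq' : q ∈ Set.Icc (0 : ℝ) 1 := hq ▸ Nuisance.pi_mem_Icc (hM.2.1 o.X) c
  have hg : gap Nuisance.sigma2 η θ o = m' - m := by rw [gap, hm, hm']
  rw [hg]
  refine ⟨hq', hb p hp' q hq' m m' ((min_le_left _ _).trans hso.1) hso.2 ?_⟩
  refine (min_le_right _ _).trans ?_
  rw [div_le_iff₀ (by positivity)]
  have := mul_le_mul_of_nonneg_right (le_abs_self M) hvo.1.le
  nlinarith [hvo.1, hvo.2]

/-- Conditional second moments bounded by `B`, in `ℝ≥0∞`. -/
theorem lintegral_mul_le_of_orth [IsFiniteMeasure Q] {w V s : Obs 𝒳 → ℝ}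
    (hw : ∀ o, 0 ≤ w o ∧ w o ≤ 1) (hV0 : ∀ o, 0 ≤ V o)
    (mw : Measurable w) (mV : Measurable V)
    (hV : Orth Q fun o => w o * (V o - s o)) {B : ℝ}
    (ms : Measurable s) (hs : ∀ᵐ o ∂Q, 0 ≤ s o ∧ s o ≤ B) {h : Obs 𝒳 → ℝ≥0∞}
    (mh : Measurable[Obs.sigmaX] h) :
    ∫⁻ o, ENNReal.ofReal (w o * V o) * h o ∂Q ≤ ENNReal.ofReal B * ∫⁻ o, h o ∂Q := by
  have mf : Measurable fun o => ENNReal.ofReal (w o * V o) := (mw.mul mV).ennreal_ofReal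
  set ν := Q.withDensity fun o => ENNReal.ofReal (w o * V o) with hν
  have mh' : Measurable h := mh.mono Obs.sigmaX_le le_rfl
  have iws : Integrable (fun o => w o * s o) Q := by
    refine Integrable.of_bound (mw.mul ms).aestronglyMeasurable B ?_
    filter_upwards [hs] with o ho
    rw [Real.norm_eq_abs, abs_of_nonneg (mul_nonneg (hw o).1 ho.1)]
    exact (mul_le_of_le_one_left ho.1 (hw o).2).trans ho.2
  have iwV : Integrable (fun o => w o * V o) Q :=
    (hV.integrable.add iws).congr (ae_of_all _ fun o => by simp only [Pi.add_apply]; ring)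
  -- On sets of covariates the measure with density `w V` is dominated by `B` times `Q`, because
  -- there `w V` may be replaced by `w s`. Comparing the trimmed measures covers every nonnegative
  -- `h` of the covariates, with no integrability assumption on `h`.
  have hle : ν.trim Obs.sigmaX_le ≤ ENNReal.ofReal B • Q.trim Obs.sigmaX_le := by
    refine Measure.le_iff.2 fun A hA => ?_
    have hA' := Obs.sigmaX_le _ hA
    rw [trim_measurableSet_eq _ hA, Measure.smul_apply, trim_measurableSet_eq _ hA, hν,
      withDensity_apply _ hA', smul_eq_mul]
    have h1 : ∫ o in A, w o * V o ∂Q = ∫ o in A, w o * s o ∂Q := by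
      have := hV.setIntegral_eq_zero Obs.sigmaX_le hA
      have e : ∫ o in A, w o * (V o - s o) ∂Q = ∫ o in A, w o * V o ∂Q - ∫ o in A, w o * s o ∂Q := by
        rw [← integral_sub iwV.integrableOn iws.integrableOn]
        exact integral_congr_ae (ae_of_all _ fun o => by simp only; ring)
      linarith
    rw [← ofReal_integral_eq_lintegral_ofReal iwV.integrableOn
      (ae_of_all _ fun o => mul_nonneg (hw o).1 (hV0 o)), h1,
      ofReal_integral_eq_lintegral_ofReal iws.integrableOn
      (ae_restrict_of_ae (hs.mono fun o ho => mul_nonneg (hw o).1 ho.1))]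
    calc _ ≤ ∫⁻ _ in A, ENNReal.ofReal B ∂Q := by
          refine lintegral_mono_ae (ae_restrict_of_ae (hs.mono fun o ho => ?_))
          exact ENNReal.ofReal_le_ofReal ((mul_le_of_le_one_left ho.1 (hw o).2).trans ho.2)
      _ = _ := by simp
  calc _ = ∫⁻ o, h o ∂ν := by
        rw [hν, lintegral_withDensity_eq_lintegral_mul _ mf mh']; rfl
    _ = ∫⁻ o, h o ∂(ν.trim Obs.sigmaX_le) := (lintegral_trim Obs.sigmaX_le mh).symm
    _ ≤ ∫⁻ o, h o ∂(ENNReal.ofReal B • Q.trim Obs.sigmaX_le) := lintegral_mono' hle le_rfl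
    _ = _ := by rw [lintegral_smul_measure, lintegral_trim Obs.sigmaX_le mh, smul_eq_mul]

end SMD

/-! ### Linearity of cross-fitted averages. -/

section Linear
variable {𝒳 Ω : Type*} {K : ℕ} {F : CrossFitting K} {N : NuisanceEstimator 𝒳 F} {O : ℕ → Ω → Obs 𝒳}

theorem crossAvg_add (ψ χ : Nuisance 𝒳 → Obs 𝒳 → ℝ) (n : ℕ) (ω : Ω) :
    crossAvg N O (fun θ o => ψ θ o + χ θ o) n ω = crossAvg N O ψ n ω + crossAvg N O χ n ω := by
  simp only [crossAvg, Finset.sum_add_distrib, add_div]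

theorem crossAvg_const_mul (a : ℝ) (ψ : Nuisance 𝒳 → Obs 𝒳 → ℝ) (n : ℕ) (ω : Ω) :
    crossAvg N O (fun θ o => a * ψ θ o) n ω = a * crossAvg N O ψ n ω := by
  simp only [crossAvg, ← Finset.mul_sum, mul_div_assoc]

theorem crossAvg_sub (ψ χ : Nuisance 𝒳 → Obs 𝒳 → ℝ) (n : ℕ) (ω : Ω) :
    crossAvg N O (fun θ o => ψ θ o - χ θ o) n ω = crossAvg N O ψ n ω - crossAvg N O χ n ω := by
  simp only [crossAvg, Finset.sum_sub_distrib, sub_div]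

variable [MeasurableSpace Ω] {μ : Measure Ω}

theorem isLittleOp_crossAvg_add {ψ χ : Nuisance 𝒳 → Obs 𝒳 → ℝ}
    (h1 : IsLittleOp μ (fun n ω => ‖√(n : ℝ) * crossAvg N O ψ n ω‖ₑ) fun _ => 1)
    (h2 : IsLittleOp μ (fun n ω => ‖√(n : ℝ) * crossAvg N O χ n ω‖ₑ) fun _ => 1) :
    IsLittleOp μ (fun n ω => ‖√(n : ℝ) * crossAvg N O (fun θ o => ψ θ o + χ θ o) n ω‖ₑ)
      fun _ => 1 :=
  (h1.add h2).mono fun n ω => by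
    rw [crossAvg_add, mul_add]
    exact enorm_add_le _ _

theorem isLittleOp_crossAvg_const_mul {ψ : Nuisance 𝒳 → Obs 𝒳 → ℝ} (a : ℝ)
    (h1 : IsLittleOp μ (fun n ω => ‖√(n : ℝ) * crossAvg N O ψ n ω‖ₑ) fun _ => 1) :
    IsLittleOp μ (fun n ω => ‖√(n : ℝ) * crossAvg N O (fun θ o => a * ψ θ o) n ω‖ₑ)
      fun _ => 1 :=
  (h1.const_mul (C := |a|)).mono fun n ω => by
    rw [crossAvg_const_mul, ← mul_assoc, mul_comm _ a, mul_assoc, enorm_mul, ← Real.norm_eq_abs,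
      ofReal_norm]

end Linear

/-! ### Estimation error for the standardized mean difference. -/

section Theta
variable {𝒳 : Type*}

/-- The weight of `(Y - μ₀)²` in `φ_ϑ`. -/
def thetaWeight (c : Bool) (κ : ℝ) (θ : Nuisance 𝒳) (o : Obs 𝒳) : ℝ :=
  thetaK κ (θ.pi c o.X) * (1 / (2 * √(θ.sigma2 o.X))) / (1 - θ.e1 o.X)

/-- With `δ` the error of `μ₀`, the estimated squared residual is `(Y - μ₀)² - 2 δ (Y - μ₀) + δ²`:
the fixed-outcome score, a cross term with conditional mean zero, and a squared error. -/
theorem phiTheta_sub_eq (c : Bool) (κ : ℝ) (η θ : Nuisance 𝒳) (o : Obs 𝒳) :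
    phiTheta κ θ o - phiTheta κ η o
      = ((thetaFamily c κ).score (Obs.ind c) (fun o => (o.Y - η.mu0 o.X) ^ 2) θ o
          - (thetaFamily c κ).score (Obs.ind c) (fun o => (o.Y - η.mu0 o.X) ^ 2) η o)
        + (thetaWeight c κ θ o * (-2 * gap Nuisance.mu0 η θ o) * ((1 - o.zz) * (o.Y - η.mu0 o.X))
          + thetaWeight c κ θ o * (1 - o.zz) * (gap Nuisance.mu0 η θ o * gap Nuisance.mu0 η θ o)) := by
  rw [phiTheta_eq c, phiTheta_eq c]
  simp only [ScoreFamily.score, drScore, bivFamily, thetaWeight, gap]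
  ring

variable [MeasurableSpace 𝒳] {Ω : Type*} [MeasurableSpace Ω] {μ : Measure Ω}
  [IsProbabilityMeasure μ]
  {K : ℕ} {F : CrossFitting K} {N : NuisanceEstimator 𝒳 F} {O : ℕ → Ω → Obs 𝒳}
  {Q : Measure (Obs 𝒳)} {PX : Measure 𝒳} {η : Nuisance 𝒳} {ε : ℝ} {c : Bool}

theorem measurable_thetaWeight {α : Type*} [MeasurableSpace α] (κ : ℝ) {p s e : α → ℝ}
    (hp : Measurable p) (hs : Measurable s) (he : Measurable e) :
    Measurable fun x => thetaK κ (p x) * (1 / (2 * √(s x))) / (1 - e x) :=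
  ((measurable_theta κ).2.1.comp (hp.prodMk hs)).div (measurable_const.sub he)

theorem exists_abs_thetaWeight_le (c : Bool) (κ M : ℝ) : ∃ A : ℝ, 0 < A ∧ ∀ (θ : Nuisance 𝒳),
    BoundedPropensity Q M θ → (∀ x, θ.pi1 x ∈ Set.Icc (0 : ℝ) 1) → BoundedVariance Q M θ →
    ∀ᵐ o ∂Q, |thetaWeight c κ θ o| ≤ A := by
  obtain ⟨C, hC, hb⟩ := exists_theta_bounds κ
  refine ⟨C * (1 + |M|) * |M| + 1, by positivity, fun θ h1 h2 h3 => ?_⟩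
  filter_upwards [h1, h3] with o c1 c3
  have hq := Nuisance.pi_mem_Icc (h2 o.X) c
  obtain ⟨b1, -⟩ := hb _ hq _ hq
  have ht : 0 < √(θ.sigma2 o.X) := Real.sqrt_pos.2 c3.1
  have hts := Real.sq_sqrt c3.1.le
  -- If `σ̃ ≥ 1` the bound is immediate; otherwise `σ̃² ≤ σ̃`, and `1 ≤ M σ̃²` gives `1 ≤ |M| σ̃`.
  have i1 : 1 / (2 * √(θ.sigma2 o.X)) ≤ 1 + |M| := by
    rw [div_le_iff₀ (by positivity)]
    have hM := mul_le_mul_of_nonneg_right (le_abs_self M) c3.1.le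
    rcases le_total 1 √(θ.sigma2 o.X) with h | h
    · nlinarith [abs_nonneg M]
    · have : √(θ.sigma2 o.X) ^ 2 ≤ √(θ.sigma2 o.X) := by nlinarith
      have := mul_le_mul_of_nonneg_left this (abs_nonneg M)
      nlinarith [abs_nonneg M]
  have hc1 : 0 < 1 - θ.e1 o.X := by linarith [c1.2.1]
  have i2 : 1 / (1 - θ.e1 o.X) ≤ |M| := by
    rw [div_le_iff₀ hc1]
    exact c1.2.2.2.trans (mul_le_mul_of_nonneg_right (le_abs_self M) hc1.le)
  rw [thetaWeight, div_eq_mul_one_div, abs_mul, abs_mul, abs_of_pos (by positivity : 0 < 1 / (1 - θ.e1 o.X)),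
    abs_of_pos (by positivity : 0 < 1 / (2 * √(θ.sigma2 o.X)))]
  have := mul_le_mul (mul_le_mul b1 i1 (by positivity) hC) i2 (by positivity) (by positivity)
  linarith

theorem lintegral_sq_gap_le (hQX : Q.map Obs.X = PX) (hN : N.IsMeasurable) (hη : η.IsMeasurable)
    (n : ℕ) (k : Fin K) (ω : Ω) :
    ∫⁻ o, ‖gap Nuisance.mu0 η (fit N O n k ω) o‖ₑ * ‖gap Nuisance.mu0 η (fit N O n k ω) o‖ₑ ∂Q
      ≤ err PX N O η Nuisance.mu0 k n ω * err PX N O η Nuisance.mu0 k n ω := by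
  have mg : Measurable (gap Nuisance.mu0 η (fit N O n k ω)) :=
    ((hN.fit n k ω).mu0.comp Obs.measurable_X).sub (hη.mu0.comp Obs.measurable_X)
  rw [← eLpNorm_gap_fit hN hQX hη (fun θ hθ => hθ.mu0) k n ω]
  exact lintegral_mul_le_eLpNorm mg mg

/-- The cross term has mean zero, and, since the conditional variance of `Y` is bounded, its second
moment is bounded by a multiple of the squared `L²` error of `μ₀`; so the `L²` criterion applies.
The squared error of `μ₀` is small in `L¹` at rate `n^{-1/2}`, and the `L¹` criterion applies
without centering. -/
theorem SampleSetup.crossAvg_phiTheta (D : SampleSetup μ N O Q PX η ε c) (κ : ℝ)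
    {s B : ℝ} (hs : 0 < s) (hsB : ∀ᵐ o ∂Q, s ≤ η.sigma2 o.X ∧ η.sigma2 o.X ≤ B)
    (hL4 : MemLp (fun o => (1 - o.zz) * ((o.Y - η.mu0 o.X) ^ 2 - η.sigma2 o.X)) 2 Q)
    (hinv : ∀ k, IsBoundedOp μ (invSup PX N O Nuisance.sigma2 k))
    (hsc : ∀ k, IsLittleOp μ (err PX N O η Nuisance.sigma2 k) fun _ => 1)
    (hes : ∀ k, IsLittleOp μ (fun n ω => err PX N O η Nuisance.e1 k n ω
        * err PX N O η Nuisance.sigma2 k n ω) fun n => (n : ℝ) ^ (-(1 / 2) : ℝ))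
    (hss : ∀ k, IsLittleOp μ (fun n ω => err PX N O η Nuisance.sigma2 k n ω
        * err PX N O η Nuisance.sigma2 k n ω) fun n => (n : ℝ) ^ (-(1 / 2) : ℝ))
    (hmm : ∀ k, IsLittleOp μ (fun n ω => err PX N O η Nuisance.mu0 k n ω
        * err PX N O η Nuisance.mu0 k n ω) fun n => (n : ℝ) ^ (-(1 / 2) : ℝ)) :
    IsLittleOp μ (fun n ω => ‖√(n : ℝ) * crossAvg N O
      (fun θ o => phiTheta κ θ o - phiTheta κ η o) n ω‖ₑ) fun _ => 1 := by
  have := D.isProbabilityMeasure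
  have H := D.nuisance
  have hη := H.isMeasurable
  have hN := D.measurable_fit
  simp only [phiTheta_sub_eq c κ η]
  have mD : FitMeasurable N (thetaWeight c κ) := fun n k =>
    measurable_thetaWeight κ (hN.joint.2.1 c n k) (hN.joint.2.2.2.2 n k) (hN.joint.1 n k)
  have mg : FitMeasurable N (gap Nuisance.mu0 η) := fun n k =>
    (hN.joint.2.2.2.1 n k).sub ((hη.mu0.comp Obs.measurable_X).comp measurable_snd)
  have mz : Measurable fun o : Obs 𝒳 => 1 - o.zz := measurable_const.sub Obs.measurable_zz
  have mY : Measurable fun o : Obs 𝒳 => o.Y - η.mu0 o.X :=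
    Obs.measurable_Y.sub (hη.mu0.comp Obs.measurable_X)
  refine isLittleOp_crossAvg_add (D.crossAvg_thetaFamily κ hs hsB hL4 hinv hsc hes hss)
    (isLittleOp_crossAvg_add (isLittleOp_crossAvg_of_L2 D.measurable_sample D.indep D.law
      (fun n k => ((mD n k).mul (measurable_const.mul (mg n k))).mul
        ((mz.mul mY).comp measurable_snd)) (fun k => ?_) (fun k => ?_))
      (isLittleOp_crossAvg_of_L1 D.measurable_sample D.indep D.law
      (fun n k => ((mD n k).mul (mz.comp measurable_snd)).mul ((mg n k).mul (mg n k))) fun k => ?_))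
  · refine IsLittleOp.of_good _ (D.exists_good_variance hinv k)
      (fun _ => (hmm k).one_of_half) fun M => ?_
    obtain ⟨A, hA, hA'⟩ := exists_abs_thetaWeight_le (Q := Q) c κ M
    refine ⟨4 * A ^ 2 * (|B| + 1), by positivity, fun n ω hG => ?_⟩
    set θ := fit N O n k ω with hθ
    have mgX : Measurable[Obs.sigmaX] (gap Nuisance.mu0 η θ) :=
      measurable_comp_X (f := fun x => θ.mu0 x - η.mu0 x) ((hN.fit n k ω).mu0.sub hη.mu0)
    calc _ ≤ ∫⁻ o, ENNReal.ofReal (4 * A ^ 2) * (ENNReal.ofReal ((1 - o.zz) * (o.Y - η.mu0 o.X) ^ 2)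
          * (‖gap Nuisance.mu0 η θ o‖ₑ * ‖gap Nuisance.mu0 η θ o‖ₑ)) ∂Q := by
          refine lintegral_mono_ae ?_
          filter_upwards [hA' θ hG.1 hG.2.1 hG.2.2] with o ho
          rw [← enorm_pow, ← enorm_mul, ← ofReal_norm, ← ofReal_norm, ← ENNReal.ofReal_mul',
            ← ENNReal.ofReal_mul (by positivity)]
          · refine ENNReal.ofReal_le_ofReal ?_
            have hw2 : thetaWeight c κ θ o ^ 2 ≤ A ^ 2 := sq_le_sq' (abs_le.1 ho).1 (abs_le.1 ho).2
            have hz2 : (1 - o.zz) ^ 2 = 1 - o.zz := by rcases o.zz_eq with h | h <;> simp [h]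
            have hz0 : 0 ≤ 1 - o.zz := by rcases o.zz_eq with h | h <;> simp [h]
            rw [Real.norm_eq_abs, Real.norm_eq_abs, abs_mul_self, abs_of_nonneg (sq_nonneg _)]
            have e : (thetaWeight c κ θ o * (-2 * gap Nuisance.mu0 η θ o)
                * ((1 - o.zz) * (o.Y - η.mu0 o.X))) ^ 2
                = thetaWeight c κ θ o ^ 2 * (4 * ((1 - o.zz) ^ 2 * (o.Y - η.mu0 o.X) ^ 2
                  * (gap Nuisance.mu0 η θ o * gap Nuisance.mu0 η θ o))) := by ring
            rw [e, hz2]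
            refine (mul_le_mul_of_nonneg_right hw2 ?_).trans (le_of_eq (by ring))
            have := mul_self_nonneg (gap Nuisance.mu0 η θ o)
            positivity
          · positivity
      _ ≤ ENNReal.ofReal (4 * A ^ 2) * (ENNReal.ofReal (|B| + 1)
          * ∫⁻ o, ‖gap Nuisance.mu0 η θ o‖ₑ * ‖gap Nuisance.mu0 η θ o‖ₑ ∂Q) := by
          rw [lintegral_const_mul' _ _ ENNReal.ofReal_ne_top]
          refine mul_le_mul' le_rfl (lintegral_mul_le_of_orth (w := fun o => 1 - o.zz)
            (V := fun o => (o.Y - η.mu0 o.X) ^ 2)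
            (fun o => by rcases o.zz_eq with h | h <;> simp [h]) (fun o => sq_nonneg _) mz
            (mY.pow_const 2) (s := fun o => η.sigma2 o.X) H.orth_sigma2
            (H.measurable_sigma2.comp Obs.measurable_X) ?_ ?_)
          · filter_upwards [hsB] with o ho
            exact ⟨hs.le.trans ho.1, ho.2.trans (by linarith [le_abs_self B])⟩
          · exact (measurable_enorm.mul measurable_enorm).comp mgX
      _ ≤ _ := by
          rw [← mul_assoc, ← ENNReal.ofReal_mul (by positivity)]
          exact mul_le_mul' le_rfl (lintegral_sq_gap_le D.law_X hN hη n k ω)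
  · refine IsLittleOp.zero.mono fun n ω => ?_
    set θ := fit N O n k ω with hθ
    have hθm := hN.fit (O := O) n k ω
    have : ∫ o, thetaWeight c κ θ o * (-2 * gap Nuisance.mu0 η θ o)
        * ((1 - o.zz) * (o.Y - η.mu0 o.X)) ∂Q = 0 := by
      -- When the integrand is not integrable, its integral is `0` by convention, so the conclusion
      -- holds for every estimate, not only on the good event.
      by_cases hi : Integrable (fun o => thetaWeight c κ θ o * (-2 * gap Nuisance.mu0 η θ o)
        * ((1 - o.zz) * (o.Y - η.mu0 o.X))) Q
      · refine (H.orth_mu0.mul_left (f := fun o => thetaWeight c κ θ o * (-2 * gap Nuisance.mu0 η θ o))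
          ?_ hi).integral_eq_zero Obs.sigmaX_le
        exact measurable_comp_X (f := fun x => thetaK κ (θ.pi c x) * (1 / (2 * √(θ.sigma2 x)))
            / (1 - θ.e1 x) * (-2 * (θ.mu0 x - η.mu0 x)))
          ((measurable_thetaWeight κ (hθm.pi c) hθm.sigma2 hθm.e1).mul
            (measurable_const.mul (hθm.mu0.sub hη.mu0)))
      · exact integral_undef hi
    rw [this]; simp
  · refine IsLittleOp.of_good _ (D.exists_good_variance hinv k) (fun _ => hmm k) fun M => ?_
    obtain ⟨A, hA, hA'⟩ := exists_abs_thetaWeight_le (Q := Q) c κ M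
    refine ⟨A, hA, fun n ω hG => ?_⟩
    set θ := fit N O n k ω with hθ
    calc _ ≤ ∫⁻ o, ENNReal.ofReal A
          * (‖gap Nuisance.mu0 η θ o‖ₑ * ‖gap Nuisance.mu0 η θ o‖ₑ) ∂Q := by
          refine lintegral_mono_ae ?_
          filter_upwards [hA' θ hG.1 hG.2.1 hG.2.2] with o ho
          rw [enorm_mul, enorm_mul (gap _ _ _ _)]
          refine mul_le_mul' ?_ le_rfl
          rw [← ofReal_norm, Real.norm_eq_abs, abs_mul]
          refine ENNReal.ofReal_le_ofReal ?_
          refine (mul_le_of_le_one_right (abs_nonneg _) ?_).trans ho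
          rcases o.zz_eq with h | h <;> simp [h]
      _ ≤ _ := by
          rw [lintegral_const_mul' _ _ ENNReal.ofReal_ne_top]
          exact mul_le_mul' le_rfl (lintegral_sq_gap_le D.law_X hN hη n k ω)

theorem SampleSetup.crossAvg_phiNu0SMDe (D : SampleSetup μ N O Q PX η ε c) (κ : ℝ)
    {s B B' : ℝ} (hs : 0 < s) (hsB : ∀ᵐ o ∂Q, s ≤ η.sigma2 o.X ∧ η.sigma2 o.X ≤ B)
    (hB : ∀ᵐ o ∂Q, |η.mu0 o.X| ≤ B')
    (hL4 : MemLp (fun o => (1 - o.zz) * ((o.Y - η.mu0 o.X) ^ 2 - η.sigma2 o.X)) 2 Q)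
    (hinv : ∀ k, IsBoundedOp μ (invSup PX N O Nuisance.sigma2 k))
    (hmc : ∀ k, IsLittleOp μ (err PX N O η Nuisance.mu0 k) fun _ => 1)
    (hem : ∀ k, IsLittleOp μ (fun n ω => err PX N O η Nuisance.e1 k n ω
        * err PX N O η Nuisance.mu0 k n ω) fun n => (n : ℝ) ^ (-(1 / 2) : ℝ))
    (hpm : ∀ k, IsLittleOp μ (fun n ω => err PX N O η (fun θ => θ.pi c) k n ω
        * err PX N O η Nuisance.mu0 k n ω) fun n => (n : ℝ) ^ (-(1 / 2) : ℝ))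
    (hsc : ∀ k, IsLittleOp μ (err PX N O η Nuisance.sigma2 k) fun _ => 1)
    (hes : ∀ k, IsLittleOp μ (fun n ω => err PX N O η Nuisance.e1 k n ω
        * err PX N O η Nuisance.sigma2 k n ω) fun n => (n : ℝ) ^ (-(1 / 2) : ℝ))
    (hss : ∀ k, IsLittleOp μ (fun n ω => err PX N O η Nuisance.sigma2 k n ω
        * err PX N O η Nuisance.sigma2 k n ω) fun n => (n : ℝ) ^ (-(1 / 2) : ℝ))
    (hmm : ∀ k, IsLittleOp μ (fun n ω => err PX N O η Nuisance.mu0 k n ω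
        * err PX N O η Nuisance.mu0 k n ω) fun n => (n : ℝ) ^ (-(1 / 2) : ℝ)) :
    IsLittleOp μ (fun n ω => ‖√(n : ℝ) * crossAvg N O
      (fun θ o => phiNu0SMDe c κ θ o - phiNu0SMDe c κ η o) n ω‖ₑ) fun _ => 1 := by
  have h := isLittleOp_crossAvg_add (D.crossAvg_phiNu0MR one_pos hB hmc hem hpm)
    (isLittleOp_crossAvg_const_mul (etaC c κ) (D.crossAvg_phiTheta κ hs hsB hL4 hinv hsc hes hss hmm))
  have e : (fun θ o => phiNu0SMDe c κ θ o - phiNu0SMDe c κ η o) = fun (θ : Nuisance 𝒳) o =>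
      phiNu0MR c 1 θ o - phiNu0MR c 1 η o + etaC c κ * (phiTheta κ θ o - phiTheta κ η o) := by
    funext θ o
    rw [phiNu0SMDe, phiNu0SMDe, phiNu0PI_eq, phiNu0PI_eq]
    ring
  rw [e]
  exact h

end Theta

/-! ### Path derivatives of functionals of the observed data law -/

section Gradients
variable {𝒳 : Type*} [MeasurableSpace 𝒳] {Q : Measure (Obs 𝒳)}

/-- `φ` is an uncentered influence function of `Ψ` at `Q`. -/
structure IsGradient (Ψ : Measure (Obs 𝒳) → ℝ) (Q : Measure (Obs 𝒳)) (φ : Obs 𝒳 → ℝ) : Prop where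
  memLp : MemLp φ 2 Q
  integral_eq : ∫ o, φ o ∂Q = Ψ Q
  hasDerivAt : ∀ g : Obs 𝒳 → ℝ, Measurable g → (∃ M, ∀ o, |g o| ≤ M) →
    HasDerivAt (fun t => Ψ (path Q g t)) (∫ o, φ o * g o ∂Q) 0

namespace IsGradient
variable {Ψ Ψ' : Measure (Obs 𝒳) → ℝ} {φ φ' : Obs 𝒳 → ℝ}

theorem integrable_mul [IsFiniteMeasure Q] (h : IsGradient Ψ Q φ) {g : Obs 𝒳 → ℝ} (hg : Measurable g)
    (hM : ∃ M, ∀ o, |g o| ≤ M) : Integrable (fun o => φ o * g o) Q := by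
  obtain ⟨M, hM⟩ := hM
  exact (h.memLp.integrable one_le_two).mul_bdd (c := M) hg.aestronglyMeasurable (ae_of_all _ hM)

theorem add_const_mul [IsFiniteMeasure Q] (h : IsGradient Ψ Q φ) (h' : IsGradient Ψ' Q φ') (a : ℝ) :
    IsGradient (fun ν => Ψ ν + a * Ψ' ν) Q fun o => φ o + a * φ' o where
  memLp := h.memLp.add (h'.memLp.const_mul a)
  integral_eq := by
    rw [integral_add (h.memLp.integrable one_le_two) ((h'.memLp.integrable one_le_two).const_mul a),
      integral_const_mul, h.integral_eq, h'.integral_eq]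
  hasDerivAt g hg hM := by
    refine ((h.hasDerivAt g hg hM).add ((h'.hasDerivAt g hg hM).const_mul a)).congr_deriv ?_
    rw [← integral_const_mul, ← integral_add (h.integrable_mul hg hM)
      ((h'.integrable_mul hg hM).const_mul a)]
    exact integral_congr_ae (ae_of_all _ fun o => by simp only; ring)

theorem congr (h : IsGradient Ψ Q φ) (hφ : ∀ o, φ' o = φ o)
    (hΨ : ∀ g : Obs 𝒳 → ℝ, Measurable g → (∃ M, ∀ o, |g o| ≤ M) →
      ∀ᶠ t in 𝓝 (0 : ℝ), Ψ' (path Q g t) = Ψ (path Q g t)) : IsGradient Ψ' Q φ' := by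
  obtain rfl : φ' = φ := funext hφ
  refine ⟨h.memLp, ?_, fun g hg hM => (h.hasDerivAt g hg hM).congr_of_eventuallyEq (hΨ g hg hM)⟩
  have := (hΨ (fun _ => 0) measurable_const ⟨0, by simp⟩).self_of_nhds
  rw [path_zero] at this
  rw [h.integral_eq, this]

end IsGradient

variable {ε : ℝ} {V1 V0 e a1 u1 a0 u0 G : Obs 𝒳 → ℝ}

namespace IsScore

theorem memLp_two (S : IsScore Q ε V1 V0 e a1 u1 a0 u0 G)
    (hL1 : MemLp (fun o => o.zz * (V1 o - u1 o)) 2 Q)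
    (hL0 : MemLp (fun o => (1 - o.zz) * (V0 o - u0 o)) 2 Q) (hG : MemLp G 2 Q)
    {C : ℝ} (hC : 0 ≤ C) (ha : ∀ᵐ o ∂Q, |a1 o| ≤ C ∧ |a0 o| ≤ C) :
    MemLp (drScore V1 V0 e a1 u1 a0 u0 G) 2 Q := by
  have hε := S.eps_pos
  have m1 : Measurable fun o => a1 o / e o :=
    Measurable.of_sigmaX (S.measurable_a1.div S.measurable_e)
  have m0 : Measurable fun o => a0 o / (1 - e o) :=
    Measurable.of_sigmaX (S.measurable_a0.div (measurable_const.sub S.measurable_e))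
  have b1 : MemLp (fun o => a1 o / e o) ∞ Q := memLp_top_of_bound m1.aestronglyMeasurable (C / ε) (by
    filter_upwards [ha, S.e_mem] with o h h'
    rw [Real.norm_eq_abs, abs_div, abs_of_pos (hε.trans_le h'.1)]
    exact div_le_div₀ hC h.1 hε h'.1)
  have b0 : MemLp (fun o => a0 o / (1 - e o)) ∞ Q :=
    memLp_top_of_bound m0.aestronglyMeasurable (C / ε) (by
      filter_upwards [ha, S.e_mem] with o h h'
      have : ε ≤ 1 - e o := by linarith [h'.2]
      rw [Real.norm_eq_abs, abs_div, abs_of_pos (hε.trans_le this)]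
      exact div_le_div₀ hC h.2 hε this)
  refine (((hL1.mul (r := 2) b1).add (hL0.mul (r := 2) b0)).add hG).ae_eq (ae_of_all _ fun o => ?_)
  simp only [Pi.add_apply, Pi.mul_apply, drScore]
  ring

variable [IsFiniteMeasure Q]

/-- The dominating function is built from the conditional means of the absolute residuals: they are
square integrable, and the regressions move by at most `|t|` times multiples of them. The extra
allowance `t² B` serves functionals whose plug-in term differs from `f` of the tilted regressions by
a term of order `t²`. -/
theorem exists_path_expansion_le (S : IsScore Q ε V1 V0 e a1 u1 a0 u0 G)
    (hL1 : MemLp (fun o => o.zz * (V1 o - u1 o)) 2 Q)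
    (hL0 : MemLp (fun o => (1 - o.zz) * (V0 o - u0 o)) 2 Q)
    {C : ℝ} (hC : 0 ≤ C) (ha : ∀ᵐ o ∂Q, |a1 o| ≤ C ∧ |a0 o| ≤ C)
    {g : Obs 𝒳 → ℝ} {M : ℝ} (hg : Measurable g) (hM : ∀ o, |g o| ≤ M)
    {B : Obs 𝒳 → ℝ} (hB : Integrable B Q) (hB0 : ∀ᵐ o ∂Q, 0 ≤ B o) :
    ∃ D : ℝ, ∀ t : ℝ, |t| * M ≤ 1 / 2 → ∀ v1 v0 G' : Obs 𝒳 → ℝ, Measurable[Obs.sigmaX] v1 →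
      Measurable[Obs.sigmaX] v0 → Measurable[Obs.sigmaX] G' →
      (Orth (path Q g t) fun o => o.zz * (V1 o - v1 o)) →
      (Orth (path Q g t) fun o => (1 - o.zz) * (V0 o - v0 o)) →
      (∀ᵐ o ∂Q, |G' o - G o - a1 o * (v1 o - u1 o) - a0 o * (v0 o - u0 o)|
        ≤ C * ((v1 o - u1 o) ^ 2 + (v0 o - u0 o) ^ 2) + t ^ 2 * B o) →
      Integrable G' (path Q g t) ∧
      |∫ o, G' o ∂(path Q g t) - ∫ o, G o ∂Q
        - t * ∫ o, drScore V1 V0 e a1 u1 a0 u0 G o * g o ∂Q| ≤ D * t ^ 2 := by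
  set H1 := fun o => 2 * M / ε * Q[fun o => |o.zz * (V1 o - u1 o)| | Obs.sigmaX] o
  set H0 := fun o => 2 * M / ε * Q[fun o => |(1 - o.zz) * (V0 o - u0 o)| | Obs.sigmaX] o
  have i1 : Integrable (fun o => H1 o ^ 2) Q := ((hL1.abs.condExp one_le_two).const_mul _).integrable_sq
  have i0 : Integrable (fun o => H0 o ^ 2) Q := ((hL0.abs.condExp one_le_two).const_mul _).integrable_sq
  -- One function dominates the first-order terms, through `H ≤ 1 + H²`, and the second-order terms,
  -- through `H²`.
  set B' := fun o => C * (1 + (H1 o ^ 2 + H0 o ^ 2)) + B o with hB'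
  have iB' : Integrable B' Q := (((integrable_const 1).add (i1.add i0)).const_mul C).add hB
  refine ⟨(2 * M / ε + 3 / 2) * ∫ o, B' o ∂Q, fun t ht v1 v0 G' hv1 hv0 hG' h1 h0 hr => ?_⟩
  have c1 := abs_tilted_sub_le hg hM ht S.eps_pos (S.e_mem.mono fun _ h => h.1) S.measurable_e
    S.measurable_u1 hv1 (fun o => by rcases o.zz_eq with h | h <;> simp [h]) integrable_zz S.orth_e
    S.orth1 h1
  have c0 := abs_tilted_sub_le hg hM ht S.eps_pos (e := fun o => 1 - e o)
    (S.e_mem.mono fun _ h => by linarith [h.2]) (measurable_const.sub S.measurable_e)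
    S.measurable_u0 hv0 (w := fun o => 1 - o.zz) (fun o => by rcases o.zz_eq with h | h <;> simp [h])
    integrable_one_sub_zz (S.orth_e.neg.congr (ae_of_all _ fun o => by simp only; ring)) S.orth0 h0
  refine S.abs_path_expansion_le hg hM ht hv1 hv0 hG' h1 h0 iB' ?_ ?_ ?_
  · filter_upwards [ha, c1, hB0] with o h2 h3 h4
    rw [abs_mul]
    change |v1 o - u1 o| ≤ |t| * H1 o at h3
    have h5 : |t| * H1 o ≤ |t| * (1 + (H1 o ^ 2 + H0 o ^ 2)) :=
      mul_le_mul_of_nonneg_left (by nlinarith [sq_nonneg (H1 o - 1), sq_nonneg (H0 o)]) (abs_nonneg t)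
    calc _ ≤ C * (|t| * (1 + (H1 o ^ 2 + H0 o ^ 2))) :=
          mul_le_mul h2.1 (h3.trans h5) (abs_nonneg _) hC
      _ ≤ _ := by
          have := mul_nonneg (abs_nonneg t) h4
          simp only [hB']; nlinarith
  · filter_upwards [ha, c0, hB0] with o h2 h3 h4
    rw [abs_mul]
    change |v0 o - u0 o| ≤ |t| * H0 o at h3
    have h5 : |t| * H0 o ≤ |t| * (1 + (H1 o ^ 2 + H0 o ^ 2)) :=
      mul_le_mul_of_nonneg_left (by nlinarith [sq_nonneg (H0 o - 1), sq_nonneg (H1 o)]) (abs_nonneg t)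
    calc _ ≤ C * (|t| * (1 + (H1 o ^ 2 + H0 o ^ 2))) :=
          mul_le_mul h2.2 (h3.trans h5) (abs_nonneg _) hC
      _ ≤ _ := by
          have := mul_nonneg (abs_nonneg t) h4
          simp only [hB']; nlinarith
  · filter_upwards [hr, c1, c0] with o h2 h3 h4
    change |v1 o - u1 o| ≤ |t| * H1 o at h3
    change |v0 o - u0 o| ≤ |t| * H0 o at h4
    refine h2.trans ?_
    have q1 : (v1 o - u1 o) ^ 2 ≤ t ^ 2 * H1 o ^ 2 := by
      rw [← sq_abs, ← sq_abs t, ← mul_pow]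
      exact pow_le_pow_left₀ (abs_nonneg _) h3 2
    have q0 : (v0 o - u0 o) ^ 2 ≤ t ^ 2 * H0 o ^ 2 := by
      rw [← sq_abs, ← sq_abs t, ← mul_pow]
      exact pow_le_pow_left₀ (abs_nonneg _) h4 2
    have := mul_le_mul_of_nonneg_left (add_le_add q1 q0) hC
    have := mul_nonneg hC (sq_nonneg t)
    simp only [hB']; nlinarith

/-- The functional `∫ G` along paths has the score as its gradient. -/
theorem isGradient (S : IsScore Q ε V1 V0 e a1 u1 a0 u0 G)
    (hL1 : MemLp (fun o => o.zz * (V1 o - u1 o)) 2 Q)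
    (hL0 : MemLp (fun o => (1 - o.zz) * (V0 o - u0 o)) 2 Q) (hG : MemLp G 2 Q)
    {C : ℝ} (hC : 0 ≤ C) (ha : ∀ᵐ o ∂Q, |a1 o| ≤ C ∧ |a0 o| ≤ C)
    {Ψ : Measure (Obs 𝒳) → ℝ}
    (h : ∀ (g : Obs 𝒳 → ℝ) (M : ℝ), Measurable g → (∀ o, |g o| ≤ M) →
      ∃ B : Obs 𝒳 → ℝ, Integrable B Q ∧ (∀ᵐ o ∂Q, 0 ≤ B o) ∧
      ∀ t : ℝ, |t| * M ≤ 1 / 2 → ∃ v1 v0 G' : Obs 𝒳 → ℝ, Measurable[Obs.sigmaX] v1 ∧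
      Measurable[Obs.sigmaX] v0 ∧ Measurable[Obs.sigmaX] G' ∧
      (Orth (path Q g t) fun o => o.zz * (V1 o - v1 o)) ∧
      (Orth (path Q g t) fun o => (1 - o.zz) * (V0 o - v0 o)) ∧
      (∀ᵐ o ∂Q, |G' o - G o - a1 o * (v1 o - u1 o) - a0 o * (v0 o - u0 o)|
        ≤ C * ((v1 o - u1 o) ^ 2 + (v0 o - u0 o) ^ 2) + t ^ 2 * B o) ∧
      Ψ (path Q g t) = ∫ o, G' o ∂(path Q g t)) :
    IsGradient Ψ Q (drScore V1 V0 e a1 u1 a0 u0 G) := by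
  have key : ∀ (g : Obs 𝒳 → ℝ) (M : ℝ), Measurable g → (∀ o, |g o| ≤ M) →
      ∃ D : ℝ, ∀ t : ℝ, |t| * M ≤ 1 / 2 →
      |Ψ (path Q g t) - ∫ o, G o ∂Q - t * ∫ o, drScore V1 V0 e a1 u1 a0 u0 G o * g o ∂Q|
        ≤ D * t ^ 2 := by
    intro g M hg hM
    obtain ⟨B, hB, hB0, h⟩ := h g M hg hM
    obtain ⟨D, hD⟩ := S.exists_path_expansion_le hL1 hL0 hC ha hg hM hB hB0
    refine ⟨D, fun t ht => ?_⟩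
    obtain ⟨v1, v0, G', m1, m0, mG, h1, h0, hr, hΨ⟩ := h t ht
    rw [hΨ]
    exact (hD t ht v1 v0 G' m1 m0 mG h1 h0 hr).2
  -- At `t = 0` the quadratic bound forces `Ψ Q = ∫ G`.
  have zero : ∀ g : Obs 𝒳 → ℝ, Measurable g → (∃ M, ∀ o, |g o| ≤ M) → Ψ Q = ∫ o, G o ∂Q := by
    rintro g hg ⟨M, hM⟩
    obtain ⟨D, hD⟩ := key g M hg hM
    have := hD 0 (by simp)
    rw [path_zero, zero_mul, sub_zero] at this
    have := abs_nonpos_iff.1 (this.trans (by simp))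
    linarith
  refine ⟨S.memLp_two hL1 hL0 hG hC ha, ?_, fun g hg hM => ?_⟩
  · rw [S.integral_eq, zero (fun _ => 0) measurable_const ⟨0, by simp⟩]
  · have hz := zero g hg hM
    obtain ⟨M, hM⟩ := hM
    obtain ⟨D, hD⟩ := key g M hg hM
    -- This radius ensures `|t| M ≤ 1/2`.
    refine hasDerivAt_of_sq_bound (δ := 1 / (2 * (|M| + 1))) (C := D) (by positivity) fun t ht => ?_
    rw [path_zero, hz]
    refine hD t ?_
    have h1 : |t| * M ≤ 1 / (2 * (|M| + 1)) * (|M| + 1) :=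
      (mul_le_mul_of_nonneg_left (by linarith [le_abs_self M]) (abs_nonneg t)).trans
        (mul_le_mul_of_nonneg_right ht (by positivity))
    refine h1.trans (le_of_eq ?_)
    field_simp

end IsScore
end Gradients

/-! ### Gradients of the stratum probability and of the means. -/

section GradientInstances
variable {𝒳 : Type*} [MeasurableSpace 𝒳] {Q : Measure (Obs 𝒳)} [IsFiniteMeasure Q]
  {η : Nuisance 𝒳} {ε : ℝ} {c : Bool} {g : Obs 𝒳 → ℝ} {M t : ℝ}

namespace IsObsNuisance

theorem obsPi_path_mem (H : IsObsNuisance Q c ε η) (hg : Measurable g) (hM : ∀ o, |g o| ≤ M)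
    (ht : |t| * M ≤ 1 / 2) : ∀ᵐ o ∂Q, obsPi (path Q g t) c o ∈ Set.Icc (0 : ℝ) 1 :=
  have := isFiniteMeasure_path (Q := Q) hM ht
  (absolutelyContinuous_path hg hM ht).ae_le (obsPi_mem_Icc c (H.condExp_zz_pos hg hM ht))

theorem integrable_Y_path (H : IsObsNuisance Q c ε η) (hg : Measurable g) (hM : ∀ o, |g o| ≤ M)
    (ht : |t| * M ≤ 1 / 2) : Integrable Obs.Y (path Q g t) :=
  Integrable.path hg hM ht (H.memLp_Y.integrable one_le_two)

theorem abs_control_sub_le (H : IsObsNuisance Q c ε η) (hg : Measurable g) (hM : ∀ o, |g o| ≤ M)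
    (ht : |t| * M ≤ 1 / 2) {V v v' : Obs 𝒳 → ℝ} (hv : Measurable[Obs.sigmaX] v)
    (hv' : Measurable[Obs.sigmaX] v') (hV : Orth Q fun o => (1 - o.zz) * (V o - v o))
    (hV' : Orth (path Q g t) fun o => (1 - o.zz) * (V o - v' o)) :
    ∀ᵐ o ∂Q, |v' o - v o| ≤
      |t| * (2 * M / ε * Q[fun o => |(1 - o.zz) * (V o - v o)| | Obs.sigmaX] o) :=
  abs_tilted_sub_le hg hM ht H.eps_pos (e := fun o => 1 - η.e1 o.X)
    (H.e_mem.mono fun _ h => by linarith [h.2])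
    (measurable_const.sub (measurable_comp_X H.measurable_e1)) hv hv' (w := fun o => 1 - o.zz)
    (fun o => by rcases o.zz_eq with h | h <;> simp [h]) integrable_one_sub_zz H.orth_one_sub_e hV hV'

theorem memLp_control_residual (H : IsObsNuisance Q c ε η) {B : ℝ}
    (hB : ∀ᵐ o ∂Q, |η.mu0 o.X| ≤ B) : MemLp (fun o => (1 - o.zz) * (o.Y - η.mu0 o.X)) 2 Q := by
  have hm : Measurable fun o : Obs 𝒳 => η.mu0 o.X := H.measurable_mu0.comp Obs.measurable_X
  have h1 : MemLp (fun o : Obs 𝒳 => η.mu0 o.X) 2 Q :=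
    MemLp.of_bound hm.aestronglyMeasurable B (by simpa only [Real.norm_eq_abs] using hB)
  refine (H.memLp_Y.sub h1).mono ((measurable_const.sub Obs.measurable_zz).mul
    (Obs.measurable_Y.sub hm)).aestronglyMeasurable (ae_of_all _ fun o => ?_)
  rw [norm_mul, Pi.sub_apply]
  refine mul_le_of_le_one_left (norm_nonneg _) ?_
  rcases o.zz_eq with h | h <;> simp [h]

/-- The treated regression along the path is always `π_c` of the tilted law, so only the control
regression and the plug-in term remain to be supplied. -/
theorem isGradient_biv (H : IsObsNuisance Q c ε η) {w : Nuisance 𝒳 → 𝒳 → ℝ} {a b f : ℝ → ℝ → ℝ}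
    {V0 : Obs 𝒳 → ℝ} (S : (bivFamily c w a b f).IsTrue Q ε (Obs.ind c) V0 η)
    (hL0 : MemLp (fun o => (1 - o.zz) * (V0 o - w η o.X)) 2 Q) {C : ℝ} (hC : 0 ≤ C)
    (hb : ∀ᵐ o ∂Q, |a (η.pi c o.X) (w η o.X)| ≤ C ∧ |b (η.pi c o.X) (w η o.X)| ≤ C ∧
      |f (η.pi c o.X) (w η o.X)| ≤ C)
    {Ψ : Measure (Obs 𝒳) → ℝ}
    (h : ∀ (g : Obs 𝒳 → ℝ) (M : ℝ), Measurable g → (∀ o, |g o| ≤ M) →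
      ∃ B : Obs 𝒳 → ℝ, Integrable B Q ∧ (∀ᵐ o ∂Q, 0 ≤ B o) ∧
      ∀ t : ℝ, |t| * M ≤ 1 / 2 → ∃ v0 G' : Obs 𝒳 → ℝ,
      Measurable[Obs.sigmaX] v0 ∧ Measurable[Obs.sigmaX] G' ∧
      (Orth (path Q g t) fun o => (1 - o.zz) * (V0 o - v0 o)) ∧
      (∀ᵐ o ∂Q, ∀ p q m, p = η.pi c o.X → q = obsPi (path Q g t) c o → m = w η o.X →
        p ∈ Set.Icc (0 : ℝ) 1 → q ∈ Set.Icc (0 : ℝ) 1 →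
        |G' o - f p m - a p m * (q - p) - b p m * (v0 o - m)|
        ≤ C * ((q - p) ^ 2 + (v0 o - m) ^ 2) + t ^ 2 * B o) ∧
      Ψ (path Q g t) = ∫ o, G' o ∂(path Q g t)) :
    IsGradient Ψ Q ((bivFamily c w a b f).score (Obs.ind c) V0 η) := by
  have mp : Measurable fun o : Obs 𝒳 => η.pi c o.X :=
    (H.isMeasurable.pi c).comp Obs.measurable_X
  refine IsScore.isGradient S ?_ hL0 ?_ hC (hb.mono fun o h => ⟨h.1, h.2.1⟩) fun g M hg hM => ?_
  · refine MemLp.of_bound (Obs.measurable_zz.mul ((Obs.measurable_ind c).sub mp)).aestronglyMeasurable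
      1 ?_
    filter_upwards [H.abs_zz_mul_le] with o h using h
  · refine MemLp.of_bound (Measurable.of_sigmaX S.measurable_G).aestronglyMeasurable C ?_
    filter_upwards [hb] with o h using h.2.2
  · obtain ⟨B, hB, hB0, h⟩ := h g M hg hM
    refine ⟨B, hB, hB0, fun t ht => ?_⟩
    have := isFiniteMeasure_path (Q := Q) hM ht
    obtain ⟨v0, G', m0, mG, h0, hr, hΨ⟩ := h t ht
    refine ⟨obsPi (path Q g t) c, v0, G', measurable_condExp_X _ _, m0, mG, orth_obsPi c, h0, ?_, hΨ⟩
    filter_upwards [hr, H.pi_mem, H.obsPi_path_mem hg hM ht] with o h1 h2 h3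
      using h1 _ _ _ rfl rfl rfl h2 h3

theorem isGradient_margPi (H : IsObsNuisance Q c ε η) : IsGradient (margPi c) Q (phiPi c η) := by
  have hz : Orth Q fun o : Obs 𝒳 => (1 - o.zz) * ((fun _ => (0 : ℝ)) o - 0) :=
    Orth.of_setIntegral (by simp) (by simp)
  have hb : ∀ᵐ o ∂Q, |(1 : ℝ)| ≤ 1 ∧ |(0 : ℝ)| ≤ 1 ∧ |η.pi c o.X| ≤ 1 := by
    filter_upwards [H.pi_mem] with o ho
    simp [abs_of_nonneg ho.1, ho.2]
  have S := H.isTrue_bivFamily (w := fun _ _ => 0) (a := fun _ _ => 1) (b := fun _ _ => 0)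
    (f := fun p _ => p) (fun _ _ => measurable_const) measurable_const measurable_const
    measurable_fst hz hb
  refine (H.isGradient_biv S (by simp) zero_le_one hb (Ψ := margPi c) fun g M hg hM =>
    ⟨fun _ => 0, integrable_zero _ _ _, by simp, fun t ht => ⟨fun _ => 0, obsPi (path Q g t) c,
      measurable_const, measurable_condExp_X _ _, ?_, ae_of_all _ ?_, rfl⟩⟩).congr
    (phiPi_eq c (fun _ => 0) η) fun _ _ _ => Eventually.of_forall fun _ => rfl
  · have := isFiniteMeasure_path (Q := Q) hM ht
    exact Orth.of_setIntegral (by simp) (by simp)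
  · rintro o p q m - rfl - - -
    simp only [one_mul, zero_mul, sub_self, abs_zero, mul_zero, add_zero]
    positivity

/-- Along the path the regression of `I(S = c) Y` among the treated is again the product of the
tilted `π_c` and `μ_{1c}`, which is also the plug-in term; the Taylor remainder is therefore zero.
-/
theorem isGradient_nu1 (H : IsObsNuisance Q c ε η) : IsGradient (nu1 c) Q (phiNu1 c η) := by
  obtain ⟨B, hB⟩ := MemLp.exists_ae_abs_le H.memLp_mu1
  have mp : Measurable fun o : Obs 𝒳 => η.pi c o.X * η.mu1 o.X :=
    ((H.isMeasurable.pi c).comp Obs.measurable_X).mul (H.measurable_mu1.comp Obs.measurable_X)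
  have hG : MemLp (fun o : Obs 𝒳 => η.pi c o.X * η.mu1 o.X) 2 Q := by
    refine MemLp.of_bound mp.aestronglyMeasurable B ?_
    filter_upwards [hB, H.pi_mem] with o h1 h2
    rw [norm_mul, Real.norm_eq_abs, Real.norm_eq_abs, abs_of_nonneg h2.1]
    exact (mul_le_of_le_one_left (abs_nonneg _) h2.2).trans h1
  have hL1 : MemLp (fun o : Obs 𝒳 => o.zz * (o.ind c * o.Y - η.pi c o.X * η.mu1 o.X)) 2 Q := by
    refine (H.memLp_Y.abs.add hG.abs).mono (Obs.measurable_zz.mul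
      (((Obs.measurable_ind c).mul Obs.measurable_Y).sub mp)).aestronglyMeasurable
      (ae_of_all _ fun o => ?_)
    rw [norm_mul]
    change |o.zz| * |o.ind c * o.Y - η.pi c o.X * η.mu1 o.X|
      ≤ |(|o.Y| + |η.pi c o.X * η.mu1 o.X|)|
    rw [abs_of_nonneg (add_nonneg (abs_nonneg o.Y) (abs_nonneg (η.pi c o.X * η.mu1 o.X)))]
    have h1 : |o.zz| ≤ 1 := by rcases o.zz_eq with h | h <;> simp [h]
    have h2 : |o.ind c * o.Y| ≤ |o.Y| := by
      rw [abs_mul]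
      refine mul_le_of_le_one_left (abs_nonneg _) ?_
      rcases o.ind_eq c with h | h <;> simp [h]
    exact (mul_le_of_le_one_left (abs_nonneg _) h1).trans
      ((abs_sub _ _).trans (add_le_add h2 le_rfl))
  refine (IsScore.isGradient H.isTrue_nu1Family hL1 (by simp [nu1Family]) hG zero_le_one
    (by simp [nu1Family]) (Ψ := nu1 c) fun g M hg hM =>
    ⟨fun _ => 0, integrable_zero _ _ _, by simp, fun t ht => ?_⟩).congr
    (phiNu1_eq c (fun _ => 0) η) fun _ _ _ => Eventually.of_forall fun _ => rfl
  have := isFiniteMeasure_path (Q := Q) hM ht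
  have mm : Measurable[Obs.sigmaX] fun o =>
      obsPi (path Q g t) c o * obsMu1 (path Q g t) c o :=
    (measurable_condExp_X _ _).mul (measurable_condExp_X _ _)
  refine ⟨_, fun _ => 0, _, mm, measurable_const, mm,
    orth_obsPi_mul_obsMu1 c (H.integrable_Y_path hg hM ht) (H.condExp_zz_pos hg hM ht),
    Orth.of_setIntegral (by simp) (by simp), ae_of_all _ fun o => ?_, rfl⟩
  simp only [nu1Family, one_mul, sub_self, abs_zero, mul_zero, add_zero]
  positivity

theorem isGradient_nu0MR (H : IsObsNuisance Q c ε η) {ρ B : ℝ} (hρ : 0 < ρ)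
    (hB : ∀ᵐ o ∂Q, |η.mu0 o.X| ≤ B) : IsGradient (nu0MR c ρ) Q (phiNu0MR c ρ η) := by
  have hr := rhoC_pos hρ c
  obtain ⟨C, hC, hb⟩ := exists_mr_bounds hr
  have hB0 := abs_nonneg B
  have ef : ∀ p m, p * mrMean (rhoC c ρ) p m = mrEpsMu (rhoC c ρ) p * m := fun p m => by
    unfold mrMean mrEpsMu; ring
  refine (H.isGradient_biv (H.isTrue_mr hr hB) (H.memLp_control_residual hB)
    (C := C * (1 + |B|)) (by positivity) ?_ (Ψ := nu0MR c ρ) fun g M hg hM =>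
    ⟨fun _ => 0, integrable_zero _ _ _, by simp, fun t ht => ?_⟩).congr
    (phiNu0MR_eq c ρ η) fun _ _ _ => Eventually.of_forall fun _ => rfl
  · filter_upwards [hB, H.pi_mem] with o h1 hp
    obtain ⟨b1, b2, -⟩ := hb _ hp _ hp
    have hB' : |η.mu0 o.X| ≤ 1 + |B| := by linarith [le_abs_self B]
    refine ⟨?_, b1.trans (le_mul_of_one_le_right hC (by linarith)), ?_⟩
    · rw [mrEpsPi_eq hr hp, abs_mul]; gcongr
    · rw [ef, abs_mul]; gcongr
  · have := isFiniteMeasure_path (Q := Q) hM ht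
    have m1 : Measurable[Obs.sigmaX] (obsPi (path Q g t) c) := measurable_condExp_X _ _
    have m0 : Measurable[Obs.sigmaX] (obsMu0 (path Q g t)) := measurable_condExp_X _ _
    refine ⟨obsMu0 (path Q g t), _, m0, (measurable_mr (rhoC c ρ)).2.2.comp (m1.prodMk m0),
      orth_obsMu0 (H.integrable_Y_path hg hM ht), ?_, rfl⟩
    filter_upwards [hB] with o ho p q m hp hq hm hp' hq'
    rw [← hm] at ho
    obtain ⟨b1, b2, b3, b4, b5⟩ := hb p hp' q hq'
    simp only [Function.comp, ← hq]
    rw [ef, ef, mrEpsPi_eq hr hp']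
    generalize rhoC c ρ / ((rhoC c ρ - 1) * p + 1) ^ 2 = k at *
    generalize obsMu0 (path Q g t) o = m'
    have e : mrEpsMu (rhoC c ρ) q * m' - mrEpsMu (rhoC c ρ) p * m - k * m * (q - p)
        - mrEpsMu (rhoC c ρ) p * (m' - m)
        = (mrEpsMu (rhoC c ρ) q - mrEpsMu (rhoC c ρ) p - k * (q - p)) * m
          + (mrEpsMu (rhoC c ρ) q - mrEpsMu (rhoC c ρ) p) * (m' - m) := by ring
    rw [e, mul_zero, add_zero]
    refine (abs_add_le _ _).trans ?_
    rw [abs_mul, abs_mul]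
    have t1 := mul_le_mul b5 (ho.trans (le_abs_self B)) (abs_nonneg _) (by positivity)
    have t2 := mul_le_mul_of_nonneg_right b4 (abs_nonneg (m' - m))
    have t3 : |q - p| * |m' - m| ≤ (q - p) ^ 2 + (m' - m) ^ 2 := by
      rw [← sq_abs (q - p), ← sq_abs (m' - m)]
      nlinarith [sq_nonneg (|q - p| - |m' - m|), sq_nonneg (|q - p|), sq_nonneg (|m' - m|)]
    have t4 := mul_le_mul_of_nonneg_left t3 hC
    have p1 : 0 ≤ C * |B| * (m' - m) ^ 2 := by positivity
    linarith

theorem isGradient_nu0GOR (H : IsObsNuisance Q c ε η) {ρ l h : ℝ} (hρ : 0 < ρ) (hlh : l < h)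
    (hY : ∀ᵐ o ∂Q, o.Z = false → o.Y ∈ Set.Icc l h) :
    IsGradient (nu0GOR c ρ l h) Q (phiNu0GOR c ρ l h η) := by
  have hr := rhoC_pos hρ c
  obtain ⟨C, hC, hb⟩ := exists_gor_bounds hr hlh
  have hm := H.mu0_mem hY
  have hB : ∀ᵐ o ∂Q, |η.mu0 o.X| ≤ |l| + |h| := hm.mono fun o ho =>
    (abs_le_max_abs_abs ho.1 ho.2).trans (max_le_add_of_nonneg (abs_nonneg _) (abs_nonneg _))
  have h0 : ((0 : ℝ), l) ∈ Set.Icc (0 : ℝ) 1 ×ˢ Set.Icc l h :=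
    ⟨⟨le_rfl, zero_le_one⟩, ⟨le_rfl, hlh.le⟩⟩
  have hC' : C ≤ C * (1 + (h - l)) := le_mul_of_one_le_right hC (by linarith)
  refine (H.isGradient_biv (H.isTrue_gor hr hlh hY) (H.memLp_control_residual hB)
    (C := C * (1 + (h - l))) (hC.trans hC') ?_ (Ψ := nu0GOR c ρ l h) fun g M hg hM =>
    ⟨fun _ => 0, integrable_zero _ _ _, by simp, fun t ht => ?_⟩).congr
    (phiNu0GOR_eq c ρ l h η) fun _ _ _ => Eventually.of_forall fun _ => rfl
  · filter_upwards [hm, H.pi_mem] with o hm hp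
    obtain ⟨-, -, -, -, b5, -⟩ := hb 0 l (η.pi c o.X) (η.mu0 o.X) h0 ⟨hp, hm⟩
    obtain ⟨b1, b2, -⟩ := hb (η.pi c o.X) (η.mu0 o.X) 0 l ⟨hp, hm⟩ h0
    refine ⟨b1.trans hC', b2.trans hC', ?_⟩
    simp only [zero_mul, sub_zero] at b5
    have t1 : |η.pi c o.X| ≤ 1 := abs_le.2 ⟨by linarith [hp.1], hp.2⟩
    have t2 : |η.mu0 o.X - l| ≤ h - l := abs_le.2 ⟨by linarith [hm.1], by linarith [hm.2]⟩
    exact b5.trans (mul_le_mul_of_nonneg_left (add_le_add t1 t2) hC)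
  · have := isFiniteMeasure_path (Q := Q) hM ht
    have m1 : Measurable[Obs.sigmaX] (obsPi (path Q g t) c) := measurable_condExp_X _ _
    have m0 : Measurable[Obs.sigmaX] (obsMu0 (path Q g t)) := measurable_condExp_X _ _
    have ho := orth_obsMu0 (H.integrable_Y_path hg hM ht)
    refine ⟨obsMu0 (path Q g t), _, m0, (measurable_gor (rhoC c ρ) l h).2.2.comp (m1.prodMk m0),
      ho, ?_, rfl⟩
    -- The laws have the same null sets, so control outcomes stay in `[l, h]` under the tilted law,
    -- and so does its regression; the bounds on the rectangle apply.
    filter_upwards [hm, (absolutelyContinuous_path hg hM ht).ae_le (mem_Icc_of_orth_control m0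
      (H.integrable_Y_path hg hM ht) ho (H.condExp_one_sub_zz_pos hg hM ht)
      (path_absolutelyContinuous.ae_le hY))] with o hm hm' p q m hp hq hm0 hp' hq'
    rw [← hm0] at hm
    simp only [Function.comp, ← hq]
    rw [mul_zero, add_zero]
    exact (hb p m q _ ⟨hp', hm⟩ ⟨hq', hm'⟩).2.2.2.2.2.trans
      (mul_le_mul_of_nonneg_right hC' (by positivity))

end IsObsNuisance
end GradientInstances

/-! ### Gradient for the standardized mean difference. -/

theorem exists_theta_remainder_bounds (κ : ℝ) {d B : ℝ} (hd0 : 0 < d) : ∃ C : ℝ, 0 ≤ C ∧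
    ∀ p ∈ Set.Icc (0 : ℝ) 1, ∀ q ∈ Set.Icc (0 : ℝ) 1, ∀ s s' : ℝ, d ≤ s → s ≤ B → 0 ≤ s' →
      |thetaK' κ p * √s| ≤ C ∧ |thetaK κ p * (1 / (2 * √s))| ≤ C ∧ |thetaK κ p * √s| ≤ C ∧
      |thetaK κ q| ≤ C ∧
      |thetaK κ q * √s' - thetaK κ p * √s - thetaK' κ p * √s * (q - p)
          - thetaK κ p * (1 / (2 * √s)) * (s' - s)| ≤ C * ((q - p) ^ 2 + (s' - s) ^ 2) := by
  obtain ⟨C, hC, hb⟩ := exists_theta_bounds κ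
  have hsd : 0 < √d := Real.sqrt_pos.2 hd0
  obtain ⟨A, hA⟩ : ∃ A, A = 1 + √B + 1 / √d + 1 / (2 * √d * d) := ⟨_, rfl⟩
  have hB0 := Real.sqrt_nonneg B
  have q1 : 0 < 1 / √d := by positivity
  have q3 : 0 < 1 / (2 * √d * d) := by positivity
  have hA0 : 0 < A := by rw [hA]; positivity
  refine ⟨C * (2 * A), by positivity, fun p hp q hq s s' hds hsB hs' => ?_⟩
  obtain ⟨b1, b2, -, b4, b5⟩ := hb p hp q hq
  obtain ⟨b1', -⟩ := hb q hq p hp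
  have hsm : √s ≤ √B := Real.sqrt_le_sqrt hsB
  have hs0 := Real.sqrt_nonneg s
  have half : 1 / (2 * √s) ≤ 1 / √d :=
    one_div_le_one_div_of_le hsd (by linarith [Real.sqrt_le_sqrt hds])
  have half0 : 0 ≤ 1 / (2 * √s) := by positivity
  have l1 := abs_sqrt_sub_le hd0 hds hs'
  have l2 := abs_sqrt_remainder_le hd0 hds hs'
  have bound : ∀ {u v : ℝ}, |u| ≤ C → 0 ≤ v → v ≤ A → |u * v| ≤ C * (2 * A) := by
    intro u v hu hv hvA
    rw [abs_mul, abs_of_nonneg hv]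
    exact mul_le_mul hu (by linarith) hv hC
  refine ⟨bound b2 hs0 (by linarith), bound b1 half0 (by linarith), bound b1 hs0 (by linarith),
    b1'.trans (le_mul_of_one_le_right hC (by linarith)), ?_⟩
  -- Expansion around the true value `(p, s)`, so that `s'` need only be nonnegative: remainder of
  -- each factor, plus the product of the two increments.
  have e : thetaK κ q * √s' - thetaK κ p * √s - thetaK' κ p * √s * (q - p)
        - thetaK κ p * (1 / (2 * √s)) * (s' - s)
      = (thetaK κ q - thetaK κ p - thetaK' κ p * (q - p)) * √s
        + thetaK κ p * (√s' - √s - 1 / (2 * √s) * (s' - s))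
        + (thetaK κ q - thetaK κ p) * (√s' - √s) := by ring
  rw [e]
  refine (abs_add_three _ _ _).trans ?_
  rw [abs_mul, abs_mul, abs_mul, abs_of_nonneg hs0]
  have t1 := mul_le_mul b5 hsm hs0 (by positivity)
  have t2 := mul_le_mul b1 l2 (abs_nonneg _) hC
  have t3 := mul_le_mul b4 l1 (abs_nonneg _) (by positivity)
  have t4 : |q - p| * |s' - s| ≤ ((q - p) ^ 2 + (s' - s) ^ 2) / 2 := by
    rw [← sq_abs (q - p), ← sq_abs (s' - s)]
    nlinarith [sq_nonneg (|q - p| - |s' - s|)]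
  generalize |q - p| = x at *
  generalize |s' - s| = y at *
  have hX : 0 ≤ (q - p) ^ 2 := sq_nonneg _
  have hY : 0 ≤ (s' - s) ^ 2 := sq_nonneg _
  generalize (q - p) ^ 2 = X at *
  generalize (s' - s) ^ 2 = Y at *
  have t5 : X * √B + 1 / (2 * √d * d) * Y + 1 / √d * (x * y) ≤ 2 * A * (X + Y) := by
    have u1 : X * √B ≤ X * A := mul_le_mul_of_nonneg_left (by linarith) hX
    have u2 : 1 / (2 * √d * d) * Y ≤ A * Y := mul_le_mul_of_nonneg_right (by linarith) hY
    have u3 : 1 / √d * (x * y) ≤ 1 / √d * ((X + Y) / 2) := mul_le_mul_of_nonneg_left t4 q1.le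
    have u4 : 1 / √d * ((X + Y) / 2) ≤ A * ((X + Y) / 2) :=
      mul_le_mul_of_nonneg_right (by linarith) (by positivity)
    have : 0 ≤ A * (X + Y) := by positivity
    linarith
  have := mul_le_mul_of_nonneg_left t5 hC
  linarith

section ThetaGradient
variable {𝒳 : Type*} [MeasurableSpace 𝒳] {Q : Measure (Obs 𝒳)} [IsFiniteMeasure Q]
  {η : Nuisance 𝒳} {ε : ℝ} {c : Bool} {g : Obs 𝒳 → ℝ} {M t s B B' : ℝ}

/-- A domination by a constant plus a mean-zero residual bounds the conditional mean by the
constant. With the residual of `σ₀²` in the role of `r`, it bounds conditional moments of `Y - μ₀`.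
-/
theorem Orth.condExp_le {r f : Obs 𝒳 → ℝ} (hr : Orth Q r) (hf : Integrable f Q) {a : ℝ}
    (h : ∀ᵐ o ∂Q, f o ≤ a + r o) : ∀ᵐ o ∂Q, Q[f | Obs.sigmaX] o ≤ a := by
  have h1 := condExp_mono (m := Obs.sigmaX) hf ((integrable_const a).add hr.integrable) h
  have h2 := condExp_add (integrable_const a) hr.integrable (μ := Q) Obs.sigmaX
  rw [condExp_const Obs.sigmaX_le] at h2
  filter_upwards [h1, h2, hr.condExp_eq] with o a1 a2 a3
  rw [a2, Pi.add_apply, a3] at a1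
  simpa using a1

namespace IsObsNuisance

/-- Bounded conditional variance makes the displacement of `μ₀` along the path uniformly of order
`t`, not merely dominated in `L²`. This allows its square to be placed in the `t² B` allowance and
to be squared again. -/
theorem abs_obsMu0_path_sub_le (H : IsObsNuisance Q c ε η) (hg : Measurable g)
    (hM : ∀ o, |g o| ≤ M) (ht : |t| * M ≤ 1 / 2)
    (hsB : ∀ᵐ o ∂Q, 0 ≤ η.sigma2 o.X ∧ η.sigma2 o.X ≤ B) :
    ∀ᵐ o ∂Q, |obsMu0 (path Q g t) o - η.mu0 o.X| ≤ |t| * (2 * M / ε * (1 + B)) := by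
  have := isFiniteMeasure_path (Q := Q) hM ht
  -- From `|y| ≤ 1 + y²` and `y² = σ₀² + (y² - σ₀²)`, with `y = Y - μ₀` and `σ₀² ≤ B`.
  have h1 := H.orth_sigma2.condExp_le (a := 1 + B) H.orth_mu0.integrable.abs (by
    filter_upwards [hsB] with o h
    rw [abs_mul]
    rcases o.zz_eq with hz | hz
    · rw [hz, sub_zero, abs_one, one_mul, one_mul, ← sq_abs (o.Y - _)]
      nlinarith [sq_nonneg (|o.Y - η.mu0 o.X| - 1)]
    · rw [hz]; simp only [sub_self, abs_zero, zero_mul, add_zero]; linarith)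
  filter_upwards [H.abs_control_sub_le hg hM ht (measurable_comp_X H.measurable_mu0)
    (measurable_condExp_X _ _) H.orth_mu0 (orth_obsMu0 (H.integrable_Y_path hg hM ht)), h1]
    with o a1 a2
  have hM0 : 0 ≤ M := (abs_nonneg _).trans (hM o)
  have hε := H.eps_pos
  exact a1.trans (by gcongr)

theorem memLp_obsMu0_path (H : IsObsNuisance Q c ε η) (hg : Measurable g)
    (hM : ∀ o, |g o| ≤ M) (ht : |t| * M ≤ 1 / 2)
    (hsB : ∀ᵐ o ∂Q, 0 ≤ η.sigma2 o.X ∧ η.sigma2 o.X ≤ B) (hB : ∀ᵐ o ∂Q, |η.mu0 o.X| ≤ B') :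
    MemLp (obsMu0 (path Q g t)) ∞ (path Q g t) := by
  refine memLp_top_of_bound (Measurable.of_sigmaX (measurable_condExp_X _ _)).aestronglyMeasurable
    (|t| * (2 * M / ε * (1 + B)) + B') (path_absolutelyContinuous.ae_le ?_)
  filter_upwards [H.abs_obsMu0_path_sub_le hg hM ht hsB, hB] with o h1 h2
  rw [Real.norm_eq_abs]
  have := abs_add_le (obsMu0 (path Q g t) o - η.mu0 o.X) (η.mu0 o.X)
  rw [sub_add_cancel] at this
  linarith

/-- The outcome `(Y - μ₀)²` keeps the untilted `μ₀`, so its regression under the tilted law is the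
tilted variance plus the squared displacement of the mean. -/
theorem orth_path_sq (H : IsObsNuisance Q c ε η) (hg : Measurable g)
    (hM : ∀ o, |g o| ≤ M) (ht : |t| * M ≤ 1 / 2)
    (hsB : ∀ᵐ o ∂Q, 0 ≤ η.sigma2 o.X ∧ η.sigma2 o.X ≤ B) :
    Orth (path Q g t) fun o => (1 - o.zz) * ((o.Y - η.mu0 o.X) ^ 2
      - (obsSigma2 (path Q g t) o + (obsMu0 (path Q g t) o - η.mu0 o.X) ^ 2)) := by
  have := isFiniteMeasure_path (Q := Q) hM ht
  have mf : Measurable[Obs.sigmaX] fun o => 2 * (obsMu0 (path Q g t) o - η.mu0 o.X) :=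
    measurable_const.mul ((measurable_condExp_X _ _).sub (measurable_comp_X H.measurable_mu0))
  have h1 := orth_obsMu0 (H.integrable_Y_path hg hM ht)
  have h2 := h1.mul_left mf (h1.integrable.bdd_mul
    (c := 2 * (|t| * (2 * M / ε * (1 + B)))) (Measurable.of_sigmaX mf).aestronglyMeasurable
    (path_absolutelyContinuous.ae_le (by
      filter_upwards [H.abs_obsMu0_path_sub_le hg hM ht hsB] with o h
      rw [norm_mul, Real.norm_two, Real.norm_eq_abs]
      linarith)))
  refine ((orth_obsSigma2 (MemLp.path hM ht H.memLp_Y)).add h2).congr (ae_of_all _ fun o => ?_)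
  simp only
  ring

theorem obsSigma2_path_nonneg (H : IsObsNuisance Q c ε η) (hg : Measurable g)
    (hM : ∀ o, |g o| ≤ M) (ht : |t| * M ≤ 1 / 2)
    (hsB : ∀ᵐ o ∂Q, 0 ≤ η.sigma2 o.X ∧ η.sigma2 o.X ≤ B) (hB : ∀ᵐ o ∂Q, |η.mu0 o.X| ≤ B') :
    ∀ᵐ o ∂Q, 0 ≤ obsSigma2 (path Q g t) o := by
  have := isFiniteMeasure_path (Q := Q) hM ht
  have hY := MemLp.path hM ht H.memLp_Y
  refine (absolutelyContinuous_path hg hM ht).ae_le ((orth_obsSigma2 hY).ae_le_of_le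
    (measurable_condExp_X _ _) integrable_one_sub_zz ?_ (H.condExp_one_sub_zz_pos hg hM ht) ?_)
  · exact Integrable.one_sub_zz_mul (V := fun o => (o.Y - obsMu0 (path Q g t) o) ^ 2)
      (hY.sub ((H.memLp_obsMu0_path hg hM ht hsB hB).mono_exponent le_top)).integrable_sq
  · refine ae_of_all _ fun o => ?_
    rw [zero_mul]
    refine mul_nonneg ?_ (sq_nonneg _)
    rcases o.zz_eq with h | h <;> simp [h]

theorem obsSigma2_path_le (H : IsObsNuisance Q c ε η) (hg : Measurable g)
    (hM : ∀ o, |g o| ≤ M) (ht : |t| * M ≤ 1 / 2)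
    (hsB : ∀ᵐ o ∂Q, 0 ≤ η.sigma2 o.X ∧ η.sigma2 o.X ≤ B) :
    ∀ᵐ o ∂Q, obsSigma2 (path Q g t) o ≤ B + |t| * (2 * M / ε * (2 * B)) := by
  have := isFiniteMeasure_path (Q := Q) hM ht
  -- From `|y² - σ₀²| ≤ y² + σ₀² = 2 σ₀² + (y² - σ₀²)`.
  have h1 := H.orth_sigma2.condExp_le (a := 2 * B) H.orth_sigma2.integrable.abs (by
    filter_upwards [hsB] with o h
    rcases o.zz_eq with hz | hz
    · rw [hz, sub_zero, one_mul, abs_le]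
      constructor <;> nlinarith [sq_nonneg (o.Y - η.mu0 o.X)]
    · rw [hz]; simp only [sub_self, abs_zero, zero_mul, add_zero]; linarith)
  filter_upwards [H.abs_control_sub_le hg hM ht (v' := fun o => obsSigma2 (path Q g t) o
      + (obsMu0 (path Q g t) o - η.mu0 o.X) ^ 2) (measurable_comp_X H.measurable_sigma2)
    ((measurable_condExp_X _ _).add (((measurable_condExp_X _ _).sub
      (measurable_comp_X H.measurable_mu0)).pow_const 2)) H.orth_sigma2 (H.orth_path_sq hg hM ht hsB),
    h1, hsB] with o a1 a2 a3
  have hM0 : 0 ≤ M := (abs_nonneg _).trans (hM o)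
  have hε := H.eps_pos
  have h2 := (abs_le.1 a1).2
  have h3 : |t| * (2 * M / ε * Q[fun o => |(1 - o.zz) * ((o.Y - η.mu0 o.X) ^ 2 - η.sigma2 o.X)| |
      Obs.sigmaX] o) ≤ |t| * (2 * M / ε * (2 * B)) := by gcongr
  have h4 := sq_nonneg (obsMu0 (path Q g t) o - η.mu0 o.X)
  linarith

/-- With `D` the squared displacement of `μ₀`, the control regression along the path is `σ_t² + D`,
whereas the functional contains `σ_t²`. As `D` is of order `t²`, the discrepancy does not affect the
derivative, and the score needs no term for `μ₀` in `ϑ`. -/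
theorem isGradient_theta (H : IsObsNuisance Q c ε η) (κ : ℝ)
    (hs : 0 < s) (hsB : ∀ᵐ o ∂Q, s ≤ η.sigma2 o.X ∧ η.sigma2 o.X ≤ B)
    (hB : ∀ᵐ o ∂Q, |η.mu0 o.X| ≤ B')
    (hL4 : MemLp (fun o => (1 - o.zz) * ((o.Y - η.mu0 o.X) ^ 2 - η.sigma2 o.X)) 2 Q) :
    IsGradient (fun ν => ∫ o, thetaK κ (obsPi ν c o) * √(obsSigma2 ν o) ∂ν) Q (phiTheta κ η) := by
  obtain ⟨C, hC, hb⟩ := exists_theta_remainder_bounds κ (B := B) hs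
  have hsB' : ∀ᵐ o ∂Q, 0 ≤ η.sigma2 o.X ∧ η.sigma2 o.X ≤ B :=
    hsB.mono fun o h => ⟨hs.le.trans h.1, h.2⟩
  have hε := H.eps_pos
  refine (H.isGradient_biv (H.isTrue_theta κ hs hsB) hL4 (C := 2 * C) (by positivity) ?_
    -- The second summand of the witness bounds the linear term in `D`. The first bounds `2 C D²`,
    -- with one factor `D` estimated uniformly in `t` by `((1 + B) / ε)²` and the other by `t² (2 M
    -- (1 + B) / ε)²`.
    (Ψ := fun ν => ∫ o, thetaK κ (obsPi ν c o) * √(obsSigma2 ν o) ∂ν) fun g M hg hM => ⟨fun _ => 2 * C * ((1 + B) / ε) ^ 2 * (2 * M / ε * (1 + B)) ^ 2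
      + C * (2 * M / ε * (1 + B)) ^ 2, integrable_const _, ae_of_all _ fun o => by positivity,
      fun t ht => ?_⟩).congr (phiTheta_eq c κ η) fun _ _ _ => Eventually.of_forall fun _ => rfl
  · filter_upwards [hsB, H.pi_mem] with o h1 hp
    obtain ⟨b1, b2, b3, -⟩ := hb _ hp _ hp _ 0 h1.1 h1.2 le_rfl
    exact ⟨by linarith, by linarith, by linarith⟩
  · have := isFiniteMeasure_path (Q := Q) hM ht
    have m1 : Measurable[Obs.sigmaX] (obsPi (path Q g t) c) := measurable_condExp_X _ _
    have m2 : Measurable[Obs.sigmaX] (obsSigma2 (path Q g t)) := measurable_condExp_X _ _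
    have m3 : Measurable[Obs.sigmaX] (obsMu0 (path Q g t)) := measurable_condExp_X _ _
    refine ⟨_, _, m2.add ((m3.sub (measurable_comp_X H.measurable_mu0)).pow_const 2),
      (measurable_theta κ).2.2.comp (m1.prodMk m2), H.orth_path_sq hg hM ht hsB', ?_, rfl⟩
    filter_upwards [hsB, H.obsSigma2_path_nonneg hg hM ht hsB' hB,
      H.abs_obsMu0_path_sub_le hg hM ht hsB'] with o h1 h2 h3 p q m hp hq hm hp' hq'
    have hM0 : 0 ≤ M := (abs_nonneg _).trans (hM o)
    rw [← hm] at h1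
    obtain ⟨-, b2, -, -, b5⟩ := hb p hp' q hq' m _ h1.1 h1.2 h2
    simp only [Function.comp, ← hq, Pi.add_apply]
    generalize obsSigma2 (path Q g t) o = s' at *
    have hd1 : (obsMu0 (path Q g t) o - η.mu0 o.X) ^ 2 ≤ t ^ 2 * (2 * M / ε * (1 + B)) ^ 2 := by
      rw [← sq_abs, ← sq_abs t, ← mul_pow]
      exact pow_le_pow_left₀ (abs_nonneg _) h3 2
    have hB1 : 0 ≤ 1 + B := by linarith [h1.1, h1.2]
    -- The uniform bound, from `|t| M ≤ 1/2`.
    have hd2 : (obsMu0 (path Q g t) o - η.mu0 o.X) ^ 2 ≤ ((1 + B) / ε) ^ 2 := by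
      rw [← sq_abs]
      refine pow_le_pow_left₀ (abs_nonneg _) (h3.trans ?_) 2
      have : |t| * (2 * M / ε * (1 + B)) = (|t| * M) * (2 * ((1 + B) / ε)) := by ring
      rw [this]
      refine (mul_le_mul_of_nonneg_right ht (by positivity)).trans (le_of_eq (by ring))
    have hd0 := sq_nonneg (obsMu0 (path Q g t) o - η.mu0 o.X)
    generalize (obsMu0 (path Q g t) o - η.mu0 o.X) ^ 2 = D at *
    generalize (2 * M / ε * (1 + B)) ^ 2 = K2 at *
    generalize ((1 + B) / ε) ^ 2 = K3 at *
    have e : thetaK κ q * √s' - thetaK κ p * √m - thetaK' κ p * √m * (q - p)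
          - thetaK κ p * (1 / (2 * √m)) * (s' + D - m)
        = (thetaK κ q * √s' - thetaK κ p * √m - thetaK' κ p * √m * (q - p)
          - thetaK κ p * (1 / (2 * √m)) * (s' - m)) - thetaK κ p * (1 / (2 * √m)) * D := by ring
    rw [e]
    refine (abs_sub _ _).trans ?_
    rw [abs_mul (thetaK κ p * _), abs_of_nonneg hd0]
    have t1 := mul_le_mul b2 hd1 hd0 hC
    -- Passage from the displacement of the variance to that of the regression `s' + D`; this
    -- doubles the constant in front of the squares.
    have t2 : (s' - m) ^ 2 ≤ 2 * (s' + D - m) ^ 2 + 2 * (D * D) := by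
      nlinarith [sq_nonneg (s' - m + 2 * D)]
    have t3 : D * D ≤ K3 * (t ^ 2 * K2) := mul_le_mul hd2 hd1 hd0 (hd0.trans hd2)
    have t4 := mul_le_mul_of_nonneg_left (t2.trans (add_le_add le_rfl
      (mul_le_mul_of_nonneg_left t3 zero_le_two))) hC
    have t5 := mul_nonneg hC (sq_nonneg (q - p))
    linarith

/-- Pointwise, `π_c μ_{0c}` is `π_c μ₀` plus `η_c` times the integrand of `ϑ`. Splitting the
integral needs both parts integrable under the tilted law, which the uniform bounds on the tilted
mean and variance provide for small `t`. -/
theorem isGradient_nu0SMDe (H : IsObsNuisance Q c ε η) (κ : ℝ)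
    (hs : 0 < s) (hsB : ∀ᵐ o ∂Q, s ≤ η.sigma2 o.X ∧ η.sigma2 o.X ≤ B)
    (hB : ∀ᵐ o ∂Q, |η.mu0 o.X| ≤ B')
    (hL4 : MemLp (fun o => (1 - o.zz) * ((o.Y - η.mu0 o.X) ^ 2 - η.sigma2 o.X)) 2 Q) :
    IsGradient (nu0SMDe c κ) Q (phiNu0SMDe c κ η) := by
  have hsB' : ∀ᵐ o ∂Q, 0 ≤ η.sigma2 o.X ∧ η.sigma2 o.X ≤ B :=
    hsB.mono fun o h => ⟨hs.le.trans h.1, h.2⟩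
  obtain ⟨C, hC, hb⟩ := exists_theta_bounds κ
  refine ((H.isGradient_nu0MR one_pos hB).add_const_mul (H.isGradient_theta κ hs hsB hB hL4)
    (etaC c κ)).congr (fun o => by rw [phiNu0SMDe, phiNu0PI_eq]) fun g hg ⟨M, hM⟩ => ?_
  -- The splitting is only claimed near `t = 0`, which suffices for the derivative.
  have hev : ∀ᶠ t : ℝ in 𝓝 0, |t| * M < 1 / 2 := by
    have : Continuous fun t : ℝ => |t| * M := by fun_prop
    exact this.continuousAt.eventually_lt continuousAt_const (by simp)
  filter_upwards [hev] with t ht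
  have ht := ht.le
  have := isFiniteMeasure_path (Q := Q) hM ht
  have m1 : Measurable (obsPi (path Q g t) c) := Measurable.of_sigmaX (measurable_condExp_X _ _)
  have m2 : Measurable (obsSigma2 (path Q g t)) := Measurable.of_sigmaX (measurable_condExp_X _ _)
  have hp := (path_absolutelyContinuous (g := g) (t := t)).ae_le (H.obsPi_path_mem hg hM ht)
  have h1 : ∀ p m, p * mrMean (rhoC c 1) p m = p * m := fun p m => by
    have : rhoC c 1 = 1 := by cases c <;> simp [rhoC]
    simp [this, mrMean, mrGamma]
  have i1 : Integrable (fun o => obsPi (path Q g t) c o * obsMu0 (path Q g t) o) (path Q g t) :=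
    ((H.memLp_obsMu0_path hg hM ht hsB' hB).integrable le_top).bdd_mul (c := 1)
      m1.aestronglyMeasurable (by
        filter_upwards [hp] with o ho
        rw [Real.norm_eq_abs, abs_of_nonneg ho.1]
        exact ho.2)
  have i2 : Integrable (fun o => thetaK κ (obsPi (path Q g t) c o) * √(obsSigma2 (path Q g t) o))
      (path Q g t) := by
    refine Integrable.of_bound ((measurable_theta κ).2.2.comp (m1.prodMk m2)).aestronglyMeasurable
      (C * √(B + |t| * (2 * M / ε * (2 * B)))) ?_
    filter_upwards [hp, path_absolutelyContinuous.ae_le (H.obsSigma2_path_le hg hM ht hsB')]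
      with o ho h2
    rw [norm_mul, Real.norm_eq_abs, Real.norm_eq_abs, abs_of_nonneg (Real.sqrt_nonneg _)]
    exact mul_le_mul (hb _ ho _ ho).1 (Real.sqrt_le_sqrt h2) (Real.sqrt_nonneg _) hC
  simp only [nu0SMDe, nu0MR, h1]
  rw [← integral_const_mul, ← integral_add i1 (i2.const_mul _)]
  refine integral_congr_ae (ae_of_all _ fun o => ?_)
  simp only [smdeMean, thetaK]
  ring

end IsObsNuisance
end ThetaGradient

/-! ### Asymptotic normality -/

section Normality
variable {𝒳 : Type*} [MeasurableSpace 𝒳] {Ω : Type*} [MeasurableSpace Ω] {μ : Measure Ω}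
  {Q : Measure (Obs 𝒳)} {O : ℕ → Ω → Obs 𝒳}
  {K : ℕ} {F : CrossFitting K} {N : NuisanceEstimator 𝒳 F} {η : Nuisance 𝒳} {c : Bool}

theorem identDistrib_comp (hO : ∀ i, Measurable (O i)) (hlaw : ∀ i, μ.map (O i) = Q)
    {f : Obs 𝒳 → ℝ} (hf : Measurable f) (i : ℕ) :
    IdentDistrib (fun ω => f (O i ω)) (fun ω => f (O 0 ω)) μ μ :=
  IdentDistrib.comp ⟨(hO i).aemeasurable, (hO 0).aemeasurable, by rw [hlaw, hlaw]⟩ hf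

variable [IsProbabilityMeasure μ]

/-- The limit law is tight, and the portmanteau theorem for closed sets carries its tail bound over
to large `n`. -/
theorem TendstoInDistribution.isBoundedOp {T : ℕ → Ω → ℝ} {ν : Measure ℝ} [IsProbabilityMeasure ν]
    (h : TendstoInDistribution T atTop (id : ℝ → ℝ) (fun _ => μ) ν) :
    IsBoundedOp μ fun n ω => ENNReal.ofReal |T n ω| := by
  intro δ hδ
  have ht := tendsto_measure_norm_gt_of_isTightMeasureSet (isTightMeasureSet_singleton (μ := ν))
  obtain ⟨r, hr, hr0⟩ := ((ht.eventually (gt_mem_nhds hδ)).and (eventually_ge_atTop 0)).exists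
  simp only [Set.mem_singleton_iff, iSup_iSup_eq_left] at hr
  -- Moving from `r` to `r + 1` makes this closed set a subset of the open tail `|x| > r`.
  have hF : IsClosed {x : ℝ | r + 1 ≤ |x|} := isClosed_le continuous_const continuous_abs
  have h1 := ProbabilityMeasure.limsup_measure_closed_le_of_tendsto h.tendsto hF
  simp only [ProbabilityMeasure.coe_mk, Measure.map_id] at h1
  have h2 : ν {x : ℝ | r + 1 ≤ |x|} < δ := (measure_mono fun x hx => by
    simp only [Set.mem_ofPred_eq, Real.norm_eq_abs] at hx ⊢; linarith).trans_lt hr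
  refine ⟨r + 1, (eventually_lt_of_limsup_lt (h1.trans_lt h2)).mono fun n hn => ?_⟩
  rw [Measure.map_apply_of_aemeasurable (h.forall_aemeasurable n) hF.measurableSet] at hn
  refine (measure_mono fun ω hω => ?_).trans hn.le
  simp only [Set.mem_ofPred_eq, Set.mem_preimage] at hω ⊢
  by_contra hcon
  exact absurd hω (not_lt.2 (ENNReal.ofReal_le_ofReal (not_le.1 hcon).le))

theorem measurable_crossAvg (hO : ∀ i, Measurable (O i)) {ψ : Nuisance 𝒳 → Obs 𝒳 → ℝ}
    (hψ : FitMeasurable N ψ) (n : ℕ) : Measurable (crossAvg N O ψ n) := by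
  refine Measurable.div_const (Finset.measurable_sum _ fun i _ => ?_) _
  exact (hψ n (F.fold n i)).comp
    ((measurable_pi_lambda (fun ω (j : F.train n (F.fold n i)) => O j ω) fun j => hO j).prodMk (hO i))

/-- The law of large numbers for sample averages. -/
theorem tendstoInMeasure_crossAvg_const (hO : ∀ i, Measurable (O i)) (hindep : iIndepFun O μ)
    (hlaw : ∀ i, μ.map (O i) = Q) {f : Obs 𝒳 → ℝ} (hf : Measurable f) (hfi : Integrable f Q) :
    TendstoInMeasure μ (fun n ω => crossAvg N O (fun _ => f) n ω - ∫ o, f o ∂Q) atTop 0 := by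
  have hint : ∫ ω, f (O 0 ω) ∂μ = ∫ o, f o ∂Q := by
    rw [← hlaw 0, integral_map (hO 0).aemeasurable hf.aestronglyMeasurable]
  have h := strong_law_ae_real (μ := μ) (fun i ω => f (O i ω))
    (by have := hfi; rw [← hlaw 0] at this; exact this.comp_measurable (hO 0))
    (fun i j hij => (hindep.indepFun hij).comp hf hf) (identDistrib_comp hO hlaw hf)
  rw [hint] at h
  refine tendstoInMeasure_of_tendsto_ae (fun n => ?_) ?_
  · exact ((measurable_crossAvg hO (fun n k => hf.comp measurable_snd) n).sub
      measurable_const).aestronglyMeasurable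
  · filter_upwards [h] with ω hω
    have := hω.sub_const (∫ o, f o ∂Q)
    rw [sub_self] at this
    refine this.congr fun n => ?_
    rw [crossAvg, Fin.sum_univ_eq_sum_range (fun i => f (O i ω))]

/-- The central limit theorem for sample averages. -/
theorem tendstoInDistribution_crossAvg_const (hO : ∀ i, Measurable (O i)) (hindep : iIndepFun O μ)
    (hlaw : ∀ i, μ.map (O i) = Q) {f : Obs 𝒳 → ℝ} (hf : Measurable f) (hf2 : MemLp f 2 Q)
    (h0 : ∫ o, f o ∂Q = 0) :
    TendstoInDistribution (fun (n : ℕ) ω => √(n : ℝ) * crossAvg N O (fun _ => f) n ω) atTop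
      (id : ℝ → ℝ) (fun _ => μ) (gaussianReal 0 (variance f Q).toNNReal) := by
  have hint : ∫ ω, f (O 0 ω) ∂μ = 0 := by
    rw [← h0, ← hlaw 0, integral_map (hO 0).aemeasurable hf.aestronglyMeasurable]
  have hvar : variance (fun ω => f (O 0 ω)) μ = variance f Q := by
    rw [← hlaw 0, variance_map hf.aemeasurable (hO 0).aemeasurable]
    rfl
  have h := tendstoInDistribution_inv_sqrt_mul_sum_sub (P := μ) (X := fun i ω => f (O i ω))
    (Y := (id : ℝ → ℝ)) (P' := gaussianReal 0 (variance f Q).toNNReal)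
    (by rw [hvar]; exact HasLaw.id)
    ((memLp_map_measure_iff hf.aestronglyMeasurable (hO 0).aemeasurable).1 (by rw [hlaw 0]; exact hf2))
    (hindep.comp (fun _ => f) fun _ => hf) (identDistrib_comp hO hlaw hf)
  rw [hint] at h
  have e : (fun (n : ℕ) ω => √(n : ℝ) * crossAvg N O (fun _ => f) n ω) = fun (n : ℕ) ω =>
      (√(n : ℝ))⁻¹ * (∑ k ∈ Finset.range n, f (O k ω) - n * 0) := by
    funext n ω
    rw [crossAvg, Fin.sum_univ_eq_sum_range (fun i => f (O i ω)), mul_zero, sub_zero,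
      mul_div_assoc', mul_comm, mul_div_assoc, Real.sqrt_div_self, mul_comm]
  rw [e]
  exact h

/-- The quotient rule for `(ν_{1c} - ν_{0c}) / π_c`. The mean is zero because the three scores
integrate to their functionals. -/
theorem isInfluenceFunction_ifDelta [IsFiniteMeasure Q] {nu0 : Measure (Obs 𝒳) → ℝ}
    {phi0 : Nuisance 𝒳 → Obs 𝒳 → ℝ} (Gp : IsGradient (margPi c) Q (phiPi c η))
    (G1 : IsGradient (nu1 c) Q (phiNu1 c η)) (G0 : IsGradient nu0 Q (phi0 η))
    (hne : margPi c Q ≠ 0) :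
    IsInfluenceFunction (delta c nu0) Q (ifDelta c nu0 phi0 Q η) := by
  have i1 := G1.memLp.integrable one_le_two
  have i0 := G0.memLp.integrable one_le_two
  have ip := Gp.memLp.integrable one_le_two
  have hi : Integrable (fun o => phiNu1 c η o - phi0 η o) Q := i1.sub i0
  refine ⟨((G1.memLp.sub G0.memLp).sub (Gp.memLp.const_mul _)).const_mul _, ?_, fun g hg hM _ => ?_⟩
  · simp only [ifDelta]
    rw [integral_const_mul, integral_sub hi (ip.const_mul _), integral_sub i1 i0,
      integral_const_mul, G1.integral_eq, G0.integral_eq, Gp.integral_eq, delta]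
    field_simp
    ring
  · have j1 := G1.integrable_mul hg hM
    have j0 := G0.integrable_mul hg hM
    have jp := Gp.integrable_mul hg hM
    have hj : Integrable (fun o => phiNu1 c η o * g o - phi0 η o * g o) Q := j1.sub j0
    have hd := ((G1.hasDerivAt g hg hM).sub (G0.hasDerivAt g hg hM)).div (Gp.hasDerivAt g hg hM)
      (by rwa [path_zero])
    simp only [Pi.sub_apply, path_zero] at hd
    refine hd.congr_deriv ?_
    have e : ∀ o, ifDelta c nu0 phi0 Q η o * g o = 1 / margPi c Q *
        (phiNu1 c η o * g o - phi0 η o * g o - delta c nu0 Q * (phiPi c η o * g o)) := fun o => by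
      rw [ifDelta]; ring
    simp only [e]
    rw [integral_const_mul, integral_sub hj (jp.const_mul _), integral_sub j1 j0,
      integral_const_mul, delta]
    field_simp

/-- A ratio of estimators that are asymptotically equivalent to sample averages. -/
theorem isRootNNormal_deltaHat [IsFiniteMeasure Q] (hO : ∀ i, Measurable (O i))
    (hindep : iIndepFun O μ) (hlaw : ∀ i, μ.map (O i) = Q) {nu0 : Measure (Obs 𝒳) → ℝ}
    {phi0 : Nuisance 𝒳 → Obs 𝒳 → ℝ} (mp : FitMeasurable N (phiPi c))
    (m1 : FitMeasurable N (phiNu1 c)) (m0 : FitMeasurable N phi0)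
    (mp' : Measurable (phiPi c η)) (m1' : Measurable (phiNu1 c η)) (m0' : Measurable (phi0 η))
    (hp : IsLittleOp μ (fun n ω => ‖√(n : ℝ) * crossAvg N O
      (fun θ o => phiPi c θ o - phiPi c η o) n ω‖ₑ) fun _ => 1)
    (h1 : IsLittleOp μ (fun n ω => ‖√(n : ℝ) * crossAvg N O
      (fun θ o => phiNu1 c θ o - phiNu1 c η o) n ω‖ₑ) fun _ => 1)
    (h0 : IsLittleOp μ (fun n ω => ‖√(n : ℝ) * crossAvg N O
      (fun θ o => phi0 θ o - phi0 η o) n ω‖ₑ) fun _ => 1)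
    (Gp : IsGradient (margPi c) Q (phiPi c η))
    (G1 : IsGradient (nu1 c) Q (phiNu1 c η)) (G0 : IsGradient nu0 Q (phi0 η))
    (hpos : 0 < margPi c Q) :
    IsRootNNormal μ (deltaHat N O c phi0) (delta c nu0) Q (ifDelta c nu0 phi0 Q η) := by
  have hIF := isInfluenceFunction_ifDelta (c := c) Gp G1 G0 hpos.ne'
  set π := margPi c Q with hπ
  set D := delta c nu0 Q with hD
  set φ := ifDelta c nu0 phi0 Q η with hφ
  have mφ : Measurable φ := measurable_const.mul ((m1'.sub m0').sub (measurable_const.mul mp'))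
  set W := fun n ω => crossAvg N O (phiPi c) n ω with hW
  have mW : ∀ n, Measurable (W n) := fun n => measurable_crossAvg hO mp n
  set T := fun (n : ℕ) ω => √(n : ℝ) * (deltaHat N O c phi0 n ω - D) with hT
  have mT : ∀ n, Measurable (T n) := fun n => measurable_const.mul ((((measurable_crossAvg hO m1 n).sub
    (measurable_crossAvg hO m0 n)).div (mW n)).sub measurable_const)
  -- the linear part
  have hR : IsLittleOp μ (fun n ω => ‖√(n : ℝ) * crossAvg N O (fun θ o =>
      1 / π * ((phiNu1 c θ o - phiNu1 c η o) + ((-1) * (phi0 θ o - phi0 η o)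
        + (-D) * (phiPi c θ o - phiPi c η o)))) n ω‖ₑ) fun _ => 1 :=
    isLittleOp_crossAvg_const_mul _ (isLittleOp_crossAvg_add h1
      (isLittleOp_crossAvg_add (isLittleOp_crossAvg_const_mul _ h0) (isLittleOp_crossAvg_const_mul _ hp)))
  set X := fun (n : ℕ) ω => √(n : ℝ) * crossAvg N O (fun θ o =>
      1 / π * (phiNu1 c θ o - phi0 θ o - D * phiPi c θ o)) n ω with hX
  have mX : ∀ n, Measurable (X n) := fun n => measurable_const.mul (measurable_crossAvg hO
    (fun n k => measurable_const.mul (((m1 n k).sub (m0 n k)).sub (measurable_const.mul (mp n k)))) n)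
  have hXd : TendstoInDistribution X atTop (id : ℝ → ℝ) (fun _ => μ)
      (gaussianReal 0 (variance φ Q).toNNReal) := by
    refine tendstoInDistribution_of_tendstoInMeasure_sub X id
      (tendstoInDistribution_crossAvg_const (N := N) hO hindep hlaw mφ hIF.1 hIF.2.1) ?_
      fun n => (mX n).aemeasurable
    convert hR.tendstoInMeasure using 1
    funext n ω
    simp only [hX, Pi.sub_apply]
    rw [← mul_sub, ← crossAvg_sub]
    congr 2
    funext θ o
    simp only [hφ, ifDelta]
    ring
  -- the denominator
  have hWp : IsLittleOp μ (fun n ω => ‖W n ω - π‖ₑ) fun _ => 1 := by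
    have a1 : IsLittleOp μ (fun n ω => ‖crossAvg N O
        (fun θ o => phiPi c θ o - phiPi c η o) n ω‖ₑ) fun _ => 1 := by
      refine hp.mono fun n ω => ?_
      rcases Nat.eq_zero_or_pos n with rfl | hn
      · simp [crossAvg]
      · rw [enorm_mul]
        refine le_mul_of_one_le_left' ?_
        rw [← ofReal_norm, Real.norm_eq_abs, abs_of_nonneg (Real.sqrt_nonneg _), ENNReal.one_le_ofReal,
          Real.one_le_sqrt]
        exact_mod_cast hn
    have a2 := isLittleOp_of_tendstoInMeasure (tendstoInMeasure_crossAvg_const (N := N) hO hindep hlaw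
      mp' (Gp.memLp.integrable one_le_two))
    refine (a1.add a2).mono fun n ω => ?_
    rw [crossAvg_sub, Gp.integral_eq]
    refine le_trans (le_of_eq ?_) (enorm_add_le _ _)
    congr 1
    simp only [hW]
    ring
  have hWm := tendstoInMeasure_iff_norm.1 hWp.tendstoInMeasure
  simp only [Pi.zero_apply, sub_zero, Real.norm_eq_abs] at hWm
  -- If `|W - π| < min(π/2, δ π/2)`, then `W > π/2`, and `|π / W - 1| = |W - π| / W < δ`.
  have hV : TendstoInMeasure μ (fun n ω => π / W n ω) atTop fun _ => 1 := by
    rw [tendstoInMeasure_iff_norm]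
    intro δ hδ
    refine tendsto_of_tendsto_of_tendsto_of_le_of_le tendsto_const_nhds
      (hWm (min (π / 2) (δ * (π / 2))) (by positivity)) (fun _ => zero_le)
      fun n => measure_mono fun ω hω => ?_
    simp only [Set.mem_ofPred_eq, Real.norm_eq_abs] at hω ⊢
    by_contra hcon
    obtain ⟨c1, c2⟩ := lt_min_iff.1 (not_le.1 hcon)
    have hw : π / 2 < W n ω := by linarith [(abs_lt.1 c1).1]
    have hw0 : 0 < W n ω := by linarith
    have : π / W n ω - 1 = -(W n ω - π) / W n ω := by field_simp; ring
    rw [this, abs_div, abs_neg, abs_of_pos hw0, le_div_iff₀ hw0] at hω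
    nlinarith
  -- Slutsky's theorem for the product of the linear part and `π / W`.
  have hXV := hXd.continuous_comp_prodMk_of_tendstoInMeasure_const (g := fun x : ℝ × ℝ => x.1 * x.2)
    (by fun_prop) hV fun n => (measurable_const.div (mW n)).aemeasurable
  have hZ : (fun ω : ℝ => (id ω : ℝ) * 1) = id := by funext ω; simp
  simp only [hZ] at hXV
  have hTd : TendstoInDistribution T atTop (id : ℝ → ℝ) (fun _ => μ)
      (gaussianReal 0 (variance φ Q).toNNReal) := by
    refine tendstoInDistribution_of_tendstoInMeasure_sub T id hXV ?_ fun n => (mT n).aemeasurable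
    rw [tendstoInMeasure_iff_norm]
    intro δ hδ
    refine tendsto_of_tendsto_of_tendsto_of_le_of_le tendsto_const_nhds
      (hWm π hpos) (fun _ => zero_le) fun n => measure_mono fun ω hω => ?_
    simp only [Set.mem_ofPred_eq, Pi.sub_apply, Pi.zero_apply, sub_zero] at hω ⊢
    -- Where the denominator is nonzero, the standardized estimator equals exactly `X · (π / W)`. A
    -- zero denominator, where division returns `0`, has probability tending to zero, because it
    -- forces `|W - π| = π`.
    by_cases hw : W n ω = 0
    · rw [hw, zero_sub, abs_neg, abs_of_pos hpos]
    · exfalso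
      have e : T n ω = X n ω * (π / W n ω) := by
        simp only [hT, hX, deltaHat]
        rw [crossAvg_const_mul, crossAvg_sub, crossAvg_sub, crossAvg_const_mul]
        change √(n : ℝ) * (_ / W n ω - D) = √(n : ℝ) * (1 / π * (_ - D * W n ω)) * (π / W n ω)
        field_simp
      rw [e, sub_self, norm_zero] at hω
      linarith
  exact ⟨hIF, TendstoInDistribution.isBoundedOp hTd, hTd⟩

end Normality

/-! ### Measurability of the scores -/

section Measurability
variable {𝒳 α : Type*} [MeasurableSpace 𝒳] [MeasurableSpace α] {T : α → Nuisance 𝒳}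
  {o : α → Obs 𝒳} {c : Bool}

/-- Joint measurability of a parametrized nuisance function along a measurable observation. -/
structure MeasurableAlong (T : α → Nuisance 𝒳) (o : α → Obs 𝒳) : Prop where
  obs : Measurable o
  e1 : Measurable fun a => (T a).e1 (o a).X
  pi1 : Measurable fun a => (T a).pi1 (o a).X
  mu1 : Measurable fun a => (T a).mu1 (o a).X
  mu0 : Measurable fun a => (T a).mu0 (o a).X
  sigma2 : Measurable fun a => (T a).sigma2 (o a).X

theorem NuisanceEstimator.IsMeasurable.measurableAlong {K : ℕ} {F : CrossFitting K}
    {N : NuisanceEstimator 𝒳 F} (hN : N.IsMeasurable) (n : ℕ) (k : Fin K) :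
    MeasurableAlong (fun q : (F.train n k → Obs 𝒳) × Obs 𝒳 => N n k q.1) Prod.snd where
  obs := measurable_snd
  e1 := hN.joint.1 n k
  pi1 := hN.joint.2.1 true n k
  mu1 := hN.joint.2.2.1 n k
  mu0 := hN.joint.2.2.2.1 n k
  sigma2 := hN.joint.2.2.2.2 n k

theorem IsObsNuisance.measurableAlong {Q : Measure (Obs 𝒳)} {ε : ℝ} {η : Nuisance 𝒳}
    (H : IsObsNuisance Q c ε η) : MeasurableAlong (fun _ : Obs 𝒳 => η) id where
  obs := measurable_id
  e1 := H.measurable_e1.comp Obs.measurable_X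
  pi1 := H.measurable_pi1.comp Obs.measurable_X
  mu1 := H.measurable_mu1.comp Obs.measurable_X
  mu0 := H.measurable_mu0.comp Obs.measurable_X
  sigma2 := H.measurable_sigma2.comp Obs.measurable_X

namespace MeasurableAlong

theorem pi (h : MeasurableAlong T o) (c : Bool) : Measurable fun a => (T a).pi c (o a).X := by
  cases c
  · exact measurable_const.sub h.pi1
  · exact h.pi1

theorem score {a1 u1 a0 u0 G : α → ℝ} (h : MeasurableAlong T o)
    (m1 : Measurable a1) (m2 : Measurable u1) (m3 : Measurable a0) (m4 : Measurable u0)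
    (m5 : Measurable G) :
    Measurable fun a => (1 - (o a).zz) / (T a).e0 (o a).X * a0 a * u0 a
      + (o a).zz / (T a).e1 (o a).X * a1 a * u1 a + G a := by
  have hz := Obs.measurable_zz.comp h.obs
  exact ((((measurable_const.sub hz).div (measurable_const.sub h.e1)).mul m3).mul m4).add
    (((hz.div h.e1).mul m1).mul m2) |>.add m5

theorem phiPi (h : MeasurableAlong T o) : Measurable fun a => phiPi c (T a) (o a) :=
  (((Obs.measurable_zz.comp h.obs).div h.e1).mul
    (((Obs.measurable_ind c).comp h.obs).sub (h.pi c))).add (h.pi c)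

theorem phiNu1 (h : MeasurableAlong T o) : Measurable fun a => phiNu1 c (T a) (o a) := by
  have hz : Measurable fun a => (o a).zz / (T a).e1 (o a).X :=
    (Obs.measurable_zz.comp h.obs).div h.e1
  have hi : Measurable fun a => (o a).ind c := (Obs.measurable_ind c).comp h.obs
  exact (((hz.mul hi).mul ((Obs.measurable_Y.comp h.obs : Measurable fun a => (o a).Y).sub h.mu1)).add
    ((hz.mul h.mu1).mul (hi.sub (h.pi c)))).add ((h.pi c).mul h.mu1)

theorem phiNu0GOR (h : MeasurableAlong T o) (ρ l u : ℝ) :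
    Measurable fun a => phiNu0GOR c ρ l u (T a) (o a) := by
  obtain ⟨m1, m2, m3⟩ := measurable_gor (rhoC c ρ) l u
  have hb := (h.pi c).prodMk h.mu0
  have hs := h.score (m1.comp hb) (((Obs.measurable_ind c).comp h.obs).sub (h.pi c)) (m2.comp hb)
    ((Obs.measurable_Y.comp h.obs).sub h.mu0) (m3.comp hb)
  simp only [PISens.phiNu0GOR]
  exact hs

theorem phiNu0MR (h : MeasurableAlong T o) (ρ : ℝ) :
    Measurable fun a => phiNu0MR c ρ (T a) (o a) := by
  obtain ⟨m1, m2, m3⟩ := measurable_mr (rhoC c ρ)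
  have hb := (h.pi c).prodMk h.mu0
  exact h.score (m1.comp hb) (((Obs.measurable_ind c).comp h.obs).sub (h.pi c)) (m2.comp hb)
    ((Obs.measurable_Y.comp h.obs).sub h.mu0) (m3.comp hb)

theorem phiTheta (h : MeasurableAlong T o) (κ : ℝ) :
    Measurable fun a => phiTheta κ (T a) (o a) := by
  have hp := h.pi1
  have hs := h.sigma2
  refine h.score ?_ (((Obs.measurable_ind true).comp h.obs).sub h.pi1) ?_
    ((((Obs.measurable_Y.comp h.obs).sub h.mu0).pow_const 2).sub h.sigma2) ?_
  · unfold thetaDotPi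
    exact Measurable.div (by fun_prop) (measurable_const.mul (Measurable.pow_const (by fun_prop) _))
  · unfold thetaDotSigma
    fun_prop
  · unfold theta
    fun_prop

theorem phiNu0SMDe (h : MeasurableAlong T o) (κ : ℝ) :
    Measurable fun a => phiNu0SMDe c κ (T a) (o a) := by
  simp only [PISens.phiNu0SMDe, phiNu0PI_eq]
  exact (h.phiNu0MR 1).add (measurable_const.mul (h.phiTheta κ))

end MeasurableAlong
end Measurability

/-! ### The sample -/

section Final
variable {𝒳 : Type*} [MeasurableSpace 𝒳] {P : Measure (FullData 𝒳)} {c : Bool} {η : Nuisance 𝒳}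

theorem map_observe_map_X : (P.map FullData.observe).map Obs.X = P.map FullData.X :=
  Measure.map_map Obs.measurable_X FullData.measurable_observe

theorem ae_observe_of_ae_map_X {p : 𝒳 → Prop} (h : ∀ᵐ x ∂(P.map FullData.X), p x) :
    ∀ᵐ o ∂(P.map FullData.observe), p o.X :=
  ae_of_ae_map Obs.measurable_X.aemeasurable (map_observe_map_X (P := P) ▸ h)

theorem control_outcome_mem {s : Set ℝ} (hs : MeasurableSet s) (h : ∀ᵐ d ∂P, d.Y0 ∈ s) :
    ∀ᵐ o ∂(P.map FullData.observe), o.Z = false → o.Y ∈ s := by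
  rw [ae_map_iff FullData.measurable_observe.aemeasurable]
  · filter_upwards [h] with d hd hz
    have hz' : d.Z = false := hz
    simpa [FullData.observe, Obs.Y, FullData.Y, hz'] using hd
  · have h1 : MeasurableSet {o : Obs 𝒳 | o.Z = false} :=
      Obs.measurable_Z (measurableSet_singleton false)
    exact h1.imp (Obs.measurable_Y hs)

variable [IsProbabilityMeasure P]

/-- The functional `π_c` is the probability of the stratum. -/
theorem IsTrueNuisance.margPi_pos {ε : ℝ} (hη : IsTrueNuisance P c η)
    (H : IsObsNuisance (P.map FullData.observe) c ε η) (hc : P {d | d.C = c} ≠ 0) :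
    0 < margPi c (P.map FullData.observe) := by
  have mo := FullData.measurable_observe (𝒳 := 𝒳)
  have : IsProbabilityMeasure (P.map FullData.observe) :=
    Measure.isProbabilityMeasure_map mo.aemeasurable
  have mC : MeasurableSet {d : FullData 𝒳 | d.C = c} :=
    FullData.measurable_C (measurableSet_singleton c)
  have mp : Measurable fun o : Obs 𝒳 => η.pi c o.X := (hη.measurable_pi c).comp Obs.measurable_X
  have me : Measurable fun o : Obs 𝒳 => η.e1 o.X := hη.measurable_e1.comp Obs.measurable_X
  have i0 : Integrable (fun d : FullData 𝒳 => if d.C = c then (1 : ℝ) else 0) P :=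
    (integrable_indicator_one mC).congr (ae_of_all _ fun d => by
      by_cases h : d.C = c <;> simp [h])
  have ip : Integrable (fun o : Obs 𝒳 => η.pi c o.X) (P.map FullData.observe) :=
    Integrable.of_bound mp.aestronglyMeasurable 1 (by
      filter_upwards [H.pi_mem] with o ho
      rw [Real.norm_eq_abs, abs_of_nonneg ho.1]; exact ho.2)
  have iw : Integrable (fun o : Obs 𝒳 => (η.e1 o.X)⁻¹ * (o.zz * (o.ind c - η.pi c o.X)))
      (P.map FullData.observe) :=
    H.orth_pi.integrable.bdd_mul (c := ε⁻¹) me.inv.aestronglyMeasurable (by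
      filter_upwards [H.e_mem] with o ho
      rw [norm_inv, Real.norm_eq_abs, abs_of_pos (H.eps_pos.trans_le ho.1)]
      exact inv_anti₀ H.eps_pos ho.1)
  have hw := (H.orth_pi.mul_left (measurable_comp_X (f := fun x => (η.e1 x)⁻¹) hη.measurable_e1.inv) iw).integral_eq_zero
    Obs.sigmaX_le
  have hC := (meanZero_stratum hη c).integral_eq_zero FullData.sigmaX_le
  have ip' : Integrable (fun d : FullData 𝒳 => η.pi c d.X) P := ip.comp_measurable mo
  rw [integral_sub i0 ip', sub_eq_zero] at hC
  -- The score `φ_{π_c}` integrates to the functional; its weighted residual has mean zero, and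
  -- `π_c(X)` has mean `P(C = c)` on the full data.
  have e1 : margPi c (P.map FullData.observe) = P.real {d | d.C = c} := by
    rw [← H.isGradient_margPi.integral_eq]
    have e : ∀ o, phiPi c η o = (η.e1 o.X)⁻¹ * (o.zz * (o.ind c - η.pi c o.X)) + η.pi c o.X :=
      fun o => by rw [phiPi]; ring
    simp only [e]
    rw [integral_add iw ip, hw, zero_add, integral_map mo.aemeasurable mp.aestronglyMeasurable]
    refine hC.symm.trans ?_
    rw [← integral_indicator_one mC]
    exact integral_congr_ae (ae_of_all _ fun d => by by_cases h : d.C = c <;> simp [h])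
  rw [e1]
  exact ENNReal.toReal_pos hc (measure_ne_top _ _)

/-- On controls `Y = Y₀`, and the product of two `L⁴` functions is in `L²`; boundedness of `μ₀` and
`σ₀²` takes care of the rest. -/
theorem memLp_control_sq_residual (hη : IsTrueNuisance P c η) (hY : MemLp FullData.Y0 4 P)
    (hm : MemLp η.mu0 ∞ (P.map FullData.X)) (hs : MemLp η.sigma2 ∞ (P.map FullData.X)) :
    MemLp (fun o : Obs 𝒳 => (1 - o.zz) * ((o.Y - η.mu0 o.X) ^ 2 - η.sigma2 o.X)) 2
      (P.map FullData.observe) := by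
  have mX := FullData.measurable_X (𝒳 := 𝒳)
  have mo := FullData.measurable_observe (𝒳 := 𝒳)
  have mm := hη.measurable_mu0.comp (Obs.measurable_X (𝒳 := 𝒳))
  have ms := hη.measurable_sigma2.comp (Obs.measurable_X (𝒳 := 𝒳))
  have mr : Measurable fun o : Obs 𝒳 => (1 - o.zz) * ((o.Y - η.mu0 o.X) ^ 2 - η.sigma2 o.X) :=
    (measurable_const.sub Obs.measurable_zz).mul (((Obs.measurable_Y.sub mm).pow_const 2).sub ms)
  rw [memLp_map_measure_iff mr.aestronglyMeasurable mo.aemeasurable]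
  have hm' : MemLp (fun d : FullData 𝒳 => η.mu0 d.X) 4 P :=
    (hm.comp_of_map mX.aemeasurable).mono_exponent le_top
  have hs' : MemLp (fun d : FullData 𝒳 => η.sigma2 d.X) 2 P :=
    (hs.comp_of_map mX.aemeasurable).mono_exponent le_top
  have hr : MemLp (fun d : FullData 𝒳 => d.Y0 - η.mu0 d.X) 4 P := hY.sub hm'
  have hh : ENNReal.HolderTriple 4 4 2 := ⟨by
    rw [show (4 : ℝ≥0∞) = 2 * 2 by norm_num, ENNReal.mul_inv (by simp) (by simp), ← two_mul,
      ← mul_assoc, ENNReal.mul_inv_cancel (by simp) (by simp), one_mul]⟩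
  have hq : MemLp (fun d : FullData 𝒳 => (d.Y0 - η.mu0 d.X) * (d.Y0 - η.mu0 d.X)) 2 P :=
    hr.mul' hr
  have ht : MemLp (fun d : FullData 𝒳 => (d.Y0 - η.mu0 d.X) * (d.Y0 - η.mu0 d.X) - η.sigma2 d.X)
      2 P := hq.sub hs'
  refine ht.mono (mr.comp mo).aestronglyMeasurable (ae_of_all _ fun d => ?_)
  simp only [Function.comp]
  rw [observe_zz]
  by_cases hd : d.Z = true
  · simp [hd]
  · simp [hd, FullData.observe, Obs.Y, FullData.Y, Obs.X, sq]

end Final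

/-! ### Assembly of the three components. -/

section Combine
variable {𝒳 : Type*} [MeasurableSpace 𝒳] {Ω : Type*} [MeasurableSpace Ω] {μ : Measure Ω}
  [IsProbabilityMeasure μ] {Q : Measure (Obs 𝒳)} {PX : Measure 𝒳} {O : ℕ → Ω → Obs 𝒳}
  {K : ℕ} {F : CrossFitting K} {N : NuisanceEstimator 𝒳 F} {η : Nuisance 𝒳} {ε : ℝ} {c : Bool}

theorem SampleSetup.isRootNNormal (D : SampleSetup μ N O Q PX η ε c) (hpos : 0 < margPi c Q)
    (hmc : ∀ k, IsLittleOp μ (err PX N O η Nuisance.mu1 k) fun _ => 1)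
    (hem : ∀ k, IsLittleOp μ (fun n ω => err PX N O η Nuisance.e1 k n ω
        * err PX N O η Nuisance.mu1 k n ω) fun n => (n : ℝ) ^ (-(1 / 2) : ℝ))
    {nu0 : Measure (Obs 𝒳) → ℝ} {phi0 : Nuisance 𝒳 → Obs 𝒳 → ℝ}
    (m0 : FitMeasurable N phi0) (m0' : Measurable (phi0 η))
    (h0 : IsLittleOp μ (fun n ω => ‖√(n : ℝ) * crossAvg N O
      (fun θ o => phi0 θ o - phi0 η o) n ω‖ₑ) fun _ => 1)
    (G0 : IsGradient nu0 Q (phi0 η)) :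
    IsRootNNormal μ (deltaHat N O c phi0) (delta c nu0) Q (ifDelta c nu0 phi0 Q η) := by
  have := D.isProbabilityMeasure
  have H := D.nuisance
  have hN := D.measurable_fit
  exact isRootNNormal_deltaHat D.measurable_sample D.indep D.law
    (fun n k => (hN.measurableAlong n k).phiPi) (fun n k => (hN.measurableAlong n k).phiNu1) m0
    H.measurableAlong.phiPi H.measurableAlong.phiNu1 m0' D.crossAvg_phiPi
    (D.crossAvg_phiNu1 hmc hem) h0 H.isGradient_margPi H.isGradient_nu1 G0 hpos

end Combine

end PISens

end

open PISens

theorem mainTheorem5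
    {𝒳 : Type*} [MeasurableSpace 𝒳] [StandardBorelSpace 𝒳]
    {Ω : Type*} [MeasurableSpace Ω] (μ : Measure Ω) [IsProbabilityMeasure μ]
    -- the full-data law, ignorability, and a stratum of positive probability
    (P : Measure (FullData 𝒳)) [IsProbabilityMeasure P] (hA1 : Ignorability P)
    (c : Bool) (hc : P {d | d.C = c} ≠ 0)
    -- the i.i.d. observed sample
    (O : ℕ → Ω → Obs 𝒳) (hO : ∀ i, Measurable (O i)) (hindep : iIndepFun O μ)
    (hlaw : ∀ i, μ.map (O i) = P.map FullData.observe)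
    -- the true nuisance functions and their cross-fitted estimators
    (η : Nuisance 𝒳) (hη : IsTrueNuisance P c η)
    {K : ℕ} (F : CrossFitting K) (N : NuisanceEstimator 𝒳 F) (hN : N.IsMeasurable)
    -- positivity
    (hpos : ∃ ε : ℝ, 0 < ε ∧ ∀ᵐ x ∂(P.map FullData.X), ε ≤ η.e1 x ∧ η.e1 x < 1 - ε)
    -- regularity
    (hY1 : MemLp FullData.Y1 2 P) (hY0 : MemLp FullData.Y0 2 P)
    (hmu1 : MemLp η.mu1 ∞ (P.map FullData.X))
    (hpi : ∀ n k data x, (N n k data).pi1 x ∈ Set.Icc (0 : ℝ) 1)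
    -- consistency
    (he_cons : ∀ k, IsLittleOp μ (err (P.map FullData.X) N O η Nuisance.e1 k) fun _ => 1)
    (hpi_cons : ∀ k, IsLittleOp μ (err (P.map FullData.X) N O η (fun θ => θ.pi c) k) fun _ => 1)
    (hmu1_cons : ∀ k, IsLittleOp μ (err (P.map FullData.X) N O η Nuisance.mu1 k) fun _ => 1)
    (hmu0_cons : ∀ k, IsLittleOp μ (err (P.map FullData.X) N O η Nuisance.mu0 k) fun _ => 1)
    -- bounded inverse propensity score estimates
    (he1_inv : ∀ k, IsBoundedOp μ (invSup (P.map FullData.X) N O Nuisance.e1 k))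
    (he0_inv : ∀ k, IsBoundedOp μ (invSup (P.map FullData.X) N O Nuisance.e0 k))
    -- the `eπ` and `eμ` rates
    (hepi : ∀ k, IsLittleOp μ
      (fun n ω => err (P.map FullData.X) N O η Nuisance.e1 k n ω
        * err (P.map FullData.X) N O η (fun θ => θ.pi c) k n ω)
      fun n => (n : ℝ) ^ (-(1 / 2) : ℝ))
    (hemu1 : ∀ k, IsLittleOp μ
      (fun n ω => err (P.map FullData.X) N O η Nuisance.e1 k n ω
        * err (P.map FullData.X) N O η Nuisance.mu1 k n ω)
      fun n => (n : ℝ) ^ (-(1 / 2) : ℝ))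
    (hemu0 : ∀ k, IsLittleOp μ
      (fun n ω => err (P.map FullData.X) N O η Nuisance.e1 k n ω
        * err (P.map FullData.X) N O η Nuisance.mu0 k n ω)
      fun n => (n : ℝ) ^ (-(1 / 2) : ℝ))
    -- the `π` rate
    (hpi_rate : ∀ k, IsLittleOp μ (err (P.map FullData.X) N O η (fun θ => θ.pi c) k)
      fun n => (n : ℝ) ^ (-(1 / 4) : ℝ)) :
    -- generalized odds ratio
    (∀ ρ l h : ℝ, 0 < ρ → l < h →
      (∀ᵐ d ∂P, d.Y0 ∈ Set.Icc l h) →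
      (∀ n k data x, (N n k data).mu0 x ∈ Set.Icc l h) →
      (∀ k, IsLittleOp μ (err (P.map FullData.X) N O η Nuisance.mu0 k)
        fun n => (n : ℝ) ^ (-(1 / 4) : ℝ)) →
      IsRootNNormal μ (deltaHat N O c (phiNu0GOR c ρ l h)) (delta c (nu0GOR c ρ l h))
        (P.map FullData.observe)
        (ifDelta c (nu0GOR c ρ l h) (phiNu0GOR c ρ l h) (P.map FullData.observe) η)) ∧
    -- odds ratio: the case `l = 0`, `h = 1`
    (∀ ρ : ℝ, 0 < ρ →
      (∀ᵐ d ∂P, d.Y0 ∈ Set.Icc (0 : ℝ) 1) →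
      (∀ n k data x, (N n k data).mu0 x ∈ Set.Icc (0 : ℝ) 1) →
      (∀ k, IsLittleOp μ (err (P.map FullData.X) N O η Nuisance.mu0 k)
        fun n => (n : ℝ) ^ (-(1 / 4) : ℝ)) →
      IsRootNNormal μ (deltaHat N O c (phiNu0GOR c ρ 0 1)) (delta c (nu0GOR c ρ 0 1))
        (P.map FullData.observe)
        (ifDelta c (nu0GOR c ρ 0 1) (phiNu0GOR c ρ 0 1) (P.map FullData.observe) η)) ∧
    -- mean ratio
    (∀ ρ : ℝ, 0 < ρ →
      MemLp η.mu0 ∞ (P.map FullData.X) →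
      (∀ k, IsLittleOp μ
        (fun n ω => err (P.map FullData.X) N O η (fun θ => θ.pi c) k n ω
          * err (P.map FullData.X) N O η Nuisance.mu0 k n ω)
        fun n => (n : ℝ) ^ (-(1 / 2) : ℝ)) →
      IsRootNNormal μ (deltaHat N O c (phiNu0MR c ρ)) (delta c (nu0MR c ρ))
        (P.map FullData.observe)
        (ifDelta c (nu0MR c ρ) (phiNu0MR c ρ) (P.map FullData.observe) η)) ∧
    -- standardized mean difference, equal variances
    (∀ κ : ℝ,
      MemLp FullData.Y0 4 P →
      MemLp η.mu0 ∞ (P.map FullData.X) →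
      MemLp η.sigma2 ∞ (P.map FullData.X) →
      (∃ s : ℝ, 0 < s ∧ ∀ᵐ x ∂(P.map FullData.X), s ≤ η.sigma2 x) →
      (∀ k, IsBoundedOp μ (invSup (P.map FullData.X) N O Nuisance.sigma2 k)) →
      (∀ k, IsLittleOp μ (err (P.map FullData.X) N O η Nuisance.sigma2 k) fun _ => 1) →
      (∀ k, IsLittleOp μ
        (fun n ω => err (P.map FullData.X) N O η Nuisance.e1 k n ω
          * err (P.map FullData.X) N O η Nuisance.sigma2 k n ω)
        fun n => (n : ℝ) ^ (-(1 / 2) : ℝ)) →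
      (∀ k, IsLittleOp μ (err (P.map FullData.X) N O η Nuisance.mu0 k)
        fun n => (n : ℝ) ^ (-(1 / 4) : ℝ)) →
      (∀ k, IsLittleOp μ (err (P.map FullData.X) N O η Nuisance.sigma2 k)
        fun n => (n : ℝ) ^ (-(1 / 4) : ℝ)) →
      IsRootNNormal μ (deltaHat N O c (phiNu0SMDe c κ)) (delta c (nu0SMDe c κ))
        (P.map FullData.observe)
        (ifDelta c (nu0SMDe c κ) (phiNu0SMDe c κ) (P.map FullData.observe) η)) := by
  obtain ⟨ε, hε, he⟩ := hpos
  have : IsProbabilityMeasure (P.map FullData.observe) :=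
    Measure.isProbabilityMeasure_map FullData.measurable_observe.aemeasurable
  have H := hη.isObsNuisance hA1 hε he hY1 hY0 hmu1
  have D : SampleSetup μ N O (P.map FullData.observe) (P.map FullData.X) η ε c :=
    { nuisance := H
      measurable_sample := hO
      indep := hindep
      law := hlaw
      measurable_fit := hN
      law_X := map_observe_map_X
      pi_mem := hpi
      e_cons := he_cons
      pi_cons := hpi_cons
      propensity := fun k => boundedPropensity_fit map_observe_map_X (he1_inv k) (he0_inv k)
      e_pi := hepi
      pi_pi := fun k => (hpi_rate k).mul_quarter (hpi_rate k) }
  have hpos := hη.margPi_pos H hc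
  have GOR : ∀ ρ l h : ℝ, 0 < ρ → l < h →
      (∀ᵐ d ∂P, d.Y0 ∈ Set.Icc l h) →
      (∀ n k data x, (N n k data).mu0 x ∈ Set.Icc l h) →
      (∀ k, IsLittleOp μ (err (P.map FullData.X) N O η Nuisance.mu0 k)
        fun n => (n : ℝ) ^ (-(1 / 4) : ℝ)) →
      IsRootNNormal μ (deltaHat N O c (phiNu0GOR c ρ l h)) (delta c (nu0GOR c ρ l h))
        (P.map FullData.observe)
        (ifDelta c (nu0GOR c ρ l h) (phiNu0GOR c ρ l h) (P.map FullData.observe) η) := by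
    intro ρ l h hρ hlh hY hm0 hrate
    have hY' := control_outcome_mem measurableSet_Icc hY
    exact D.isRootNNormal hpos hmu1_cons hemu1
      (fun n k => (hN.measurableAlong n k).phiNu0GOR ρ l h) (H.measurableAlong.phiNu0GOR ρ l h)
      (D.crossAvg_phiNu0GOR hρ hlh hY' hm0 hmu0_cons hemu0
        fun k => (hrate k).mul_quarter (hrate k))
      (H.isGradient_nu0GOR hρ hlh hY')
  -- The odds ratio is the generalized one with bounds `0` and `1`.
  refine ⟨GOR, fun ρ hρ => GOR ρ 0 1 hρ zero_lt_one, fun ρ hρ hmu0 hpm => ?_,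
    fun κ hY4 hmu0 hsig hsig0 hinv hsc hes hrate hsrate => ?_⟩
  · obtain ⟨B, hB⟩ := MemLp.exists_ae_abs_le hmu0
    have hB' := ae_observe_of_ae_map_X hB
    exact D.isRootNNormal hpos hmu1_cons hemu1
      (fun n k => (hN.measurableAlong n k).phiNu0MR ρ) (H.measurableAlong.phiNu0MR ρ)
      (D.crossAvg_phiNu0MR hρ hB' hmu0_cons hemu0 hpm) (H.isGradient_nu0MR hρ hB')
  · obtain ⟨B, hB⟩ := MemLp.exists_ae_abs_le hmu0
    obtain ⟨B', hB'⟩ := MemLp.exists_ae_abs_le hsig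
    obtain ⟨s, hs, hsl⟩ := hsig0
    have b1 := ae_observe_of_ae_map_X hB
    have b2 : ∀ᵐ o ∂(P.map FullData.observe), s ≤ η.sigma2 o.X ∧ η.sigma2 o.X ≤ B' :=
      ae_observe_of_ae_map_X (p := fun x => s ≤ η.sigma2 x ∧ η.sigma2 x ≤ B') (by
        filter_upwards [hB', hsl] with x h1 h2 using ⟨h2, (le_abs_self _).trans h1⟩)
    have hL4 := memLp_control_sq_residual hη hY4 hmu0 hsig
    exact D.isRootNNormal hpos hmu1_cons hemu1
      (fun n k => (hN.measurableAlong n k).phiNu0SMDe κ) (H.measurableAlong.phiNu0SMDe κ)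
      (D.crossAvg_phiNu0SMDe κ hs b2 b1 hL4 hinv hmu0_cons hemu0
        -- The principal ignorability part needs only the product rate of `π_c` and `μ₀`, which two
        -- quarter rates provide.
        (fun k => (hpi_rate k).mul_quarter (hrate k)) hsc hes
        (fun k => (hsrate k).mul_quarter (hsrate k)) fun k => (hrate k).mul_quarter (hrate k))
      (H.isGradient_nu0SMDe κ hs b2 b1 hL4)
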